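/- **Theorem 3.4 (bosonization of the vertex operators for the Drinfeld comultiplication).** Let $n\ge 2$ and let $K$ be a field of characteristic $0$ with a nonzero element $q^{1/2}\in K$ that is not a root of unity (for example $K=\mathbb C(q^{1/2})$); $[k]=\frac{q^k-q^{-k}}{q-q^{-1}}$. *Fock spaces.* Let $\alpha_1,\dots,\alpha_{n-1}$ and $\bar\Lambda_1,\dots,\bar\Lambda_{n-1}$ be the simple roots and fundamental weights of $\mathfrak{sl}_n$, $\bar\Lambda_0=\bar\Lambda_n=0$, $\bar Q\subset\bar P$ the root and weight lattices. The twisted group algebra $K[\bar P]$ is generated by the invertible elements $e^{\alpha_2},\dots,e^{\alpha_{n-1}},e^{\bar\Lambda_{n-1}}$ with $e^{\alpha_i}e^{\alpha_j}=(-1)^{(\alpha_i,\alpha_j)}e^{\alpha_j}e^{\alpha_i}$, $e^{\alpha_i}e^{\bar\Lambda_{n-1}}=(-1)^{\delta_{i,n-1}}e^{\bar\Lambda_{n-1}}e^{\alpha_i}$, and $e^{\alpha}=e^{m_2\alpha_2}\cdots e^{m_{n-1}\alpha_{n-1}}e^{m_n\bar\Lambda_{n-1}}$ for $\alpha=m_2\alpha_2+\dots+m_{n-1}\alpha_{n-1}+m_n\bar\Lambda_{n-1}$.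 Let $a_{i,k}$ ($1\le i\le n-1$, $k\ne0$) satisfy $[a_{i,k},a_{j,l}]=\delta_{k+l,0}\frac{[(\alpha_i,\alpha_j)k][k]}{k}$ and put, for $0\le i\le n$, $$a^*_{i,k}=\frac1{[k]^2[nk]}\sum_{j=1}^{n-1}[\min(i,j)k]\,[\min(n-i,n-j)k]\,a_{j,k}\qquad(\text{so } a^*_{0,k}=a^*_{n,k}=0).$$ Let $\mathcal F_i=K[a_{j,-k}:1\le j\le n-1,\,k>0]\otimes K[\bar Q]e^{\bar\Lambda_i}$, so $\mathcal F_n=\mathcal F_0$; $a_{j,k}$ acts by multiplication for $k<0$ and by $[a_{j,k},\cdot\,]$ for $k>0$, $e^\alpha$ by left multiplication, $\partial_\alpha (f\otimes e^\beta)=(\alpha,\beta)f\otimes e^\beta$, and $|\Lambda_i\rangle=1\otimes e^{\bar\Lambda_i}$. The currents act on $\mathcal F_i$ by $$x_l^{\pm}(w)=\exp\Big[\pm\sum_{k>0}\tfrac{a_{l,-k}}{[k]}q^{\mp k/2}w^k\Big]\exp\Big[\mp\sum_{k>0}\tfrac{a_{l,k}}{[k]}q^{\mp k/2}w^{-k}\Big]e^{\pm\alpha_l}w^{\pm\partial_{\alpha_l}+1},$$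 $$\varphi_l(w)=\exp\Big[-(q-q^{-1})\sum_{k>0}a_{l,-k}w^k\Big]q^{-\partial_{\alpha_l}},\qquad \psi_l(w)=\exp\Big[(q-q^{-1})\sum_{k>0}a_{l,k}w^{-k}\Big]q^{\partial_{\alpha_l}}\qquad(1\le l\le n-1).$$ *Vertex operators.* Fix $0\le i\le n-1$. Vertex operators of type I and II are families $\Phi_j(z),\Psi_j(z):\mathcal F_{i+1}\to\mathcal F_i((z))$, $0\le j\le n-1$; dual vertex operators are families $\Phi^*_j(z),\Psi^*_j(z):\mathcal F_i\to\mathcal F_{i+1}((z))$ ($K$-linear maps), subject to the normalization $\langle\Lambda_i|\Phi_i(z)|\Lambda_{i+1}\rangle=\langle\Lambda_i|\Psi_i(z)|\Lambda_{i+1}\rangle=\langle\Lambda_{i+1}|\Phi^*_i(z)|\Lambda_i\rangle=\langle\Lambda_{i+1}|\Psi^*_i(z)|\Lambda_i\rangle=1$ and to the following intertwining relations. Let $u=w/z$, $\delta(u)=\sum_{k\in\mathbb Z}u^k$, and $$g_{l,l-1}(u)=\frac{q^{-1}-q^{1-l}u}{1-q^{-l}u}=\frac{q-q^{l-1}u^{-1}}{1-q^{l}u^{-1}},\qquad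 g_{l,l}(u)=\frac{q-q^{-l-1}u}{1-q^{-l}u}=\frac{q^{-1}-q^{l+1}u^{-1}}{1-q^{l}u^{-1}},\qquad g_{l,j}=1\ (j\ne l-1,l).$$ In relations with $\varphi_l(w)$ the function $g_{l,j}$ is expanded in powers of $w/z$, in relations with $\psi_l(w)$ in powers of $z/w$; in relations with $x_l^\pm(w)$ it is expanded in powers of $z/w$ where it multiplies a product $x^\pm_l(w)\Phi_j(z)$ or $x^\pm_l(w)\Psi_j(z)$, and in powers of $w/z$ where it multiplies a product $\Phi^*_j(z)x_l^\pm(w)$ or $\Psi_j^*(z)x_l^\pm(w)$. For all $1\le l\le n-1$, $0\le j\le n-1$: * Type I: $[\Phi_j(z),x_l^+(w)]=\delta_{l-1,j}\,\delta\big(\tfrac{w}{q^{l-1}z}\big)\varphi_l(wq^{1/2})\Phi_l(z)$; $\Phi_j(z)x_l^-(w)=g_{l,j}(u)\,x_l^-(w)\Phi_j(z)+\delta_{l,j}\,\delta\big(\tfrac{w}{q^lz}\big)\Phi_{l-1}(z)$; $\Phi_j(z)\varphi_l(w)=g_{l,j}(q^{1/2}u)\varphi_l(w)\Phi_j(z)$;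 $\Phi_j(z)\psi_l(w)=g_{l,j}(q^{-1/2}u)\psi_l(w)\Phi_j(z)$. * Type II: $\Psi_j(z)x_l^+(w)=g_{l,j}(u)\,x_l^+(w)\Psi_j(z)+\delta_{l-1,j}\,\delta\big(\tfrac{w}{q^lz}\big)\Psi_l(z)$; $[\Psi_j(z),x_l^-(w)]=0$ for $j\ne l$, and the locality condition $\big(1-\tfrac{w}{q^{l+1}z}\big)[\Psi_l(z),x_l^-(w)]=0$; $\Psi_j(z)\varphi_l(w)=g_{l,j}(q^{-1/2}u)\varphi_l(w)\Psi_j(z)$; $\Psi_j(z)\psi_l(w)=g_{l,j}(q^{1/2}u)\psi_l(w)\Psi_j(z)$. * Dual of type I: $[x_l^+(w),\Phi^*_j(z)]=0$ for $j\ne l$, and the locality condition $\big(1-\tfrac{w}{q^{l+1}z}\big)[x_l^+(w),\Phi^*_l(z)]=0$; $x_l^-(w)\Phi_j^*(z)=g_{l,j}(u)\,\Phi_j^*(z)x_l^-(w)+\delta_{l-1,j}\,\delta\big(\tfrac{w}{q^lz}\big)\Phi^*_l(z)$; $\varphi_l(w)\Phi_j^*(z)=g_{l,j}(q^{1/2}u)\Phi_j^*(z)\varphi_l(w)$;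 $\psi_l(w)\Phi_j^*(z)=g_{l,j}(q^{-1/2}u)\Phi_j^*(z)\psi_l(w)$. * Dual of type II: $x_l^+(w)\Psi_j^*(z)=g_{l,j}(u)\,\Psi_j^*(z)x_l^+(w)+\delta_{l,j}\,\delta\big(\tfrac{w}{q^lz}\big)\Psi^*_{l-1}(z)$; $[x_l^-(w),\Psi_j^*(z)]=\delta_{l-1,j}\,\delta\big(\tfrac{w}{q^{l-1}z}\big)\Psi_l^*(z)\psi_l(wq^{1/2})$; $\varphi_l(w)\Psi_j^*(z)=g_{l,j}(q^{-1/2}u)\Psi_j^*(z)\varphi_l(w)$; $\psi_l(w)\Psi_j^*(z)=g_{l,j}(q^{1/2}u)\Psi_j^*(z)\psi_l(w)$. *Claim.* In each of the four cases the vertex operator exists and is unique, and it is given by $$\begin{aligned} \Phi_j^{(i,i+1)}(z)={}&\exp\Big[\sum_{k>0}\big(-a^*_{j,-k}q^{\frac32k}+a^*_{j+1,-k}q^{\frac12k}\big)(q^jz)^k\Big]\exp\Big[\sum_{k>0}\big(-a^*_{j,k}q^{-\frac12k}+a^*_{j+1,k}q^{\frac12k}\big)(q^jz)^{-k}\Big]\\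 &\cdot e^{\bar\Lambda_j-\bar\Lambda_{j+1}}(q^{j+1}z)^{\partial_{\bar\Lambda_j}}(q^jz)^{-\partial_{\bar\Lambda_{j+1}}}(-1)^{(n-1)\partial_{\bar\Lambda_1}}(c)_j^i,\\ \Psi_j^{(i,i+1)}(z)={}&\exp\Big[\sum_{k>0}\big(-a^*_{j,-k}q^{\frac12k}+a^*_{j+1,-k}q^{-\frac12k}\big)(q^jz)^k\Big]\exp\Big[\sum_{k>0}\big(-a^*_{j,k}q^{-\frac32k}+a^*_{j+1,k}q^{-\frac12k}\big)(q^jz)^{-k}\Big]\\ &\cdot e^{\bar\Lambda_j-\bar\Lambda_{j+1}}(q^{j+1}z)^{\partial_{\bar\Lambda_j}}(q^jz)^{-\partial_{\bar\Lambda_{j+1}}}(-1)^{(n-1)\partial_{\bar\Lambda_1}}(c)_j^i,\\ \Phi_j^{*(i+1,i)}(z)={}&\exp\Big[\sum_{k>0}\big(a^*_{j,-k}q^{\frac32k}-a^*_{j+1,-k}q^{\frac12k}\big)(q^jz)^k\Big]\exp\Big[\sum_{k>0}\big(a^*_{j,k}q^{-\frac12k}-a^*_{j+1,k}q^{\frac12k}\big)(q^jz)^{-k}\Big]\\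 &\cdot e^{-\bar\Lambda_j+\bar\Lambda_{j+1}}(q^{j+1}z)^{-\partial_{\bar\Lambda_j}}(q^jz)^{\partial_{\bar\Lambda_{j+1}}}(-1)^{-(n-1)\partial_{\bar\Lambda_1}}(c^*)_j^i,\\ \Psi_j^{*(i+1,i)}(z)={}&\exp\Big[\sum_{k>0}\big(a^*_{j,-k}q^{\frac12k}-a^*_{j+1,-k}q^{-\frac12k}\big)(q^jz)^k\Big]\exp\Big[\sum_{k>0}\big(a^*_{j,k}q^{-\frac32k}-a^*_{j+1,k}q^{-\frac12k}\big)(q^jz)^{-k}\Big]\\ &\cdot e^{-\bar\Lambda_j+\bar\Lambda_{j+1}}(q^{j+1}z)^{-\partial_{\bar\Lambda_j}}(q^jz)^{\partial_{\bar\Lambda_{j+1}}}(-1)^{-(n-1)\partial_{\bar\Lambda_1}}(c^*)_j^i, \end{aligned}$$ where, with $\kappa_0=(-1)^{\frac12(n-1)(n-2)}$ and $\kappa_j=1$ for $j\ge1$, $$(c)_j^i=\kappa_j\,(-q)^{j-i}\,[(-1)^{-(n-1)}z]^{\frac{n-i-1}n}(-1)^{\frac12(n-i-1)(n-i-2)},\qquad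 (c^*)_j^i=\kappa_j\,[(-1)^{n-1}]^{\frac{n-i}n}[q^nz]^{\frac in}(-1)^{\frac12(n-i)(n-i-1)}.$$ Fractional powers are combined by adding exponents; on each $f\otimes e^\beta$ the total exponents of $q$, $z$ and $-1$ are integers. -/

import Mathlib

open scoped BigOperators

namespace QAffine

noncomputable section

/-! ### Weights of `sl_n` and the twisted group algebra -/

/-- The weight lattice of `sl_n`. A weight is given by its coordinates in the basis of the
fundamental weights: the coordinate at `b : Fin (n - 1)` is the coefficient of the fundamental
weight number `b + 1`; it equals the pairing with the simple root number `b + 1`. -/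
abbrev Weight (n : ℕ) : Type := Fin (n - 1) → ℤ

/-- The (classical) fundamental weight `Λ_j`; it is `0` for `j = 0` and for `j = n`. -/
def fundWt {n : ℕ} (j : ℕ) : Weight n := fun b => if (b : ℕ) + 1 = j then 1 else 0

/-- Cartan matrix of type `A_{n-1}`; `l : Fin (n - 1)` stands for the node number `l + 1`. -/
abbrev cartan {n : ℕ} (l b : Fin (n - 1)) : ℤ := CartanMatrix.A (n - 1) l b

/-- The simple root number `l + 1`. -/
def simpleRoot {n : ℕ} (l : Fin (n - 1)) : Weight n := fun b => cartan l b

/-- The root lattice. -/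
def rootLattice (n : ℕ) : AddSubgroup (Weight n) :=
  AddSubgroup.closure (Set.range simpleRoot)

/-- The invariant form, `(Λ_a, Λ_b) = min(a,b) (n - max(a,b)) / n` for `1 ≤ a, b ≤ n - 1`. -/
def pairing {n : ℕ} (x y : Weight n) : ℚ :=
  ∑ a : Fin (n - 1), ∑ b : Fin (n - 1), (x a : ℚ) * (y b : ℚ) *
    ((min ((a : ℕ) + 1) ((b : ℕ) + 1) : ℕ) : ℚ) *
      ((n : ℚ) - ((max ((a : ℕ) + 1) ((b : ℕ) + 1) : ℕ) : ℚ)) / (n : ℚ)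

/-- Coordinates of a weight in the basis `α_2, …, α_{n-1}, Λ_{n-1}`: `coord k` is the coefficient
of `α_k` for `2 ≤ k ≤ n - 1`, and `coord n` is the coefficient of `Λ_{n-1}`. This uses
`Λ_a = -α_{a+1} - 2 α_{a+2} - ⋯ - (n-1-a) α_{n-1} + (n-a) Λ_{n-1}`. -/
def coord {n : ℕ} (k : ℕ) (x : Weight n) : ℤ :=
  if k = n then ∑ b : Fin (n - 1), x b * ((n : ℤ) - ((b : ℕ) + 1 : ℤ))
  else -∑ b : Fin (n - 1), x b * ((k - ((b : ℕ) + 1) : ℕ) : ℤ)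

/-- The sign in `e^x e^y = ± e^{x+y}`. Here `e^x` is the ordered monomial
`(e^{α_2})^{m_2} ⋯ (e^{α_{n-1}})^{m_{n-1}} (e^{Λ_{n-1}})^{m_n}`, `m_k = coord k x`; of the generators
`e^{α_2}, …, e^{α_{n-1}}, e^{Λ_{n-1}}` exactly the neighbouring ones anticommute, all other pairs
commute. -/
def latticeSign {n : ℕ} (x y : Weight n) : ℤˣ :=
  (-1) ^ (∑ k ∈ Finset.Ico 2 n, coord (k + 1) x * coord k y)

/-! ### Heisenberg algebra and Fock spaces -/

/-- The `q`-integer `[k] = (q^k - q^{-k}) / (q - q^{-1})`, where `q = s ^ 2`. -/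
def qInt {K : Type*} [Field K] (s : K) (k : ℤ) : K :=
  ((s ^ 2) ^ k - (s ^ 2) ^ (-k)) / (s ^ 2 - (s ^ 2)⁻¹)

/-- The oscillator space: polynomials in the variables `a_{j,-k}`, `1 ≤ j ≤ n - 1`, `k ≥ 1`.
The variable `(l, r)` is `a_{l+1, -(r+1)}`. -/
abbrev Osc (n : ℕ) (K : Type*) [Field K] : Type _ := MvPolynomial (Fin (n - 1) × ℕ) K

/-- The Heisenberg generator `a_{l+1, k}`: for `k < 0` multiplication by the variable, for `k > 0`
the derivation `[a_{l+1,k}, ·]`, where `[a_{i,k}, a_{j,-k}] = [(α_i,α_j) k] [k] / k`.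
(The index `k = 0` does not occur; the value there is `0`.) -/
def heis {n : ℕ} {K : Type*} [Field K] (s : K) (l : Fin (n - 1)) :
    ℤ → Module.End K (Osc n K)
  | Int.ofNat 0 => 0
  | Int.ofNat (r + 1) =>
      (MvPolynomial.mkDerivation K (fun p : Fin (n - 1) × ℕ =>
        if p.2 = r then
          (MvPolynomial.C (qInt s (cartan l p.1 * ((r : ℤ) + 1)) * qInt s ((r : ℤ) + 1)
            / ((r : K) + 1)) : Osc n K)
        else 0)).toLinearMap
  | Int.negSucc r => LinearMap.mulLeft K (MvPolynomial.X (l, r))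

/-- The dual generator
`a*_{j,k} = ([k]^2 [nk])^{-1} ∑_{l=1}^{n-1} [min(j,l) k] [min(n-j,n-l) k] a_{l,k}`.
It is `0` for `j = 0` and for `j = n`. -/
def heisDual {n : ℕ} {K : Type*} [Field K] (s : K) (j : ℕ) (k : ℤ) : Module.End K (Osc n K) :=
  ∑ l : Fin (n - 1),
    (qInt s ((min j ((l : ℕ) + 1) : ℕ) * k) * qInt s ((min (n - j) (n - ((l : ℕ) + 1)) : ℕ) * k)
      / (qInt s k ^ 2 * qInt s (n * k))) • heis s l k

/-- The coefficient of `z ^ m` in the exponential of `∑_{k > 0} f k z^k`. -/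
def expCoeff {K : Type*} [Field K] {R : Type*} [Ring R] [Algebra K R] (f : ℕ → R) (m : ℕ) : R :=
  ∑ r ∈ Finset.range (m + 1), ((r.factorial : K)⁻¹) •
    PowerSeries.coeff m ((PowerSeries.mk fun k => if k = 0 then 0 else f k) ^ r)

/-- The coefficient of `z ^ m` in `exp[∑_{k > 0} f k z^k] exp[∑_{k > 0} g k z^{-k}]`, as an operator
on the oscillator space. In all uses `f k` is a combination of the `a_{l,-k}` and `g k` one of the
`a_{l,k}`, so that the sum is finite on every polynomial; the operator is given on monomials and
extended linearly. -/
def expMode {n : ℕ} {K : Type*} [Field K] (f g : ℕ → Module.End K (Osc n K)) (m : ℤ) :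
    Module.End K (Osc n K) :=
  (MvPolynomial.basisMonomials (Fin (n - 1) × ℕ) K).constr K fun d =>
    ∑ᶠ p : ℕ × ℕ, if (p.1 : ℤ) - p.2 = m then
      expCoeff (K := K) f p.1 (expCoeff (K := K) g p.2 (MvPolynomial.monomial d 1)) else 0

/-- The sum of all Fock spaces: the tensor product of the oscillator space with the span of the
`e^x`, `x` in the weight lattice; `Finsupp.single x f` is `f ⊗ e^x`. -/
abbrev TotalFock (n : ℕ) (K : Type*) [Field K] : Type _ := Weight n →₀ Osc n K

/-- The coset of `Λ_i` modulo the root lattice. -/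
def wtCoset (n i : ℕ) : Set (Weight n) := {x | x - fundWt i ∈ rootLattice n}

/-- The Fock space `F_i`. As `Λ_n = 0 = Λ_0`, one has `F_n = F_0`. -/
abbrev Fock (n : ℕ) (K : Type*) [Field K] (i : ℕ) : Submodule K (TotalFock n K) :=
  Finsupp.supported (Osc n K) K (wtCoset n i)

/-- The highest weight vector `|Λ_i⟩ = 1 ⊗ e^{Λ_i}` of `F_i`. -/
def vac (n : ℕ) (K : Type*) [Field K] (i : ℕ) : Fock n K i :=
  ⟨Finsupp.single (fundWt i) 1, Finsupp.single_mem_supported K _ (by simp [wtCoset])⟩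

/-- The matrix coefficient `⟨Λ_i| v`: the coefficient of `1 ⊗ e^{Λ_i}` in `v`. -/
def vacCoeff {n : ℕ} {K : Type*} [Field K] (i : ℕ) (v : Fock n K i) : K :=
  MvPolynomial.constantCoeff ((v : TotalFock n K) (fundWt i))

/-- The coefficient of `z ^ m` in
`exp[∑_{k > 0} f k z^k] exp[∑_{k > 0} g k z^{-k}] e^γ κ(∂) z^{e(∂)}`, where `κ(∂)` and `z^{e(∂)}`
multiply `e^x` by `κ x` and by `z^{e x}`. -/
def totalMode {n : ℕ} {K : Type*} [Field K] (f g : ℕ → Module.End K (Osc n K)) (γ : Weight n)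
    (κ : Weight n → K) (e : Weight n → ℤ) (m : ℤ) : Module.End K (TotalFock n K) :=
  Finsupp.lsum K fun x =>
    (Finsupp.lsingle (γ + x)).comp
      ((κ x * (((latticeSign γ x : ℤˣ) : ℤ) : K)) • expMode f g (m - e x))

theorem totalMode_mem {n : ℕ} {K : Type*} [Field K] (f g : ℕ → Module.End K (Osc n K))
    (γ : Weight n) (κ : Weight n → K) (e : Weight n → ℤ) (m : ℤ) {i i' : ℕ}
    (h : ∀ x ∈ wtCoset n i, γ + x ∈ wtCoset n i') (v : TotalFock n K) (hv : v ∈ Fock n K i) :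
    totalMode f g γ κ e m v ∈ Fock n K i' := by
  unfold totalMode
  rw [Finsupp.lsum_apply, Finsupp.sum]
  refine Submodule.sum_mem _ fun x hx => ?_
  exact Finsupp.single_mem_supported K _ (h x (hv hx))

/-- `totalMode` as a map `F_i → F_{i'}`, for `γ` that maps the weights of `F_i` to those of
`F_{i'}`. -/
def fockMode {n : ℕ} {K : Type*} [Field K] (f g : ℕ → Module.End K (Osc n K)) (γ : Weight n)
    (κ : Weight n → K) (e : Weight n → ℤ) (m : ℤ) (i i' : ℕ)
    (h : ∀ x ∈ wtCoset n i, γ + x ∈ wtCoset n i') : Fock n K i →ₗ[K] Fock n K i' :=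
  (totalMode f g γ κ e m).restrict (totalMode_mem f g γ κ e m h)

theorem add_mem_wtCoset {n i i' : ℕ} {γ : Weight n}
    (h : γ + fundWt i - fundWt i' ∈ rootLattice n) (x : Weight n) (hx : x ∈ wtCoset n i) :
    γ + x ∈ wtCoset n i' := by
  have := add_mem h hx
  show γ + x - fundWt i' ∈ rootLattice n
  convert this using 1
  abel

theorem simpleRoot_mem {n : ℕ} (l : Fin (n - 1)) : simpleRoot l ∈ rootLattice n :=
  AddSubgroup.subset_closure ⟨l, rfl⟩

/-! ### The level one action of the currents on `F_i` -/

/-- The coefficient of `w ^ a` in the current `x^ε_{l+1}(w)`, `ε = ± 1`: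
`exp[ε ∑ a_{-k} q^{-εk/2} w^k / [k]] exp[-ε ∑ a_k q^{-εk/2} w^{-k} / [k]] e^{εα} w^{ε∂_α + 1}`. -/
def current {n : ℕ} {K : Type*} [Field K] (s : K) (ε : ℤ) (l : Fin (n - 1)) (i : ℕ) (a : ℤ) :
    Fock n K i →ₗ[K] Fock n K i :=
  fockMode
    (fun k => ((ε : K) * s ^ (-ε * k) / qInt s k) • heis s l (-(k : ℤ)))
    (fun k => (-(ε : K) * s ^ (-ε * k) / qInt s k) • heis s l (k : ℤ))
    (ε • simpleRoot l) (fun _ => 1) (fun x => ε * x l + 1) a i i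
    (add_mem_wtCoset (by
      rw [add_sub_cancel_right]; exact AddSubgroup.zsmul_mem _ (simpleRoot_mem l) ε))

/-- The coefficient of `w ^ a` in `x^+_{l+1}(w)`. -/
abbrev xPlus {n : ℕ} {K : Type*} [Field K] (s : K) (l : Fin (n - 1)) (i : ℕ) (a : ℤ) :
    Fock n K i →ₗ[K] Fock n K i := current s 1 l i a

/-- The coefficient of `w ^ a` in `x^-_{l+1}(w)`. -/
abbrev xMinus {n : ℕ} {K : Type*} [Field K] (s : K) (l : Fin (n - 1)) (i : ℕ) (a : ℤ) :
    Fock n K i →ₗ[K] Fock n K i := current s (-1) l i a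

/-- The coefficient of `w ^ a` in
`φ_{l+1}(w) = exp[-(q - q^{-1}) ∑_{k>0} a_{l+1,-k} w^k] q^{-∂_α}`. -/
def phiCur {n : ℕ} {K : Type*} [Field K] (s : K) (l : Fin (n - 1)) (i : ℕ) (a : ℤ) :
    Fock n K i →ₗ[K] Fock n K i :=
  fockMode (fun k => (-(s ^ 2 - (s ^ 2)⁻¹)) • heis s l (-(k : ℤ))) (fun _ => 0)
    0 (fun x => (s ^ 2) ^ (-x l)) (fun _ => 0) a i i
    (add_mem_wtCoset (by simp [zero_mem]))

/-- The coefficient of `w ^ a` in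
`ψ_{l+1}(w) = exp[(q - q^{-1}) ∑_{k>0} a_{l+1,k} w^{-k}] q^{∂_α}`. -/
def psiCur {n : ℕ} {K : Type*} [Field K] (s : K) (l : Fin (n - 1)) (i : ℕ) (a : ℤ) :
    Fock n K i →ₗ[K] Fock n K i :=
  fockMode (fun _ => 0) (fun k => (s ^ 2 - (s ^ 2)⁻¹) • heis s l (k : ℤ))
    0 (fun x => (s ^ 2) ^ (x l)) (fun _ => 0) a i i
    (add_mem_wtCoset (by simp [zero_mem]))

/-! ### Formal series in two variables -/

/-- `∑ k, f k = v`, where all but finitely many terms are `0`. -/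
def IsFinSum {V : Type*} [AddCommGroup V] (f : ℤ → V) (v : V) : Prop :=
  (Function.support f).Finite ∧ ∑ᶠ k, f k = v

/-- `C(w/z) P(z,w) = R(z,w)` for the formal series `C(u) = ∑ c k u^k`,
`P(z,w) = ∑ P a b w^a z^b`, `R(z,w) = ∑ R a b w^a z^b`; the sums that define the product are
required to be finite. -/
def IsSeriesMul {K V : Type*} [Field K] [AddCommGroup V] [Module K V] (c : ℤ → K)
    (P R : ℤ → ℤ → V) : Prop :=
  ∀ a b : ℤ, IsFinSum (fun k => c k • P (a - k) (b + k)) (R a b)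

/-- The coefficients of the expansion of `(A - B t) / (1 - D t)` in nonnegative powers of `t`. -/
def expand {K : Type*} [Field K] (A B D : K) (k : ℤ) : K :=
  if k < 0 then 0 else if k = 0 then A else A * D ^ k - B * D ^ (k - 1)

/-- The expansion in nonnegative powers of `u = w/z` of
`(A - B u) / (1 - D u)`. -/
def fracW {K : Type*} [Field K] (A B D : K) (k : ℤ) : K := expand A B D k

/-- The expansion in nonnegative powers of `u⁻¹ = z/w` of
`(A - B u⁻¹) / (1 - D u⁻¹)`. -/
def fracZ {K : Type*} [Field K] (A B D : K) (k : ℤ) : K := expand A B D (-k)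

/-- The expansion in nonnegative powers of `u⁻¹ = z/w` of
`(A - B u) / (1 - D u) = (B / D - (A / D) u⁻¹) / (1 - D⁻¹ u⁻¹)`. -/
def fracW' {K : Type*} [Field K] (A B D : K) (k : ℤ) : K := fracZ (B / D) (A / D) D⁻¹ k

/-- The expansion in nonnegative powers of `u = w/z` of
`(A - B u⁻¹) / (1 - D u⁻¹) = (B / D - (A / D) u) / (1 - D⁻¹ u)`. -/
def fracZ' {K : Type*} [Field K] (A B D : K) (k : ℤ) : K := fracW (B / D) (A / D) D⁻¹ k

/-- The coefficients of `δ(u / p) = ∑_k p^{-k} u^k`. -/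
def delta {K : Type*} [Field K] (p : K) (k : ℤ) : K := p ^ (-k)

/-! ### Vertex operators -/

/-- The components of an operator-valued formal series `F_a → F_b`: `Φ j m` is the coefficient of
`z ^ m` in the component number `j`, `0 ≤ j ≤ n - 1`. -/
abbrev Components (n : ℕ) (K : Type*) [Field K] (a b : ℕ) : Type _ :=
  Fin n → ℤ → (Fock n K a →ₗ[K] Fock n K b)

/-- On every vector every component is a formal Laurent series in `z`. -/
def IsLaurent {n : ℕ} {K : Type*} [Field K] {a b : ℕ} (Φ : Components n K a b) : Prop :=
  ∀ (j : Fin n) (v : Fock n K a), ∃ N : ℤ, ∀ m < N, Φ j m v = 0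

/-- For the node number `l + 1`, the component index `l`. -/
def lo {n : ℕ} (l : Fin (n - 1)) : Fin n := ⟨l, by omega⟩

/-- For the node number `l + 1`, the component index `l + 1`. -/
def hi {n : ℕ} (l : Fin (n - 1)) : Fin n := ⟨(l : ℕ) + 1, by omega⟩

/-- Normalized vertex operators of type I, `F_{i+1} → F_i ⊗ V_z`.
In the fields, `l` stands for the node number `l + 1`, so that `q^{l+1}` is `(s^2)^(l+1)`, and
`q^{1/2} = s`. -/
structure IsTypeI {n : ℕ} {K : Type*} [Field K] (s : K) (i : ℕ) (hi' : i < n)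
    (Φ : Components n K (i + 1) i) : Prop where
  laurent : IsLaurent Φ
  normalized : ∀ m : ℤ, vacCoeff i (Φ ⟨i, hi'⟩ m (vac n K (i + 1))) = if m = 0 then 1 else 0
  xPlus_lo : ∀ (l : Fin (n - 1)) (v : Fock n K (i + 1)),
    IsSeriesMul (delta ((s ^ 2) ^ (l : ℕ)))
      (fun a b => s ^ a • phiCur s l i a (Φ (hi l) b v))
      (fun a b => Φ (lo l) b (xPlus s l (i + 1) a v) - xPlus s l i a (Φ (lo l) b v))
  xPlus_ne : ∀ (l : Fin (n - 1)) (j : Fin n), j ≠ lo l → ∀ (v : Fock n K (i + 1)) (a b : ℤ),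
    Φ j b (xPlus s l (i + 1) a v) = xPlus s l i a (Φ j b v)
  xMinus_lo : ∀ (l : Fin (n - 1)) (v : Fock n K (i + 1)),
    IsSeriesMul (fracZ (s ^ 2) ((s ^ 2) ^ (l : ℕ)) ((s ^ 2) ^ ((l : ℕ) + 1)))
      (fun a b => xMinus s l i a (Φ (lo l) b v))
      (fun a b => Φ (lo l) b (xMinus s l (i + 1) a v))
  xMinus_hi : ∀ (l : Fin (n - 1)) (v : Fock n K (i + 1)),
    IsSeriesMul (fracZ (s ^ 2)⁻¹ ((s ^ 2) ^ ((l : ℕ) + 2)) ((s ^ 2) ^ ((l : ℕ) + 1)))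
      (fun a b => xMinus s l i a (Φ (hi l) b v))
      (fun a b => Φ (hi l) b (xMinus s l (i + 1) a v)
        - delta ((s ^ 2) ^ ((l : ℕ) + 1)) a • Φ (lo l) (a + b) v)
  xMinus_ne : ∀ (l : Fin (n - 1)) (j : Fin n), j ≠ lo l → j ≠ hi l →
    ∀ (v : Fock n K (i + 1)) (a b : ℤ),
      Φ j b (xMinus s l (i + 1) a v) = xMinus s l i a (Φ j b v)
  phi_lo : ∀ (l : Fin (n - 1)) (v : Fock n K (i + 1)),
    IsSeriesMul (fracW (s ^ 2)⁻¹ (s ^ (-2 * ((l : ℤ) + 1) + 3)) (s ^ (-2 * ((l : ℤ) + 1) + 1)))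
      (fun a b => phiCur s l i a (Φ (lo l) b v))
      (fun a b => Φ (lo l) b (phiCur s l (i + 1) a v))
  phi_hi : ∀ (l : Fin (n - 1)) (v : Fock n K (i + 1)),
    IsSeriesMul (fracW (s ^ 2) (s ^ (-2 * ((l : ℤ) + 1) - 1)) (s ^ (-2 * ((l : ℤ) + 1) + 1)))
      (fun a b => phiCur s l i a (Φ (hi l) b v))
      (fun a b => Φ (hi l) b (phiCur s l (i + 1) a v))
  phi_ne : ∀ (l : Fin (n - 1)) (j : Fin n), j ≠ lo l → j ≠ hi l →
    ∀ (v : Fock n K (i + 1)) (a b : ℤ),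
      Φ j b (phiCur s l (i + 1) a v) = phiCur s l i a (Φ j b v)
  psi_lo : ∀ (l : Fin (n - 1)) (v : Fock n K (i + 1)),
    IsSeriesMul (fracZ (s ^ 2) (s ^ (2 * ((l : ℤ) + 1) - 1)) (s ^ (2 * ((l : ℤ) + 1) + 1)))
      (fun a b => psiCur s l i a (Φ (lo l) b v))
      (fun a b => Φ (lo l) b (psiCur s l (i + 1) a v))
  psi_hi : ∀ (l : Fin (n - 1)) (v : Fock n K (i + 1)),
    IsSeriesMul (fracZ (s ^ 2)⁻¹ (s ^ (2 * ((l : ℤ) + 1) + 3)) (s ^ (2 * ((l : ℤ) + 1) + 1)))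
      (fun a b => psiCur s l i a (Φ (hi l) b v))
      (fun a b => Φ (hi l) b (psiCur s l (i + 1) a v))
  psi_ne : ∀ (l : Fin (n - 1)) (j : Fin n), j ≠ lo l → j ≠ hi l →
    ∀ (v : Fock n K (i + 1)) (a b : ℤ),
      Φ j b (psiCur s l (i + 1) a v) = psiCur s l i a (Φ j b v)

/-- Normalized vertex operators of type II, `F_{i+1} → V_z ⊗ F_i`. -/
structure IsTypeII {n : ℕ} {K : Type*} [Field K] (s : K) (i : ℕ) (hi' : i < n)
    (Ψ : Components n K (i + 1) i) : Prop where
  laurent : IsLaurent Ψ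
  normalized : ∀ m : ℤ, vacCoeff i (Ψ ⟨i, hi'⟩ m (vac n K (i + 1))) = if m = 0 then 1 else 0
  xPlus_lo : ∀ (l : Fin (n - 1)) (v : Fock n K (i + 1)),
    IsSeriesMul (fracW' (s ^ 2)⁻¹ ((s ^ 2) ^ (-(l : ℤ))) ((s ^ 2) ^ (-((l : ℤ) + 1))))
      (fun a b => xPlus s l i a (Ψ (lo l) b v))
      (fun a b => Ψ (lo l) b (xPlus s l (i + 1) a v)
        - delta ((s ^ 2) ^ ((l : ℕ) + 1)) a • Ψ (hi l) (a + b) v)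
  xPlus_hi : ∀ (l : Fin (n - 1)) (v : Fock n K (i + 1)),
    IsSeriesMul (fracW' (s ^ 2) ((s ^ 2) ^ (-((l : ℤ) + 2))) ((s ^ 2) ^ (-((l : ℤ) + 1))))
      (fun a b => xPlus s l i a (Ψ (hi l) b v))
      (fun a b => Ψ (hi l) b (xPlus s l (i + 1) a v))
  xPlus_ne : ∀ (l : Fin (n - 1)) (j : Fin n), j ≠ lo l → j ≠ hi l →
    ∀ (v : Fock n K (i + 1)) (a b : ℤ),
      Ψ j b (xPlus s l (i + 1) a v) = xPlus s l i a (Ψ j b v)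
  /-- The locality condition `(1 - w / (q^{l+2} z)) [Ψ_{l+1}(z), x^-_{l+1}(w)] = 0`. -/
  xMinus_hi : ∀ (l : Fin (n - 1)) (v : Fock n K (i + 1)) (a b : ℤ),
    Ψ (hi l) b (xMinus s l (i + 1) a v) - xMinus s l i a (Ψ (hi l) b v)
      - (s ^ 2) ^ (-((l : ℤ) + 2)) • (Ψ (hi l) (b + 1) (xMinus s l (i + 1) (a - 1) v)
          - xMinus s l i (a - 1) (Ψ (hi l) (b + 1) v)) = 0
  xMinus_ne : ∀ (l : Fin (n - 1)) (j : Fin n), j ≠ hi l → ∀ (v : Fock n K (i + 1)) (a b : ℤ),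
    Ψ j b (xMinus s l (i + 1) a v) = xMinus s l i a (Ψ j b v)
  phi_lo : ∀ (l : Fin (n - 1)) (v : Fock n K (i + 1)),
    IsSeriesMul (fracW (s ^ 2)⁻¹ (s ^ (-2 * ((l : ℤ) + 1) + 1)) (s ^ (-2 * ((l : ℤ) + 1) - 1)))
      (fun a b => phiCur s l i a (Ψ (lo l) b v))
      (fun a b => Ψ (lo l) b (phiCur s l (i + 1) a v))
  phi_hi : ∀ (l : Fin (n - 1)) (v : Fock n K (i + 1)),
    IsSeriesMul (fracW (s ^ 2) (s ^ (-2 * ((l : ℤ) + 1) - 3)) (s ^ (-2 * ((l : ℤ) + 1) - 1)))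
      (fun a b => phiCur s l i a (Ψ (hi l) b v))
      (fun a b => Ψ (hi l) b (phiCur s l (i + 1) a v))
  phi_ne : ∀ (l : Fin (n - 1)) (j : Fin n), j ≠ lo l → j ≠ hi l →
    ∀ (v : Fock n K (i + 1)) (a b : ℤ),
      Ψ j b (phiCur s l (i + 1) a v) = phiCur s l i a (Ψ j b v)
  psi_lo : ∀ (l : Fin (n - 1)) (v : Fock n K (i + 1)),
    IsSeriesMul (fracZ (s ^ 2) (s ^ (2 * ((l : ℤ) + 1) - 3)) (s ^ (2 * ((l : ℤ) + 1) - 1)))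
      (fun a b => psiCur s l i a (Ψ (lo l) b v))
      (fun a b => Ψ (lo l) b (psiCur s l (i + 1) a v))
  psi_hi : ∀ (l : Fin (n - 1)) (v : Fock n K (i + 1)),
    IsSeriesMul (fracZ (s ^ 2)⁻¹ (s ^ (2 * ((l : ℤ) + 1) + 1)) (s ^ (2 * ((l : ℤ) + 1) - 1)))
      (fun a b => psiCur s l i a (Ψ (hi l) b v))
      (fun a b => Ψ (hi l) b (psiCur s l (i + 1) a v))
  psi_ne : ∀ (l : Fin (n - 1)) (j : Fin n), j ≠ lo l → j ≠ hi l →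
    ∀ (v : Fock n K (i + 1)) (a b : ℤ),
      Ψ j b (psiCur s l (i + 1) a v) = psiCur s l i a (Ψ j b v)

/-- Normalized dual vertex operators of type I, `F_i ⊗ V_z → F_{i+1}`. -/
structure IsDualTypeI {n : ℕ} {K : Type*} [Field K] (s : K) (i : ℕ) (hi' : i < n)
    (Φ : Components n K i (i + 1)) : Prop where
  laurent : IsLaurent Φ
  normalized : ∀ m : ℤ, vacCoeff (i + 1) (Φ ⟨i, hi'⟩ m (vac n K i)) = if m = 0 then 1 else 0
  /-- The locality condition `(1 - w / (q^{l+2} z)) [x^+_{l+1}(w), Φ*_{l+1}(z)] = 0`. -/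
  xPlus_hi : ∀ (l : Fin (n - 1)) (v : Fock n K i) (a b : ℤ),
    xPlus s l (i + 1) a (Φ (hi l) b v) - Φ (hi l) b (xPlus s l i a v)
      - (s ^ 2) ^ (-((l : ℤ) + 2)) • (xPlus s l (i + 1) (a - 1) (Φ (hi l) (b + 1) v)
          - Φ (hi l) (b + 1) (xPlus s l i (a - 1) v)) = 0
  xPlus_ne : ∀ (l : Fin (n - 1)) (j : Fin n), j ≠ hi l → ∀ (v : Fock n K i) (a b : ℤ),
    xPlus s l (i + 1) a (Φ j b v) = Φ j b (xPlus s l i a v)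
  xMinus_lo : ∀ (l : Fin (n - 1)) (v : Fock n K i),
    IsSeriesMul (fracZ' (s ^ 2) ((s ^ 2) ^ (l : ℕ)) ((s ^ 2) ^ ((l : ℕ) + 1)))
      (fun a b => Φ (lo l) b (xMinus s l i a v))
      (fun a b => xMinus s l (i + 1) a (Φ (lo l) b v)
        - delta ((s ^ 2) ^ ((l : ℕ) + 1)) a • Φ (hi l) (a + b) v)
  xMinus_hi : ∀ (l : Fin (n - 1)) (v : Fock n K i),
    IsSeriesMul (fracZ' (s ^ 2)⁻¹ ((s ^ 2) ^ ((l : ℕ) + 2)) ((s ^ 2) ^ ((l : ℕ) + 1)))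
      (fun a b => Φ (hi l) b (xMinus s l i a v))
      (fun a b => xMinus s l (i + 1) a (Φ (hi l) b v))
  xMinus_ne : ∀ (l : Fin (n - 1)) (j : Fin n), j ≠ lo l → j ≠ hi l →
    ∀ (v : Fock n K i) (a b : ℤ),
      xMinus s l (i + 1) a (Φ j b v) = Φ j b (xMinus s l i a v)
  phi_lo : ∀ (l : Fin (n - 1)) (v : Fock n K i),
    IsSeriesMul (fracW (s ^ 2)⁻¹ (s ^ (-2 * ((l : ℤ) + 1) + 3)) (s ^ (-2 * ((l : ℤ) + 1) + 1)))
      (fun a b => Φ (lo l) b (phiCur s l i a v))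
      (fun a b => phiCur s l (i + 1) a (Φ (lo l) b v))
  phi_hi : ∀ (l : Fin (n - 1)) (v : Fock n K i),
    IsSeriesMul (fracW (s ^ 2) (s ^ (-2 * ((l : ℤ) + 1) - 1)) (s ^ (-2 * ((l : ℤ) + 1) + 1)))
      (fun a b => Φ (hi l) b (phiCur s l i a v))
      (fun a b => phiCur s l (i + 1) a (Φ (hi l) b v))
  phi_ne : ∀ (l : Fin (n - 1)) (j : Fin n), j ≠ lo l → j ≠ hi l →
    ∀ (v : Fock n K i) (a b : ℤ),
      phiCur s l (i + 1) a (Φ j b v) = Φ j b (phiCur s l i a v)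
  psi_lo : ∀ (l : Fin (n - 1)) (v : Fock n K i),
    IsSeriesMul (fracZ (s ^ 2) (s ^ (2 * ((l : ℤ) + 1) - 1)) (s ^ (2 * ((l : ℤ) + 1) + 1)))
      (fun a b => Φ (lo l) b (psiCur s l i a v))
      (fun a b => psiCur s l (i + 1) a (Φ (lo l) b v))
  psi_hi : ∀ (l : Fin (n - 1)) (v : Fock n K i),
    IsSeriesMul (fracZ (s ^ 2)⁻¹ (s ^ (2 * ((l : ℤ) + 1) + 3)) (s ^ (2 * ((l : ℤ) + 1) + 1)))
      (fun a b => Φ (hi l) b (psiCur s l i a v))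
      (fun a b => psiCur s l (i + 1) a (Φ (hi l) b v))
  psi_ne : ∀ (l : Fin (n - 1)) (j : Fin n), j ≠ lo l → j ≠ hi l →
    ∀ (v : Fock n K i) (a b : ℤ),
      psiCur s l (i + 1) a (Φ j b v) = Φ j b (psiCur s l i a v)

/-- Normalized dual vertex operators of type II, `V_z ⊗ F_i → F_{i+1}`. -/
structure IsDualTypeII {n : ℕ} {K : Type*} [Field K] (s : K) (i : ℕ) (hi' : i < n)
    (Ψ : Components n K i (i + 1)) : Prop where
  laurent : IsLaurent Ψ
  normalized : ∀ m : ℤ, vacCoeff (i + 1) (Ψ ⟨i, hi'⟩ m (vac n K i)) = if m = 0 then 1 else 0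
  xPlus_lo : ∀ (l : Fin (n - 1)) (v : Fock n K i),
    IsSeriesMul (fracW (s ^ 2)⁻¹ ((s ^ 2) ^ (-(l : ℤ))) ((s ^ 2) ^ (-((l : ℤ) + 1))))
      (fun a b => Ψ (lo l) b (xPlus s l i a v))
      (fun a b => xPlus s l (i + 1) a (Ψ (lo l) b v))
  xPlus_hi : ∀ (l : Fin (n - 1)) (v : Fock n K i),
    IsSeriesMul (fracW (s ^ 2) ((s ^ 2) ^ (-((l : ℤ) + 2))) ((s ^ 2) ^ (-((l : ℤ) + 1))))
      (fun a b => Ψ (hi l) b (xPlus s l i a v))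
      (fun a b => xPlus s l (i + 1) a (Ψ (hi l) b v)
        - delta ((s ^ 2) ^ ((l : ℕ) + 1)) a • Ψ (lo l) (a + b) v)
  xPlus_ne : ∀ (l : Fin (n - 1)) (j : Fin n), j ≠ lo l → j ≠ hi l →
    ∀ (v : Fock n K i) (a b : ℤ),
      xPlus s l (i + 1) a (Ψ j b v) = Ψ j b (xPlus s l i a v)
  xMinus_lo : ∀ (l : Fin (n - 1)) (v : Fock n K i),
    IsSeriesMul (delta ((s ^ 2) ^ (l : ℕ)))
      (fun a b => s ^ a • Ψ (hi l) b (psiCur s l i a v))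
      (fun a b => xMinus s l (i + 1) a (Ψ (lo l) b v) - Ψ (lo l) b (xMinus s l i a v))
  xMinus_ne : ∀ (l : Fin (n - 1)) (j : Fin n), j ≠ lo l → ∀ (v : Fock n K i) (a b : ℤ),
    xMinus s l (i + 1) a (Ψ j b v) = Ψ j b (xMinus s l i a v)
  phi_lo : ∀ (l : Fin (n - 1)) (v : Fock n K i),
    IsSeriesMul (fracW (s ^ 2)⁻¹ (s ^ (-2 * ((l : ℤ) + 1) + 1)) (s ^ (-2 * ((l : ℤ) + 1) - 1)))
      (fun a b => Ψ (lo l) b (phiCur s l i a v))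
      (fun a b => phiCur s l (i + 1) a (Ψ (lo l) b v))
  phi_hi : ∀ (l : Fin (n - 1)) (v : Fock n K i),
    IsSeriesMul (fracW (s ^ 2) (s ^ (-2 * ((l : ℤ) + 1) - 3)) (s ^ (-2 * ((l : ℤ) + 1) - 1)))
      (fun a b => Ψ (hi l) b (phiCur s l i a v))
      (fun a b => phiCur s l (i + 1) a (Ψ (hi l) b v))
  phi_ne : ∀ (l : Fin (n - 1)) (j : Fin n), j ≠ lo l → j ≠ hi l →
    ∀ (v : Fock n K i) (a b : ℤ),
      phiCur s l (i + 1) a (Ψ j b v) = Ψ j b (phiCur s l i a v)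
  psi_lo : ∀ (l : Fin (n - 1)) (v : Fock n K i),
    IsSeriesMul (fracZ (s ^ 2) (s ^ (2 * ((l : ℤ) + 1) - 3)) (s ^ (2 * ((l : ℤ) + 1) - 1)))
      (fun a b => Ψ (lo l) b (psiCur s l i a v))
      (fun a b => psiCur s l (i + 1) a (Ψ (lo l) b v))
  psi_hi : ∀ (l : Fin (n - 1)) (v : Fock n K i),
    IsSeriesMul (fracZ (s ^ 2)⁻¹ (s ^ (2 * ((l : ℤ) + 1) + 1)) (s ^ (2 * ((l : ℤ) + 1) - 1)))
      (fun a b => Ψ (hi l) b (psiCur s l i a v))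
      (fun a b => psiCur s l (i + 1) a (Ψ (hi l) b v))
  psi_ne : ∀ (l : Fin (n - 1)) (j : Fin n), j ≠ lo l → j ≠ hi l →
    ∀ (v : Fock n K i) (a b : ℤ),
      psiCur s l (i + 1) a (Ψ j b v) = Ψ j b (psiCur s l i a v)

/-! ### The bosonic formulas -/

theorem fundWt_sub_succ {n : ℕ} {j : ℕ} (hj : j < n) :
    (fundWt j - fundWt (j + 1) + fundWt 1 : Weight n) ∈ rootLattice n := by
  induction j with
  | zero =>
    have : (fundWt 0 - fundWt (0 + 1) + fundWt 1 : Weight n) = 0 := by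
      ext b; simp [fundWt]
    rw [this]; exact zero_mem _
  | succ j ih =>
    have h := add_mem (ih (by omega)) (simpleRoot_mem (n := n) ⟨j, by omega⟩)
    convert h using 1
    ext b
    simp only [fundWt, simpleRoot, cartan, CartanMatrix.A, Matrix.of_apply, Pi.add_apply,
      Pi.sub_apply, Fin.ext_iff]
    split_ifs <;> omega

theorem vertexShift {n i j : ℕ} (hi' : i < n) (hj : j < n) :
    (fundWt j - fundWt (j + 1) + fundWt (i + 1) - fundWt i : Weight n) ∈ rootLattice n := by
  have h := sub_mem (fundWt_sub_succ hj) (fundWt_sub_succ hi')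
  convert h using 1
  abel

theorem vertexShiftDual {n i j : ℕ} (hi' : i < n) (hj : j < n) :
    (-fundWt j + fundWt (j + 1) + fundWt i - fundWt (i + 1) : Weight n) ∈ rootLattice n := by
  have h := sub_mem (fundWt_sub_succ hi') (fundWt_sub_succ hj)
  convert h using 1
  abel

/-- The exponents `∑_{k>0} (-a*_{j,-k} q^{αk/2} + a*_{j+1,-k} q^{βk/2}) (q^j z)^k` (coefficient of
`z^k`). -/
def creExp {n : ℕ} {K : Type*} [Field K] (s : K) (j : ℕ) (α β : ℤ) (k : ℕ) :
    Module.End K (Osc n K) :=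
  (s ^ 2) ^ ((j : ℤ) * k) •
    (-(s ^ (α * k) • heisDual s j (-(k : ℤ))) + s ^ (β * k) • heisDual s (j + 1) (-(k : ℤ)))

/-- The exponents `∑_{k>0} (-a*_{j,k} q^{αk/2} + a*_{j+1,k} q^{βk/2}) (q^j z)^{-k}` (coefficient of
`z^{-k}`). -/
def annExp {n : ℕ} {K : Type*} [Field K] (s : K) (j : ℕ) (α β : ℤ) (k : ℕ) :
    Module.End K (Osc n K) :=
  (s ^ 2) ^ (-((j : ℤ) * k)) •
    (-(s ^ (α * k) • heisDual s j (k : ℤ)) + s ^ (β * k) • heisDual s (j + 1) (k : ℤ))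

/-- The sign `(-1)^{(n-1)(n-2)/2}` of the component `j = 0`. -/
def compSign (n j : ℕ) : ℤˣ := if j = 0 then (-1) ^ (n - 1).choose 2 else 1

/-- The scalar by which
`(q^{j+1})^{∂_{Λ_j}} (q^j)^{-∂_{Λ_{j+1}}} (-1)^{(n-1)(∂_{Λ_1} - (n-i-1)/n)}
  (-1)^{(n-i-1)(n-i-2)/2} (-q)^{j-i}`,
times the sign of the component, acts on `e^x`. The rational exponents under the floor signs are
integers for all weights `x` of `F_{i+1}`. -/
def vertexScalar {n : ℕ} {K : Type*} [Field K] (s : K) (i j : ℕ) (x : Weight n) : K :=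
  (s ^ 2) ^ ⌊((j : ℚ) + 1) * pairing (fundWt j) x - (j : ℚ) * pairing (fundWt (j + 1)) x⌋ *
    (-1) ^ ⌊((n : ℚ) - 1) * (pairing (fundWt 1) x - ((n : ℚ) - i - 1) / n)⌋ *
    (-1) ^ (n - i - 1).choose 2 * (-(s ^ 2)) ^ ((j : ℤ) - i) * (((compSign n j : ℤˣ) : ℤ) : K)

/-- The exponent of `z` in `z^{∂_{Λ_j} - ∂_{Λ_{j+1}} + (n-i-1)/n}` on `e^x`; it is an integer before
taking the floor, for all weights `x` of `F_{i+1}`. -/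
def vertexZExp {n : ℕ} (i j : ℕ) (x : Weight n) : ℤ :=
  ⌊pairing (fundWt j) x - pairing (fundWt (j + 1)) x + ((n : ℚ) - i - 1) / n⌋

/-- The scalar by which
`(q^{j+1})^{-∂_{Λ_j}} (q^j)^{∂_{Λ_{j+1}}} (q^n)^{i/n} (-1)^{(n-1)(-∂_{Λ_1} + (n-i)/n)}
  (-1)^{(n-i)(n-i-1)/2}`,
times the sign of the component, acts on `e^x`. The rational exponents under the floor signs are
integers for all weights `x` of `F_i`. -/
def dualScalar {n : ℕ} {K : Type*} [Field K] (s : K) (i j : ℕ) (x : Weight n) : K :=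
  (s ^ 2) ^ ⌊-((j : ℚ) + 1) * pairing (fundWt j) x + (j : ℚ) * pairing (fundWt (j + 1)) x + i⌋ *
    (-1) ^ ⌊((n : ℚ) - 1) * (-pairing (fundWt 1) x + ((n : ℚ) - i) / n)⌋ *
    (-1) ^ (n - i).choose 2 * (((compSign n j : ℤˣ) : ℤ) : K)

/-- The exponent of `z` in `z^{-∂_{Λ_j} + ∂_{Λ_{j+1}} + i/n}` on `e^x`; it is an integer before
taking the floor, for all weights `x` of `F_i`. -/
def dualZExp {n : ℕ} (i j : ℕ) (x : Weight n) : ℤ :=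
  ⌊-pairing (fundWt j) x + pairing (fundWt (j + 1)) x + (i : ℚ) / n⌋

/-- The bosonic formula for the type I vertex operator. -/
def typeI {n : ℕ} {K : Type*} [Field K] (s : K) (i : ℕ) (hi' : i < n) :
    Components n K (i + 1) i := fun j m =>
  fockMode (creExp s j 3 1) (annExp s j (-1) 1) (fundWt j - fundWt ((j : ℕ) + 1))
    (vertexScalar s i j) (vertexZExp i j) m (i + 1) i (add_mem_wtCoset (vertexShift hi' j.2))

/-- The bosonic formula for the type II vertex operator. -/
def typeII {n : ℕ} {K : Type*} [Field K] (s : K) (i : ℕ) (hi' : i < n) :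
    Components n K (i + 1) i := fun j m =>
  fockMode (creExp s j 1 (-1)) (annExp s j (-3) (-1)) (fundWt j - fundWt ((j : ℕ) + 1))
    (vertexScalar s i j) (vertexZExp i j) m (i + 1) i (add_mem_wtCoset (vertexShift hi' j.2))

/-- The bosonic formula for the dual type I vertex operator. -/
def dualTypeI {n : ℕ} {K : Type*} [Field K] (s : K) (i : ℕ) (hi' : i < n) :
    Components n K i (i + 1) := fun j m =>
  fockMode (fun k => -creExp s j 3 1 k) (fun k => -annExp s j (-1) 1 k)
    (-fundWt j + fundWt ((j : ℕ) + 1))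
    (dualScalar s i j) (dualZExp i j) m i (i + 1) (add_mem_wtCoset (vertexShiftDual hi' j.2))

/-- The bosonic formula for the dual type II vertex operator. -/
def dualTypeII {n : ℕ} {K : Type*} [Field K] (s : K) (i : ℕ) (hi' : i < n) :
    Components n K i (i + 1) := fun j m =>
  fockMode (fun k => -creExp s j 1 (-1) k) (fun k => -annExp s j (-3) (-1) k)
    (-fundWt j + fundWt ((j : ℕ) + 1))
    (dualScalar s i j) (dualZExp i j) m i (i + 1) (add_mem_wtCoset (vertexShiftDual hi' j.2))

end

end QAffine

/-! Existence rests on Wick's theorem. Every operator here is a normally ordered exponential: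
creation part, annihilation part, lattice element, zero modes. The product of a current at `w` and a
component at `z` is, in either order, a scalar series in `u = w/z` times one and the same normally
ordered product (`op_op`, `op_op'`), the scalar being the exponential of a contraction. The `a*_j`
are dual to the `a_l` for the `q`-Cartan matrix (`dualCoeff_three_term`,
`sum_qInt_cartan_mul_dualCoeff`), so the current `x^ε` of node `l + 1` contracts only with the
components `l` and `l + 1`. Together with the zero modes the contraction sums to `(u - A)^m` in one
order and to `r (u - A')^m` in the other, with `m` in `{0, 1, -1}`, each expanded in its own domain
(`isOPE_current`); the currents `φ`, `ψ` give quotients `(1 - X u)/(1 - Y u)` in the same way.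

The relations are then statements about these functions. If `A = A'` and `r = 1`, the case `m = 1`
gives commuting operators, and `m = -1` a commutator proportional to `δ(u/A)`, hence locality. If `A
≠ A'`, the quotient of the two functions is the prescribed `g`, up to a delta function at a pole. A
delta function restricts the normally ordered product to `w = ρ z`, where it fuses: the oscillator
parts of neighbouring components differ by exactly one current (`bosonF_succ`, `bosonH_succ`), so
the residue is the neighbouring component, or its product with `φ` or `ψ`. The scalars `(-q)^{j-i}`,
`κ_j` and `(-1)^{(n-1)∂}` are what makes the coefficients and the lattice signs come out right
(`latticeSign_commutator`, `latticeSign_simpleRoot_compWt_succ`). Normally ordered products are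
bounded below in both exponents, so all products of series are finite sums and a rational factor may
be checked after clearing its denominator.

For uniqueness let `D` be a component of the difference of two solutions. The modes of `φ` generate
a sector from `1 ⊗ e^x`; the zero mode of `φ` fixes the weight of `D(1 ⊗ e^x)`; and the modes of `ψ`
force the lowest nonzero mode of `D` on `1 ⊗ e^x` to be a scalar multiple of `1 ⊗ e^{γ+x}`. So `D`
vanishes on a sector as soon as this scalar does (`IsIntertwiner.vanishesAt_of_lowest`). For the
component number `i` the normalization kills the scalar in the highest weight sector. For each node
some current obeys a homogeneous relation with `D`, which carries vanishing from `x` to `x ± α`,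
hence to the whole coset (`IsIntertwiner.eq_zero_of_linked`). The inhomogeneous relations join
neighbouring components: in one direction the delta term is determined by the other terms, in the
other direction the relation becomes homogeneous and a comparison of leading exponents of the
currents leaves only zero (`IsIntertwiner.eq_zero_of_fracZ`, `IsIntertwiner.eq_zero_of_fracW`). -/

namespace QAffine
noncomputable section

/-! ### Exponentials of formal series -/

section Exponential

variable {R : Type*} [Ring R]

/-- The formal derivative of a power series over a possibly noncommutative ring. -/
def serDeriv (A : PowerSeries R) : PowerSeries R :=
  PowerSeries.mk fun m => (m + 1) • PowerSeries.coeff (m + 1) A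

theorem coeff_serDeriv (A : PowerSeries R) (m : ℕ) :
    PowerSeries.coeff m (serDeriv A) = (m + 1) • PowerSeries.coeff (m + 1) A := by
  simp [serDeriv]

theorem serDeriv_add (A B : PowerSeries R) : serDeriv (A + B) = serDeriv A + serDeriv B := by
  ext m; simp [coeff_serDeriv]

theorem serDeriv_mul (A B : PowerSeries R) :
    serDeriv (A * B) = serDeriv A * B + A * serDeriv B := by
  ext m
  have h1 : (m + 1) • PowerSeries.coeff (m + 1) (A * B)
      = ∑ p ∈ Finset.HasAntidiagonal.antidiagonal (m + 1),
          p.1 • (PowerSeries.coeff p.1 A * PowerSeries.coeff p.2 B)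
        + ∑ p ∈ Finset.HasAntidiagonal.antidiagonal (m + 1),
          p.2 • (PowerSeries.coeff p.1 A * PowerSeries.coeff p.2 B) := by
    rw [PowerSeries.coeff_mul, Finset.smul_sum, ← Finset.sum_add_distrib]
    refine Finset.sum_congr rfl fun p hp => ?_
    rw [← add_smul, Finset.HasAntidiagonal.mem_antidiagonal.mp hp]
  rw [coeff_serDeriv, h1, Finset.Nat.sum_antidiagonal_succ, Finset.Nat.sum_antidiagonal_succ',
    map_add, PowerSeries.coeff_mul, PowerSeries.coeff_mul]
  simp only [coeff_serDeriv, smul_mul_assoc, mul_smul_comm, zero_smul, zero_add]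

theorem serDeriv_pow_succ (A : PowerSeries R) (h : Commute A (serDeriv A)) (r : ℕ) :
    serDeriv (A ^ (r + 1)) = (r + 1) • (A ^ r * serDeriv A) := by
  induction r with
  | zero => simp
  | succ r ih =>
    rw [pow_succ, serDeriv_mul, ih, smul_mul_assoc, mul_assoc, ← h.eq, ← mul_assoc, ← pow_succ,
      ← succ_nsmul]

/-- `E` is the exponential of `F` (the constant term of `F` is ignored): `E(0) = 1` and
`E' = E F'`. -/
def IsExp (F E : PowerSeries R) : Prop :=
  PowerSeries.coeff 0 E = 1 ∧ serDeriv E = E * serDeriv F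

theorem IsExp.succ_smul {F E : PowerSeries R} (h : IsExp F E) (m : ℕ) :
    (m + 1) • PowerSeries.coeff (m + 1) E = ∑ p ∈ Finset.HasAntidiagonal.antidiagonal m,
      PowerSeries.coeff p.1 E * ((p.2 + 1) • PowerSeries.coeff (p.2 + 1) F) := by
  rw [← coeff_serDeriv, h.2, PowerSeries.coeff_mul]
  simp only [coeff_serDeriv]

/-- The equation `E' = E F'` with `E(0) = 1` is a recursion for the coefficients of `E`, solvable
uniquely when integers can be cancelled. Identities between exponentials below are proved by
checking this equation. -/
theorem IsExp.ext [IsAddTorsionFree R] {F F' E E' : PowerSeries R} (h : IsExp F E)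
    (h' : IsExp F' E')
    (hF : ∀ k, PowerSeries.coeff (k + 1) F = PowerSeries.coeff (k + 1) F') : E = E' := by
  have key : ∀ m, PowerSeries.coeff m E = PowerSeries.coeff m E' := by
    intro m
    induction m using Nat.strong_induction_on with
    | _ m ih =>
      rcases m with _ | m
      · rw [h.1, h'.1]
      · apply nsmul_right_injective (Nat.succ_ne_zero m)
        show (m + 1) • _ = (m + 1) • _
        rw [h.succ_smul, h'.succ_smul]
        refine Finset.sum_congr rfl fun p hp => ?_
        rw [ih p.1 (by have := Finset.HasAntidiagonal.mem_antidiagonal.mp hp; omega), hF]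
  ext m
  exact key m

theorem IsExp.add {F G E H : PowerSeries R} (h : IsExp F E) (h' : IsExp G H)
    (hc : Commute (serDeriv F) H) : IsExp (F + G) (E * H) := by
  refine ⟨by simp [PowerSeries.coeff_mul, h.1, h'.1], ?_⟩
  rw [serDeriv_mul, serDeriv_add, h.2, h'.2, mul_add, mul_assoc, hc.eq, mul_assoc, mul_assoc]

end Exponential

/-! ### Exponential coefficients over an algebra in characteristic zero. -/

section ExpCoeff

variable {K : Type*} [Field K] {R : Type*} [Ring R] [Algebra K R]

theorem coeff_pow_eq_zero {P : PowerSeries R} (h0 : PowerSeries.coeff 0 P = 0) :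
    ∀ (r m : ℕ), m < r → PowerSeries.coeff m (P ^ r) = 0 := by
  intro r
  induction r with
  | zero => intro m hm; omega
  | succ r ih =>
    intro m hm
    rw [pow_succ, PowerSeries.coeff_mul]
    refine Finset.sum_eq_zero fun p hp => ?_
    have := Finset.HasAntidiagonal.mem_antidiagonal.mp hp
    rcases Nat.eq_zero_or_pos p.2 with h2 | h2
    · rw [h2, h0, mul_zero]
    · rw [ih p.1 (by omega), zero_mul]

/-- The exponent has no constant term, so its `r`-th power starts in degree `r` and the truncation
bound is immaterial. This allows coefficients of different degrees to be compared over one range of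
`r`. -/
theorem expCoeff_eq_sum {f : ℕ → R} {m N : ℕ} (hN : m < N) :
    expCoeff (K := K) f m = ∑ r ∈ Finset.range N, ((r.factorial : K)⁻¹) •
      PowerSeries.coeff m ((PowerSeries.mk fun k => if k = 0 then 0 else f k) ^ r) := by
  unfold expCoeff
  refine Finset.sum_subset (Finset.range_mono (by omega)) fun r _ hr => ?_
  rw [coeff_pow_eq_zero (by simp) _ _ (by simpa using hr), smul_zero]

theorem expCoeff_zero (f : ℕ → R) : expCoeff (K := K) f 0 = 1 := by
  simp [expCoeff]

/-- The exponential series of `∑ f k z^k`. -/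
def expSer (K : Type*) [Field K] {R : Type*} [Ring R] [Algebra K R] (f : ℕ → R) :
    PowerSeries R := PowerSeries.mk (expCoeff (K := K) f)

theorem isExp_expSer [CharZero K] {f : ℕ → R} (hf : ∀ i j, Commute (f i) (f j)) :
    IsExp (PowerSeries.mk f) (expSer K f) := by
  refine ⟨by simp [expSer, expCoeff_zero], ?_⟩
  set P : PowerSeries R := PowerSeries.mk fun k => if k = 0 then 0 else f k with hP
  have hd : serDeriv (PowerSeries.mk f) = serDeriv P := by
    ext m; simp [coeff_serDeriv, hP]
  have hcomm : Commute P (serDeriv P) := by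
    ext m
    rw [PowerSeries.coeff_mul, PowerSeries.coeff_mul, ← Finset.Nat.sum_antidiagonal_swap]
    refine Finset.sum_congr rfl fun p _ => ?_
    simp only [hP, coeff_serDeriv, PowerSeries.coeff_mk, Prod.fst_swap, Prod.snd_swap,
      Nat.succ_ne_zero, if_false]
    by_cases h : p.2 = 0
    · simp [h]
    · rw [if_neg h, mul_smul_comm, smul_mul_assoc, (hf _ _).eq]
  rw [hd]
  ext m
  -- The derivative of the term number `r + 1` of the exponential is the term number `r` times the
  -- derivative of the exponent; the factor `r + 1` cancels against the factorial.
  have e1 : ∀ r : ℕ, (((r + 1).factorial : K)⁻¹) • ((m + 1) • PowerSeries.coeff (m + 1) (P ^ (r + 1)))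
      = ((r.factorial : K)⁻¹) • PowerSeries.coeff m (P ^ r * serDeriv P) := by
    intro r
    rw [← coeff_serDeriv, serDeriv_pow_succ P hcomm, map_nsmul, ← Nat.cast_smul_eq_nsmul K, smul_smul,
      Nat.factorial_succ]
    congr 1
    have : ((r + 1 : ℕ) : K) ≠ 0 := by exact_mod_cast Nat.succ_ne_zero r
    have h2 : (r.factorial : K) ≠ 0 := by exact_mod_cast Nat.factorial_ne_zero r
    push_cast at this ⊢
    field_simp
  rw [coeff_serDeriv, PowerSeries.coeff_mul]
  simp only [expSer, PowerSeries.coeff_mk]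
  rw [expCoeff_eq_sum (N := m + 2) (by omega), Finset.sum_range_succ']
  simp only [pow_zero, PowerSeries.coeff_one, Nat.succ_ne_zero, if_false, smul_zero, add_zero,
    Finset.smul_sum]
  rw [← hP]
  calc _ = ∑ r ∈ Finset.range (m + 1),
        ((r.factorial : K)⁻¹) • PowerSeries.coeff m (P ^ r * serDeriv P) := by
        refine Finset.sum_congr rfl fun r _ => ?_
        rw [← e1, smul_comm]
    _ = _ := by
        simp only [PowerSeries.coeff_mul, Finset.smul_sum]
        rw [Finset.sum_comm]
        refine Finset.sum_congr rfl fun p hp => ?_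
        rw [expCoeff_eq_sum (N := m + 1) (by have := Finset.HasAntidiagonal.mem_antidiagonal.mp hp; omega),
          Finset.sum_mul]
        simp only [smul_mul_assoc, ← hP]

theorem isAddTorsionFree_of_charZero (K : Type*) [Field K] [CharZero K] (R : Type*) [Ring R]
    [Algebra K R] : IsAddTorsionFree R := by
  refine ⟨fun m hm x y h => ?_⟩
  have h' : (m : K) • x = (m : K) • y := by
    simpa [Nat.cast_smul_eq_nsmul] using h
  have hm' : (m : K) ≠ 0 := by exact_mod_cast hm
  simpa [smul_smul, inv_mul_cancel₀ hm'] using congrArg (fun t => ((m : K)⁻¹) • t) h'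

theorem expCoeff_congr {f g : ℕ → R} (h : ∀ k, 0 < k → f k = g k) (m : ℕ) :
    expCoeff (K := K) f m = expCoeff (K := K) g m := by
  have : (PowerSeries.mk fun k => if k = 0 then 0 else f k)
      = PowerSeries.mk fun k => if k = 0 then 0 else g k := by
    ext k
    simp only [PowerSeries.coeff_mk]
    split_ifs with hk
    · rfl
    · exact h k (Nat.pos_of_ne_zero hk)
  simp only [expCoeff, this]

theorem expCoeff_map {S : Type*} [Ring S] [Algebra K S] (φ : R →ₐ[K] S) (f : ℕ → R) (m : ℕ) :
    φ (expCoeff (K := K) f m) = expCoeff (K := K) (fun k => φ (f k)) m := by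
  have : (PowerSeries.mk fun k => if k = 0 then 0 else φ (f k))
      = PowerSeries.map φ.toRingHom (PowerSeries.mk fun k => if k = 0 then 0 else f k) := by
    ext k
    simp only [PowerSeries.coeff_mk, PowerSeries.coeff_map]
    split_ifs <;> simp
  simp only [expCoeff, this, map_sum, map_smul, ← map_pow, PowerSeries.coeff_map]
  rfl

variable [CharZero K]

theorem expCoeff_unique {f e : ℕ → R} (hf : ∀ i j, Commute (f i) (f j)) (h0 : e 0 = 1)
    (hrec : ∀ m, (m + 1) • e (m + 1) = ∑ p ∈ Finset.HasAntidiagonal.antidiagonal m, e p.1 * ((p.2 + 1) • f (p.2 + 1)))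
    (m : ℕ) : expCoeff (K := K) f m = e m := by
  have := isAddTorsionFree_of_charZero K R
  have h : IsExp (PowerSeries.mk f) (PowerSeries.mk e) := by
    refine ⟨by simpa using h0, ?_⟩
    ext m
    rw [coeff_serDeriv, PowerSeries.coeff_mul]
    simpa [coeff_serDeriv] using hrec m
  have := (isExp_expSer (K := K) hf).ext h fun _ => rfl
  simpa [expSer] using congrArg (PowerSeries.coeff m) this

theorem expCoeff_succ {f : ℕ → R} (hf : ∀ i j, Commute (f i) (f j)) (m : ℕ) :
    (m + 1) • expCoeff (K := K) f (m + 1) = ∑ p ∈ Finset.HasAntidiagonal.antidiagonal m,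
      expCoeff (K := K) f p.1 * ((p.2 + 1) • f (p.2 + 1)) := by
  simpa [expSer] using (isExp_expSer (K := K) hf).succ_smul m

theorem expCoeff_add {S : Type*} [CommRing S] [Algebra K S] (f g : ℕ → S) (m : ℕ) :
    expCoeff (K := K) (fun k => f k + g k) m
      = ∑ p ∈ Finset.HasAntidiagonal.antidiagonal m, expCoeff (K := K) f p.1 * expCoeff (K := K) g p.2 := by
  have := isAddTorsionFree_of_charZero K S
  have h := (isExp_expSer (K := K) (f := f) fun i j => Commute.all _ _).add
    (isExp_expSer (K := K) (f := g) fun i j => Commute.all _ _) (Commute.all _ _)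
  have := (isExp_expSer (K := K) (f := fun k => f k + g k) fun i j => Commute.all _ _).ext h
    fun _ => by simp
  simpa [expSer, PowerSeries.coeff_mul] using congrArg (PowerSeries.coeff m) this

theorem expCoeff_scale {S : Type*} [CommRing S] [Algebra K S] (c : S) (f : ℕ → S) (m : ℕ) :
    expCoeff (K := K) (fun k => c ^ k * f k) m = c ^ m * expCoeff (K := K) f m := by
  refine expCoeff_unique (e := fun m => c ^ m * expCoeff (K := K) f m)
    (fun i j => Commute.all _ _) (by simp [expCoeff_zero]) (fun m => ?_) m
  rw [← mul_smul_comm, expCoeff_succ fun i j => Commute.all _ _, Finset.mul_sum]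
  refine Finset.sum_congr rfl fun p hp => ?_
  rw [← Finset.HasAntidiagonal.mem_antidiagonal.mp hp]
  simp only [nsmul_eq_mul]
  ring

theorem expCoeff_of_eq_zero {f : ℕ → R} (h : ∀ k, 0 < k → f k = 0) (m : ℕ) :
    expCoeff (K := K) f m = if m = 0 then 1 else 0 := by
  rw [expCoeff_congr (g := fun _ => 0) h]
  refine expCoeff_unique (e := fun m => if m = 0 then 1 else 0)
    (fun i j => Commute.zero_left _) (by simp) (fun m => ?_) m
  simp

/-- The exponent is `-log(1 - D z)`. This lemma and the next one turn contractions into rational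
functions. -/
theorem expCoeff_geom (D : K) (m : ℕ) :
    expCoeff (K := K) (fun k => D ^ k / k) m = D ^ m := by
  refine expCoeff_unique (fun i j => Commute.all _ _) (by simp) (fun m => ?_) m
  have : ∀ p ∈ Finset.HasAntidiagonal.antidiagonal m, D ^ p.1 * ((p.2 + 1) • (D ^ (p.2 + 1) / ((p.2 + 1 : ℕ) : K)))
      = D ^ (m + 1) := by
    intro p hp
    have h2 : ((p.2 + 1 : ℕ) : K) ≠ 0 := Nat.cast_ne_zero.mpr (Nat.succ_ne_zero _)
    rw [nsmul_eq_mul, mul_div_cancel₀ _ h2, ← pow_add, ← Finset.HasAntidiagonal.mem_antidiagonal.mp hp, add_assoc]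
  rw [Finset.sum_congr rfl this]
  simp

theorem expCoeff_neg_geom (D : K) (m : ℕ) :
    expCoeff (K := K) (fun k => -(D ^ k / k)) m
      = if m = 0 then 1 else if m = 1 then -D else 0 := by
  refine expCoeff_unique (e := fun m => if m = 0 then 1 else if m = 1 then -D else 0)
    (fun i j => Commute.all _ _) (by simp) (fun m => ?_) m
  have h2 : ∀ k : ℕ, (k + 1) • (-(D ^ (k + 1) / ((k + 1 : ℕ) : K))) = -D ^ (k + 1) := by
    intro k
    have h2 : ((k + 1 : ℕ) : K) ≠ 0 := Nat.cast_ne_zero.mpr (Nat.succ_ne_zero _)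
    rw [nsmul_eq_mul, mul_neg, mul_div_cancel₀ _ h2]
  simp only [h2]
  rcases m with _ | m
  · simp
  · rw [Finset.Nat.sum_antidiagonal_succ]
    rcases m with _ | m
    · simp; ring
    · rw [Finset.Nat.sum_antidiagonal_succ]
      simp; ring

end ExpCoeff


/-! ### Normally ordered exponentials on the oscillator space -/

section Modes

variable {n : ℕ} {K : Type*} [Field K]

/-- The creation part `∑_l F k l a_{l+1,-k}`, as a linear form. -/
def creForm (F : ℕ → Fin (n - 1) → K) (k : ℕ) : Osc n K :=
  ∑ l, MvPolynomial.C (F k l) * MvPolynomial.X (l, k - 1)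

/-- The coefficients of the exponential of the creation part. -/
def creCoeff (F : ℕ → Fin (n - 1) → K) (m : ℤ) : Osc n K :=
  if 0 ≤ m then expCoeff (K := K) (creForm F) m.toNat else 0

/-- The annihilation part number `k`, with the constant value `H k l` on the variable of
`a_{l+1,-k}`. -/
def annDer (H : ℕ → Fin (n - 1) → K) (k : ℕ) : Derivation K (Osc n K) (Osc n K) :=
  MvPolynomial.mkDerivation K fun p => if p.2 + 1 = k then MvPolynomial.C (H k p.1) else 0

/-- The exponential of the annihilation part as a translation of the variables. -/
def transl (H : ℕ → Fin (n - 1) → K) : Osc n K →ₐ[K] Polynomial (Osc n K) :=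
  MvPolynomial.aeval fun p => Polynomial.C (MvPolynomial.X p) +
    Polynomial.C (MvPolynomial.C (H (p.2 + 1) p.1)) * Polynomial.X ^ (p.2 + 1)

theorem transl_X (H : ℕ → Fin (n - 1) → K) (p : Fin (n - 1) × ℕ) :
    transl H (MvPolynomial.X p) = Polynomial.C (MvPolynomial.X p) +
      Polynomial.C (MvPolynomial.C (H (p.2 + 1) p.1)) * Polynomial.X ^ (p.2 + 1) := by
  simp [transl]

theorem transl_C (H : ℕ → Fin (n - 1) → K) (c : K) :
    transl H (MvPolynomial.C c) = Polynomial.C (MvPolynomial.C c) := by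
  rw [transl, MvPolynomial.aeval_C]; rfl

theorem annDer_X (H : ℕ → Fin (n - 1) → K) (k : ℕ) (p : Fin (n - 1) × ℕ) :
    annDer H k (MvPolynomial.X p) = if p.2 + 1 = k then MvPolynomial.C (H k p.1) else 0 := by
  simp [annDer, MvPolynomial.mkDerivation_X]

/-- Both derivations are constant on the variables, so their commutator kills every variable. -/
theorem annDer_commute (H : ℕ → Fin (n - 1) → K) (i j : ℕ) :
    Commute (annDer H i).toLinearMap (annDer H j).toLinearMap := by
  have h : ⁅annDer H i, annDer H j⁆ = 0 := by
    apply MvPolynomial.derivation_ext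
    intro p
    rw [Derivation.commutator_apply, annDer_X, annDer_X]
    split_ifs <;> simp [annDer]
  refine LinearMap.ext fun p => ?_
  have := DFunLike.congr_fun h p
  rw [Derivation.commutator_apply] at this
  exact sub_eq_zero.mp this

/-- Chain rule in the translation parameter, proved on variables and extended by Leibniz. Only the
derivations whose index occurs in `p` contribute, so every sufficiently long truncation of the sum
is correct. -/
theorem derivative_transl (H : ℕ → Fin (n - 1) → K) (p : Osc n K) :
    ∃ T₀, ∀ T, T₀ ≤ T → Polynomial.derivative (transl H p) = ∑ k ∈ Finset.range T,
      (k + 1) • (Polynomial.X ^ k * transl H (annDer H (k + 1) p)) := by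
  induction p using MvPolynomial.induction_on with
  | C c => exact ⟨0, fun T _ => by rw [transl_C]; simp [annDer]⟩
  | add p q hp hq =>
    obtain ⟨A, hA⟩ := hp
    obtain ⟨B, hB⟩ := hq
    refine ⟨max A B, fun T hT => ?_⟩
    rw [map_add, map_add, hA T (le_trans (le_max_left _ _) hT),
      hB T (le_trans (le_max_right _ _) hT), ← Finset.sum_add_distrib]
    simp [mul_add]
  | mul_X p i hp =>
    obtain ⟨A, hA⟩ := hp
    refine ⟨max A (i.2 + 1), fun T hT => ?_⟩
    have hX : Polynomial.derivative (transl H (MvPolynomial.X i)) = ∑ k ∈ Finset.range T,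
        (k + 1) • (Polynomial.X ^ k * transl H (annDer H (k + 1) (MvPolynomial.X i))) := by
      rw [Finset.sum_eq_single i.2]
      · rw [annDer_X, if_pos rfl, transl_X, transl_C, Polynomial.derivative_add,
          Polynomial.derivative_C, zero_add, Polynomial.derivative_C_mul,
          Polynomial.derivative_X_pow]
        simp only [add_tsub_cancel_right, nsmul_eq_mul, Polynomial.C_eq_natCast]
        ring
      · intro b _ hb
        rw [annDer_X, if_neg (by omega)]
        simp
      · intro h
        exact absurd (Finset.mem_range.mpr (by have := le_max_right A (i.2 + 1); omega)) h
    rw [map_mul, Polynomial.derivative_mul, hX, hA T (le_trans (le_max_left _ _) hT),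
      Finset.sum_mul, Finset.mul_sum, ← Finset.sum_add_distrib]
    refine Finset.sum_congr rfl fun k _ => ?_
    rw [Derivation.leibniz]
    simp only [smul_eq_mul, map_add, map_mul, nsmul_eq_mul]
    ring

theorem coeff_transl_succ (H : ℕ → Fin (n - 1) → K) (p : Osc n K) (t : ℕ) :
    (t + 1) • (transl H p).coeff (t + 1) = ∑ x ∈ Finset.HasAntidiagonal.antidiagonal t,
      (transl H ((x.2 + 1) • annDer H (x.2 + 1) p)).coeff x.1 := by
  obtain ⟨T, hT⟩ := derivative_transl H p
  have h := congrArg (fun P => Polynomial.coeff P t) (hT (T + (t + 1)) (by omega))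
  simp only [Polynomial.coeff_derivative, Polynomial.finsetSum_coeff, Polynomial.coeff_smul,
    Polynomial.coeff_X_pow_mul'] at h
  rw [nsmul_eq_mul, mul_comm]
  push_cast
  rw [h, ← Finset.Nat.sum_antidiagonal_swap]
  simp only [Prod.fst_swap, Prod.snd_swap]
  rw [Finset.Nat.sum_antidiagonal_eq_sum_range_succ
    (fun i j => (transl H ((i + 1) • annDer H (i + 1) p)).coeff j)]
  symm
  refine Finset.sum_subset_zero_on_sdiff (Finset.range_mono (by omega)) ?_ ?_
  · intro k hk
    rw [if_neg (by simp at hk; omega), smul_zero]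
  · intro k hk
    rw [if_pos (by simp at hk; omega), map_nsmul, Polynomial.coeff_smul]

theorem coeff_zero_transl (H : ℕ → Fin (n - 1) → K) (p : Osc n K) :
    (transl H p).coeff 0 = p := by
  rw [Polynomial.coeff_zero_eq_eval_zero]
  induction p using MvPolynomial.induction_on with
  | C c => rw [transl_C]; simp
  | add p q hp hq => rw [map_add, Polynomial.eval_add, hp, hq]
  | mul_X p i hp => rw [map_mul, Polynomial.eval_mul, hp, transl_X]; simp

/-- Taylor's formula: the exponential of commuting constant derivations is a translation, because
both sides satisfy the same differential equation in the parameter. Hence the annihilation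
exponential is an algebra homomorphism with values in polynomials, which makes all later sums
finite. -/
theorem expCoeff_annDer [CharZero K] (H : ℕ → Fin (n - 1) → K) (t : ℕ) (p : Osc n K) :
    expCoeff (K := K) (fun k => (annDer H k).toLinearMap) t p = (transl H p).coeff t := by
  have := expCoeff_unique (K := K) (f := fun k => (annDer H k).toLinearMap)
    (e := fun t => ((Polynomial.lcoeff (Osc n K) t).restrictScalars K).comp
      (transl H).toLinearMap) (annDer_commute H)
    (LinearMap.ext fun q => coeff_zero_transl H q)
    (fun m => LinearMap.ext fun q => by
      have := coeff_transl_succ H q m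
      simpa [LinearMap.sum_apply, add_mul] using this) t
  rw [this]
  rfl

/-- `P(y) ↦ ∑ A (m + t) P_t`. -/
def pairL {S : Type*} [CommRing S] (A : ℤ → S) (m : ℤ) : Polynomial S →ₗ[S] S :=
  Polynomial.lsum fun t => LinearMap.mulLeft S (A (m + t))

theorem pairL_monomial {S : Type*} [CommRing S] (A : ℤ → S) (m : ℤ) (t : ℕ) (r : S) :
    pairL A m (Polynomial.monomial t r) = A (m + t) * r := by
  rw [pairL, Polynomial.lsum_apply, Polynomial.sum_monomial_index _ _ (by simp)]
  rfl

theorem pairL_X_pow_mul {S : Type*} [CommRing S] (A : ℤ → S) (m : ℤ) (i : ℕ)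
    (P : Polynomial S) : pairL A m (Polynomial.X ^ i * P) = pairL A (m + i) P := by
  induction P using Polynomial.induction_on' with
  | add p q hp hq => rw [mul_add, map_add, map_add, hp, hq]
  | monomial t r =>
    rw [Polynomial.X_pow_mul_monomial, pairL_monomial, pairL_monomial]
    push_cast
    rw [add_assoc, add_comm (t : ℤ)]

theorem pairL_C_mul {S : Type*} [CommRing S] (A : ℤ → S) (m : ℤ) (r : S)
    (P : Polynomial S) : pairL A m (Polynomial.C r * P) = r * pairL A m P := by
  rw [← Polynomial.smul_eq_C_mul, map_smul, smul_eq_mul]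

/-- The coefficient of `z ^ m` in the normally ordered exponential with creation part `F` and
annihilation part `H`. -/
def mode (F H : ℕ → Fin (n - 1) → K) (m : ℤ) : Module.End K (Osc n K) :=
  ((pairL (creCoeff F) m).restrictScalars K).comp (transl H).toLinearMap

theorem mode_apply (F H : ℕ → Fin (n - 1) → K) (m : ℤ) (p : Osc n K) :
    mode F H m p = pairL (creCoeff F) m (transl H p) := rfl

/-- Replaces the finite-support sum of the definition by a pairing with a polynomial, valid on all
vectors and not only on monomials. -/
theorem expMode_eq_mode [CharZero K] {f g : ℕ → Module.End K (Osc n K)}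
    {F H : ℕ → Fin (n - 1) → K} (hf : ∀ k, 0 < k → f k = LinearMap.mulLeft K (creForm F k))
    (hg : ∀ k, 0 < k → g k = (annDer H k).toLinearMap) (m : ℤ) :
    expMode f g m = mode F H m := by
  refine (MvPolynomial.basisMonomials (Fin (n - 1) × ℕ) K).ext fun d => ?_
  rw [expMode, Module.Basis.constr_basis, MvPolynomial.coe_basisMonomials, mode_apply, pairL,
    Polynomial.lsum_apply, Polynomial.sum]
  set q : Osc n K := MvPolynomial.monomial d 1
  have h1 : ∀ i j : ℕ, expCoeff (K := K) f i (expCoeff (K := K) g j q)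
      = expCoeff (K := K) (creForm F) i * (transl H q).coeff j := by
    intro i j
    rw [expCoeff_congr (K := K) hg, expCoeff_annDer, expCoeff_congr (K := K) hf]
    have := expCoeff_map (K := K) (Algebra.lmul K (Osc n K)) (creForm F) i
    exact (LinearMap.congr_fun this _).symm
  simp only [h1]
  -- The index `t` in the support of the polynomial stands for the pair `(m + t, t)`. When `m + t`
  -- is negative, `toNat` gives a pair off the diagonal, whose summand is `0`, in agreement with
  -- `creCoeff`.
  have hinj : Function.Injective fun t : ℕ => ((m + t).toNat, t) := fun a b h => (Prod.ext_iff.mp h).2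
  rw [finsum_eq_sum_of_support_subset (s := (transl H q).support.map ⟨_, hinj⟩), Finset.sum_map]
  · refine Finset.sum_congr rfl fun t _ => ?_
    simp only [Function.Embedding.coeFn_mk, LinearMap.mulLeft_apply, creCoeff]
    by_cases h : 0 ≤ m + t
    · rw [if_pos h, if_pos (by rw [Int.toNat_of_nonneg h]; ring)]
    · rw [if_neg h, if_neg (by omega), zero_mul]
  · rintro ⟨i, j⟩ hij
    simp only [Function.mem_support, ne_eq, ite_eq_right_iff, Classical.not_imp] at hij
    simp only [Finset.coe_map, Function.Embedding.coeFn_mk, Set.mem_image, Finset.mem_coe,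
      Polynomial.mem_support_iff, Prod.mk.injEq]
    refine ⟨j, fun h => hij.2 (by rw [h, mul_zero]), by omega, rfl⟩

/-! ### Operator products -/

/-- The contraction of an annihilation part with a creation part. -/
def contr (H F : ℕ → Fin (n - 1) → K) (k : ℕ) : K := ∑ l, H k l * F k l

theorem transl_creForm (H F : ℕ → Fin (n - 1) → K) {k : ℕ} (hk : 0 < k) :
    transl H (creForm F k) = Polynomial.CAlgHom (R := K) (creForm F k) +
      Polynomial.X ^ k * Algebra.ofId K (Polynomial (Osc n K)) (contr H F k) := by
  have hk' : k - 1 + 1 = k := by omega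
  have e : ∀ c : K, Algebra.ofId K (Polynomial (Osc n K)) c
      = Polynomial.C (MvPolynomial.C c) := fun c => rfl
  simp only [creForm, contr, map_sum, map_mul, transl_C, transl_X, hk', e,
    Polynomial.CAlgHom_apply, Finset.mul_sum, ← Finset.sum_add_distrib]
  refine Finset.sum_congr rfl fun l _ => ?_
  ring

/-- Wick's theorem for one exponential: translation adds a scalar to the linear form `creForm F k`,
so the creation exponential is multiplied by the exponential of the contraction, carried by the
translation variable. -/
theorem transl_creCoeff [CharZero K] (H F : ℕ → Fin (n - 1) → K) (b : ℤ) (I : ℕ) (hI : b < I) :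
    transl H (creCoeff F b) = ∑ i ∈ Finset.range I,
      Polynomial.X ^ i * Polynomial.C (expCoeff (K := K) (contr H F) i • creCoeff F (b - i)) := by
  by_cases hb : 0 ≤ b
  · obtain ⟨m, rfl⟩ := Int.eq_ofNat_of_zero_le hb
    have h1 : transl H (creCoeff F (m : ℤ)) = ∑ p ∈ Finset.HasAntidiagonal.antidiagonal m,
        Polynomial.C (expCoeff (K := K) (creForm F) p.1) *
          (Polynomial.X ^ p.2 * Polynomial.C (MvPolynomial.C (expCoeff (K := K) (contr H F) p.2))) := by
      rw [creCoeff, if_pos hb, Int.toNat_natCast, expCoeff_map,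
        expCoeff_congr fun k hk => transl_creForm H F hk, expCoeff_add]
      refine Finset.sum_congr rfl fun p _ => ?_
      rw [expCoeff_scale, ← expCoeff_map, ← expCoeff_map]
      rfl
    rw [h1, ← Finset.Nat.sum_antidiagonal_swap]
    simp only [Prod.fst_swap, Prod.snd_swap]
    rw [Finset.Nat.sum_antidiagonal_eq_sum_range_succ (fun i j =>
      Polynomial.C (expCoeff (K := K) (creForm F) j) *
          (Polynomial.X ^ i * Polynomial.C (MvPolynomial.C (expCoeff (K := K) (contr H F) i))))]
    refine Finset.sum_subset_zero_on_sdiff (Finset.range_mono (by omega)) ?_ ?_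
    · intro k hk
      rw [creCoeff, if_neg (by simp at hk; omega)]
      simp
    · intro k hk
      have : (m : ℤ) - k = ((m - k : ℕ) : ℤ) := by simp at hk; omega
      rw [this, creCoeff, if_pos (by omega), Int.toNat_natCast, MvPolynomial.smul_eq_C_mul,
        Polynomial.C_mul]
      ring
  · rw [creCoeff, if_neg hb, map_zero]
    symm
    refine Finset.sum_eq_zero fun i _ => ?_
    rw [creCoeff, if_neg (by omega)]
    simp

theorem mode_creCoeff_mul [CharZero K] (F H F' : ℕ → Fin (n - 1) → K) (a b : ℤ) (r : Osc n K)
    (I : ℕ) (hI : b < I) :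
    mode F H a (creCoeff F' b * r) = ∑ i ∈ Finset.range I,
      expCoeff (K := K) (contr H F') i • (creCoeff F' (b - i) * mode F H (a + i) r) := by
  rw [mode_apply, map_mul, transl_creCoeff H F' b I hI, Finset.sum_mul, map_sum]
  refine Finset.sum_congr rfl fun i _ => ?_
  rw [mul_assoc, pairL_X_pow_mul, pairL_C_mul, mode_apply, smul_mul_assoc]

/-- `Q(y, y') ↦ ∑ A' (b + t) A (a + h) Q_{h, t}`, where `h` is the exponent of `y` and `t` the one
of `y'`. -/
def pairL₂ {S : Type*} [CommRing S] (A A' : ℤ → S) (a b : ℤ) :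
    Polynomial (Polynomial S) →ₗ[S] S :=
  Polynomial.lsum fun t => (LinearMap.mulLeft S (A' (b + t))).comp (pairL A a)

theorem pairL₂_monomial {S : Type*} [CommRing S] (A A' : ℤ → S) (a b : ℤ) (t : ℕ)
    (P : Polynomial S) :
    pairL₂ A A' a b (Polynomial.monomial t P) = A' (b + t) * pairL A a P := by
  rw [pairL₂, Polynomial.lsum_apply, Polynomial.sum_monomial_index _ _ (by simp)]
  rfl

theorem bivariate_induction {S : Type*} [CommRing S] {M : Polynomial (Polynomial S) → Prop}
    (hadd : ∀ P Q, M P → M Q → M (P + Q))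
    (hmon : ∀ t h r, M (Polynomial.monomial t (Polynomial.monomial h r))) (Q) : M Q := by
  induction Q using Polynomial.induction_on' with
  | add p q hp hq => exact hadd _ _ hp hq
  | monomial t P =>
    induction P using Polynomial.induction_on' with
    | add p q hp hq => rw [map_add]; exact hadd _ _ hp hq
    | monomial h r => exact hmon t h r

/-- Creation parts commute, as do translations; hence both orders of a product lead to the same
normally ordered expression (`nord_swap`). -/
theorem pairL₂_swap {S : Type*} [CommRing S] (A A' : ℤ → S) (a b : ℤ)
    (Q : Polynomial (Polynomial S)) :
    pairL₂ A A' a b (Polynomial.Bivariate.swap Q) = pairL₂ A' A b a Q := by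
  induction Q using bivariate_induction with
  | hadd P Q hP hQ => rw [map_add, map_add, map_add, hP, hQ]
  | hmon t h r =>
    rw [Polynomial.Bivariate.swap_monomial_monomial, pairL₂_monomial, pairL₂_monomial,
      pairL_monomial, pairL_monomial]
    ring

/-- The composition of two translations. -/
def transl₂ (H H' : ℕ → Fin (n - 1) → K) : Osc n K →ₐ[K] Polynomial (Polynomial (Osc n K)) :=
  (Polynomial.mapAlgHom (transl H)).comp (transl H')

theorem transl₂_X (H H' : ℕ → Fin (n - 1) → K) (p : Fin (n - 1) × ℕ) :
    transl₂ H H' (MvPolynomial.X p) = Polynomial.C (Polynomial.C (MvPolynomial.X p)) +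
      Polynomial.C (Polynomial.C (MvPolynomial.C (H (p.2 + 1) p.1))) *
        Polynomial.C Polynomial.X ^ (p.2 + 1) +
      Polynomial.C (Polynomial.C (MvPolynomial.C (H' (p.2 + 1) p.1))) *
        Polynomial.X ^ (p.2 + 1) := by
  simp only [transl₂, AlgHom.comp_apply, transl_X, map_add, map_mul, map_pow]
  simp [transl_X]

theorem swap_transl₂ (H H' : ℕ → Fin (n - 1) → K) (p : Osc n K) :
    Polynomial.Bivariate.swap (transl₂ H H' p) = transl₂ H' H p := by
  have : ((Polynomial.Bivariate.swap (R := Osc n K)).toAlgHom.restrictScalars K).comp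
      (transl₂ H H') = transl₂ H' H := by
    apply MvPolynomial.algHom_ext
    intro i
    show Polynomial.Bivariate.swap (transl₂ H H' (MvPolynomial.X i)) = _
    rw [transl₂_X, transl₂_X, map_add, map_add, map_mul, map_mul, map_pow, map_pow,
      Polynomial.Bivariate.swap_X, Polynomial.Bivariate.swap_Y, Polynomial.Bivariate.swap_C_C,
      Polynomial.Bivariate.swap_C_C, Polynomial.Bivariate.swap_C_C]
    ring
  exact DFunLike.congr_fun this p

/-- The coefficient of `w ^ a z ^ b` in the normally ordered product of two normally ordered
exponentials. -/
def nord (F H F' H' : ℕ → Fin (n - 1) → K) (p : Osc n K) (a b : ℤ) : Osc n K :=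
  pairL₂ (creCoeff F) (creCoeff F') a b (transl₂ H H' p)

theorem nord_swap (F H F' H' : ℕ → Fin (n - 1) → K) (p : Osc n K) (a b : ℤ) :
    nord F H F' H' p a b = nord F' H' F H p b a := by
  rw [nord, nord, ← swap_transl₂, pairL₂_swap]

/-- Wick's theorem for the modes: the product is `exp(contraction)(z/w)` times the normally ordered
product, and a factor `(z/w)^i` moves the exponents from `(a, b)` to `(a + i, b - i)`. -/
theorem mode_mode [CharZero K] (F H F' H' : ℕ → Fin (n - 1) → K) (p : Osc n K) (a b : ℤ) :
    ∃ I₀ : ℕ, ∀ I, I₀ ≤ I → mode F H a (mode F' H' b p) = ∑ i ∈ Finset.range I,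
      expCoeff (K := K) (contr H F') i • nord F H F' H' p (a + i) (b - i) := by
  have key : ∀ Q : Polynomial (Osc n K), ∃ I₀ : ℕ, ∀ I, I₀ ≤ I →
      mode F H a (pairL (creCoeff F') b Q) = ∑ i ∈ Finset.range I,
        expCoeff (K := K) (contr H F') i •
          pairL₂ (creCoeff F) (creCoeff F') (a + i) (b - i) (Polynomial.mapAlgHom (transl H) Q) := by
    intro Q
    induction Q using Polynomial.induction_on' with
    | add p q hp hq =>
      obtain ⟨A, hA⟩ := hp
      obtain ⟨B, hB⟩ := hq
      refine ⟨max A B, fun I hI => ?_⟩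
      simp only [map_add, smul_add, Finset.sum_add_distrib]
      rw [hA I (le_trans (le_max_left _ _) hI), hB I (le_trans (le_max_right _ _) hI)]
    | monomial t r =>
      refine ⟨(b + t).toNat + 1, fun I hI => ?_⟩
      rw [pairL_monomial, mode_creCoeff_mul _ _ _ _ _ _ I (by omega)]
      refine Finset.sum_congr rfl fun i _ => ?_
      rw [Polynomial.coe_mapAlgHom, Polynomial.map_monomial, pairL₂_monomial, mode_apply,
        show b - i + t = b + t - i by ring]
      rfl
  exact key _

theorem exists_pairL₂_eq_zero (F F' : ℕ → Fin (n - 1) → K)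
    (Q : Polynomial (Polynomial (Osc n K))) :
    ∃ B : ℤ, ∀ a b, (a < B ∨ b < B) → pairL₂ (creCoeff F) (creCoeff F') a b Q = 0 := by
  induction Q using bivariate_induction with
  | hadd P Q hP hQ =>
    obtain ⟨A, hA⟩ := hP
    obtain ⟨B, hB⟩ := hQ
    refine ⟨min A B, fun a b h => ?_⟩
    rw [map_add, hA a b (by omega), hB a b (by omega), add_zero]
  | hmon t h r =>
    refine ⟨-(t + h), fun a b hab => ?_⟩
    rw [pairL₂_monomial, pairL_monomial]
    rcases hab with hab | hab
    · rw [creCoeff, creCoeff, if_neg (show ¬ 0 ≤ a + (h : ℤ) by omega)]; simp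
    · rw [creCoeff, if_neg (show ¬ 0 ≤ b + (t : ℤ) by omega)]; simp

/-- Creation series have no negative modes, and a fixed vector is translated into a polynomial, so
both exponents are bounded below. This is what lets an arbitrary two-sided series in `w/z` act on
the family. -/
theorem exists_nord_eq_zero (F H F' H' : ℕ → Fin (n - 1) → K) (p : Osc n K) :
    ∃ B : ℤ, ∀ a b, (a < B ∨ b < B) → nord F H F' H' p a b = 0 :=
  exists_pairL₂_eq_zero F F' _

end Modes


/-! ### Fusion of normally ordered exponentials -/

section Fusion

variable {n : ℕ} {K : Type*} [Field K]

theorem creCoeff_of_neg (F : ℕ → Fin (n - 1) → K) {m : ℤ} (hm : m < 0) : creCoeff F m = 0 :=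
  if_neg (by omega)

theorem creCoeff_natCast (F : ℕ → Fin (n - 1) → K) (m : ℕ) :
    creCoeff F (m : ℤ) = expCoeff (K := K) (creForm F) m := by
  rw [creCoeff, if_pos (by omega), Int.toNat_natCast]

variable [CharZero K]

theorem expCoeff_creForm_fuse {F F' F₁₂ : ℕ → Fin (n - 1) → K} {ρ : K}
    (hF : ∀ k, 0 < k → ∀ l, F₁₂ k l = ρ ^ k * F k l + F' k l) (m : ℕ) :
    expCoeff (K := K) (creForm F₁₂) m = ∑ i ∈ Finset.range (m + 1),
      ρ ^ i • (expCoeff (K := K) (creForm F) i * expCoeff (K := K) (creForm F') (m - i)) := by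
  have h : ∀ k, 0 < k → creForm F₁₂ k = MvPolynomial.C ρ ^ k * creForm F k + creForm F' k := by
    intro k hk
    simp only [creForm, Finset.mul_sum, ← Finset.sum_add_distrib]
    refine Finset.sum_congr rfl fun l _ => ?_
    rw [hF k hk]
    simp only [map_add, map_mul, map_pow]
    ring
  rw [expCoeff_congr h, expCoeff_add]
  rw [Finset.Nat.sum_antidiagonal_eq_sum_range_succ
    (fun i j => expCoeff (K := K) (fun k => MvPolynomial.C ρ ^ k * creForm F k) i
      * expCoeff (K := K) (creForm F') j)]
  refine Finset.sum_congr rfl fun i _ => ?_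
  rw [expCoeff_scale, MvPolynomial.smul_eq_C_mul, map_pow, mul_assoc]

/-- Multiplicativity of the exponential at `w = ρ z`; `h` and `t` are the shifts caused by the
annihilation variables. The nonzero terms have `k` between `-h` and `M + t`, which explains the
bound on `L`. -/
theorem creCoeff_fuse {F F' F₁₂ : ℕ → Fin (n - 1) → K} {ρ : K} (hρ : ρ ≠ 0)
    (hF : ∀ k, 0 < k → ∀ l, F₁₂ k l = ρ ^ k * F k l + F' k l) (M : ℤ) (h t : ℕ) {L : ℕ}
    (hL : h + M.natAbs + t ≤ L) :
    ∑ k ∈ Finset.Icc (-(L : ℤ)) L, ρ ^ k • (creCoeff F (k + h) * creCoeff F' (M - k + t))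
      = ρ ^ (-(h : ℤ)) • creCoeff F₁₂ (M + h + t) := by
  by_cases hM : 0 ≤ M + h + t
  · obtain ⟨m, hm⟩ := Int.eq_ofNat_of_zero_le hM
    rw [hm]
    rw [creCoeff_natCast, expCoeff_creForm_fuse hF, Finset.smul_sum]
    have hinj : Function.Injective fun i : ℕ => (i : ℤ) - h := fun a b hab => by
      simpa using hab
    calc _ = ∑ k ∈ (Finset.range (m + 1)).map ⟨_, hinj⟩,
          ρ ^ k • (creCoeff F (k + h) * creCoeff F' (M - k + t)) := by
          symm
          refine Finset.sum_subset ?_ ?_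
          · intro k hk
            simp only [Finset.mem_map, Finset.mem_range, Function.Embedding.coeFn_mk] at hk
            obtain ⟨i, hi, rfl⟩ := hk
            rw [Finset.mem_Icc]
            omega
          · intro k _ hk
            simp only [Finset.mem_map, Finset.mem_range, Function.Embedding.coeFn_mk, not_exists,
              not_and] at hk
            by_cases h1 : 0 ≤ k + h
            · have := hk (k + h).toNat
              rw [creCoeff_of_neg F', mul_zero, smul_zero]
              by_contra h2
              exact this (by omega) (by omega)
            · rw [creCoeff_of_neg F (by omega), zero_mul, smul_zero]
      _ = _ := by
          rw [Finset.sum_map]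
          refine Finset.sum_congr rfl fun i hi => ?_
          have hi' : i ≤ m := by simpa [Nat.lt_succ_iff] using hi
          simp only [Function.Embedding.coeFn_mk]
          have e1 : (i : ℤ) - h + h = i := by ring
          have e2 : M - (i - h) + t = ((m - i : ℕ) : ℤ) := by
            rw [Nat.cast_sub hi']
            linarith [show M + h + t = (m : ℤ) from hm]
          rw [e1, e2, creCoeff_natCast, creCoeff_natCast, smul_smul, sub_eq_add_neg,
            zpow_add₀ hρ, zpow_natCast, mul_comm]
  · rw [creCoeff_of_neg F₁₂ (by omega), smul_zero]
    refine Finset.sum_eq_zero fun k _ => ?_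
    by_cases h1 : 0 ≤ k + h
    · rw [creCoeff_of_neg F' (by omega), mul_zero, smul_zero]
    · rw [creCoeff_of_neg F (by omega), zero_mul, smul_zero]

/-- Restriction of a polynomial in `y`, `y'` to `y = ρ⁻¹ y'`. -/
def diagEval (ρ : K) : Polynomial (Polynomial (Osc n K)) →+* Polynomial (Osc n K) :=
  Polynomial.eval₂RingHom (Polynomial.eval₂RingHom Polynomial.C
    (Polynomial.C (MvPolynomial.C ρ⁻¹) * Polynomial.X)) Polynomial.X

theorem diagEval_monomial (ρ : K) (t h : ℕ) (r : Osc n K) :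
    diagEval ρ (Polynomial.monomial t (Polynomial.monomial h r))
      = Polynomial.monomial (h + t) (ρ ^ (-(h : ℤ)) • r) := by
  simp only [diagEval, Polynomial.coe_eval₂RingHom, Polynomial.eval₂_monomial]
  rw [← Polynomial.C_mul_X_pow_eq_monomial, MvPolynomial.smul_eq_C_mul, zpow_neg, zpow_natCast,
    ← inv_pow, map_pow, Polynomial.C_mul, Polynomial.C_pow]
  ring

theorem diagEval_transl₂ {H H' H₁₂ : ℕ → Fin (n - 1) → K} {ρ : K}
    (hH : ∀ k, 0 < k → ∀ l, H₁₂ k l = ρ⁻¹ ^ k * H k l + H' k l) (p : Osc n K) :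
    diagEval ρ (transl₂ H H' p) = transl H₁₂ p := by
  have e : ∀ r : Osc n K, diagEval ρ (Polynomial.C (Polynomial.C r)) = Polynomial.C r := by
    intro r; simp [diagEval]
  have e2 : diagEval (n := n) ρ (Polynomial.C Polynomial.X)
      = Polynomial.C (MvPolynomial.C ρ⁻¹) * Polynomial.X := by simp [diagEval]
  have e3 : diagEval (n := n) ρ Polynomial.X = Polynomial.X := by simp [diagEval]
  induction p using MvPolynomial.induction_on with
  | C c => rw [transl_C, transl₂, AlgHom.comp_apply, transl_C]; simp [e]
  | add p q hp hq => simp only [map_add, hp, hq]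
  | mul_X p i hp =>
    rw [map_mul, map_mul, map_mul, hp, transl₂_X, transl_X, hH (i.2 + 1) (Nat.succ_pos _)]
    simp only [map_add, map_mul, map_pow, e, e2, e3]
    ring

/-- Restriction of a normally ordered product to `w = ρ z`. It is again a normally ordered
exponential: creation parts add with weight `ρ^k`, annihilation parts with weight `ρ^{-k}`. -/
theorem nord_fuse {F F' F₁₂ H H' H₁₂ : ℕ → Fin (n - 1) → K} {ρ : K} (hρ : ρ ≠ 0)
    (hF : ∀ k, 0 < k → ∀ l, F₁₂ k l = ρ ^ k * F k l + F' k l)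
    (hH : ∀ k, 0 < k → ∀ l, H₁₂ k l = ρ⁻¹ ^ k * H k l + H' k l) (p : Osc n K) (M : ℤ) :
    ∃ L₀ : ℕ, ∀ L : ℕ, L₀ ≤ L → ∑ k ∈ Finset.Icc (-(L : ℤ)) L,
      ρ ^ k • nord F H F' H' p k (M - k) = mode F₁₂ H₁₂ M p := by
  have key : ∀ Q : Polynomial (Polynomial (Osc n K)), ∃ L₀ : ℕ, ∀ L : ℕ, L₀ ≤ L →
      ∑ k ∈ Finset.Icc (-(L : ℤ)) L, ρ ^ k • pairL₂ (creCoeff F) (creCoeff F') k (M - k) Q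
        = pairL (creCoeff F₁₂) M (diagEval ρ Q) := by
    intro Q
    induction Q using bivariate_induction with
    | hadd P Q hP hQ =>
      obtain ⟨A, hA⟩ := hP
      obtain ⟨B, hB⟩ := hQ
      refine ⟨max A B, fun L hL => ?_⟩
      simp only [map_add, smul_add, Finset.sum_add_distrib]
      rw [hA L (le_trans (le_max_left _ _) hL), hB L (le_trans (le_max_right _ _) hL)]
    | hmon t h r =>
      refine ⟨h + M.natAbs + t, fun L hL => ?_⟩
      rw [diagEval_monomial, pairL_monomial, mul_smul_comm, ← smul_mul_assoc]
      push_cast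
      rw [← add_assoc, ← creCoeff_fuse hρ hF M h t hL, Finset.sum_mul]
      refine Finset.sum_congr rfl fun k _ => ?_
      rw [pairL₂_monomial, pairL_monomial, smul_mul_assoc]
      congr 1
      ring
  obtain ⟨L₀, h⟩ := key (transl₂ H H' p)
  refine ⟨L₀, fun L hL => ?_⟩
  rw [mode_apply, ← diagEval_transl₂ hH]
  exact h L hL

end Fusion

/-! ### Series acting on doubly bounded families -/

section Act

variable {K V : Type*} [Field K] [AddCommGroup V] [Module K V]

/-- `N a b` vanishes for small `a` and for small `b`. -/
def IsBddBelow₂ (N : ℤ → ℤ → V) : Prop := ∃ B : ℤ, ∀ a b, (a < B ∨ b < B) → N a b = 0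

/-- The product of `∑ c k (w/z)^k` and `∑ N a b w^a z^b`. -/
def act (c : ℤ → K) (N : ℤ → ℤ → V) (a b : ℤ) : V := ∑ᶠ k, c k • N (a - k) (b + k)

theorem IsBddBelow₂.finite {N : ℤ → ℤ → V} (hN : IsBddBelow₂ N) (c : ℤ → K) (a b : ℤ) :
    (Function.support fun k => c k • N (a - k) (b + k)).Finite := by
  obtain ⟨B, hB⟩ := hN
  refine (Set.finite_Icc (B - b) (a - B)).subset fun k hk => ?_
  by_contra h
  refine hk ?_
  simp only [Set.mem_Icc, not_and_or, not_le] at h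
  show c k • N (a - k) (b + k) = 0
  rw [hB _ _ (by omega), smul_zero]

theorem act_add {N : ℤ → ℤ → V} (hN : IsBddBelow₂ N) (c d : ℤ → K) (a b : ℤ) :
    act (fun k => c k + d k) N a b = act c N a b + act d N a b := by
  unfold act
  rw [← finsum_add_distrib (hN.finite c a b) (hN.finite d a b)]
  simp only [add_smul]

theorem act_smul {N : ℤ → ℤ → V} (hN : IsBddBelow₂ N) (r : K) (c : ℤ → K) (a b : ℤ) :
    act (fun k => r * c k) N a b = r • act c N a b := by
  unfold act
  rw [smul_finsum' _ (hN.finite c a b)]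
  simp only [mul_smul]

theorem act_sub {N : ℤ → ℤ → V} (hN : IsBddBelow₂ N) (c d : ℤ → K) (a b : ℤ) :
    act (fun k => c k - d k) N a b = act c N a b - act d N a b := by
  unfold act
  rw [← finsum_sub_distrib (hN.finite c a b) (hN.finite d a b)]
  simp only [sub_smul]

theorem act_shift (c : ℤ → K) (N : ℤ → ℤ → V) (m a b : ℤ) :
    act c N (a - m) (b + m) = act (fun k => c (k - m)) N a b := by
  unfold act
  rw [← finsum_comp_equiv (Equiv.subRight m)]
  refine finsum_congr fun k => ?_
  simp only [Equiv.subRight_apply]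
  congr 2 <;> ring

theorem act_single (N : ℤ → ℤ → V) (a b : ℤ) :
    act (fun k => if k = 0 then (1 : K) else 0) N a b = N a b := by
  unfold act
  rw [finsum_eq_single _ 0 fun k hk => by simp [hk]]
  simp

/-- Exchanging `w` and `z` exchanges the two expansion domains, so each statement about `fracZ`
follows from its analogue for `fracW`. -/
theorem isSeriesMul_swap {c : ℤ → K} {P R : ℤ → ℤ → V} :
    IsSeriesMul (fun k => c (-k)) P R ↔ IsSeriesMul c (fun a b => P b a) (fun a b => R b a) := by
  have h : ∀ a b, IsFinSum (fun k => c (-k) • P (a - k) (b + k)) (R a b)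
      ↔ IsFinSum (fun k => c k • P (a + k) (b - k)) (R a b) := by
    intro a b
    unfold IsFinSum
    have e : (fun k : ℤ => c (-k) • P (a - k) (b + k))
        = (fun k : ℤ => c k • P (a + k) (b - k)) ∘ (Equiv.neg ℤ) := by
      ext k
      simp [sub_eq_add_neg]
    have e1 := finsum_comp_equiv (Equiv.neg ℤ) (f := fun k : ℤ => c k • P (a + k) (b - k))
    rw [e]
    refine and_congr ?_ ?_
    · rw [Function.support_comp_eq_preimage]
      exact ⟨fun h => Set.Finite.of_preimage h (Equiv.neg ℤ).surjective,
        fun h => h.preimage (Equiv.neg ℤ).injective.injOn⟩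
    · exact Eq.congr e1 rfl
  exact ⟨fun H a b => (h b a).mp (H b a), fun H a b => (h a b).mpr (H b a)⟩

/-- A series `(A - B u)/(1 - D u)` may be checked after clearing the denominator, on families that
vanish far out. -/
theorem isSeriesMul_fracW {A B D : K} {P R : ℤ → ℤ → V}
    (hP : ∀ a b, ∃ k₀ : ℤ, ∀ k, k₀ ≤ k → P (a - k) (b + k) = 0)
    (hR : ∀ a b, ∃ k₀ : ℤ, ∀ k, k₀ ≤ k → R (a - k) (b + k) = 0)
    (h : ∀ a b, R a b - D • R (a - 1) (b + 1) = A • P a b - B • P (a - 1) (b + 1)) :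
    IsSeriesMul (fracW A B D) P R := by
  -- Iterating the cleared relation `m` times gives the partial sum of the series and two remainders
  -- at distance `m`; these vanish for large `m` by `hP` and `hR`.
  have key : ∀ (m : ℕ) a b, R a b = D ^ m • R (a - m) (b + m)
      + ∑ k ∈ Finset.range (m + 1), fracW A B D k • P (a - k) (b + k)
      - (A * D ^ m) • P (a - m) (b + m) := by
    intro m
    induction m with
    | zero => intro a b; simp [fracW, expand]
    | succ m ih =>
      intro a b
      have h1 := h (a - m) (b + m)
      have e1 : a - (m : ℤ) - 1 = a - ((m + 1 : ℕ) : ℤ) := by push_cast; ring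
      have e2 : b + (m : ℤ) + 1 = b + ((m + 1 : ℕ) : ℤ) := by push_cast; ring
      rw [e1, e2, sub_eq_iff_eq_add] at h1
      rw [ih a b, h1, Finset.sum_range_succ _ (m + 1)]
      have e3 : fracW A B D ((m + 1 : ℕ) : ℤ) = A * D ^ (m + 1) - B * D ^ m := by
        rw [fracW, expand, if_neg (by omega), if_neg (by omega)]
        rw [zpow_natCast]
        congr 2
        rw [show ((m + 1 : ℕ) : ℤ) - 1 = (m : ℤ) by push_cast; ring, zpow_natCast]
      rw [e3]
      module
  intro a b
  obtain ⟨k₁, hk₁⟩ := hP a b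
  obtain ⟨k₂, hk₂⟩ := hR a b
  set m : ℕ := (max k₁ k₂).toNat
  have hsupp : (Function.support fun k => fracW A B D k • P (a - k) (b + k))
      ⊆ ↑((Finset.range (m + 1)).map ⟨((↑) : ℕ → ℤ), Nat.cast_injective⟩) := by
    intro k hk
    simp only [Finset.coe_map, Function.Embedding.coeFn_mk, Set.mem_image, Finset.mem_coe,
      Finset.mem_range]
    by_contra hcon
    refine hk ?_
    simp only [not_exists, not_and] at hcon
    rcases lt_or_ge k 0 with h0 | h0
    · simp [fracW, expand, h0]
    · show _ • _ = _
      rw [hk₁ k, smul_zero]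
      have h1 := hcon k.toNat
      by_contra h2
      exact h1 (by omega) (by omega)
  refine ⟨(Finset.finite_toSet _).subset hsupp, ?_⟩
  rw [finsum_eq_sum_of_support_subset _ hsupp, Finset.sum_map, key m a b, hk₁ m (by omega),
    hk₂ m (by omega)]
  simp

theorem isSeriesMul_fracZ {A B D : K} {P R : ℤ → ℤ → V}
    (hP : ∀ a b, ∃ k₀ : ℤ, ∀ k, k₀ ≤ k → P (a + k) (b - k) = 0)
    (hR : ∀ a b, ∃ k₀ : ℤ, ∀ k, k₀ ≤ k → R (a + k) (b - k) = 0)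
    (h : ∀ a b, R a b - D • R (a + 1) (b - 1) = A • P a b - B • P (a + 1) (b - 1)) :
    IsSeriesMul (fracZ A B D) P R := by
  refine (isSeriesMul_swap (c := fracW A B D)).mpr ?_
  exact isSeriesMul_fracW (fun a b => hP b a) (fun a b => hR b a) (fun a b => h b a)

/-- Clearing the denominator needs no boundedness: finiteness of the defining sums suffices to shift
the summation index. -/
theorem IsSeriesMul.fracW_local {A B D : K} {P R : ℤ → ℤ → V}
    (h : IsSeriesMul (fracW A B D) P R) (a b : ℤ) :
    R a b - D • R (a - 1) (b + 1) = A • P a b - B • P (a - 1) (b + 1) := by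
  obtain ⟨h1, h2⟩ := h a b
  obtain ⟨h3, h4⟩ := h (a - 1) (b + 1)
  -- The recursion for the coefficients of `(A - B u)/(1 - D u)`, with its two inhomogeneous terms
  -- at `k = 0` and `k = 1`.
  have e : ∀ k : ℤ, fracW A B D k • P (a - k) (b + k)
      = D • (fracW A B D (k - 1) • P (a - k) (b + k))
        + ((if k = 0 then A • P a b else 0) - if k = 1 then B • P (a - 1) (b + 1) else 0) := by
    intro k
    rcases lt_trichotomy k 0 with hk | rfl | hk
    · simp [fracW, expand, hk, hk.ne, show k - 1 < 0 by omega, show k ≠ 1 by omega]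
    · simp [fracW, expand]
    · rcases eq_or_ne k 1 with rfl | hk1
      · simp only [fracW, expand]
        simp
        module
      · by_cases hD : D = 0
        · simp [fracW, expand, hD, hk.not_gt, hk.ne', hk1, show k - 1 ≠ 0 by omega,
            zero_zpow _ hk.ne', zero_zpow _ (show k - 1 ≠ 0 by omega)]
        · simp only [fracW, expand, hk.not_gt, hk.ne', hk1, show k - 1 ≠ 0 by omega,
            show ¬ k - 1 < 0 by omega, if_false, smul_smul, sub_zero, add_zero]
          congr 1
          rw [mul_sub, ← mul_assoc, mul_comm D A, mul_assoc, ← zpow_one_add₀ hD, ← mul_assoc,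
            mul_comm D B, mul_assoc, ← zpow_one_add₀ hD]
          congr 3 <;> ring
  have hfin0 : (Function.support fun k : ℤ => if k = 0 then A • P a b else 0).Finite :=
    (Set.finite_singleton (0 : ℤ)).subset fun k hk => by
      by_contra h'; exact hk (if_neg h')
  have hfin1 : (Function.support fun k : ℤ => if k = 1 then B • P (a - 1) (b + 1) else 0).Finite :=
    (Set.finite_singleton (1 : ℤ)).subset fun k hk => by
      by_contra h'; exact hk (if_neg h')
  have e5 : (fun k : ℤ => fracW A B D (k - 1) • P (a - k) (b + k))
      = (fun k : ℤ => fracW A B D k • P (a - 1 - k) (b + 1 + k)) ∘ (Equiv.subRight (1 : ℤ)) := by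
    ext k
    simp only [Function.comp, Equiv.subRight_apply]
    congr 2 <;> ring
  have hfin2 : (Function.support fun k : ℤ => fracW A B D (k - 1) • P (a - k) (b + k)).Finite := by
    rw [e5, Function.support_comp_eq_preimage]
    exact h3.preimage (Equiv.subRight (1 : ℤ)).injective.injOn
  have hfin3 : (Function.support fun k : ℤ =>
      D • (fracW A B D (k - 1) • P (a - k) (b + k))).Finite :=
    hfin2.subset fun k hk h' => hk (by
      show D • (fun k : ℤ => fracW A B D (k - 1) • P (a - k) (b + k)) k = 0
      rw [h', smul_zero])
  rw [← h2, finsum_congr e, finsum_add_distrib hfin3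
    ((hfin0.union hfin1).subset (Function.support_sub _ _)), finsum_sub_distrib hfin0 hfin1,
    ← smul_finsum' _ hfin2, e5, finsum_eq_single (fun k : ℤ => if k = 0 then A • P a b else 0) 0
      (fun k hk => if_neg hk),
    finsum_eq_single (fun k : ℤ => if k = 1 then B • P (a - 1) (b + 1) else 0) 1
      (fun k hk => if_neg hk), if_pos rfl, if_pos rfl]
  have := finsum_comp_equiv (Equiv.subRight (1 : ℤ))
    (f := fun k : ℤ => fracW A B D k • P (a - 1 - k) (b + 1 + k))
  rw [show (∑ᶠ i, ((fun k : ℤ => fracW A B D k • P (a - 1 - k) (b + 1 + k))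
    ∘ (Equiv.subRight (1 : ℤ))) i) = R (a - 1) (b + 1) from this.trans h4]
  abel

theorem IsSeriesMul.fracZ_local {A B D : K} {P R : ℤ → ℤ → V}
    (h : IsSeriesMul (fracZ A B D) P R) (a b : ℤ) :
    R a b - D • R (a + 1) (b - 1) = A • P a b - B • P (a + 1) (b - 1) :=
  ((isSeriesMul_swap (c := fracW A B D)).mp h).fracW_local b a

theorem act_eq_zero_of_lt {N : ℤ → ℤ → V} {B : ℤ} (hN : ∀ a b, (a < B ∨ b < B) → N a b = 0)
    {c : ℤ → K} {k₁ : ℤ} (hc : ∀ k < k₁, c k = 0) {a b : ℤ} (h : a < B + k₁) :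
    act c N a b = 0 := by
  unfold act
  rw [← finsum_zero (α := ℤ)]
  refine finsum_congr fun k => ?_
  rcases lt_or_ge k k₁ with hk | hk
  · rw [hc k hk, zero_smul]
  · rw [hN _ _ (by omega), smul_zero]

theorem act_eq_zero_of_lt' {N : ℤ → ℤ → V} {B : ℤ} (hN : ∀ a b, (a < B ∨ b < B) → N a b = 0)
    {c : ℤ → K} {k₁ : ℤ} (hc : ∀ k, k₁ < k → c k = 0) {a b : ℤ} (h : b < B - k₁) :
    act c N a b = 0 := by
  unfold act
  rw [← finsum_zero (α := ℤ)]
  refine finsum_congr fun k => ?_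
  rcases lt_or_ge k₁ k with hk | hk
  · rw [hc k hk, zero_smul]
  · rw [hN _ _ (by omega), smul_zero]

/-- Reduces an identity of operator-valued series to the scalar recursion `(1 - D u) e(u) = (A - B
u) c(u)`. The lower bound on the supports of `c` and `e` selects the expansion in `u`. -/
theorem isSeriesMul_fracW_act {N : ℤ → ℤ → V} (hN : IsBddBelow₂ N) {A B D : K} {c e : ℤ → K}
    {k₁ : ℤ} (hc : ∀ k < k₁, c k = 0) (he : ∀ k < k₁, e k = 0)
    (h : ∀ k, e k - D * e (k - 1) = A * c k - B * c (k - 1)) :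
    IsSeriesMul (fracW A B D) (act c N) (act e N) := by
  obtain ⟨B₀, hB₀⟩ := id hN
  refine isSeriesMul_fracW (fun a b => ⟨a - B₀ - k₁ + 1, fun k hk => ?_⟩)
    (fun a b => ⟨a - B₀ - k₁ + 1, fun k hk => ?_⟩) fun a b => ?_
  · exact act_eq_zero_of_lt hB₀ hc (by omega)
  · exact act_eq_zero_of_lt hB₀ he (by omega)
  · rw [act_shift, act_shift, ← act_smul hN, ← act_smul hN, ← act_smul hN, ← act_sub hN,
      ← act_sub hN]
    congr 1
    ext k
    exact h k

theorem isSeriesMul_fracZ_act {N : ℤ → ℤ → V} (hN : IsBddBelow₂ N) {A B D : K} {c e : ℤ → K}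
    {k₁ : ℤ} (hc : ∀ k, k₁ < k → c k = 0) (he : ∀ k, k₁ < k → e k = 0)
    (h : ∀ k, e k - D * e (k + 1) = A * c k - B * c (k + 1)) :
    IsSeriesMul (fracZ A B D) (act c N) (act e N) := by
  obtain ⟨B₀, hB₀⟩ := id hN
  have hsh : ∀ (c : ℤ → K) a b, act c N (a + 1) (b - 1) = act (fun k => c (k + 1)) N a b := by
    intro c a b
    simpa [sub_eq_add_neg] using act_shift c N (-1) a b
  refine isSeriesMul_fracZ (fun a b => ⟨b - B₀ + k₁ + 1, fun k hk => ?_⟩)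
    (fun a b => ⟨b - B₀ + k₁ + 1, fun k hk => ?_⟩) fun a b => ?_
  · exact act_eq_zero_of_lt' hB₀ hc (by omega)
  · exact act_eq_zero_of_lt' hB₀ he (by omega)
  · rw [hsh, hsh, ← act_smul hN, ← act_smul hN, ← act_smul hN, ← act_sub hN,
      ← act_sub hN]
    congr 1
    ext k
    exact h k

theorem isSeriesMul_act {N : ℤ → ℤ → V} (hN : IsBddBelow₂ N) (c : ℤ → K) :
    IsSeriesMul c N (act c N) := fun a b => ⟨hN.finite c a b, rfl⟩

end Act

/-! ### Scalar series acting on normally ordered products. -/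

section ActNord

variable {n : ℕ} {K : Type*} [Field K]

theorem isBddBelow₂_nord (F H F' H' : ℕ → Fin (n - 1) → K) (p : Osc n K) :
    IsBddBelow₂ (nord F H F' H' p) := exists_nord_eq_zero F H F' H' p

variable [CharZero K]

/-- The rule `δ(w/(ρz)) N(w,z) = δ(w/(ρz)) N(ρz,z)`, combined with fusion on the line `w = ρ z`. -/
theorem act_delta_nord {F F' F₁₂ H H' H₁₂ : ℕ → Fin (n - 1) → K} {ρ : K} (hρ : ρ ≠ 0)
    (hF : ∀ k, 0 < k → ∀ l, F₁₂ k l = ρ ^ k * F k l + F' k l)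
    (hH : ∀ k, 0 < k → ∀ l, H₁₂ k l = ρ⁻¹ ^ k * H k l + H' k l) (p : Osc n K) (a b : ℤ) :
    act (delta ρ) (nord F H F' H' p) a b = ρ ^ (-a) • mode F₁₂ H₁₂ (a + b) p := by
  obtain ⟨L₀, hL₀⟩ := nord_fuse hρ hF hH p (a + b)
  have hfin : (Function.support fun k => ρ ^ k • nord F H F' H' p k (a + b - k)).Finite := by
    have := (isBddBelow₂_nord F H F' H' p).finite (fun k => ρ ^ (-k)) 0 (a + b)
    refine (this.preimage (Equiv.neg ℤ).injective.injOn).subset fun k hk h => hk ?_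
    simpa [sub_eq_add_neg] using h
  -- The window must be long enough both for the fusion formula and to contain the support of the
  -- summand.
  obtain ⟨L₁, hL₁⟩ : ∃ L₁ : ℕ, (Function.support fun k => ρ ^ k • nord F H F' H' p k (a + b - k))
      ⊆ ↑(Finset.Icc (-(L₁ : ℤ)) L₁) := by
    obtain ⟨u, hu⟩ := hfin.bddAbove
    obtain ⟨l, hl⟩ := hfin.bddBelow
    refine ⟨max u.natAbs l.natAbs, fun k hk => ?_⟩
    have h1 := hu hk
    have h2 := hl hk
    simp only [Finset.coe_Icc, Set.mem_Icc]
    omega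
  have hsub : ((Finset.Icc (-(L₁ : ℤ)) L₁ : Finset ℤ) : Set ℤ)
      ⊆ ↑(Finset.Icc (-((max L₀ L₁ : ℕ) : ℤ)) (max L₀ L₁ : ℕ)) := by
    intro k hk
    simp only [Finset.coe_Icc, Set.mem_Icc] at hk ⊢
    omega
  rw [← hL₀ (max L₀ L₁) (le_max_left _ _), ← finsum_eq_sum_of_support_subset _ (hL₁.trans hsub),
    smul_finsum' _ hfin, act, ← finsum_comp_equiv (Equiv.subLeft a)]
  refine finsum_congr fun k => ?_
  simp only [Equiv.subLeft_apply, delta]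
  rw [smul_smul, ← zpow_add₀ hρ, sub_sub_cancel]
  congr 2 <;> ring_nf

/-- The series `∑_{k ≥ 0} c_k u^{-k}`. -/
def serZ (c : ℕ → K) (k : ℤ) : K := if k ≤ 0 then c (-k).toNat else 0

/-- The series `∑_{k ≥ 0} c_k u^k`. -/
def serW (c : ℕ → K) (k : ℤ) : K := if 0 ≤ k then c k.toNat else 0

theorem mode_mode_eq_act (F H F' H' : ℕ → Fin (n - 1) → K) (p : Osc n K) (a b : ℤ) :
    mode F H a (mode F' H' b p)
      = act (serZ (expCoeff (K := K) (contr H F'))) (nord F H F' H' p) a b := by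
  obtain ⟨I₀, hI⟩ := mode_mode F H F' H' p a b
  obtain ⟨B, hB⟩ := isBddBelow₂_nord F H F' H' p
  have hinj : Function.Injective fun i : ℕ => -(i : ℤ) := fun a b hab => by simpa using hab
  rw [hI (max I₀ (b - B + 1).toNat) (le_max_left _ _), act,
    finsum_eq_sum_of_support_subset
      (s := (Finset.range (max I₀ (b - B + 1).toNat)).map ⟨_, hinj⟩), Finset.sum_map]
  · refine Finset.sum_congr rfl fun i _ => ?_
    simp [serZ, sub_eq_add_neg]
  · intro k hk
    by_contra hcon
    refine hk ?_
    simp only [Finset.coe_map, Function.Embedding.coeFn_mk, Set.mem_image, Finset.mem_coe,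
      Finset.mem_range, not_exists, not_and] at hcon
    show _ • _ = _
    by_cases h0 : k ≤ 0
    · have := hcon (-k).toNat
      rw [hB, smul_zero]
      right
      by_contra h2
      exact this (by omega) (by omega)
    · rw [serZ, if_neg h0, zero_smul]

/-- In the opposite order the other contraction appears, expanded in `u` instead of `u⁻¹`, but it
acts on the same family `nord F H F' H' p`; the two orders thereby become comparable. -/
theorem mode_mode_eq_act' (F H F' H' : ℕ → Fin (n - 1) → K) (p : Osc n K) (a b : ℤ) :
    mode F' H' b (mode F H a p)
      = act (serW (expCoeff (K := K) (contr H' F))) (nord F H F' H' p) a b := by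
  rw [mode_mode_eq_act, act, act, ← finsum_comp_equiv (Equiv.neg ℤ)]
  refine finsum_congr fun k => ?_
  simp only [Equiv.neg_apply, serZ, serW, neg_neg, Left.neg_nonpos_iff, sub_neg_eq_add]
  rw [nord_swap, sub_eq_add_neg]

end ActNord


/-! ### The weight lattice -/

section Lattice

variable {n : ℕ}

/-- The weight `Λ_j - Λ_{j+1}` of the component number `j`. -/
abbrev compWt {n : ℕ} (j : ℕ) : Weight n := fundWt j - fundWt (j + 1)

theorem simpleRoot_eq (l : Fin (n - 1)) :
    simpleRoot l = 2 * fundWt ((l : ℕ) + 1) - fundWt l - fundWt ((l : ℕ) + 2) := by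
  ext b
  simp only [fundWt, simpleRoot, cartan, CartanMatrix.A, Matrix.of_apply, Pi.sub_apply,
    Pi.mul_apply, Pi.ofNat_apply, Fin.ext_iff]
  split_ifs <;> first | contradiction | omega

theorem simpleRoot_eq_compWt (l : Fin (n - 1)) :
    simpleRoot l = compWt ((l : ℕ) + 1) - compWt l := by
  rw [simpleRoot_eq]
  ext b
  simp only [Pi.sub_apply, Pi.mul_apply, Pi.ofNat_apply]
  ring

theorem pairing_add_right (x y z : Weight n) : pairing x (y + z) = pairing x y + pairing x z := by
  simp only [pairing, ← Finset.sum_add_distrib]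
  refine Finset.sum_congr rfl fun a _ => Finset.sum_congr rfl fun b _ => ?_
  rw [Pi.add_apply]
  push_cast
  ring

theorem pairing_zsmul_right (x y : Weight n) (c : ℤ) : pairing x (c • y) = c * pairing x y := by
  simp only [pairing, Finset.mul_sum]
  refine Finset.sum_congr rfl fun a _ => Finset.sum_congr rfl fun b _ => ?_
  rw [Pi.smul_apply, smul_eq_mul]
  push_cast
  ring

theorem pairing_comm (x y : Weight n) : pairing x y = pairing y x := by
  unfold pairing
  rw [Finset.sum_comm]
  refine Finset.sum_congr rfl fun a _ => Finset.sum_congr rfl fun b _ => ?_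
  rw [min_comm, max_comm]
  ring

theorem pairing_fundWt {j : ℕ} (hj : j ≤ n) (x : Weight n) :
    pairing (fundWt j) x = ∑ b : Fin (n - 1), (x b : ℚ) *
      (((min j ((b : ℕ) + 1) : ℕ) : ℚ) * ((n : ℚ) - ((max j ((b : ℕ) + 1) : ℕ) : ℚ)) / n) := by
  unfold pairing
  by_cases h : 1 ≤ j ∧ j < n
  · rw [Finset.sum_eq_single ⟨j - 1, by omega⟩]
    · refine Finset.sum_congr rfl fun b _ => ?_
      have : j - 1 + 1 = j := by omega
      simp only [fundWt, this, if_true]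
      push_cast
      ring
    · intro a _ ha
      refine Finset.sum_eq_zero fun b _ => ?_
      have : ¬ ((a : ℕ) + 1 = j) := fun h' => ha (Fin.ext (by simp; omega))
      simp [fundWt, this]
    · intro h'; exact absurd (Finset.mem_univ _) h'
  · have h0 : (fundWt j : Weight n) = 0 := by
      ext b
      simp only [fundWt, Pi.zero_apply, ite_eq_right_iff]
      intro hb
      have := b.2
      omega
    rw [h0]
    symm
    simp only [Pi.zero_apply, Int.cast_zero, zero_mul, zero_div, Finset.sum_const_zero]
    refine Finset.sum_eq_zero fun b _ => ?_
    have hb := b.2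
    rcases Nat.eq_zero_or_pos j with rfl | hj0
    · simp
    · rw [max_eq_left (by omega), show j = n by omega]
      simp

/-- The explicit form is the inverse Cartan matrix: its rows are piecewise linear in the index with
one kink, and `Λ_0 = Λ_n = 0` takes care of the boundary nodes. -/
theorem pairing_second_difference (l : Fin (n - 1)) (x : Weight n) :
    2 * pairing (fundWt ((l : ℕ) + 1)) x - pairing (fundWt (l : ℕ)) x
      - pairing (fundWt ((l : ℕ) + 2)) x = x l := by
  have hl := l.2
  have hn : (n : ℚ) ≠ 0 := by exact_mod_cast (show n ≠ 0 by omega)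
  rw [pairing_fundWt (by omega), pairing_fundWt (by omega), pairing_fundWt (by omega),
    Finset.mul_sum, ← Finset.sum_sub_distrib, ← Finset.sum_sub_distrib, Finset.sum_eq_single l]
  · rw [min_eq_left (by omega), min_eq_left (by omega), min_eq_right (by omega),
      max_eq_right (by omega), max_eq_right (by omega), max_eq_left (by omega)]
    push_cast
    field_simp
    ring
  · intro b _ hb
    have hb' : (b : ℕ) ≠ l := fun h => hb (Fin.ext h)
    rcases lt_or_gt_of_ne hb' with h | h
    · rw [min_eq_right (by omega), min_eq_right (by omega), min_eq_right (by omega),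
        max_eq_left (by omega), max_eq_left (by omega), max_eq_left (by omega)]
      push_cast
      field_simp
      ring
    · rw [min_eq_left (by omega), min_eq_left (by omega), min_eq_left (by omega),
        max_eq_right (by omega), max_eq_right (by omega), max_eq_right (by omega)]
      push_cast
      field_simp
      ring
  · intro h'; exact absurd (Finset.mem_univ _) h'

theorem pairing_fundWt_simpleRoot {j : ℕ} (l : Fin (n - 1)) :
    pairing (fundWt j) (simpleRoot l) = if (l : ℕ) + 1 = j then 1 else 0 := by
  have h2 := pairing_second_difference l (fundWt j)
  have e : simpleRoot l = (2 : ℤ) • fundWt ((l : ℕ) + 1) + (-1 : ℤ) • fundWt l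
      + (-1 : ℤ) • fundWt ((l : ℕ) + 2) := by
    rw [simpleRoot_eq]
    ext b
    simp only [Pi.add_apply, Pi.smul_apply, Pi.sub_apply, Pi.mul_apply, Pi.ofNat_apply, smul_eq_mul]
    ring
  rw [e, pairing_add_right, pairing_add_right, pairing_zsmul_right, pairing_zsmul_right,
    pairing_zsmul_right, pairing_comm _ (fundWt (l + 1)), pairing_comm _ (fundWt l),
    pairing_comm _ (fundWt (l + 2))]
  simp only [fundWt] at h2 ⊢
  push_cast at h2 ⊢
  linarith

/-! ### The sign cocycle -/

theorem coord_add (k : ℕ) (x y : Weight n) : coord k (x + y) = coord k x + coord k y := by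
  unfold coord
  split_ifs
  · rw [← Finset.sum_add_distrib]
    exact Finset.sum_congr rfl fun b _ => by rw [Pi.add_apply]; ring
  · rw [← neg_add, ← Finset.sum_add_distrib]
    exact congrArg _ (Finset.sum_congr rfl fun b _ => by rw [Pi.add_apply]; ring)

theorem coord_zsmul (k : ℕ) (c : ℤ) (x : Weight n) : coord k (c • x) = c * coord k x := by
  unfold coord
  split_ifs
  · rw [Finset.mul_sum]
    exact Finset.sum_congr rfl fun b _ => by rw [Pi.smul_apply, smul_eq_mul]; ring
  · rw [mul_neg, Finset.mul_sum]
    exact congrArg _ (Finset.sum_congr rfl fun b _ => by rw [Pi.smul_apply, smul_eq_mul]; ring)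

theorem coord_sub (k : ℕ) (x y : Weight n) : coord k (x - y) = coord k x - coord k y := by
  have := coord_add k x ((-1 : ℤ) • y)
  rw [coord_zsmul] at this
  rw [show x - y = x + (-1 : ℤ) • y by simp [sub_eq_add_neg], this]
  ring

theorem latticeSign_add_left (x y z : Weight n) :
    latticeSign (x + y) z = latticeSign x z * latticeSign y z := by
  simp only [latticeSign, ← zpow_add, ← Finset.sum_add_distrib]
  congr 1
  exact Finset.sum_congr rfl fun k _ => by rw [coord_add]; ring

theorem latticeSign_add_right (x y z : Weight n) :
    latticeSign x (y + z) = latticeSign x y * latticeSign x z := by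
  simp only [latticeSign, ← zpow_add, ← Finset.sum_add_distrib]
  congr 1
  exact Finset.sum_congr rfl fun k _ => by rw [coord_add]; ring

theorem latticeSign_zsmul_left (c : ℤ) (x y : Weight n) :
    latticeSign (c • x) y = latticeSign x y ^ c := by
  simp only [latticeSign, ← zpow_mul, Finset.sum_mul]
  congr 1
  exact Finset.sum_congr rfl fun k _ => by rw [coord_zsmul]; ring

theorem latticeSign_zsmul_right (c : ℤ) (x y : Weight n) :
    latticeSign x (c • y) = latticeSign x y ^ c := by
  simp only [latticeSign, ← zpow_mul, Finset.sum_mul]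
  congr 1
  exact Finset.sum_congr rfl fun k _ => by rw [coord_zsmul]; ring

theorem latticeSign_neg_left (x y : Weight n) : latticeSign (-x) y = latticeSign x y := by
  rw [show -x = (-1 : ℤ) • x by simp, latticeSign_zsmul_left, zpow_neg_one, Int.units_inv_eq_self]

theorem latticeSign_neg_right (x y : Weight n) : latticeSign x (-y) = latticeSign x y := by
  rw [show -y = (-1 : ℤ) • y by simp, latticeSign_zsmul_right, zpow_neg_one, Int.units_inv_eq_self]

theorem neg_one_zpow_congr {a b : ℤ} (h : (2 : ℤ) ∣ a - b) : (-1 : ℤˣ) ^ a = (-1) ^ b := by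
  obtain ⟨c, hc⟩ := h
  rw [show a = b + 2 * c by omega, zpow_add, zpow_mul]
  simp

theorem coord_fundWt {j k : ℕ} (hj : j ≤ n) (hk : k ≤ n) : coord k (fundWt j : Weight n)
    = if j = 0 then 0 else if k = n then (n : ℤ) - j else -((k - j : ℕ) : ℤ) := by
  by_cases h : 1 ≤ j ∧ j < n
  · have key : ∀ f : ℕ → ℤ, ∑ b : Fin (n - 1), (fundWt j : Weight n) b * f ((b : ℕ) + 1) = f j := by
      intro f
      rw [Finset.sum_eq_single ⟨j - 1, by omega⟩]
      · simp [fundWt, show j - 1 + 1 = j by omega]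
      · intro a _ ha
        have : ¬ ((a : ℕ) + 1 = j) := fun h' => ha (Fin.ext (by simp; omega))
        simp [fundWt, this]
      · intro h'; exact absurd (Finset.mem_univ _) h'
    rw [if_neg (by omega)]
    unfold coord
    split_ifs
    · simpa using key fun t => (n : ℤ) - (t : ℤ)
    · rw [key fun t => ((k - t : ℕ) : ℤ)]
  · have h0 : (fundWt j : Weight n) = 0 := by
      ext b
      simp only [fundWt, Pi.zero_apply, ite_eq_right_iff]
      intro hb
      have := b.2
      omega
    rw [h0]
    simp only [coord, Pi.zero_apply, zero_mul, Finset.sum_const_zero, neg_zero, ite_self]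
    split_ifs <;> first | contradiction | omega

theorem coord_compWt {j k : ℕ} (hj : j < n) (hk2 : 2 ≤ k) (hk : k ≤ n) :
    coord k (compWt j : Weight n) =
      if j = 0 then (if k = n then -((n : ℤ) - 1) else (k : ℤ) - 1)
      else if k = n then 1 else if j < k then -1 else 0 := by
  rw [coord_sub, coord_fundWt hj.le hk, coord_fundWt (by omega) hk]
  split_ifs <;> first | contradiction | omega

/-- For `l ≠ 0` the root is itself a basis vector, but `α_1 = -2α_2 - ⋯ - (n-1)α_{n-1} + nΛ_{n-1}`
is not. This is why node `1` is treated separately in all sign computations. -/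
theorem coord_simpleRoot (l : Fin (n - 1)) {k : ℕ} (hk2 : 2 ≤ k) (hk : k ≤ n) :
    coord k (simpleRoot l) =
      if (l : ℕ) = 0 then (if k = n then (n : ℤ) else -(k : ℤ))
      else if k = (l : ℕ) + 1 then 1 else 0 := by
  have hl := l.2
  rw [simpleRoot_eq_compWt, coord_sub, coord_compWt (by omega) hk2 hk,
    coord_compWt (by omega) hk2 hk]
  split_ifs <;> first | contradiction | omega

theorem sum_simpleRoot_left {l : Fin (n - 1)} (hl : (l : ℕ) ≠ 0) (y : Weight n) :
    ∑ k ∈ Finset.Ico 2 n, coord (k + 1) (simpleRoot l) * coord k y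
      = if 2 ≤ (l : ℕ) then coord l y else 0 := by
  have hl2 := l.2
  have : ∀ k ∈ Finset.Ico 2 n, coord (k + 1) (simpleRoot l) * coord k y
      = if k = (l : ℕ) then coord l y else 0 := by
    intro k hk
    rw [Finset.mem_Ico] at hk
    rw [coord_simpleRoot l (by omega) (by omega), if_neg hl]
    by_cases h : k = (l : ℕ)
    · rw [if_pos (by omega), if_pos h, h, one_mul]
    · rw [if_neg (by omega), if_neg h, zero_mul]
  rw [Finset.sum_congr rfl this, Finset.sum_ite_eq']
  simp only [Finset.mem_Ico, show (l : ℕ) < n by omega, and_true]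

theorem sum_simpleRoot_right {l : Fin (n - 1)} (hl : (l : ℕ) ≠ 0) (y : Weight n) :
    ∑ k ∈ Finset.Ico 2 n, coord (k + 1) y * coord k (simpleRoot l) = coord ((l : ℕ) + 2) y := by
  have hl2 := l.2
  have : ∀ k ∈ Finset.Ico 2 n, coord (k + 1) y * coord k (simpleRoot l)
      = if k = (l : ℕ) + 1 then coord ((l : ℕ) + 2) y else 0 := by
    intro k hk
    rw [Finset.mem_Ico] at hk
    rw [coord_simpleRoot l (by omega) (by omega), if_neg hl]
    by_cases h : k = (l : ℕ) + 1
    · rw [if_pos h, if_pos h, h, mul_one]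
    · rw [if_neg h, if_neg h, mul_zero]
  rw [Finset.sum_congr rfl this, Finset.sum_ite_eq', if_pos (by rw [Finset.mem_Ico]; omega)]

theorem two_dvd_mul_succ (k : ℤ) : (2 : ℤ) ∣ k * (k + 1) := (Int.even_mul_succ_self k).two_dvd

theorem latticeSign_simpleRoot_self (l : Fin (n - 1)) :
    latticeSign (simpleRoot l) (simpleRoot l) = 1 := by
  have hl2 := l.2
  rw [latticeSign, ← zpow_zero (-1 : ℤˣ)]
  apply neg_one_zpow_congr
  rw [sub_zero]
  by_cases hl : (l : ℕ) = 0
  · refine Finset.dvd_sum fun k hk => ?_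
    rw [Finset.mem_Ico] at hk
    rw [coord_simpleRoot l (by omega) (by omega), coord_simpleRoot l (by omega) (by omega),
      if_pos hl, if_pos hl, if_neg (show k ≠ n by omega)]
    have := two_dvd_mul_succ k
    split_ifs with h
    · rw [← h]; push_cast; rw [mul_neg, mul_comm]; exact this.neg_right
    · push_cast; rw [neg_mul_neg, mul_comm]; exact this
  · rw [sum_simpleRoot_left hl]
    split_ifs with h
    · rw [coord_simpleRoot l h (by omega), if_neg hl, if_neg (by omega)]; simp
    · simp

theorem sum_Ico_succ_choose (n : ℕ) (hn : 2 ≤ n) :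
    (2 : ℤ) ∣ ∑ k ∈ Finset.Ico 2 n, ((k : ℤ) + 1) + ((n - 1).choose 2 : ℕ) := by
  induction n, hn using Nat.le_induction with
  | base => simp
  | succ m hm ih =>
    rw [Finset.sum_Ico_succ_top hm, show m + 1 - 1 = (m - 1) + 1 by omega,
      Nat.choose_succ_succ' (m - 1) 1, Nat.choose_one_right]
    push_cast [Nat.cast_sub (show 1 ≤ m by omega)]
    obtain ⟨c, hc⟩ := ih
    exact ⟨c + m, by linarith⟩

/-- The cocycle sign met when the current of node `l + 1` fuses with a neighbouring component. It is
nontrivial only for `α_1`, and it is the origin of `κ_0`. -/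
theorem latticeSign_simpleRoot_compWt_succ (l : Fin (n - 1)) :
    latticeSign (simpleRoot l) (compWt ((l : ℕ) + 1)) = compSign n l := by
  have hl2 := l.2
  by_cases hl : (l : ℕ) = 0
  · rw [compSign, if_pos hl, latticeSign, ← zpow_natCast]
    apply neg_one_zpow_congr
    have h := sum_Ico_succ_choose n (by omega)
    have h2 : (2 : ℤ) ∣ ∑ k ∈ Finset.Ico 2 n, (coord (k + 1) (simpleRoot l)
        * coord k (compWt ((l : ℕ) + 1) : Weight n) - ((k : ℤ) + 1)) := by
      refine Finset.dvd_sum fun k hk => ?_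
      rw [Finset.mem_Ico] at hk
      rw [coord_simpleRoot l (by omega) (by omega), coord_compWt (by omega) (by omega) (by omega)]
      split_ifs <;> first | contradiction | omega
    rw [Finset.sum_sub_distrib] at h2
    omega
  · rw [compSign, if_neg hl, latticeSign, ← zpow_zero (-1 : ℤˣ)]
    congr 1
    rw [sum_simpleRoot_left hl]
    split_ifs with h
    · rw [coord_compWt (by omega) h (by omega)]
      split_ifs <;> first | contradiction | omega
    · rfl

theorem latticeSign_simpleRoot_compWt (l : Fin (n - 1)) :
    latticeSign (simpleRoot l) (compWt (l : ℕ)) = compSign n l := by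
  have h : (compWt (l : ℕ) : Weight n) = compWt ((l : ℕ) + 1) + -simpleRoot l := by
    rw [simpleRoot_eq_compWt]; abel
  rw [h, latticeSign_add_right, latticeSign_neg_right, latticeSign_simpleRoot_self, mul_one,
    latticeSign_simpleRoot_compWt_succ]

/-- `e^{α}` and `e^{Λ_j - Λ_{j+1}}` commute up to `(-1)` to their pairing, except that `α_1`
produces an extra `(-1)^{n-1}`. The zero mode `(-1)^{(n-1)∂_{Λ_1}}` of the vertex operators cancels
exactly this extra sign. -/
theorem latticeSign_commutator (l : Fin (n - 1)) {j : ℕ} (hj : j < n) :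
    latticeSign (simpleRoot l) (compWt j) * latticeSign (compWt j) (simpleRoot l)
      * (-1) ^ (((n : ℤ) - 1) * if (l : ℕ) = 0 then 1 else 0)
      = (-1 : ℤˣ) ^ (compWt j : Weight n) l := by
  have hl2 := l.2
  have hval : (compWt j : Weight n) l = (if (l : ℕ) + 1 = j then 1 else 0)
      - (if (l : ℕ) = j then 1 else 0) := by simp [fundWt]
  rw [latticeSign, latticeSign, ← zpow_add, ← zpow_add, hval]
  apply neg_one_zpow_congr
  by_cases hl : (l : ℕ) = 0
  · set y : Weight n := compWt j
    -- Modulo `2` the summand is a difference of consecutive values of `(k - 1) coord k y`, so that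
    -- the sum telescopes to its boundary terms at `2` and `n`.
    have h1 : (2 : ℤ) ∣ ∑ k ∈ Finset.Ico 2 n, ((coord (k + 1) (simpleRoot l) * coord k y
        + coord (k + 1) y * coord k (simpleRoot l))
        - ((((k + 1 : ℕ) : ℤ) - 1) * coord (k + 1) y - ((k : ℤ) - 1) * coord k y)) := by
      refine Finset.dvd_sum fun k hk => ?_
      rw [Finset.mem_Ico] at hk
      rw [coord_simpleRoot l (by omega) (by omega), coord_simpleRoot l (by omega) (by omega),
        if_pos hl, if_pos hl, if_neg (show k ≠ n by omega)]
      split_ifs with h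
      · refine ⟨k * coord k y - k * coord (k + 1) y, ?_⟩
        rw [show (n : ℤ) = k + 1 by omega]; push_cast; ring
      · refine ⟨-coord k y - k * coord (k + 1) y, ?_⟩
        push_cast; ring
    rw [Finset.sum_sub_distrib, Finset.sum_add_distrib,
      Finset.sum_Ico_sub (fun k : ℕ => ((k : ℤ) - 1) * coord k y) (show 2 ≤ n by omega)] at h1
    have e1 : coord n y = if j = 0 then -((n : ℤ) - 1) else 1 := by
      rw [coord_compWt hj (by omega) le_rfl]; simp
    have e2 := coord_compWt (n := n) hj le_rfl (show 2 ≤ n by omega)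
    -- The boundary term at `n` has the parity of `n - 1`, whatever `j` is; it cancels the extra
    -- exponent for `α_1`.
    have e3 : (2 : ℤ) ∣ ((n : ℤ) - 1) * coord n y - ((n : ℤ) - 1) * (if j = 0 then 1 else 1) := by
      rw [e1]
      split_ifs
      · have := two_dvd_mul_succ ((n : ℤ) - 1)
        rw [show ((n : ℤ) - 1) * (-((n : ℤ) - 1)) - ((n : ℤ) - 1) * 1
          = -(((n : ℤ) - 1) * (((n : ℤ) - 1) + 1)) by ring]
        exact this.neg_right
      · simp
    rw [if_pos hl, mul_one]
    simp only [ite_self, mul_one] at e3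
    push_cast at h1
    rw [e2] at h1
    split_ifs at h1 ⊢ <;> omega
  · rw [sum_simpleRoot_left hl, sum_simpleRoot_right hl, if_neg hl,
      coord_compWt (k := (l : ℕ) + 2) hj (by omega) (by omega)]
    by_cases h : 2 ≤ (l : ℕ)
    · rw [if_pos h, coord_compWt hj h (by omega)]
      split_ifs <;> first | contradiction | omega
    · rw [if_neg h]
      split_ifs <;> first | contradiction | omega

theorem sum_Ico_sub_eq_choose {j : ℕ} (hj : 1 ≤ j) (n : ℕ) :
    ∑ k ∈ Finset.Ico 2 n, (k - j) = (n - j).choose 2 := by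
  induction n with
  | zero => simp
  | succ m ih =>
    rcases lt_or_ge m 2 with hm | hm
    · rw [Finset.Ico_eq_empty (by omega), Finset.sum_empty, Nat.choose_eq_zero_of_lt (by omega)]
    · rw [Finset.sum_Ico_succ_top hm, ih]
      rcases lt_or_ge m j with h | h
      · rw [show m - j = 0 by omega, show m + 1 - j = 0 by omega, add_zero]
      · rw [show m + 1 - j = (m - j) + 1 by omega, Nat.choose_succ_succ' (m - j) 1,
          Nat.choose_one_right, add_comm]

/-- The lattice sign in the vacuum matrix coefficient for `i ≥ 1`; it explains the binomial signs in
the normalization constants. -/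
theorem latticeSign_compWt_fundWt {i j : ℕ} (hi : 1 ≤ i) (hin : i < n) (hj : i ≤ j) (hjn : j ≤ n) :
    latticeSign (compWt i : Weight n) (fundWt j) = (-1) ^ (n - j).choose 2 := by
  rw [← sum_Ico_sub_eq_choose (by omega), latticeSign, ← zpow_natCast]
  apply neg_one_zpow_congr
  push_cast
  rw [← Finset.sum_sub_distrib]
  refine Finset.dvd_sum fun k hk => ?_
  rw [Finset.mem_Ico] at hk
  rw [coord_compWt hin (by omega) (by omega), coord_fundWt hjn (by omega)]
  split_ifs <;> first | contradiction | omega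

theorem latticeSign_compWt_zero (hn : 1 ≤ n) :
    latticeSign (compWt 0 : Weight n) (fundWt 1) = 1 := by
  rw [latticeSign, ← zpow_zero (-1 : ℤˣ)]
  apply neg_one_zpow_congr
  rw [sub_zero]
  refine Finset.dvd_sum fun k hk => ?_
  rw [Finset.mem_Ico] at hk
  rw [coord_compWt (by omega) (by omega) (by omega), coord_fundWt (by omega) (by omega),
    if_pos rfl, if_neg one_ne_zero, if_neg (show k ≠ n by omega)]
  have h := two_dvd_mul_succ ((k : ℤ) - 1)
  have e : ((k - 1 : ℕ) : ℤ) = (k : ℤ) - 1 := by omega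
  rw [e]
  split_ifs with h'
  · rw [show -((n : ℤ) - 1) * -((k : ℤ) - 1) = ((k : ℤ) - 1) * ((k : ℤ) - 1 + 1) by
      rw [← h']; push_cast; ring]
    exact h
  · rw [show (((k + 1 : ℕ) : ℤ) - 1) * -((k : ℤ) - 1) = -(((k : ℤ) - 1) * ((k : ℤ) - 1 + 1)) by
      push_cast; ring]
    exact h.neg_right

end Lattice


/-! ### The `q`-Cartan matrix and the oscillator data of the operators -/

section QInt

variable {K : Type*} [Field K] {s : K}

theorem qInt_zero : qInt s 0 = 0 := by simp [qInt]

theorem qInt_neg (k : ℤ) : qInt s (-k) = -qInt s k := by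
  simp only [qInt, neg_neg, ← neg_div, neg_sub]

theorem zpow_ne_one_of_ne_zero (hs : ∀ m : ℕ, 0 < m → s ^ m ≠ 1) {k : ℤ}
    (hk : k ≠ 0) : s ^ k ≠ 1 := by
  rcases lt_or_gt_of_ne hk with h | h
  · intro h1
    refine hs (-k).toNat (by omega) ?_
    rw [← zpow_natCast, Int.toNat_of_nonneg (by omega), zpow_neg, h1, inv_one]
  · intro h1
    refine hs k.toNat (by omega) ?_
    rw [← zpow_natCast, Int.toNat_of_nonneg (by omega), h1]

theorem zpow_sq_sub_ne_zero (hs0 : s ≠ 0) (hs : ∀ m : ℕ, 0 < m → s ^ m ≠ 1) {k : ℤ}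
    (hk : k ≠ 0) : (s ^ 2) ^ k - (s ^ 2) ^ (-k) ≠ 0 := by
  intro h
  refine zpow_ne_one_of_ne_zero hs (k := 4 * k) (by omega) ?_
  have h2 : (s ^ 2) ^ k ≠ 0 := zpow_ne_zero _ (pow_ne_zero _ hs0)
  have h3 : (s ^ 2) ^ k * (s ^ 2) ^ k = 1 := by
    nth_rw 2 [sub_eq_zero.mp h]
    rw [← zpow_add₀ (pow_ne_zero _ hs0), add_neg_cancel, zpow_zero]
  rw [← h3, ← zpow_natCast s 2, ← zpow_mul, ← zpow_add₀ hs0]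
  congr 1
  push_cast
  ring

theorem q_sub_inv_ne_zero (hs0 : s ≠ 0) (hs : ∀ m : ℕ, 0 < m → s ^ m ≠ 1) :
    s ^ 2 - (s ^ 2)⁻¹ ≠ 0 := by
  simpa using zpow_sq_sub_ne_zero hs0 hs one_ne_zero

theorem qInt_ne_zero (hs0 : s ≠ 0) (hs : ∀ m : ℕ, 0 < m → s ^ m ≠ 1) {k : ℤ} (hk : k ≠ 0) :
    qInt s k ≠ 0 :=
  div_ne_zero (zpow_sq_sub_ne_zero hs0 hs hk) (q_sub_inv_ne_zero hs0 hs)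

theorem q_sub_inv_mul_qInt (hs0 : s ≠ 0) (hs : ∀ m : ℕ, 0 < m → s ^ m ≠ 1) (k : ℤ) :
    (s ^ 2 - (s ^ 2)⁻¹) * qInt s k = (s ^ 2) ^ k - (s ^ 2) ^ (-k) :=
  mul_div_cancel₀ _ (q_sub_inv_ne_zero hs0 hs)

theorem qInt_mul (m k : ℤ) : qInt s (m * k)
    = (((s ^ 2) ^ k) ^ m - (((s ^ 2) ^ k) ^ m)⁻¹) / (s ^ 2 - (s ^ 2)⁻¹) := by
  rw [qInt, mul_comm m k, zpow_neg, zpow_mul]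

theorem qInt_two_mul (hs0 : s ≠ 0) (k : ℤ) :
    qInt s (2 * k) = qInt s k * ((s ^ 2) ^ k + ((s ^ 2) ^ k)⁻¹) := by
  have h2 : (s ^ 2) ^ k ≠ 0 := zpow_ne_zero _ (pow_ne_zero _ hs0)
  rw [qInt_mul, show qInt s k = qInt s (1 * k) by rw [one_mul], qInt_mul, zpow_one, zpow_ofNat]
  rw [div_mul_eq_mul_div]
  congr 1
  field_simp
  ring

theorem qInt_recurrence (hs0 : s ≠ 0) (m k : ℤ) :
    qInt s (m * k) * ((s ^ 2) ^ k + ((s ^ 2) ^ k)⁻¹)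
      = qInt s ((m + 1) * k) + qInt s ((m - 1) * k) := by
  have h2 : (s ^ 2) ^ k ≠ 0 := zpow_ne_zero _ (pow_ne_zero _ hs0)
  rw [qInt_mul, qInt_mul, qInt_mul, zpow_add_one₀ h2, zpow_sub_one₀ h2, div_mul_eq_mul_div,
    ← add_div]
  congr 1
  have h3 : ((s ^ 2) ^ k) ^ m ≠ 0 := zpow_ne_zero _ h2
  field_simp
  ring

/-- `[(j+t)k]` and `[(m-t)k]` solve the same second order recurrence in `t`; their Wronskian
determines the diagonal entries when the `q`-Cartan matrix is inverted. -/
theorem qInt_wronskian (hs0 : s ≠ 0) (j m k : ℤ) :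
    qInt s ((j + 1) * k) * qInt s (m * k) - qInt s (j * k) * qInt s ((m - 1) * k)
      = qInt s ((j + m) * k) * qInt s k := by
  have h2 : (s ^ 2) ^ k ≠ 0 := zpow_ne_zero _ (pow_ne_zero _ hs0)
  rw [show qInt s k = qInt s (1 * k) by rw [one_mul], qInt_mul, qInt_mul, qInt_mul, qInt_mul,
    qInt_mul, qInt_mul, zpow_add_one₀ h2, zpow_sub_one₀ h2, zpow_add₀ h2, zpow_one,
    div_mul_div_comm, div_mul_div_comm, div_mul_div_comm, ← sub_div]
  congr 1
  have h3 : ((s ^ 2) ^ k) ^ m ≠ 0 := zpow_ne_zero _ h2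
  have h4 : ((s ^ 2) ^ k) ^ j ≠ 0 := zpow_ne_zero _ h2
  field_simp
  ring

end QInt

/-! ### Inverting the `q`-Cartan matrix and computing the contractions. -/

section Data

variable {n : ℕ} {K : Type*} [Field K]

/-- The coefficient of `a_{l+1,k}` in `a*_{j,k}`. -/
def dualCoeff (s : K) (j : ℕ) (k : ℤ) (l : Fin (n - 1)) : K :=
  qInt s ((min j ((l : ℕ) + 1) : ℕ) * k) * qInt s ((min (n - j) (n - ((l : ℕ) + 1)) : ℕ) * k)
      / (qInt s k ^ 2 * qInt s (n * k))

theorem dualCoeff_neg (s : K) (j : ℕ) (k : ℤ) (l : Fin (n - 1)) :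
    dualCoeff s j (-k) l = -dualCoeff s j k l := by
  simp only [dualCoeff, mul_neg, qInt_neg, neg_sq, div_neg]
  ring

theorem cartan_symm (l b : Fin (n - 1)) : cartan l b = cartan b l := by
  simp only [cartan, CartanMatrix.A, Matrix.of_apply, Fin.ext_iff]
  split_ifs <;> omega

theorem qInt_cartan (s : K) (hs0 : s ≠ 0) (l b : Fin (n - 1)) (k : ℤ) :
    qInt s (cartan l b * k) = qInt s k * (((s ^ 2) ^ k + ((s ^ 2) ^ k)⁻¹) *
      (if (b : ℕ) = l then 1 else 0) - (if (b : ℕ) + 1 = l then 1 else 0)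
        - (if (b : ℕ) = l + 1 then 1 else 0)) := by
  have h : cartan l b = if (b : ℕ) = l then 2 else if (b : ℕ) + 1 = l ∨ (b : ℕ) = l + 1
      then -1 else 0 := by
    simp only [cartan, CartanMatrix.A, Matrix.of_apply, Fin.ext_iff]
    split_ifs <;> omega
  rw [h]
  split_ifs with h1 h2 h3 h4 h5 h6 h7 <;> first | omega | skip
  · rw [qInt_two_mul hs0]; ring
  all_goals first | (rw [neg_one_mul, qInt_neg]; ring) | (rw [zero_mul, qInt_zero]; ring)

/-- The three-term relation of the dual coefficients: the `q`-Cartan matrix is invertible. -/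
theorem dualCoeff_three_term {s : K} (hs0 : s ≠ 0) (hs : ∀ m : ℕ, 0 < m → s ^ m ≠ 1)
    (l b : Fin (n - 1)) {k : ℤ} (hk : k ≠ 0) :
    qInt s k * (((s ^ 2) ^ k + ((s ^ 2) ^ k)⁻¹) * dualCoeff s ((l : ℕ) + 1) k b
      - dualCoeff s l k b - dualCoeff s ((l : ℕ) + 2) k b) = if b = l then 1 else 0 := by
  have hl := l.2
  have hb := b.2
  have hk0 := qInt_ne_zero hs0 hs hk
  have hn0 := qInt_ne_zero hs0 hs (mul_ne_zero (show (n : ℤ) ≠ 0 by omega) hk)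
  simp only [dualCoeff, Fin.ext_iff]
  rw [← mul_div_assoc, ← sub_div, ← sub_div, ← mul_div_assoc, div_eq_iff (mul_ne_zero (pow_ne_zero 2 hk0) hn0)]
  -- Off the diagonal one of the two `q`-integers in the numerator is constant and the other obeys
  -- the three-term recurrence. On the diagonal the kink leaves a Wronskian, equal to `[nk][k]`.
  rcases lt_trichotomy (b : ℕ) l with h | h | h
  · rw [if_neg h.ne, show min ((l : ℕ) + 1) ((b : ℕ) + 1) = (b : ℕ) + 1 by omega,
      show min (n - ((l : ℕ) + 1)) (n - ((b : ℕ) + 1)) = n - ((l : ℕ) + 1) by omega,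
      show min (l : ℕ) ((b : ℕ) + 1) = (b : ℕ) + 1 by omega,
      show min (n - (l : ℕ)) (n - ((b : ℕ) + 1)) = n - (l : ℕ) by omega,
      show min ((l : ℕ) + 2) ((b : ℕ) + 1) = (b : ℕ) + 1 by omega,
      show min (n - ((l : ℕ) + 2)) (n - ((b : ℕ) + 1)) = n - ((l : ℕ) + 2) by omega]
    have := qInt_recurrence hs0 ((n - ((l : ℕ) + 1) : ℕ) : ℤ) k
    rw [show (((n - ((l : ℕ) + 1) : ℕ) : ℤ) + 1) = ((n - (l : ℕ) : ℕ) : ℤ) by omega,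
      show (((n - ((l : ℕ) + 1) : ℕ) : ℤ) - 1) = ((n - ((l : ℕ) + 2) : ℕ) : ℤ) by omega] at this
    linear_combination qInt s k * qInt s ((((b : ℕ) + 1 : ℕ) : ℤ) * k) * this
  · rw [if_pos h, h, show min (l : ℕ) ((l : ℕ) + 1) = (l : ℕ) by omega,
      show min (n - (l : ℕ)) (n - ((l : ℕ) + 1)) = n - ((l : ℕ) + 1) by omega,
      show min ((l : ℕ) + 2) ((l : ℕ) + 1) = (l : ℕ) + 1 by omega,
      show min (n - ((l : ℕ) + 2)) (n - ((l : ℕ) + 1)) = n - ((l : ℕ) + 2) by omega,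
      min_self,
      min_self]
    have h1 := qInt_recurrence hs0 (((l : ℕ) + 1 : ℕ) : ℤ) k
    have h2 := qInt_wronskian hs0 (((l : ℕ) + 1 : ℕ) : ℤ) ((n - ((l : ℕ) + 1) : ℕ) : ℤ) k
    rw [show (((n - ((l : ℕ) + 1) : ℕ) : ℤ) - 1) = ((n - ((l : ℕ) + 2) : ℕ) : ℤ) by omega,
      show (((l : ℕ) + 1 : ℕ) : ℤ) + ((n - ((l : ℕ) + 1) : ℕ) : ℤ) = n by omega] at h2
    rw [show (((l : ℕ) + 1 : ℕ) : ℤ) - 1 = (l : ℕ) by omega] at h1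
    linear_combination qInt s k * qInt s (((n - ((l : ℕ) + 1) : ℕ) : ℤ) * k) * h1 + qInt s k * h2
  · rw [if_neg h.ne', show min ((l : ℕ) + 1) ((b : ℕ) + 1) = (l : ℕ) + 1 by omega,
      show min (n - ((l : ℕ) + 1)) (n - ((b : ℕ) + 1)) = n - ((b : ℕ) + 1) by omega,
      show min (l : ℕ) ((b : ℕ) + 1) = (l : ℕ) by omega,
      show min (n - (l : ℕ)) (n - ((b : ℕ) + 1)) = n - ((b : ℕ) + 1) by omega,
      show min ((l : ℕ) + 2) ((b : ℕ) + 1) = (l : ℕ) + 2 by omega,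
      show min (n - ((l : ℕ) + 2)) (n - ((b : ℕ) + 1)) = n - ((b : ℕ) + 1) by omega]
    have := qInt_recurrence hs0 (((l : ℕ) + 1 : ℕ) : ℤ) k
    rw [show (((l : ℕ) + 1 : ℕ) : ℤ) + 1 = ((l : ℕ) + 2 : ℕ) by omega,
      show (((l : ℕ) + 1 : ℕ) : ℤ) - 1 = (l : ℕ) by omega] at this
    linear_combination qInt s k * qInt s (((n - ((b : ℕ) + 1) : ℕ) : ℤ) * k) * this

theorem dualCoeff_zero_left (s : K) (k : ℤ) (b : Fin (n - 1)) : dualCoeff s 0 k b = 0 := by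
  simp [dualCoeff, qInt_zero]

theorem dualCoeff_self_left (s : K) (k : ℤ) (b : Fin (n - 1)) : dualCoeff s n k b = 0 := by
  simp [dualCoeff, qInt_zero]

/-- The dual coefficients as a function of two symmetric indices. -/
theorem dualCoeff_symm (s : K) (k : ℤ) (a b : Fin (n - 1)) :
    dualCoeff s ((a : ℕ) + 1) k b = dualCoeff s ((b : ℕ) + 1) k a := by
  simp only [dualCoeff, min_comm]

/-- The neighbours `0` and `n` do not occur among the nodes; as `f` vanishes there, the boundary
rows have the same form as the others. -/
theorem sum_three_term (l : Fin (n - 1)) (x y z : K) (f : ℕ → K) (h0 : f 0 = 0) (hn : f n = 0) :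
    ∑ b : Fin (n - 1), (x * (if (b : ℕ) = l then 1 else 0) - (if (b : ℕ) + 1 = l then y else 0)
        - (if (b : ℕ) = l + 1 then z else 0)) * f ((b : ℕ) + 1)
      = x * f ((l : ℕ) + 1) - y * f l - z * f ((l : ℕ) + 2) := by
  have hl := l.2
  have key : ∀ (m : ℕ) (t : K), m ≤ n → ∑ b : Fin (n - 1), (if (b : ℕ) + 1 = m then t else 0)
      * f ((b : ℕ) + 1) = t * f m := by
    intro m t hm
    by_cases h : 1 ≤ m ∧ m < n
    · rw [Finset.sum_eq_single ⟨m - 1, by omega⟩]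
      · simp [show m - 1 + 1 = m by omega]
      · intro b _ hb
        rw [if_neg fun h' => hb (Fin.ext (by simp; omega)), zero_mul]
      · intro h'; exact absurd (Finset.mem_univ _) h'
    · have hf : f m = 0 := by
        rcases Nat.eq_zero_or_pos m with rfl | hm0
        · exact h0
        · rw [show m = n by omega, hn]
      rw [hf, mul_zero]
      refine Finset.sum_eq_zero fun b _ => ?_
      have := b.2
      rw [if_neg (by omega), zero_mul]
  rw [← key _ x (show (l : ℕ) + 1 ≤ n by omega), ← key _ y (show (l : ℕ) ≤ n by omega),
    ← key _ z (show (l : ℕ) + 2 ≤ n by omega), ← Finset.sum_sub_distrib, ← Finset.sum_sub_distrib]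
  refine Finset.sum_congr rfl fun b _ => ?_
  simp only [Nat.add_right_cancel_iff, mul_ite, mul_one, mul_zero,
    show ((b : ℕ) + 1 = (l : ℕ) + 2) ↔ ((b : ℕ) = (l : ℕ) + 1) by omega]
  ring

/-- The duality of `a_{l+1}` and `a*_j`, with the degenerate indices `0` and `n` included. All
locality in the component index comes from it. -/
theorem sum_qInt_cartan_mul_dualCoeff {s : K} (hs0 : s ≠ 0) (hs : ∀ m : ℕ, 0 < m → s ^ m ≠ 1)
    (l : Fin (n - 1)) {j : ℕ} (hj : j ≤ n) {k : ℤ} (hk : k ≠ 0) :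
    ∑ b, qInt s (cartan l b * k) * dualCoeff s j k b = if (l : ℕ) + 1 = j then 1 else 0 := by
  have hl := l.2
  by_cases h : 1 ≤ j ∧ j < n
  · set a : Fin (n - 1) := ⟨j - 1, by omega⟩
    have ha : (a : ℕ) + 1 = j := by simp [a]; omega
    have e : ∀ b : Fin (n - 1), dualCoeff s j k b = dualCoeff s ((b : ℕ) + 1) k a := by
      intro b; rw [← ha, dualCoeff_symm]
    simp only [e]
    have h3 := dualCoeff_three_term hs0 hs l a hk
    rw [Finset.sum_congr rfl fun b _ => by rw [qInt_cartan s hs0, mul_assoc], ← Finset.mul_sum,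
      sum_three_term l _ 1 1 (fun m => dualCoeff s m k a) (dualCoeff_zero_left _ _ _)
        (dualCoeff_self_left _ _ _), one_mul, one_mul, h3]
    simp only [Fin.ext_iff]
    split_ifs <;> first | rfl | omega
  · rw [if_neg (by omega)]
    refine Finset.sum_eq_zero fun b _ => ?_
    rcases Nat.eq_zero_or_pos j with rfl | hj0
    · rw [dualCoeff_zero_left, mul_zero]
    · rw [show j = n by omega, dualCoeff_self_left, mul_zero]

theorem sum_dualCoeff_mul_qInt_cartan {s : K} (hs0 : s ≠ 0) (hs : ∀ m : ℕ, 0 < m → s ^ m ≠ 1)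
    (l : Fin (n - 1)) {j : ℕ} (hj : j ≤ n) {k : ℤ} (hk : k ≠ 0) :
    ∑ b, dualCoeff s j k b * qInt s (cartan b l * k) = if (l : ℕ) + 1 = j then 1 else 0 := by
  rw [← sum_qInt_cartan_mul_dualCoeff hs0 hs l hj hk]
  exact Finset.sum_congr rfl fun b _ => by rw [mul_comm, cartan_symm]

/-! ### Oscillator data -/

theorem heis_neg (s : K) (l : Fin (n - 1)) {k : ℕ} (hk : 0 < k) :
    heis s l (-(k : ℤ)) = LinearMap.mulLeft K (MvPolynomial.X (l, k - 1)) := by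
  obtain ⟨r, rfl⟩ : ∃ r, k = r + 1 := ⟨k - 1, by omega⟩
  rfl

theorem annDer_smul (c : K) (H : ℕ → Fin (n - 1) → K) (k : ℕ) :
    annDer (fun k l => c * H k l) k = c • annDer H k := by
  apply MvPolynomial.derivation_ext
  intro p
  rw [Derivation.smul_apply, annDer_X, annDer_X]
  split_ifs <;> simp [MvPolynomial.smul_eq_C_mul]

theorem annDer_congr {H H' : ℕ → Fin (n - 1) → K} {k : ℕ} (h : ∀ l, H k l = H' k l) :
    annDer H k = annDer H' k := by
  apply MvPolynomial.derivation_ext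
  intro p
  rw [annDer_X, annDer_X, h]

/-- The values of `a_{l+1,k}` on the variables. -/
def heisH (s : K) (l : Fin (n - 1)) (k : ℕ) (b : Fin (n - 1)) : K :=
  qInt s (cartan l b * k) * (qInt s k / k)

theorem heis_pos (s : K) (l : Fin (n - 1)) {k : ℕ} (hk : 0 < k) :
    heis s l (k : ℤ) = (annDer (heisH s l) k).toLinearMap := by
  obtain ⟨r, rfl⟩ : ∃ r, k = r + 1 := ⟨k - 1, by omega⟩
  have e : heis s l ((r + 1 : ℕ) : ℤ) = (MvPolynomial.mkDerivation K (fun p : Fin (n - 1) × ℕ =>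
      if p.2 = r then
        (MvPolynomial.C (qInt s (cartan l p.1 * ((r : ℤ) + 1)) * qInt s ((r : ℤ) + 1)
          / ((r : K) + 1)) : Osc n K)
      else 0)).toLinearMap := rfl
  rw [e]
  refine congrArg Derivation.toLinearMap (MvPolynomial.derivation_ext fun p => ?_)
  rw [annDer_X, MvPolynomial.mkDerivation_X]
  simp only [Nat.add_right_cancel_iff, heisH, Nat.cast_add, Nat.cast_one, mul_div_assoc]

theorem creForm_single (l : Fin (n - 1)) (c : ℕ → K) (k : ℕ) :
    creForm (fun k b => if b = l then c k else 0) k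
      = MvPolynomial.C (c k) * MvPolynomial.X (l, k - 1) := by
  rw [creForm, Finset.sum_eq_single l]
  · simp
  · intro b _ hb; simp [hb]
  · intro h; exact absurd (Finset.mem_univ _) h

theorem smul_heis_neg (s : K) (l : Fin (n - 1)) (c : ℕ → K) {k : ℕ} (hk : 0 < k) :
    c k • heis s l (-(k : ℤ))
      = LinearMap.mulLeft K (creForm (fun k b => if b = l then c k else 0) k) := by
  rw [heis_neg s l hk, creForm_single]
  refine LinearMap.ext fun p => ?_
  simp [MvPolynomial.smul_eq_C_mul]

theorem smul_heis_pos (s : K) (l : Fin (n - 1)) (c : ℕ → K) {k : ℕ} (hk : 0 < k) :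
    c k • heis s l (k : ℤ)
      = (annDer (fun k b => c k * heisH s l k b) k).toLinearMap := by
  rw [heis_pos s l hk, annDer_congr (H := fun k b => c k * heisH s l k b)
    (H' := fun k' b => c k * heisH s l k' b) fun _ => rfl, annDer_smul]
  rfl

theorem derivation_sum_apply {ι : Type*} (S : Finset ι)
    (D : ι → Derivation K (Osc n K) (Osc n K)) (p : Osc n K) :
    (∑ a ∈ S, D a) p = ∑ a ∈ S, D a p := by
  classical
  induction S using Finset.induction_on with
  | empty => rfl
  | insert a S ha ih => rw [Finset.sum_insert ha, Finset.sum_insert ha, Derivation.add_apply, ih]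

theorem heisDual_neg (s : K) (j : ℕ) {k : ℕ} (hk : 0 < k) :
    heisDual (n := n) s j (-(k : ℤ))
      = LinearMap.mulLeft K (creForm (fun k b => dualCoeff s j (-(k : ℤ)) b) k) := by
  refine LinearMap.ext fun p => ?_
  simp only [heisDual, LinearMap.sum_apply, LinearMap.smul_apply, heis_neg s _ hk,
    LinearMap.mulLeft_apply, creForm, Finset.sum_mul, MvPolynomial.smul_eq_C_mul, dualCoeff,
    mul_assoc]

/-- By duality the annihilation part of `a*_{j,k}` is diagonal: it differentiates only in the
variable `a_{j,-k}`. -/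
theorem heisDual_pos {s : K} (hs0 : s ≠ 0) (hs : ∀ m : ℕ, 0 < m → s ^ m ≠ 1) {j : ℕ}
    (hj : j ≤ n) {k : ℕ} (hk : 0 < k) :
    heisDual (n := n) s j (k : ℤ) = (annDer (fun k b => (if (b : ℕ) + 1 = j then 1 else 0)
      * (qInt s k / k)) k).toLinearMap := by
  have h : heisDual (n := n) s j (k : ℤ)
      = (∑ l, dualCoeff s j k l • annDer (heisH s l) k).toLinearMap := by
    rw [heisDual]
    refine LinearMap.ext fun p => ?_
    simp only [LinearMap.sum_apply, LinearMap.smul_apply, heis_pos s _ hk,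
      Derivation.coeFn_coe, derivation_sum_apply, Derivation.smul_apply, dualCoeff]
  rw [h]
  congr 1
  apply MvPolynomial.derivation_ext
  intro p
  simp only [derivation_sum_apply, Derivation.smul_apply, annDer_X]
  by_cases hp : p.2 + 1 = k
  · simp only [hp, if_true, heisH, MvPolynomial.smul_eq_C_mul, ← map_mul, ← map_sum]
    rw [← sum_dualCoeff_mul_qInt_cartan hs0 hs p.1 hj (show (k : ℤ) ≠ 0 by omega), Finset.sum_mul]
    simp only [mul_assoc]
  · simp [hp]

/-- Creation part of the current `x^ε_{l+1}`. -/
def currentF (s : K) (ε : ℤ) (l : Fin (n - 1)) (k : ℕ) (b : Fin (n - 1)) : K :=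
  if b = l then (ε : K) * s ^ (-ε * k) / qInt s k else 0

/-- Annihilation part of the current `x^ε_{l+1}`. -/
def currentH (s : K) (ε : ℤ) (l : Fin (n - 1)) (k : ℕ) (b : Fin (n - 1)) : K :=
  -(ε : K) * s ^ (-ε * k) / qInt s k * heisH s l k b

/-- Creation part of the `j`-th component of the vertex operators. -/
def bosonF (s : K) (σ : ℤ) (j : ℕ) (c : ℤ) (k : ℕ) (b : Fin (n - 1)) : K :=
  (σ : K) * (s ^ 2) ^ ((j : ℤ) * k) * (-(s ^ ((c + 1) * k) * dualCoeff s j (-(k : ℤ)) b)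
    + s ^ ((c - 1) * k) * dualCoeff s (j + 1) (-(k : ℤ)) b)

/-- Annihilation part of the `j`-th component of the vertex operators. -/
def bosonH (s : K) (σ : ℤ) (j : ℕ) (c : ℤ) (k : ℕ) (b : Fin (n - 1)) : K :=
  (σ : K) * (s ^ 2) ^ (-((j : ℤ) * k)) * (-(s ^ ((c - 3) * k) * if (b : ℕ) + 1 = j then 1 else 0)
    + s ^ ((c - 1) * k) * if (b : ℕ) + 1 = j + 1 then 1 else 0) * (qInt s k / k)

/-- One parameter covers the four cases: `c = 2` is type I, `c = 0` is type II, and `σ = -1` is the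
dual. The half-exponents of `q` are `c ± 1` in the creation part and `c - 3`, `c - 1` in the
annihilation part. -/
theorem creExp_eq (s : K) (σ : ℤ) (j : ℕ) (c : ℤ) {k : ℕ} (hk : 0 < k) :
    (σ : K) • creExp (n := n) s j (c + 1) (c - 1) k
      = LinearMap.mulLeft K (creForm (bosonF s σ j c) k) := by
  rw [creExp, heisDual_neg s j hk, heisDual_neg s (j + 1) hk]
  refine LinearMap.ext fun p => ?_
  simp only [LinearMap.smul_apply, LinearMap.add_apply, LinearMap.neg_apply,
    LinearMap.mulLeft_apply, creForm, bosonF, MvPolynomial.smul_eq_C_mul, Finset.sum_mul,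
    Finset.mul_sum, ← Finset.sum_neg_distrib, ← Finset.sum_add_distrib, map_mul, map_add, map_neg]
  exact Finset.sum_congr rfl fun b _ => by ring

theorem annExp_eq {s : K} (hs0 : s ≠ 0) (hs : ∀ m : ℕ, 0 < m → s ^ m ≠ 1) (σ : ℤ) {j : ℕ}
    (hj : j < n) (c : ℤ) {k : ℕ} (hk : 0 < k) :
    (σ : K) • annExp (n := n) s j (c - 3) (c - 1) k
      = (annDer (bosonH s σ j c) k).toLinearMap := by
  rw [annExp, heisDual_pos hs0 hs hj.le hk, heisDual_pos hs0 hs (Nat.succ_le_of_lt hj) hk]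
  have h : annDer (n := n) (bosonH s σ j c) k = (σ : K) • (s ^ 2) ^ (-((j : ℤ) * k)) •
      (-(s ^ ((c - 3) * k) • annDer (fun k b => (if (b : ℕ) + 1 = j then 1 else 0)
        * (qInt s k / k)) k) + s ^ ((c - 1) * k) • annDer (fun k b =>
          (if (b : ℕ) + 1 = j + 1 then 1 else 0) * (qInt s k / k)) k) := by
    apply MvPolynomial.derivation_ext
    intro p
    simp only [Derivation.smul_apply, Derivation.add_apply, Derivation.neg_apply, annDer_X]
    by_cases hp : p.2 + 1 = k
    · simp only [hp, if_true, bosonH, MvPolynomial.smul_eq_C_mul, ← map_mul, ← map_neg, ← map_add]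
      congr 1
      ring
    · simp [hp]
  rw [h]
  rfl

/-! ### Contractions -/

theorem contr_single {H : ℕ → Fin (n - 1) → K} (l : Fin (n - 1)) (f : ℕ → K) (k : ℕ) :
    contr H (fun k b => if b = l then f k else 0) k = H k l * f k := by
  rw [contr, Finset.sum_eq_single l]
  · simp
  · intro b _ hb; simp [hb]
  · intro h; exact absurd (Finset.mem_univ _) h

variable [CharZero K]

/-- Duality collapses the sum over the nodes, leaving terms `± X^k / k`. Exponentiated, each is a
linear factor or the inverse of one. -/
theorem contr_currentH_bosonF {s : K} (hs0 : s ≠ 0) (hs : ∀ m : ℕ, 0 < m → s ^ m ≠ 1) (ε σ c : ℤ)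
    (l : Fin (n - 1)) {j : ℕ} (hj : j < n) {k : ℕ} (hk : 0 < k) :
    contr (currentH s ε l) (bosonF s σ j c) k = (ε * σ : ℤ) *
      (-((s ^ (2 * j + c + 1 - ε)) ^ k / k * if (l : ℕ) + 1 = j then 1 else 0)
        + (s ^ (2 * j + c - 1 - ε)) ^ k / k * if (l : ℕ) = j then 1 else 0) := by
  have hk' : (k : ℤ) ≠ 0 := by omega
  have hqk := qInt_ne_zero hs0 hs hk'
  have h1 := sum_qInt_cartan_mul_dualCoeff hs0 hs l hj.le hk'
  have h2 := sum_qInt_cartan_mul_dualCoeff hs0 hs l (Nat.succ_le_of_lt hj) hk'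
  have e : contr (currentH s ε l) (bosonF s σ j c) k
      = -(ε : K) * s ^ (-ε * k) / k * (σ : K) * (s ^ 2) ^ ((j : ℤ) * k) *
        (s ^ ((c + 1) * k) * (∑ b, qInt s (cartan l b * k) * dualCoeff s j k b)
          - s ^ ((c - 1) * k) * (∑ b, qInt s (cartan l b * k) * dualCoeff s (j + 1) k b)) := by
    simp only [contr, Finset.mul_sum, ← Finset.sum_sub_distrib]
    refine Finset.sum_congr rfl fun b _ => ?_
    rw [currentH, bosonF, heisH, dualCoeff_neg, dualCoeff_neg]
    field_simp
    ring
  rw [e, h1, h2]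
  have e1 : (s ^ (2 * j + c + 1 - ε)) ^ k
      = s ^ (-ε * k) * (s ^ 2) ^ ((j : ℤ) * k) * s ^ ((c + 1) * k) := by
    rw [← zpow_natCast, ← zpow_natCast s 2, ← zpow_mul, ← zpow_mul, ← zpow_add₀ hs0,
      ← zpow_add₀ hs0]
    congr 1; push_cast; ring
  have e2 : (s ^ (2 * j + c - 1 - ε)) ^ k
      = s ^ (-ε * k) * (s ^ 2) ^ ((j : ℤ) * k) * s ^ ((c - 1) * k) := by
    rw [← zpow_natCast, ← zpow_natCast s 2, ← zpow_mul, ← zpow_mul, ← zpow_add₀ hs0,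
      ← zpow_add₀ hs0]
    congr 1; push_cast; ring
  rw [e1, e2]
  simp only [Nat.succ_eq_add_one, Nat.add_right_cancel_iff]
  push_cast
  ring

theorem contr_bosonH_currentF {s : K} (hs0 : s ≠ 0) (hs : ∀ m : ℕ, 0 < m → s ^ m ≠ 1) (ε σ c : ℤ)
    (l : Fin (n - 1)) (j : ℕ) {k : ℕ} (hk : 0 < k) :
    contr (bosonH s σ j c) (currentF s ε l) k = (ε * σ : ℤ) *
      (-((s ^ (-2 * j + c - 3 - ε)) ^ k / k * if (l : ℕ) + 1 = j then 1 else 0)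
        + (s ^ (-2 * j + c - 1 - ε)) ^ k / k * if (l : ℕ) = j then 1 else 0) := by
  have hk' : (k : ℤ) ≠ 0 := by omega
  have hqk := qInt_ne_zero hs0 hs hk'
  have hkK : (k : K) ≠ 0 := by exact_mod_cast hk.ne'
  have e0 : contr (bosonH s σ j c) (currentF s ε l) k
      = bosonH s σ j c k l * ((ε : K) * s ^ (-ε * k) / qInt s k) := contr_single l _ k
  rw [e0, bosonH]
  have e1 : (s ^ (-2 * j + c - 3 - ε)) ^ k
      = s ^ (-ε * k) * (s ^ 2) ^ (-((j : ℤ) * k)) * s ^ ((c - 3) * k) := by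
    rw [← zpow_natCast, ← zpow_natCast s 2, ← zpow_mul, ← zpow_mul, ← zpow_add₀ hs0,
      ← zpow_add₀ hs0]
    congr 1; push_cast; ring
  have e2 : (s ^ (-2 * j + c - 1 - ε)) ^ k
      = s ^ (-ε * k) * (s ^ 2) ^ (-((j : ℤ) * k)) * s ^ ((c - 1) * k) := by
    rw [← zpow_natCast, ← zpow_natCast s 2, ← zpow_mul, ← zpow_mul, ← zpow_add₀ hs0,
      ← zpow_add₀ hs0]
    congr 1; push_cast; ring
  rw [e1, e2]
  simp only [Nat.add_right_cancel_iff]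
  push_cast
  field_simp

/-- Creation part of `φ_{l+1}`. -/
def phiF (s : K) (l : Fin (n - 1)) (_k : ℕ) (b : Fin (n - 1)) : K :=
  if b = l then -(s ^ 2 - (s ^ 2)⁻¹) else 0

/-- Annihilation part of `ψ_{l+1}`. -/
def psiH (s : K) (l : Fin (n - 1)) (k : ℕ) (b : Fin (n - 1)) : K :=
  (s ^ 2 - (s ^ 2)⁻¹) * heisH s l k b

/-- The factor `q - q^{-1}` times `[k]` is `q^k - q^{-k}`, so each nonzero contraction is a
difference of two logarithms and gives a quotient of linear factors. -/
theorem contr_bosonH_phiF {s : K} (hs0 : s ≠ 0) (hs : ∀ m : ℕ, 0 < m → s ^ m ≠ 1) (σ c : ℤ)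
    (l : Fin (n - 1)) (j k : ℕ) :
    contr (bosonH s σ j c) (phiF s l) k = (σ : K) *
      (((s ^ (-2 * j + c - 1)) ^ k / k - (s ^ (-2 * j + c - 5)) ^ k / k)
          * (if (l : ℕ) + 1 = j then 1 else 0)
        - ((s ^ (-2 * j + c + 1)) ^ k / k - (s ^ (-2 * j + c - 3)) ^ k / k)
          * if (l : ℕ) = j then 1 else 0) := by
  have e0 : contr (bosonH s σ j c) (phiF s l) k
      = bosonH s σ j c k l * -(s ^ 2 - (s ^ 2)⁻¹) := contr_single l _ k
  have h := q_sub_inv_mul_qInt hs0 hs k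
  rw [e0, bosonH]
  have e : ∀ t u : ℤ, (s ^ (-2 * j + t + u)) ^ k
      = (s ^ 2) ^ (-((j : ℤ) * k)) * s ^ (t * k) * s ^ (u * k) := by
    intro t u
    rw [← zpow_natCast, ← zpow_natCast s 2, ← zpow_mul, ← zpow_mul, ← zpow_add₀ hs0,
      ← zpow_add₀ hs0]
    congr 1; push_cast; ring
  have hq1 : (s ^ 2) ^ (k : ℤ) = s ^ ((2 : ℤ) * k) := by
    rw [zpow_mul]; norm_cast
  have hq2 : (s ^ 2) ^ (-(k : ℤ)) = s ^ ((-2 : ℤ) * k) := by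
    rw [zpow_neg, hq1, neg_mul, zpow_neg]
  rw [hq1, hq2] at h
  rw [show (-2 * (j : ℤ) + c - 1) = -2 * j + (c - 3) + 2 by ring, e,
    show (-2 * (j : ℤ) + c - 5) = -2 * j + (c - 3) + (-2) by ring, e,
    show (-2 * (j : ℤ) + c + 1) = -2 * j + (c - 1) + 2 by ring, e,
    show (-2 * (j : ℤ) + c - 3) = -2 * j + (c - 1) + (-2) by ring, e]
  simp only [Nat.add_right_cancel_iff]
  linear_combination (-(σ : K) * (s ^ 2) ^ (-((j : ℤ) * k)) *
    (-(s ^ ((c - 3) * k) * if (l : ℕ) + 1 = j then 1 else 0)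
    + s ^ ((c - 1) * k) * if (l : ℕ) = j then 1 else 0) / k) * h

theorem contr_psiH_bosonF {s : K} (hs0 : s ≠ 0) (hs : ∀ m : ℕ, 0 < m → s ^ m ≠ 1) (σ c : ℤ)
    (l : Fin (n - 1)) {j : ℕ} (hj : j < n) {k : ℕ} (hk : 0 < k) :
    contr (psiH s l) (bosonF s σ j c) k = (σ : K) *
      (((s ^ (2 * j + c + 3)) ^ k / k - (s ^ (2 * j + c - 1)) ^ k / k)
          * (if (l : ℕ) + 1 = j then 1 else 0)
        - ((s ^ (2 * j + c + 1)) ^ k / k - (s ^ (2 * j + c - 3)) ^ k / k)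
          * if (l : ℕ) = j then 1 else 0) := by
  have hk' : (k : ℤ) ≠ 0 := by omega
  have h1 := sum_qInt_cartan_mul_dualCoeff hs0 hs l hj.le hk'
  have h2 := sum_qInt_cartan_mul_dualCoeff hs0 hs l (Nat.succ_le_of_lt hj) hk'
  have h := q_sub_inv_mul_qInt hs0 hs k
  have e0 : contr (psiH s l) (bosonF s σ j c) k
      = (s ^ 2 - (s ^ 2)⁻¹) * (qInt s k / k) * (σ : K) * (s ^ 2) ^ ((j : ℤ) * k) *
        (s ^ ((c + 1) * k) * (∑ b, qInt s (cartan l b * k) * dualCoeff s j k b)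
          - s ^ ((c - 1) * k) * (∑ b, qInt s (cartan l b * k) * dualCoeff s (j + 1) k b)) := by
    simp only [contr, Finset.mul_sum, ← Finset.sum_sub_distrib]
    refine Finset.sum_congr rfl fun b _ => ?_
    rw [psiH, bosonF, heisH, dualCoeff_neg, dualCoeff_neg]
    ring
  rw [e0, h1, h2]
  have e : ∀ t u : ℤ, (s ^ (2 * j + t + u)) ^ k
      = (s ^ 2) ^ ((j : ℤ) * k) * s ^ (t * k) * s ^ (u * k) := by
    intro t u
    rw [← zpow_natCast, ← zpow_natCast s 2, ← zpow_mul, ← zpow_mul, ← zpow_add₀ hs0,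
      ← zpow_add₀ hs0]
    congr 1; push_cast; ring
  have hq1 : (s ^ 2) ^ (k : ℤ) = s ^ ((2 : ℤ) * k) := by
    rw [zpow_mul]; norm_cast
  have hq2 : (s ^ 2) ^ (-(k : ℤ)) = s ^ ((-2 : ℤ) * k) := by
    rw [zpow_neg, hq1, neg_mul, zpow_neg]
  rw [hq1, hq2] at h
  rw [show (2 * (j : ℤ) + c + 3) = 2 * j + (c + 1) + 2 by ring, e,
    show (2 * (j : ℤ) + c - 1) = 2 * j + (c + 1) + (-2) by ring, e,
    show (2 * (j : ℤ) + c + 1) = 2 * j + (c - 1) + 2 by ring, e,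
    show (2 * (j : ℤ) + c - 3) = 2 * j + (c - 1) + (-2) by ring, e]
  simp only [Nat.succ_eq_add_one, Nat.add_right_cancel_iff]
  linear_combination ((σ : K) * (s ^ 2) ^ ((j : ℤ) * k) *
    ((s ^ ((c + 1) * k) * if (l : ℕ) + 1 = j then 1 else 0)
    - s ^ ((c - 1) * k) * if (l : ℕ) = j then 1 else 0) / k) * h

end Data


/-! ### Operator product expansions on the total Fock space -/

section Ops

variable {n : ℕ} {K : Type*} [Field K]

/-- The sign of the twisted group algebra as a scalar. -/
def sgn (K : Type*) [Field K] (x y : Weight n) : K := (((latticeSign x y : ℤˣ) : ℤ) : K)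

theorem sgn_add_left (x y z : Weight n) : sgn K (x + y) z = sgn K x z * sgn K y z := by
  simp [sgn, latticeSign_add_left]

theorem sgn_add_right (x y z : Weight n) : sgn K x (y + z) = sgn K x y * sgn K x z := by
  simp [sgn, latticeSign_add_right]

theorem sgn_mul_self (x y : Weight n) : sgn K x y * sgn K x y = 1 := by
  rw [sgn, ← Int.cast_mul, ← Units.val_mul, Int.units_mul_self]
  simp

theorem sgn_zero_left (x : Weight n) : sgn K 0 x = 1 := by
  have h := sgn_add_left (K := K) 0 0 x
  rw [add_zero, sgn_mul_self] at h
  exact h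

theorem sgn_zero_right (x : Weight n) : sgn K x 0 = 1 := by
  have h := sgn_add_right (K := K) x 0 0
  rw [add_zero, sgn_mul_self] at h
  exact h

theorem sgn_ne_zero (x y : Weight n) : sgn K x y ≠ 0 := by
  intro h
  have := sgn_mul_self (K := K) x y
  rw [h, zero_mul] at this
  exact zero_ne_one this

/-- The data of a normally ordered exponential operator
`exp[∑ F_k z^k] exp[∑ H_k z^{-k}] e^γ κ(∂) z^{e(∂)}`. -/
structure VOData (n : ℕ) (K : Type*) [Field K] where
  F : ℕ → Fin (n - 1) → K
  H : ℕ → Fin (n - 1) → K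
  γ : Weight n
  κ : Weight n → K
  e : Weight n → ℤ

/-- The coefficient of `z ^ m` of the operator with the given data. -/
def VOData.op (D : VOData n K) (m : ℤ) : Module.End K (TotalFock n K) :=
  Finsupp.lsum K fun x => (Finsupp.lsingle (D.γ + x)).comp
    ((D.κ x * sgn K D.γ x) • mode D.F D.H (m - D.e x))

theorem VOData.op_single (D : VOData n K) (m : ℤ) (x : Weight n) (p : Osc n K) :
    D.op m (Finsupp.single x p) = Finsupp.single (D.γ + x)
      ((D.κ x * sgn K D.γ x) • mode D.F D.H (m - D.e x) p) := by
  rw [VOData.op, Finsupp.lsum_single]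
  rfl

theorem VOData.totalMode_eq_op [CharZero K] (D : VOData n K) {f g : ℕ → Module.End K (Osc n K)}
    (hf : ∀ k, 0 < k → f k = LinearMap.mulLeft K (creForm D.F k))
    (hg : ∀ k, 0 < k → g k = (annDer D.H k).toLinearMap) (m : ℤ) :
    totalMode f g D.γ D.κ D.e m = D.op m := by
  simp only [totalMode, VOData.op, expMode_eq_mode hf hg, sgn]

/-- The normally ordered product of two operators, applied to `p ⊗ e^x`. -/
def nordOp (D₁ D₂ : VOData n K) (m : ℤ) (x : Weight n) (p : Osc n K) (a b : ℤ) : TotalFock n K :=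
  Finsupp.single (D₁.γ + D₂.γ + x)
    ((D₁.κ x * D₂.κ x * sgn K D₁.γ x * sgn K D₂.γ x * sgn K D₁.γ D₂.γ) •
      nord D₁.F D₁.H D₂.F D₂.H p (a - D₁.e x) (b - D₂.e x - m))

theorem isBddBelow₂_nordOp (D₁ D₂ : VOData n K) (m : ℤ) (x : Weight n) (p : Osc n K) :
    IsBddBelow₂ (nordOp D₁ D₂ m x p) := by
  obtain ⟨B, hB⟩ := isBddBelow₂_nord D₁.F D₁.H D₂.F D₂.H p
  refine ⟨min (B + D₁.e x) (B + D₂.e x + m), fun a b h => ?_⟩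
  rw [nordOp, hB _ _ (by omega), smul_zero, Finsupp.single_zero]

theorem act_nordOp (D₁ D₂ : VOData n K) (m : ℤ) (x : Weight n) (p : Osc n K) (c : ℤ → K)
    (a b : ℤ) : act c (nordOp D₁ D₂ m x p) a b = Finsupp.single (D₁.γ + D₂.γ + x)
    ((D₁.κ x * D₂.κ x * sgn K D₁.γ x * sgn K D₂.γ x * sgn K D₁.γ D₂.γ) •
      act c (nord D₁.F D₁.H D₂.F D₂.H p) (a - D₁.e x) (b - D₂.e x - m)) := by
  have hfin := (isBddBelow₂_nord D₁.F D₁.H D₂.F D₂.H p).finite c (a - D₁.e x) (b - D₂.e x - m)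
  set f : Osc n K →ₗ[K] TotalFock n K :=
    (D₁.κ x * D₂.κ x * sgn K D₁.γ x * sgn K D₂.γ x * sgn K D₁.γ D₂.γ) •
      Finsupp.lsingle (D₁.γ + D₂.γ + x) with hf
  have h : ∀ q, f q = Finsupp.single (D₁.γ + D₂.γ + x)
      ((D₁.κ x * D₂.κ x * sgn K D₁.γ x * sgn K D₂.γ x * sgn K D₁.γ D₂.γ) • q) := fun q => by
    rw [hf, LinearMap.smul_apply, Finsupp.lsingle_apply, Finsupp.smul_single]
  rw [← h, act, act]
  refine Eq.trans (finsum_congr fun k => ?_) (AddMonoidHom.map_finsum f.toAddMonoidHom hfin).symm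
  rw [LinearMap.toAddMonoidHom_coe, map_smul, h, nordOp]
  congr 4 <;> ring

theorem isSeriesMul_of_single {V : Type*} [AddCommGroup V] [Module K V] {c : ℤ → K}
    {P R : ℤ → ℤ → (TotalFock n K →ₗ[K] V)}
    (h : ∀ x p, IsSeriesMul c (fun a b => P a b (Finsupp.single x p))
      (fun a b => R a b (Finsupp.single x p))) (v : TotalFock n K) :
    IsSeriesMul c (fun a b => P a b v) (fun a b => R a b v) := by
  induction v using Finsupp.induction_linear with
  | zero => intro a b; simp [IsFinSum]
  | add v w hv hw =>
    intro a b
    obtain ⟨h1, h2⟩ := hv a b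
    obtain ⟨h3, h4⟩ := hw a b
    simp only [map_add, smul_add]
    refine ⟨(h1.union h3).subset (Function.support_add _ _), ?_⟩
    rw [finsum_add_distrib h1 h3, h2, h4]
  | single x p => exact h x p

theorem isSeriesMul_of_coe {V : Type*} [AddCommGroup V] [Module K V] {S : Submodule K V}
    {c : ℤ → K} {P R : ℤ → ℤ → S}
    (h : IsSeriesMul c (fun a b => (P a b : V)) (fun a b => (R a b : V))) :
    IsSeriesMul c P R := by
  intro a b
  obtain ⟨h1, h2⟩ := h a b
  have hf : (Function.support fun k => c k • P (a - k) (b + k)).Finite := by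
    refine h1.subset fun k hk hk' => hk ?_
    exact Subtype.ext hk'
  refine ⟨hf, Subtype.ext ?_⟩
  refine Eq.trans ?_ h2
  exact AddMonoidHom.map_finsum S.subtype.toAddMonoidHom hf

variable [CharZero K]

/-- Moving `w^{e(∂)}` past `e^{γ₂}` gives `w^m = z^m u^m`. The factor `z^m` is part of `nordOp`, and
`u^m` is the shift of the scalar series. -/
theorem op_op (D₁ D₂ : VOData n K) {m : ℤ} {x : Weight n} {r : K}
    (he : D₁.e (D₂.γ + x) = D₁.e x + m) (hκ : D₁.κ (D₂.γ + x) = r * D₁.κ x)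
    (p : Osc n K) (a b : ℤ) :
    D₁.op a (D₂.op b (Finsupp.single x p))
      = act (fun k => r * serZ (expCoeff (K := K) (contr D₁.H D₂.F)) (k - m))
          (nordOp D₁ D₂ m x p) a b := by
  rw [act_smul (isBddBelow₂_nordOp D₁ D₂ m x p), act_nordOp, ← act_shift, sub_add_cancel,
    VOData.op_single, VOData.op_single, map_smul, mode_mode_eq_act, he, hκ, smul_smul,
    Finsupp.smul_single, smul_smul, add_assoc, sgn_add_right, sub_sub]
  congr 2
  ring

/-- Here `z^{e(∂)}` passes `e^{γ₁}` and gives `z^m`, already contained in `nordOp`, so that the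
series is not shifted. Reordering the lattice elements costs the commutator of the cocycle, which
enters through `hκ`. -/
theorem op_op' (D₁ D₂ : VOData n K) {m : ℤ} {x : Weight n} {r : K}
    (he : D₂.e (D₁.γ + x) = D₂.e x + m)
    (hκ : D₂.κ (D₁.γ + x) * (sgn K D₂.γ D₁.γ * sgn K D₁.γ D₂.γ) = r * D₂.κ x)
    (p : Osc n K) (a b : ℤ) :
    D₂.op b (D₁.op a (Finsupp.single x p))
      = act (fun k => r * serW (expCoeff (K := K) (contr D₂.H D₁.F)) k)
          (nordOp D₁ D₂ m x p) a b := by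
  rw [act_smul (isBddBelow₂_nordOp D₁ D₂ m x p), act_nordOp,
    VOData.op_single, VOData.op_single, map_smul, mode_mode_eq_act', he, smul_smul,
    Finsupp.smul_single, smul_smul, ← add_assoc, add_comm D₂.γ, sgn_add_right, sub_sub]
  congr 2
  linear_combination (sgn K D₁.γ x * sgn K D₂.γ x * D₁.κ x * sgn K D₁.γ D₂.γ) * hκ
    - (sgn K D₁.γ x * sgn K D₂.γ x * D₁.κ x * D₂.κ (D₁.γ + x) * sgn K D₂.γ D₁.γ) *
      sgn_mul_self (K := K) D₁.γ D₂.γ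

theorem act_delta_nordOp (D₁ D₂ D₃ : VOData n K) {m : ℤ} {x : Weight n} {ρ r : K} (hρ : ρ ≠ 0)
    (hF : ∀ k, 0 < k → ∀ l, D₃.F k l = ρ ^ k * D₁.F k l + D₂.F k l)
    (hH : ∀ k, 0 < k → ∀ l, D₃.H k l = ρ⁻¹ ^ k * D₁.H k l + D₂.H k l)
    (hγ : D₁.γ + D₂.γ = D₃.γ) (he : D₁.e x + D₂.e x + m = D₃.e x)
    (hκ : D₁.κ x * D₂.κ x * sgn K D₁.γ D₂.γ * ρ ^ D₁.e x = r * D₃.κ x) (p : Osc n K) (a b : ℤ) :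
    act (delta ρ) (nordOp D₁ D₂ m x p) a b
      = (r * ρ ^ (-a)) • D₃.op (a + b) (Finsupp.single x p) := by
  rw [act_nordOp, act_delta_nord hρ hF hH, VOData.op_single, ← hγ, sgn_add_left, smul_smul,
    Finsupp.smul_single, smul_smul,
    show a - D₁.e x + (b - D₂.e x - m) = a + b - D₃.e x by rw [← he]; ring]
  congr 2
  rw [show -(a - D₁.e x) = -a + D₁.e x by ring, zpow_add₀ hρ]
  linear_combination (sgn K D₁.γ x * sgn K D₂.γ x * ρ ^ (-a)) * hκ

end Ops


/-! ### The rational series of the operator products -/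

section Series

variable {K : Type*} [Field K]

/-- The coefficients of `u - A`. -/
def lin (A : K) (k : ℤ) : K := if k = 1 then 1 else if k = 0 then -A else 0

/-- The coefficients of `1 / (u - A)`, expanded in `u⁻¹`. -/
def geoZ (A : K) (k : ℤ) : K := if k < 0 then A ^ (-k - 1) else 0

/-- The coefficients of `1 / (u - A)`, expanded in `u`. -/
def geoW (A : K) (k : ℤ) : K := if k < 0 then 0 else -A ^ (-k - 1)

/-- The two expansions of a simple pole differ by a delta function; every inhomogeneous term of the
intertwining relations arises in this way. -/
theorem geoZ_sub_geoW {A : K} (hA : A ≠ 0) (k : ℤ) : geoZ A k - geoW A k = A⁻¹ * delta A k := by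
  have h : A ^ (-k - 1) = A⁻¹ * A ^ (-k) := by rw [zpow_sub_one₀ hA, mul_comm]
  rw [geoZ, geoW, delta, ← h]
  split_ifs <;> ring

variable {V : Type*} [AddCommGroup V] [Module K V] {N : ℤ → ℤ → V}

/-- With these constants the rational function is `A₀ (u - A₂)/(u - A₁)`. -/
theorem isSeriesMul_fracZ_lin (hN : IsBddBelow₂ N) {A₁ A₂ A₀ B₀ : K} (hB : B₀ = A₀ * A₂) :
    IsSeriesMul (fracZ A₀ B₀ A₁) (act (lin A₁) N) (act (fun k => A₀ * lin A₂ k) N) := by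
  refine isSeriesMul_fracZ_act hN (k₁ := 1) (fun k hk => ?_) (fun k hk => ?_) fun k => ?_
  · rw [lin, if_neg (by omega), if_neg (by omega)]
  · rw [lin, if_neg (by omega), if_neg (by omega), mul_zero]
  · subst hB
    unfold lin
    split_ifs <;> first | omega | ring

theorem isSeriesMul_fracZ_geoZ (hN : IsBddBelow₂ N) {A₁ A₂ A₀ B₀ : K} (h₁ : A₁ ≠ 0) (h₂ : A₂ ≠ 0)
    (hB : B₀ = A₀ * A₁) :
    IsSeriesMul (fracZ A₀ B₀ A₂) (act (geoZ A₁) N) (act (fun k => A₀ * geoZ A₂ k) N) := by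
  refine isSeriesMul_fracZ_act hN (k₁ := -1) (fun k hk => ?_) (fun k hk => ?_) fun k => ?_
  · rw [geoZ, if_neg (by omega)]
  · rw [geoZ, if_neg (by omega), mul_zero]
  · subst hB
    unfold geoZ
    rcases lt_trichotomy k (-1) with h | h | h
    · rw [if_pos (by omega), if_pos (by omega), if_pos (by omega), if_pos (by omega),
        show -k - 1 = (-(k + 1) - 1) + 1 by ring, zpow_add_one₀ h₁, zpow_add_one₀ h₂]
      ring
    · subst h; norm_num
    · rw [if_neg (by omega), if_neg (by omega), if_neg (by omega), if_neg (by omega)]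
      ring

/-- With these constants the rational function is `(u - A₁)/(r (u - A₂))`. -/
theorem isSeriesMul_fracW_lin (hN : IsBddBelow₂ N) {A₁ A₂ A₀ B₀ D r : K} (hA : A₀ = B₀ * A₁)
    (hD : D = B₀ * r) (hDA : D * A₂ = 1) :
    IsSeriesMul (fracW A₀ B₀ D) (act (fun k => r * lin A₂ k) N) (act (lin A₁) N) := by
  refine isSeriesMul_fracW_act hN (k₁ := 0) (fun k hk => ?_) (fun k hk => ?_) fun k => ?_
  · rw [lin, if_neg (by omega), if_neg (by omega), mul_zero]
  · rw [lin, if_neg (by omega), if_neg (by omega)]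
  · subst hA hD
    unfold lin
    split_ifs <;> first | omega | skip
    · linear_combination -hDA
    · linear_combination A₁ * hDA
    all_goals ring

theorem isSeriesMul_fracW_geoW (hN : IsBddBelow₂ N) {A₁ A₂ A₀ B₀ D r : K} (h₁ : A₁ ≠ 0)
    (h₂ : A₂ ≠ 0) (hA : A₀ = B₀ * A₂) (hD : D = B₀ * r) (hDA : D * A₁ = 1) :
    IsSeriesMul (fracW A₀ B₀ D) (act (fun k => r * geoW A₂ k) N) (act (geoW A₁) N) := by
  refine isSeriesMul_fracW_act hN (k₁ := 0) (fun k hk => ?_) (fun k hk => ?_) fun k => ?_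
  · rw [geoW, if_pos hk, mul_zero]
  · rw [geoW, if_pos hk]
  · subst hA
    unfold geoW
    have hD' : D = A₁⁻¹ := eq_inv_of_mul_eq_one_left hDA
    rcases lt_trichotomy k 0 with h | h | h
    · rw [if_pos (by omega), if_pos (by omega), if_pos (by omega), if_pos (by omega)]
      ring
    · subst h
      have e : A₂ * A₂⁻¹ = 1 := mul_inv_cancel₀ h₂
      norm_num
      rw [hD'] at hD
      linear_combination hD - B₀ * r * e
    · rw [if_neg (by omega), if_neg (by omega), if_neg (by omega), if_neg (by omega),
        show -(k - 1) - 1 = (-k - 1) + 1 by ring, zpow_add_one₀ h₁, zpow_add_one₀ h₂]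
      linear_combination A₁ ^ (-k - 1) * hDA

/-- The series of an operator product `E V` whose exponents satisfy `m ∈ {0, ±1}`. -/
def zser (m : ℤ) (A : K) (k : ℤ) : K :=
  if m = 1 then lin A k else if m = -1 then geoZ A k else if k = 0 then 1 else 0

/-- The series of an operator product `V E` whose exponents satisfy `m ∈ {0, ±1}`. -/
def wser (m : ℤ) (A : K) (k : ℤ) : K :=
  if m = 1 then lin A k else if m = -1 then geoW A k else if k = 0 then 1 else 0

variable [CharZero K]

/-- The exponential is `(1 - A/u)^m`; the shift by `m` multiplies it by `u^m` and gives `(u - A)^m`.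
-/
theorem serZ_expCoeff {f : ℕ → K} {m : ℤ} {A : K} (hm : m = 1 ∨ m = -1 ∨ m = 0)
    (hf : ∀ k, 0 < k → f k = -(m : K) * (A ^ k / k)) (k : ℤ) :
    serZ (expCoeff (K := K) f) (k - m) = zser m A k := by
  unfold serZ zser
  rcases hm with rfl | rfl | rfl
  · rw [if_pos rfl]
    have h : ∀ t, expCoeff (K := K) f t = if t = 0 then 1 else if t = 1 then -A else 0 := by
      intro t
      rw [← expCoeff_neg_geom]
      exact expCoeff_congr (fun k hk => by rw [hf k hk]; push_cast; ring) t
    rw [h, lin]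
    split_ifs <;> first | omega | rfl
  · rw [if_neg (show ¬(-1 : ℤ) = 1 by norm_num), if_pos (rfl : (-1 : ℤ) = -1), geoZ]
    have h : ∀ t, expCoeff (K := K) f t = A ^ t := by
      intro t
      rw [← expCoeff_geom]
      exact expCoeff_congr (fun k hk => by rw [hf k hk]; push_cast; ring) t
    rw [h]
    by_cases hk : k < 0
    · rw [if_pos (by omega), if_pos hk, ← zpow_natCast, Int.toNat_of_nonneg (by omega)]
      congr 1; ring
    · rw [if_neg (by omega), if_neg hk]
  · rw [if_neg (show ¬(0 : ℤ) = 1 by norm_num), if_neg (show ¬(0 : ℤ) = -1 by norm_num),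
      expCoeff_of_eq_zero
      (fun k hk => by rw [hf k hk]; simp)]
    split_ifs <;> first | omega | rfl

/-- The exponential is `(1 - u/A)^m = (-A)^{-m} (u - A)^m`; the scalar `r` from the zero modes has
to supply the missing `(-A)^m`. -/
theorem serW_expCoeff {f : ℕ → K} {m : ℤ} {A r r' : K} (hA : A ≠ 0)
    (hm : m = 1 ∨ m = -1 ∨ m = 0)
    (hf : ∀ k, 0 < k → f k = -(m : K) * (A⁻¹ ^ k / k)) (hr : r = (-A) ^ m * r') (k : ℤ) :
    r * serW (expCoeff (K := K) f) k = r' * wser m A k := by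
  subst hr
  unfold serW wser
  rcases hm with rfl | rfl | rfl
  · rw [if_pos rfl]
    have h : ∀ t, expCoeff (K := K) f t = if t = 0 then 1 else if t = 1 then -A⁻¹ else 0 := by
      intro t
      rw [← expCoeff_neg_geom]
      exact expCoeff_congr (fun k hk => by rw [hf k hk]; push_cast; ring) t
    rw [h, lin]
    split_ifs <;> first | omega | (rw [zpow_one]; field_simp; done) | simp
  · rw [if_neg (show ¬(-1 : ℤ) = 1 by norm_num), if_pos (rfl : (-1 : ℤ) = -1), geoW]
    have h : ∀ t, expCoeff (K := K) f t = A⁻¹ ^ t := by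
      intro t
      rw [← expCoeff_geom]
      exact expCoeff_congr (fun k hk => by rw [hf k hk]; push_cast; ring) t
    rw [h]
    by_cases hk : k < 0
    · rw [if_neg (by omega), if_pos hk, mul_zero, mul_zero]
    · rw [if_pos (by omega), if_neg hk, ← zpow_natCast, Int.toNat_of_nonneg (by omega),
        zpow_sub_one₀ hA, zpow_neg (-A), zpow_one, inv_zpow, zpow_neg A, inv_neg]
      ring
  · rw [if_neg (show ¬(0 : ℤ) = 1 by norm_num), if_neg (show ¬(0 : ℤ) = -1 by norm_num),
      expCoeff_of_eq_zero
      (fun k hk => by rw [hf k hk]; simp), zpow_zero]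
    split_ifs <;> first | omega | ring

/-- The recursion of `exp ∑ (Y^k - X^k) u^k / k = (1 - X u) / (1 - Y u)`. -/
theorem serW_expCoeff_recurrence {f : ℕ → K} {X Y : K}
    (hf : ∀ k, 0 < k → f k = Y ^ k / k - X ^ k / k) (k : ℤ) :
    serW (expCoeff (K := K) f) k - Y * serW (expCoeff (K := K) f) (k - 1)
      = (if k = 0 then 1 else 0) - X * if k - 1 = 0 then 1 else 0 := by
  have h : ∀ t, expCoeff (K := K) f (t + 1) = Y ^ (t + 1) - X * Y ^ t := by
    intro t
    rw [expCoeff_congr (g := fun k => -(X ^ k / k) + Y ^ k / k)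
      (fun k hk => by rw [hf k hk]; ring), expCoeff_add, Finset.Nat.antidiagonal_succ]
    rw [Finset.sum_cons, Finset.sum_map]
    rcases t with _ | t
    · simp [expCoeff_neg_geom, expCoeff_geom]; ring
    · rw [Finset.Nat.antidiagonal_succ, Finset.sum_cons, Finset.sum_map]
      simp [expCoeff_neg_geom, expCoeff_geom]; ring
  have h0 : expCoeff (K := K) f 0 = 1 := expCoeff_zero f
  unfold serW
  rcases lt_trichotomy k 0 with hk | rfl | hk
  · rw [if_neg (by omega), if_neg (by omega), if_neg (by omega), if_neg (by omega)]; ring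
  · norm_num [h0]
  · rw [if_pos (by omega), if_pos (by omega), if_neg (by omega)]
    obtain ⟨t, rfl⟩ : ∃ t : ℕ, k = t + 1 := ⟨(k - 1).toNat, by omega⟩
    rw [show ((t : ℤ) + 1).toNat = t + 1 by omega, add_sub_cancel_right, Int.toNat_natCast, h]
    rcases t with _ | t
    · simp [h0]
    · rw [h, if_neg (by omega)]; ring

theorem serZ_expCoeff_recurrence {f : ℕ → K} {X Y : K}
    (hf : ∀ k, 0 < k → f k = Y ^ k / k - X ^ k / k) (k : ℤ) :
    serZ (expCoeff (K := K) f) k - Y * serZ (expCoeff (K := K) f) (k + 1)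
      = (if k = 0 then 1 else 0) - X * if k + 1 = 0 then 1 else 0 := by
  have h := serW_expCoeff_recurrence hf (-k)
  have e : ∀ k, serZ (expCoeff (K := K) f) k = serW (expCoeff (K := K) f) (-k) := by
    intro k; simp only [serZ, serW, Left.nonneg_neg_iff]
  rw [e, e, neg_add, ← sub_eq_add_neg, h]
  simp only [neg_eq_zero, show -k - 1 = 0 ↔ k + 1 = 0 by omega]

end Series


/-! ### Operator products of the currents with the vertex operators -/

section OPE

variable {K : Type*} [Field K] {V : Type*} [AddCommGroup V] [Module K V]

/-- `P` and `R` are the expansions of `(u - A)^m N` and `r (u - A')^m N` in the two domains. -/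
structure IsOPE (P R N : ℤ → ℤ → V) (m : ℤ) (A A' r : K) : Prop where
  bdd : IsBddBelow₂ N
  left : P = act (zser m A) N
  right : R = act (fun k => r * wser m A' k) N

variable {P R N : ℤ → ℤ → V} {A A' r : K}

theorem IsOPE.comm (h : IsOPE P R N 1 A A' r) (hA : A' = A) (hr : r = 1) : P = R := by
  rw [h.left, h.right, hA, hr]
  simp only [one_mul]
  rfl

theorem IsOPE.comm_zero (h : IsOPE P R N 0 A A' r) (hr : r = 1) : P = R := by
  rw [h.left, h.right, hr]
  simp only [one_mul]
  rfl

theorem act_geoZ (hN : IsBddBelow₂ N) (hA : A ≠ 0) (a b : ℤ) :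
    act (geoZ A) N a b = act (geoW A) N a b + A⁻¹ • act (delta A) N a b := by
  rw [← act_smul hN, ← act_add hN]
  congr 1
  funext k
  rw [← geoZ_sub_geoW hA]; ring

/-- Both orders expand the same simple pole, so their difference is its delta function. -/
theorem IsOPE.delta (h : IsOPE P R N (-1) A A' r) (hA0 : A ≠ 0) (hA : A' = A) (hr : r = 1)
    (a b : ℤ) : P a b - R a b = A⁻¹ • act (delta A) N a b := by
  have e : (fun k => (1 : K) * wser (-1) A k) = geoW A := by
    funext k; rw [one_mul]; rfl
  rw [h.left, h.right, hA, hr, e]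
  change act (geoZ A) N a b - _ = _
  rw [act_geoZ h.bdd hA0]
  abel

/-- The commutator is a multiple of `δ(u/A)`, which `1 - u/A` annihilates. -/
theorem IsOPE.local (h : IsOPE P R N (-1) A A' r) (hA0 : A ≠ 0) (hA : A' = A) (hr : r = 1)
    (a b : ℤ) : P a b - R a b - A⁻¹ • (P (a - 1) (b + 1) - R (a - 1) (b + 1)) = 0 := by
  rw [h.delta hA0 hA hr, h.delta hA0 hA hr, act_shift, ← act_smul h.bdd, ← act_smul h.bdd,
    ← act_smul h.bdd, ← act_sub h.bdd]
  unfold act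
  rw [← finsum_zero (α := ℤ)]
  refine finsum_congr fun k => ?_
  change (A⁻¹ * A ^ (-k) - A⁻¹ * (A⁻¹ * A ^ (-(k - 1)))) • N _ _ = 0
  rw [neg_sub, show 1 - k = -k + 1 by ring, zpow_add_one₀ hA0]
  have : A⁻¹ * A ^ (-k) - A⁻¹ * (A⁻¹ * (A ^ (-k) * A)) = 0 := by field_simp; ring
  rw [this, zero_smul]

theorem IsOPE.fracZ (h : IsOPE P R N 1 A A' r) {A₀ B₀ D : K} (hD : D = A) (hA : A₀ = r)
    (hB : B₀ = r * A') : IsSeriesMul (fracZ A₀ B₀ D) P R := by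
  subst hD hA
  rw [h.left, h.right]
  exact isSeriesMul_fracZ_lin h.bdd hB

/-- Multiplying `1/(u - A)` by a function expanded in `u⁻¹` yields `1/(u - A')` expanded in `u⁻¹`,
whereas the product in the other order is its expansion in `u`. The discrepancy is a delta function
at `A'`. -/
theorem IsOPE.fracZ_delta (h : IsOPE P R N (-1) A A' r) {A₀ B₀ D : K} {Q : ℤ → ℤ → V}
    (hA0 : A ≠ 0) (hA0' : A' ≠ 0) (hD : D = A') (hA : A₀ = r) (hB : B₀ = r * A)
    (hQ : ∀ a b, (r * A'⁻¹) • act (QAffine.delta A') N a b = -Q a b) :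
    IsSeriesMul (QAffine.fracZ A₀ B₀ D) P (fun a b => R a b - Q a b) := by
  subst hD hA
  have e : (fun a b => R a b - Q a b) = act (fun k => A₀ * geoZ D k) N := by
    funext a b
    rw [act_smul h.bdd, act_geoZ h.bdd hA0', smul_add, smul_smul, hQ, h.right, act_smul h.bdd,
      sub_eq_add_neg]
    rfl
  rw [h.left, e]
  exact isSeriesMul_fracZ_geoZ h.bdd hA0 hA0' hB

theorem IsOPE.fracW (h : IsOPE P R N 1 A A' r) {A₀ B₀ D : K} (hD : D * A' = 1)
    (hB : D = B₀ * r) (hA : A₀ = B₀ * A) : IsSeriesMul (fracW A₀ B₀ D) R P := by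
  rw [h.left, h.right]
  exact isSeriesMul_fracW_lin h.bdd hA hB hD

theorem IsOPE.fracW_delta (h : IsOPE P R N (-1) A A' r) {A₀ B₀ D : K} {Q : ℤ → ℤ → V}
    (hA0 : A ≠ 0) (hA0' : A' ≠ 0) (hD : D * A = 1) (hB : D = B₀ * r) (hA : A₀ = B₀ * A')
    (hQ : ∀ a b, A⁻¹ • act (QAffine.delta A) N a b = Q a b) :
    IsSeriesMul (QAffine.fracW A₀ B₀ D) R (fun a b => P a b - Q a b) := by
  have e : (fun a b => P a b - Q a b) = act (geoW A) N := by
    funext a b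
    rw [h.left]
    change act (geoZ A) N a b - _ = _
    rw [act_geoZ h.bdd hA0, hQ]
    abel
  rw [h.right, e]
  exact isSeriesMul_fracW_geoW h.bdd hA0 hA0' hA hB hD

end OPE

/-! ### Zero modes and the operator products of the four families. -/

section Family

variable {n : ℕ} {K : Type*} [Field K]

theorem sgn_zsmul {ε σ : ℤ} (hε : ε = 1 ∨ ε = -1) (hσ : σ = 1 ∨ σ = -1) (x y : Weight n) :
    sgn K (ε • x) (σ • y) = sgn K x y := by
  rcases hε with rfl | rfl <;> rcases hσ with rfl | rfl <;>
    simp [sgn, latticeSign_neg_left, latticeSign_neg_right]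

theorem cast_neg_one_zpow (z : ℤ) : ((((-1 : ℤˣ) ^ z : ℤˣ) : ℤ) : K) = (-1) ^ z := by
  rcases Int.even_or_odd z with h | h
  · rw [h.neg_one_zpow, h.neg_one_zpow]; simp
  · rw [h.neg_one_zpow, h.neg_one_zpow]; simp

theorem neg_one_zpow_neg (z : ℤ) : (-1 : K) ^ (-z) = (-1) ^ z := by
  rw [zpow_neg, ← inv_zpow, inv_neg, inv_one]

theorem compWt_apply (l : Fin (n - 1)) (j : ℕ) :
    (compWt j : Weight n) l = (if (l : ℕ) + 1 = j then 1 else 0) - if (l : ℕ) = j then 1 else 0 := by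
  simp [compWt, fundWt]

theorem sgn_commutator (l : Fin (n - 1)) {j : ℕ} (hj : j < n) :
    sgn K (simpleRoot l) (compWt j) * sgn K (compWt j) (simpleRoot l)
      * (-1) ^ (((n : ℤ) - 1) * if (l : ℕ) = 0 then 1 else 0)
      = (-1 : K) ^ (compWt j : Weight n) l := by
  have h := congrArg (fun u : ℤˣ => ((u : ℤ) : K)) (latticeSign_commutator l hj)
  simp only [Units.val_mul, Int.cast_mul, cast_neg_one_zpow] at h
  exact h

/-- The zero mode parts of the components of a vertex operator (`σ = 1`) or of a dual vertex
operator (`σ = -1`), up to the properties that the intertwining relations need. -/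
structure VertexFamily (n : ℕ) {K : Type*} [Field K] (s : K) (σ : ℤ) where
  κ : ℕ → Weight n → K
  e : ℕ → Weight n → ℤ
  τ : K
  e_current : ∀ (l : Fin (n - 1)) {j : ℕ}, j < n → ∀ (ε : ℤ) (x : Weight n),
    e j (ε • simpleRoot l + x) = e j x + ε * σ * (compWt j : Weight n) l
  κ_current : ∀ (l : Fin (n - 1)) {j : ℕ}, j < n → ∀ (ε : ℤ) (x : Weight n),
    κ j (ε • simpleRoot l + x) = κ j x *
      (s ^ 2) ^ (ε * σ * (((j : ℤ) + 1) * (if (l : ℕ) + 1 = j then 1 else 0)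
        - (j : ℤ) * if (l : ℕ) = j then 1 else 0)) *
      (-1) ^ (ε * (((n : ℤ) - 1) * if (l : ℕ) = 0 then 1 else 0))
  e_succ : ∀ (l : Fin (n - 1)) (x : Weight n), e ((l : ℕ) + 1) x = e l x + σ * x l
  κ_succ : ∀ (l : Fin (n - 1)) (x : Weight n), κ ((l : ℕ) + 1) x
    = κ l x * (s ^ 2) ^ (σ * ((l : ℤ) + 1) * x l) * τ * (((compSign n l : ℤˣ) : ℤ) : K)

/-- The data of the current `x^ε_{l+1}`. -/
def currentD (s : K) (ε : ℤ) (l : Fin (n - 1)) : VOData n K where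
  F := currentF s ε l
  H := currentH s ε l
  γ := ε • simpleRoot l
  κ _ := 1
  e x := ε * x l + 1

/-- The data of the current `φ_{l+1}`. -/
def phiD (s : K) (l : Fin (n - 1)) : VOData n K where
  F := phiF s l
  H _ _ := 0
  γ := 0
  κ x := (s ^ 2) ^ (-x l)
  e _ := 0

/-- The data of the current `ψ_{l+1}`. -/
def psiD (s : K) (l : Fin (n - 1)) : VOData n K where
  F _ _ := 0
  H := psiH s l
  γ := 0
  κ x := (s ^ 2) ^ (x l)
  e _ := 0

/-- The data of the component number `j`. -/
def VertexFamily.data {s : K} {σ : ℤ} (W : VertexFamily n s σ) (c : ℤ) (j : ℕ) : VOData n K where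
  F := bosonF s σ j c
  H := bosonH s σ j c
  γ := σ • compWt j
  κ := W.κ j
  e := W.e j

variable [CharZero K]

section Currents

variable {s : K} {σ : ℤ} (W : VertexFamily n s σ)

/-- Combines contraction, powers of the variables and lattice sign. The exponent `m` is the pairing
of the two lattice elements; the contractions in the two orders give `A` and `A'`, and the power of
`q` from the zero modes is `A'^m r`. -/
theorem isOPE_current {ε : ℤ} (hε : ε = 1 ∨ ε = -1)
    (hσ : σ = 1 ∨ σ = -1) (c : ℤ) (l : Fin (n - 1)) {j : ℕ} (hj : j < n) {A A' r : K} {m : ℤ}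
    (hm : m = ε * σ * (compWt j : Weight n) l) (hA' : A' ≠ 0)
    (h₁ : ∀ k, 0 < k → contr (currentH s ε l) (bosonF s σ j c) k = -(m : K) * (A ^ k / k))
    (h₂ : ∀ k, 0 < k → contr (bosonH s σ j c) (currentF s ε l) k = -(m : K) * (A'⁻¹ ^ k / k))
    (h₃ : (s ^ 2) ^ (ε * σ * (((j : ℤ) + 1) * (if (l : ℕ) + 1 = j then 1 else 0)
        - (j : ℤ) * if (l : ℕ) = j then 1 else 0)) = A' ^ m * r) (x : Weight n) (p : Osc n K) :
    IsOPE (fun a b => (currentD s ε l).op a ((W.data c j).op b (Finsupp.single x p)))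
      (fun a b => (W.data c j).op b ((currentD s ε l).op a (Finsupp.single x p)))
      (nordOp (currentD s ε l) (W.data c j) m x p) m A A' r := by
  have hm' : m = 1 ∨ m = -1 ∨ m = 0 := by
    rw [hm, compWt_apply]
    rcases hε with rfl | rfl <;> rcases hσ with rfl | rfl <;> split_ifs <;> simp
  refine ⟨isBddBelow₂_nordOp _ _ _ _ _, ?_, ?_⟩
  · funext a b
    rw [op_op (m := m) (r := 1) (currentD s ε l) (W.data c j)]
    · congr 1
      funext k
      rw [one_mul]
      exact serZ_expCoeff hm' h₁ k
    · show ε * (σ • compWt j + x : Weight n) l + 1 = ε * x l + 1 + m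
      rw [hm, Pi.add_apply, Pi.smul_apply, smul_eq_mul]; ring
    · exact (one_mul _).symm
  · funext a b
    rw [op_op' (m := m) (r := (-1) ^ (compWt j : Weight n) l * (A' ^ m * r))
      (currentD s ε l) (W.data c j)]
    · congr 1
      funext k
      refine serW_expCoeff hA' hm' h₂ ?_ k
      -- The lattice commutator supplies `(-1)^m`, turning `A'^m` into the factor `(-A')^m` required
      -- by `serW_expCoeff`.
      have e : (-1 : K) ^ (compWt j : Weight n) l = (-1) ^ m := by
        rw [hm]
        rcases hε with rfl | rfl <;> rcases hσ with rfl | rfl <;>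
          simp only [one_mul, mul_one, neg_mul, neg_neg, neg_one_zpow_neg]
      rw [e, ← mul_assoc, ← mul_zpow, neg_one_mul]
    · show W.e j (ε • simpleRoot l + x) = W.e j x + m
      rw [W.e_current l hj, hm]
    · show W.κ j (ε • simpleRoot l + x) * (sgn K (σ • compWt j) (ε • simpleRoot l) *
        sgn K (ε • simpleRoot l) (σ • compWt j)) = _ * W.κ j x
      have e : (-1 : K) ^ (ε * (((n : ℤ) - 1) * if (l : ℕ) = 0 then 1 else 0))
          = (-1) ^ (((n : ℤ) - 1) * if (l : ℕ) = 0 then 1 else 0) := by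
        rcases hε with rfl | rfl <;> simp only [one_mul, neg_mul, neg_one_zpow_neg]
      rw [W.κ_current l hj, sgn_zsmul hσ hε, sgn_zsmul hε hσ, ← sgn_commutator l hj, h₃, e]
      ring

/-- The two points coincide, and `r = 1`, when `c = 1 + ε`: for `x^+` in type I and `x^-` in type
II, and likewise for the duals. The same holds for the lower component. -/
theorem isOPE_current_hi (hs0 : s ≠ 0) (hs : ∀ m : ℕ, 0 < m → s ^ m ≠ 1) {ε : ℤ}
    (hε : ε = 1 ∨ ε = -1) (hσ : σ = 1 ∨ σ = -1) (c : ℤ) (l : Fin (n - 1)) (x : Weight n)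
    (p : Osc n K) :
    IsOPE (fun a b => (currentD s ε l).op a ((W.data c ((l : ℕ) + 1)).op b (Finsupp.single x p)))
      (fun a b => (W.data c ((l : ℕ) + 1)).op b ((currentD s ε l).op a (Finsupp.single x p)))
      (nordOp (currentD s ε l) (W.data c ((l : ℕ) + 1)) (ε * σ) x p) (ε * σ)
      (s ^ (2 * (l : ℤ) + 3 + c - ε)) (s ^ (2 * (l : ℤ) + 5 - c + ε))
      (s ^ (ε * σ * (c - 1 - ε))) := by
  have hl := l.2
  have hj : (l : ℕ) + 1 < n := by omega
  refine isOPE_current W hε hσ c l hj (by rw [compWt_apply]; simp) (zpow_ne_zero _ hs0)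
    (fun k hk => ?_) (fun k hk => ?_) ?_ x p
  · rw [contr_currentH_bosonF hs0 hs ε σ c l hj hk, if_pos rfl, if_neg (by omega),
      show 2 * (((l : ℕ) + 1 : ℕ) : ℤ) + c + 1 - ε = 2 * (l : ℤ) + 3 + c - ε by push_cast; ring]
    ring
  · rw [contr_bosonH_currentF hs0 hs ε σ c l _ hk, if_pos rfl, if_neg (by omega), ← zpow_neg,
      show -2 * (((l : ℕ) + 1 : ℕ) : ℤ) + c - 3 - ε = -(2 * (l : ℤ) + 5 - c + ε) by
        push_cast; ring]
    ring
  · rw [if_pos rfl, if_neg (by omega), ← zpow_natCast s 2, ← zpow_mul, ← zpow_mul,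
      ← zpow_add₀ hs0]
    congr 1; push_cast; ring

theorem isOPE_current_lo (hs0 : s ≠ 0) (hs : ∀ m : ℕ, 0 < m → s ^ m ≠ 1) {ε : ℤ}
    (hε : ε = 1 ∨ ε = -1) (hσ : σ = 1 ∨ σ = -1) (c : ℤ) (l : Fin (n - 1)) (x : Weight n)
    (p : Osc n K) :
    IsOPE (fun a b => (currentD s ε l).op a ((W.data c l).op b (Finsupp.single x p)))
      (fun a b => (W.data c l).op b ((currentD s ε l).op a (Finsupp.single x p)))
      (nordOp (currentD s ε l) (W.data c l) (-(ε * σ)) x p) (-(ε * σ))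
      (s ^ (2 * (l : ℤ) - 1 + c - ε)) (s ^ (2 * (l : ℤ) + 1 - c + ε))
      (s ^ (-(ε * σ) * (c - 1 - ε))) := by
  have hl := l.2
  have hj : (l : ℕ) < n := by omega
  refine isOPE_current W hε hσ c l hj (by rw [compWt_apply]; simp) (zpow_ne_zero _ hs0)
    (fun k hk => ?_) (fun k hk => ?_) ?_ x p
  · rw [contr_currentH_bosonF hs0 hs ε σ c l hj hk, if_neg (by omega), if_pos rfl,
      show 2 * (l : ℤ) + c - 1 - ε = 2 * (l : ℤ) - 1 + c - ε by ring]
    push_cast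
    ring
  · rw [contr_bosonH_currentF hs0 hs ε σ c l _ hk, if_neg (by omega), if_pos rfl, ← zpow_neg,
      show -2 * (l : ℤ) + c - 1 - ε = -(2 * (l : ℤ) + 1 - c + ε) by ring]
    push_cast
    ring
  · rw [if_neg (by omega), if_pos rfl, ← zpow_natCast s 2, ← zpow_mul, ← zpow_mul,
      ← zpow_add₀ hs0]
    congr 1; push_cast; ring

theorem current_comm (hs0 : s ≠ 0) (hs : ∀ m : ℕ, 0 < m → s ^ m ≠ 1) {ε : ℤ}
    (hε : ε = 1 ∨ ε = -1) (hσ : σ = 1 ∨ σ = -1) (c : ℤ) (l : Fin (n - 1)) {j : ℕ} (hj : j < n)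
    (h₁ : (l : ℕ) + 1 ≠ j) (h₂ : (l : ℕ) ≠ j) (a b : ℤ) :
    (currentD s ε l).op a * (W.data c j).op b = (W.data c j).op b * (currentD s ε l).op a := by
  refine Finsupp.lhom_ext fun x p => ?_
  have h := isOPE_current W hε hσ c l hj (A := 0) (A' := 1) (r := 1) (m := 0)
    (by rw [compWt_apply]; simp [h₁, h₂]) one_ne_zero
    (fun k hk => by rw [contr_currentH_bosonF hs0 hs ε σ c l hj hk, if_neg h₁, if_neg h₂]; simp)
    (fun k hk => by rw [contr_bosonH_currentF hs0 hs ε σ c l _ hk, if_neg h₁, if_neg h₂]; simp)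
    (by simp [h₁, h₂]) x p
  exact congrFun (congrFun (h.comm_zero rfl) a) b

end Currents

/-! ### Operator products with the currents `φ` and `ψ`. -/

section Cartan

variable {s : K}

/-- `φ` has no annihilation part, so in this order nothing is contracted and only the zero mode
`q^{-∂}` contributes. -/
theorem phi_op_op (l : Fin (n - 1)) (D : VOData n K) (x : Weight n) (p : Osc n K) (hs0 : s ≠ 0)
    (a b : ℤ) : (phiD s l).op a (D.op b (Finsupp.single x p))
      = act (fun k => (s ^ 2) ^ (-D.γ l) * if k = 0 then 1 else 0)
        (nordOp (phiD s l) D 0 x p) a b := by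
  rw [op_op (m := 0) (r := (s ^ 2) ^ (-D.γ l)) (phiD s l) D (add_zero _).symm]
  · congr 1
    funext k
    rw [serZ, expCoeff_of_eq_zero (f := contr (phiD s l).H D.F) (fun k _ => by simp [contr, phiD])]
    congr 1
    split_ifs <;> first | omega | rfl
  · show (s ^ 2) ^ (-(D.γ + x) l) = _
    rw [Pi.add_apply, neg_add, zpow_add₀ (pow_ne_zero 2 hs0)]
    rfl

theorem op_phi_op (l : Fin (n - 1)) (D : VOData n K) (x : Weight n) (p : Osc n K)
    (a b : ℤ) : D.op b ((phiD s l).op a (Finsupp.single x p))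
      = act (serW (expCoeff (K := K) (contr D.H (phiF s l))))
        (nordOp (phiD s l) D 0 x p) a b := by
  rw [op_op' (m := 0) (r := 1) (phiD s l) D]
  · congr 1
    funext k
    rw [one_mul]
    rfl
  · show D.e (0 + x) = _
    rw [zero_add, add_zero]
  · show D.κ (0 + x) * (sgn K D.γ 0 * sgn K 0 D.γ) = _
    rw [zero_add, sgn_zero_left, sgn_zero_right]; ring

theorem psi_op_op (l : Fin (n - 1)) (D : VOData n K) (x : Weight n) (p : Osc n K) (hs0 : s ≠ 0)
    (a b : ℤ) : (psiD s l).op a (D.op b (Finsupp.single x p))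
      = act (fun k => (s ^ 2) ^ (D.γ l) * serZ (expCoeff (K := K) (contr (psiH s l) D.F)) k)
        (nordOp (psiD s l) D 0 x p) a b := by
  rw [op_op (m := 0) (r := (s ^ 2) ^ (D.γ l)) (psiD s l) D (add_zero _).symm]
  · congr 1
    funext k
    rw [sub_zero]
    rfl
  · show (s ^ 2) ^ ((D.γ + x) l) = _
    rw [Pi.add_apply, zpow_add₀ (pow_ne_zero 2 hs0)]
    rfl

theorem op_psi_op (l : Fin (n - 1)) (D : VOData n K) (x : Weight n) (p : Osc n K)
    (a b : ℤ) : D.op b ((psiD s l).op a (Finsupp.single x p))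
      = act (fun k : ℤ => if k = 0 then (1 : K) else 0) (nordOp (psiD s l) D 0 x p) a b := by
  rw [op_op' (m := 0) (r := 1) (psiD s l) D]
  · congr 1
    funext k
    rw [serW, expCoeff_of_eq_zero (f := contr D.H (psiD s l).F) (fun k _ => by simp [contr, psiD]),
      one_mul]
    split_ifs <;> first | omega | rfl
  · show D.e (0 + x) = _
    rw [zero_add, add_zero]
  · show D.κ (0 + x) * (sgn K D.γ 0 * sgn K 0 D.γ) = _
    rw [zero_add, sgn_zero_left, sgn_zero_right]; ring

theorem isSeriesMul_phi (hs0 : s ≠ 0) (l : Fin (n - 1)) (D : VOData n K) {A₀ B₀ D₀ X : K}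
    (hf : ∀ k, 0 < k → contr D.H (phiF s l) k = D₀ ^ k / k - X ^ k / k)
    (hA : A₀ = (s ^ 2) ^ (D.γ l)) (hB : B₀ = A₀ * X) (v : TotalFock n K) :
    IsSeriesMul (fracW A₀ B₀ D₀) (fun a b => (phiD s l).op a (D.op b v))
      (fun a b => D.op b ((phiD s l).op a v)) := by
  refine isSeriesMul_of_single (P := fun a b => (phiD s l).op a * D.op b)
    (R := fun a b => D.op b * (phiD s l).op a) (fun x p => ?_) v
  simp only [Module.End.mul_apply, phi_op_op l D x p hs0, op_phi_op l D x p]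
  refine isSeriesMul_fracW_act (k₁ := 0) (isBddBelow₂_nordOp _ _ _ _ _) (fun k hk => ?_)
    (fun k hk => ?_) fun k => ?_
  · rw [if_neg hk.ne, mul_zero]
  · rw [serW, if_neg (by omega)]
  · have e : A₀ * (s ^ 2) ^ (-D.γ l) = 1 := by
      rw [hA, ← zpow_add₀ (pow_ne_zero 2 hs0), add_neg_cancel, zpow_zero]
    rw [serW_expCoeff_recurrence hf, hB]
    linear_combination (-(if k = 0 then 1 else 0) + X * if k - 1 = 0 then 1 else 0) * e

theorem isSeriesMul_phi_dual (hs0 : s ≠ 0) (l : Fin (n - 1)) (D : VOData n K) {A₀ B₀ D₀ Y : K}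
    (hf : ∀ k, 0 < k → contr D.H (phiF s l) k = Y ^ k / k - D₀ ^ k / k)
    (hA : A₀ = (s ^ 2) ^ (-D.γ l)) (hB : B₀ = A₀ * Y) (v : TotalFock n K) :
    IsSeriesMul (fracW A₀ B₀ D₀) (fun a b => D.op b ((phiD s l).op a v))
      (fun a b => (phiD s l).op a (D.op b v)) := by
  refine isSeriesMul_of_single (P := fun a b => D.op b * (phiD s l).op a)
    (R := fun a b => (phiD s l).op a * D.op b) (fun x p => ?_) v
  simp only [Module.End.mul_apply, phi_op_op l D x p hs0, op_phi_op l D x p]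
  refine isSeriesMul_fracW_act (k₁ := 0) (isBddBelow₂_nordOp _ _ _ _ _) (fun k hk => ?_)
    (fun k hk => ?_) fun k => ?_
  · rw [serW, if_neg (by omega)]
  · rw [if_neg hk.ne, mul_zero]
  · rw [hB, hA]
    linear_combination (-(s ^ 2) ^ (-D.γ l)) * serW_expCoeff_recurrence hf k

theorem isSeriesMul_psi (hs0 : s ≠ 0) (l : Fin (n - 1)) (D : VOData n K) {A₀ B₀ D₀ Y : K}
    (hf : ∀ k, 0 < k → contr (psiH s l) D.F k = Y ^ k / k - D₀ ^ k / k)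
    (hA : A₀ = (s ^ 2) ^ (-D.γ l)) (hB : B₀ = A₀ * Y) (v : TotalFock n K) :
    IsSeriesMul (fracZ A₀ B₀ D₀) (fun a b => (psiD s l).op a (D.op b v))
      (fun a b => D.op b ((psiD s l).op a v)) := by
  refine isSeriesMul_of_single (P := fun a b => (psiD s l).op a * D.op b)
    (R := fun a b => D.op b * (psiD s l).op a) (fun x p => ?_) v
  simp only [Module.End.mul_apply, psi_op_op l D x p hs0, op_psi_op l D x p]
  refine isSeriesMul_fracZ_act (k₁ := 0) (isBddBelow₂_nordOp _ _ _ _ _) (fun k hk => ?_)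
    (fun k hk => ?_) fun k => ?_
  · rw [serZ, if_neg (by omega), mul_zero]
  · rw [if_neg hk.ne']
  · have e : A₀ * (s ^ 2) ^ (D.γ l) = 1 := by
      rw [hA, ← zpow_add₀ (pow_ne_zero 2 hs0), neg_add_cancel, zpow_zero]
    rw [hB]
    linear_combination (-A₀ * (s ^ 2) ^ (D.γ l)) * serZ_expCoeff_recurrence hf k
      + (-(if k = 0 then 1 else 0) + D₀ * if k + 1 = 0 then 1 else 0) * e

theorem isSeriesMul_psi_dual (hs0 : s ≠ 0) (l : Fin (n - 1)) (D : VOData n K) {A₀ B₀ D₀ X : K}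
    (hf : ∀ k, 0 < k → contr (psiH s l) D.F k = D₀ ^ k / k - X ^ k / k)
    (hA : A₀ = (s ^ 2) ^ (D.γ l)) (hB : B₀ = A₀ * X) (v : TotalFock n K) :
    IsSeriesMul (fracZ A₀ B₀ D₀) (fun a b => D.op b ((psiD s l).op a v))
      (fun a b => (psiD s l).op a (D.op b v)) := by
  refine isSeriesMul_of_single (P := fun a b => D.op b * (psiD s l).op a)
    (R := fun a b => (psiD s l).op a * D.op b) (fun x p => ?_) v
  simp only [Module.End.mul_apply, psi_op_op l D x p hs0, op_psi_op l D x p]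
  refine isSeriesMul_fracZ_act (k₁ := 0) (isBddBelow₂_nordOp _ _ _ _ _) (fun k hk => ?_)
    (fun k hk => ?_) fun k => ?_
  · rw [if_neg hk.ne']
  · rw [serZ, if_neg (by omega), mul_zero]
  · rw [hB, hA]
    linear_combination ((s ^ 2) ^ (D.γ l)) * serZ_expCoeff_recurrence hf k

end Cartan

end Family


/-! ### Fusion of the currents with the components of the vertex operators -/

section Fusion

variable {n : ℕ} {K : Type*} [Field K]

theorem sq_zpow (s : K) (z : ℤ) : (s ^ 2) ^ z = s ^ (2 * z) := by
  rw [zpow_mul]; norm_cast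

theorem sq_pow (s : K) (k : ℕ) : (s ^ 2) ^ k = s ^ (2 * (k : ℤ)) := by
  rw [← sq_zpow, zpow_natCast]

theorem sq_inv (s : K) : (s ^ 2)⁻¹ = s ^ (-2 : ℤ) := by
  rw [zpow_neg]; norm_cast

theorem zpow_pow' (s : K) (z : ℤ) (k : ℕ) : (s ^ z) ^ k = s ^ (z * k) := by
  rw [zpow_mul, zpow_natCast]

/-- The three-term relation of the dual coefficients: passing to the next component adds only
oscillators of the node `l + 1`, with the coefficients of a current at a shifted argument. -/
theorem bosonF_succ {s : K} (hs0 : s ≠ 0) (hs : ∀ m : ℕ, 0 < m → s ^ m ≠ 1) (σ c : ℤ)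
    (l b : Fin (n - 1)) {k : ℕ} (hk : 0 < k) :
    bosonF s σ ((l : ℕ) + 1) c k b = bosonF s σ l c k b
      + if b = l then (σ : K) * s ^ ((2 * (l : ℤ) + 1 + c) * k) / qInt s k else 0 := by
  have hk' : -(k : ℤ) ≠ 0 := by omega
  have hqk := qInt_ne_zero hs0 hs (show (k : ℤ) ≠ 0 by omega)
  have h := dualCoeff_three_term hs0 hs l b hk'
  rw [qInt_neg, sq_zpow, ← zpow_neg] at h
  have e1 : (s ^ 2) ^ ((((l : ℕ) + 1 : ℕ) : ℤ) * k) * s ^ ((c + 1) * (k : ℤ))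
      = s ^ ((2 * (l : ℤ) + 1 + c) * k) * s ^ (-(2 * -(k : ℤ))) := by
    rw [sq_zpow, ← zpow_add₀ hs0, ← zpow_add₀ hs0]; congr 1; push_cast; ring
  have e2 : (s ^ 2) ^ ((((l : ℕ) + 1 : ℕ) : ℤ) * k) * s ^ ((c - 1) * (k : ℤ))
      = s ^ ((2 * (l : ℤ) + 1 + c) * k) := by
    rw [sq_zpow, ← zpow_add₀ hs0]; congr 1; push_cast; ring
  have e3 : (s ^ 2) ^ ((l : ℤ) * k) * s ^ ((c + 1) * (k : ℤ))
      = s ^ ((2 * (l : ℤ) + 1 + c) * k) := by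
    rw [sq_zpow, ← zpow_add₀ hs0]; congr 1; ring
  have e4 : (s ^ 2) ^ ((l : ℤ) * k) * s ^ ((c - 1) * (k : ℤ))
      = s ^ ((2 * (l : ℤ) + 1 + c) * k) * s ^ (2 * -(k : ℤ)) := by
    rw [sq_zpow, ← zpow_add₀ hs0, ← zpow_add₀ hs0]; congr 1; ring
  have h' : (if b = l then (σ : K) * s ^ ((2 * (l : ℤ) + 1 + c) * k) / qInt s k else 0)
      = (σ : K) * s ^ ((2 * (l : ℤ) + 1 + c) * k) / qInt s k * if b = l then 1 else 0 := by
    split_ifs <;> simp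
  rw [h', ← h, bosonF, bosonF]
  field_simp
  linear_combination (σ : K) * ((-dualCoeff s ((l : ℕ) + 1) (-(k : ℤ)) b) * e1
    + dualCoeff s ((l : ℕ) + 2) (-(k : ℤ)) b * e2 + dualCoeff s l (-(k : ℤ)) b * e3
    - dualCoeff s ((l : ℕ) + 1) (-(k : ℤ)) b * e4)

/-- Annihilation counterpart of `bosonF_succ`; here the row of the `q`-Cartan matrix is visible in
the values of `a_{l+1,k}` on the variables. -/
theorem bosonH_succ {s : K} (hs0 : s ≠ 0) (hs : ∀ m : ℕ, 0 < m → s ^ m ≠ 1) (σ c : ℤ)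
    (l b : Fin (n - 1)) {k : ℕ} (hk : 0 < k) :
    bosonH s σ ((l : ℕ) + 1) c k b = bosonH s σ l c k b
      - (σ : K) * s ^ ((c - 3 - 2 * (l : ℤ)) * k) / qInt s k * heisH s l k b := by
  have hqk := qInt_ne_zero hs0 hs (show (k : ℤ) ≠ 0 by omega)
  have e1 : (s ^ 2) ^ (-((((l : ℕ) + 1 : ℕ) : ℤ) * k)) * s ^ ((c - 3) * (k : ℤ))
      = s ^ ((c - 3 - 2 * (l : ℤ)) * k) * s ^ (-(2 * (k : ℤ))) := by
    rw [sq_zpow, ← zpow_add₀ hs0, ← zpow_add₀ hs0]; congr 1; push_cast; ring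
  have e2 : (s ^ 2) ^ (-((((l : ℕ) + 1 : ℕ) : ℤ) * k)) * s ^ ((c - 1) * (k : ℤ))
      = s ^ ((c - 3 - 2 * (l : ℤ)) * k) := by
    rw [sq_zpow, ← zpow_add₀ hs0]; congr 1; push_cast; ring
  have e3 : (s ^ 2) ^ (-((l : ℤ) * k)) * s ^ ((c - 3) * (k : ℤ))
      = s ^ ((c - 3 - 2 * (l : ℤ)) * k) := by
    rw [sq_zpow, ← zpow_add₀ hs0]; congr 1; ring
  have e4 : (s ^ 2) ^ (-((l : ℤ) * k)) * s ^ ((c - 1) * (k : ℤ))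
      = s ^ ((c - 3 - 2 * (l : ℤ)) * k) * s ^ (2 * (k : ℤ)) := by
    rw [sq_zpow, ← zpow_add₀ hs0, ← zpow_add₀ hs0]; congr 1; ring
  have hd : (σ : K) * s ^ ((c - 3 - 2 * (l : ℤ)) * k) / qInt s k * heisH s l k b
      = (σ : K) * s ^ ((c - 3 - 2 * (l : ℤ)) * k) * (qInt s k / k) *
        ((s ^ (2 * (k : ℤ)) + s ^ (-(2 * (k : ℤ)))) * (if (b : ℕ) = l then 1 else 0)
          - (if (b : ℕ) + 1 = l then 1 else 0) - (if (b : ℕ) = l + 1 then 1 else 0)) := by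
    rw [heisH, qInt_cartan s hs0, sq_zpow, ← zpow_neg]
    field_simp
  rw [hd, bosonH, bosonH]
  simp only [Nat.add_right_cancel_iff]
  linear_combination (σ : K) * (qInt s k / k) * ((-(if (b : ℕ) = l then 1 else 0)) * e1
    + (if (b : ℕ) = l + 1 then 1 else 0) * e2 + (if (b : ℕ) + 1 = l then 1 else 0) * e3
    - (if (b : ℕ) = l then 1 else 0) * e4)

variable {s : K} {σ : ℤ} (W : VertexFamily n s σ)

theorem compSign_sq (n l : ℕ) : (((compSign n l : ℤˣ) : ℤ) : K) * (((compSign n l : ℤˣ) : ℤ) : K)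
    = 1 := by
  rw [← Int.cast_mul, ← Units.val_mul, Int.units_mul_self]
  simp

theorem sgn_simpleRoot_compWt (l : Fin (n - 1)) :
    sgn K (simpleRoot l) (compWt (l : ℕ)) = (((compSign n l : ℤˣ) : ℤ) : K) := by
  rw [sgn, latticeSign_simpleRoot_compWt]

theorem sgn_simpleRoot_compWt_succ (l : Fin (n - 1)) :
    sgn K (simpleRoot l) (compWt ((l : ℕ) + 1)) = (((compSign n l : ℤˣ) : ℤ) : K) := by
  rw [sgn, latticeSign_simpleRoot_compWt_succ]

variable [CharZero K]

/-- At `w = q^{l+1} z` the current and the component number `l` fuse to the component number `l +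
1`. Creation and annihilation parts require the same fusion point exactly when `c = 1 - σ`: type II
with `x^+`, dual type I with `x^-`. -/
theorem fuse_up (hs0 : s ≠ 0) (hs : ∀ m : ℕ, 0 < m → s ^ m ≠ 1) (hσ : σ = 1 ∨ σ = -1)
    (hτ : W.τ ≠ 0) {c : ℤ} (hc : c = 1 - σ) (l : Fin (n - 1)) (x : Weight n) (p : Osc n K)
    (a b : ℤ) :
    act (delta ((s ^ 2) ^ ((l : ℕ) + 1))) (nordOp (currentD s σ l) (W.data c l) (-1) x p) a b
      = ((s ^ 2) ^ ((l : ℕ) + 1) * W.τ⁻¹ * ((s ^ 2) ^ ((l : ℕ) + 1)) ^ (-a)) •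
        (W.data c ((l : ℕ) + 1)).op (a + b) (Finsupp.single x p) := by
  have hρ : (s ^ 2) ^ ((l : ℕ) + 1) ≠ 0 := pow_ne_zero _ (pow_ne_zero _ hs0)
  refine act_delta_nordOp _ _ _ hρ (fun k hk b => ?_) (fun k hk b => ?_) ?_ ?_ ?_ p a b
  · show bosonF s σ ((l : ℕ) + 1) c k b = _ * currentF s σ l k b + bosonF s σ l c k b
    rw [bosonF_succ hs0 hs σ c l b hk, currentF, add_comm]
    congr 1
    split_ifs
    · rw [sq_pow, zpow_pow', mul_comm (s ^ _), div_mul_eq_mul_div, mul_assoc, ← zpow_add₀ hs0]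
      congr 3
      rw [hc]; push_cast; ring
    · rw [mul_zero]
  · show bosonH s σ ((l : ℕ) + 1) c k b = _ * currentH s σ l k b + bosonH s σ l c k b
    rw [bosonH_succ hs0 hs σ c l b hk, currentH, sub_eq_neg_add]
    congr 1
    rw [sq_pow, ← zpow_neg, zpow_pow',
      show (c - 3 - 2 * (l : ℤ)) * k = -(2 * (((l : ℕ) + 1 : ℕ) : ℤ)) * k + -σ * k by
        rw [hc]; push_cast; ring, zpow_add₀ hs0]
    ring
  · show σ • simpleRoot l + σ • compWt l = σ • compWt ((l : ℕ) + 1)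
    rw [← smul_add, simpleRoot_eq_compWt, sub_add_cancel]
  · show σ * x l + 1 + W.e l x + -1 = W.e ((l : ℕ) + 1) x
    rw [W.e_succ]; ring
  · show 1 * W.κ l x * sgn K (σ • simpleRoot l) (σ • compWt l) * _ ^ (σ * x l + 1)
      = _ * W.κ ((l : ℕ) + 1) x
    rw [sgn_zsmul hσ hσ, sgn_simpleRoot_compWt, W.κ_succ, zpow_add_one₀ hρ, ← zpow_natCast (s ^ 2),
      ← zpow_mul, show (((l : ℕ) + 1 : ℕ) : ℤ) * (σ * x l) = σ * ((l : ℤ) + 1) * x l by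
        push_cast; ring]
    field_simp

/-- The inverse passage, with the opposite current and `c = 1 + σ`: type I with `x^-`, dual type II
with `x^+`. The cocycle sign squares to `1` against the sign in `κ_succ`. -/
theorem fuse_down (hs0 : s ≠ 0) (hs : ∀ m : ℕ, 0 < m → s ^ m ≠ 1) (hσ : σ = 1 ∨ σ = -1)
    {c : ℤ} (hc : c = 1 + σ) (l : Fin (n - 1)) (x : Weight n) (p : Osc n K)
    (a b : ℤ) :
    act (delta ((s ^ 2) ^ ((l : ℕ) + 1)))
      (nordOp (currentD s (-σ) l) (W.data c ((l : ℕ) + 1)) (-1) x p) a b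
      = ((s ^ 2) ^ ((l : ℕ) + 1) * W.τ * ((s ^ 2) ^ ((l : ℕ) + 1)) ^ (-a)) •
        (W.data c l).op (a + b) (Finsupp.single x p) := by
  have hρ : (s ^ 2) ^ ((l : ℕ) + 1) ≠ 0 := pow_ne_zero _ (pow_ne_zero _ hs0)
  have hσ' : -σ = 1 ∨ -σ = -1 := by omega
  refine act_delta_nordOp _ _ _ hρ (fun k hk b => ?_) (fun k hk b => ?_) ?_ ?_ ?_ p a b
  · show bosonF s σ l c k b = _ * currentF s (-σ) l k b + bosonF s σ ((l : ℕ) + 1) c k b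
    rw [bosonF_succ hs0 hs σ c l b hk, currentF]
    split_ifs
    · rw [sq_pow, zpow_pow', show (2 * (l : ℤ) + 1 + c) * k
        = 2 * (((l : ℕ) + 1 : ℕ) : ℤ) * k + -(-σ) * k by rw [hc]; push_cast; ring, zpow_add₀ hs0]
      push_cast
      ring
    · ring
  · show bosonH s σ l c k b = _ * currentH s (-σ) l k b + bosonH s σ ((l : ℕ) + 1) c k b
    rw [bosonH_succ hs0 hs σ c l b hk, currentH]
    rw [sq_pow, ← zpow_neg, zpow_pow',
      show (c - 3 - 2 * (l : ℤ)) * k = -(2 * (((l : ℕ) + 1 : ℕ) : ℤ)) * k + -(-σ) * k by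
        rw [hc]; push_cast; ring, zpow_add₀ hs0]
    push_cast
    ring
  · show -σ • simpleRoot l + σ • compWt ((l : ℕ) + 1) = σ • compWt l
    rw [neg_smul, ← smul_neg, ← smul_add, simpleRoot_eq_compWt]
    congr 1; abel
  · show -σ * x l + 1 + W.e ((l : ℕ) + 1) x + -1 = W.e l x
    rw [W.e_succ]; ring
  · show 1 * W.κ ((l : ℕ) + 1) x * sgn K (-σ • simpleRoot l) (σ • compWt ((l : ℕ) + 1))
      * _ ^ (-σ * x l + 1) = _ * W.κ l x
    rw [sgn_zsmul hσ' hσ, sgn_simpleRoot_compWt_succ, W.κ_succ, zpow_add_one₀ hρ,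
      ← zpow_natCast (s ^ 2), ← zpow_mul,
      show (((l : ℕ) + 1 : ℕ) : ℤ) * (-σ * x l) = -(σ * ((l : ℤ) + 1) * x l) by push_cast; ring,
      zpow_neg]
    have h1 : (s ^ 2) ^ (σ * ((l : ℤ) + 1) * x l) ≠ 0 := zpow_ne_zero _ (pow_ne_zero _ hs0)
    field_simp
    linear_combination W.κ l x * W.τ * compSign_sq (K := K) n l

/-- The data of the product `φ_{l+1}(ρ z) Φ_{l+1}(z)`. -/
def VertexFamily.phiData (c : ℤ) (l : Fin (n - 1)) (ρ : K) : VOData n K where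
  F k b := ρ ^ k * phiF s l k b + bosonF s σ ((l : ℕ) + 1) c k b
  H := bosonH s σ ((l : ℕ) + 1) c
  γ := σ • compWt ((l : ℕ) + 1)
  κ x := (s ^ 2) ^ (-x l) * W.κ ((l : ℕ) + 1) x
  e := W.e ((l : ℕ) + 1)

/-- The data of the product `Φ_{l+1}(z) ψ_{l+1}(ρ z)`. -/
def VertexFamily.psiData (c : ℤ) (l : Fin (n - 1)) (ρ : K) : VOData n K where
  F := bosonF s σ ((l : ℕ) + 1) c
  H k b := ρ⁻¹ ^ k * psiH s l k b + bosonH s σ ((l : ℕ) + 1) c k b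
  γ := σ • compWt ((l : ℕ) + 1)
  κ x := (s ^ 2) ^ (x l) * W.κ ((l : ℕ) + 1) x
  e := W.e ((l : ℕ) + 1)

theorem fuse_phi (c : ℤ) (l : Fin (n - 1)) {ρ : K} (hρ : ρ ≠ 0) (x : Weight n) (p : Osc n K)
    (a b : ℤ) :
    act (delta ρ) (nordOp (phiD s l) (W.data c ((l : ℕ) + 1)) 0 x p) a b
      = (1 * ρ ^ (-a)) • (W.phiData c l ρ).op (a + b) (Finsupp.single x p) := by
  refine act_delta_nordOp _ _ _ hρ (fun k hk b => rfl) (fun k hk b => ?_) (zero_add _) ?_ ?_ p a b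
  · show _ = ρ⁻¹ ^ k * 0 + _
    rw [mul_zero, zero_add]; rfl
  · exact (add_zero _).trans (zero_add _)
  · show (s ^ 2) ^ (-x l) * W.κ ((l : ℕ) + 1) x * sgn K 0 _ * ρ ^ (0 : ℤ) = _
    rw [sgn_zero_left, zpow_zero]
    simp [VertexFamily.phiData]

theorem fuse_psi (c : ℤ) (l : Fin (n - 1)) {ρ : K} (hρ : ρ ≠ 0) (x : Weight n) (p : Osc n K)
    (a b : ℤ) :
    act (delta ρ) (nordOp (psiD s l) (W.data c ((l : ℕ) + 1)) 0 x p) a b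
      = (1 * ρ ^ (-a)) • (W.psiData c l ρ).op (a + b) (Finsupp.single x p) := by
  refine act_delta_nordOp _ _ _ hρ (fun k hk b => ?_) (fun k hk b => rfl) (zero_add _) ?_ ?_ p a b
  · show _ = ρ ^ k * 0 + _
    rw [mul_zero, zero_add]; rfl
  · exact (add_zero _).trans (zero_add _)
  · show (s ^ 2) ^ (x l) * W.κ ((l : ℕ) + 1) x * sgn K 0 _ * ρ ^ (0 : ℤ) = _
    rw [sgn_zero_left, zpow_zero]
    simp [VertexFamily.psiData]

/-- For `x^+` in type I the annihilation parts fuse at `w = q^l z`, but the creation parts do not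
fit there: they exceed those of the component `l + 1` by exactly the creation part of `φ`. -/
theorem fuse_current_phi (hs0 : s ≠ 0) (hs : ∀ m : ℕ, 0 < m → s ^ m ≠ 1) {W : VertexFamily n s 1}
    (hτ : W.τ ≠ 0) (l : Fin (n - 1)) (x : Weight n) (p : Osc n K) (a b : ℤ) :
    act (delta ((s ^ 2) ^ (l : ℕ))) (nordOp (currentD s 1 l) (W.data 2 l) (-1) x p) a b
      = ((s ^ 2) ^ (l : ℕ) * W.τ⁻¹ * ((s ^ 2) ^ (l : ℕ)) ^ (-a)) •
        (W.phiData 2 l ((s ^ 2) ^ (l : ℕ) * s)).op (a + b) (Finsupp.single x p) := by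
  have hρ : (s ^ 2) ^ (l : ℕ) ≠ 0 := pow_ne_zero _ (pow_ne_zero _ hs0)
  refine act_delta_nordOp _ _ _ hρ (fun k hk b => ?_) (fun k hk b => ?_) ?_ ?_ ?_ p a b
  · show ((s ^ 2) ^ (l : ℕ) * s) ^ k * phiF s l k b + bosonF s 1 ((l : ℕ) + 1) 2 k b
      = _ * currentF s 1 l k b + bosonF s 1 l 2 k b
    rw [bosonF_succ hs0 hs 1 2 l b hk, currentF, phiF]
    split_ifs
    · have hqk := qInt_ne_zero hs0 hs (show (k : ℤ) ≠ 0 by omega)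
      have h := q_sub_inv_mul_qInt hs0 hs (k : ℤ)
      -- The identity `(q - q^{-1})[k] = q^k - q^{-k}` splits the coefficient of `φ` into two: one
      -- cancels the increment from `bosonF_succ`, the other is the creation part of the current.
      rw [sq_zpow, sq_zpow] at h
      have e1 : ((s ^ 2) ^ (l : ℕ) * s) ^ k * s ^ (2 * (k : ℤ))
          = s ^ ((2 * (l : ℤ) + 1 + 2) * k) := by
        rw [sq_pow, ← zpow_add_one₀ hs0, zpow_pow', ← zpow_add₀ hs0]; congr 1; ring
      have e2 : ((s ^ 2) ^ (l : ℕ) * s) ^ k * s ^ (2 * -(k : ℤ))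
          = ((s ^ 2) ^ (l : ℕ)) ^ k * s ^ (-1 * (k : ℤ)) := by
        rw [sq_pow, ← zpow_add_one₀ hs0, zpow_pow', zpow_pow', ← zpow_add₀ hs0, ← zpow_add₀ hs0]
        congr 1; ring
      have e3 : ((s ^ 2) ^ (l : ℕ)) ^ k * (((1 : ℤ) : K) * s ^ (-1 * (k : ℤ)) / qInt s k)
          = ((s ^ 2) ^ (l : ℕ) * s) ^ k * s ^ (2 * -(k : ℤ)) / qInt s k := by
        rw [e2]; push_cast; ring
      have e4 : s ^ 2 - (s ^ 2)⁻¹ = (s ^ (2 * (k : ℤ)) - s ^ (2 * -(k : ℤ))) / qInt s k := by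
        rw [← h]; field_simp
      rw [← e1, e3, e4]
      push_cast
      ring
    · ring
  · show bosonH s 1 ((l : ℕ) + 1) 2 k b = _ * currentH s 1 l k b + bosonH s 1 l 2 k b
    rw [bosonH_succ hs0 hs 1 2 l b hk, currentH, sq_pow, ← zpow_neg, zpow_pow',
      show (2 - 3 - 2 * (l : ℤ)) * k = -(2 * (l : ℤ)) * k + -1 * k by ring, zpow_add₀ hs0]
    ring
  · show (1 : ℤ) • simpleRoot l + (1 : ℤ) • compWt l = (1 : ℤ) • compWt ((l : ℕ) + 1)
    rw [← smul_add, simpleRoot_eq_compWt, sub_add_cancel]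
  · show 1 * x l + 1 + W.e l x + -1 = W.e ((l : ℕ) + 1) x
    rw [W.e_succ]; ring
  · show 1 * W.κ l x * sgn K ((1 : ℤ) • simpleRoot l) ((1 : ℤ) • compWt l) * _ ^ (1 * x l + 1)
      = _ * ((s ^ 2) ^ (-x l) * W.κ ((l : ℕ) + 1) x)
    rw [one_smul, one_smul, sgn_simpleRoot_compWt, W.κ_succ, zpow_add_one₀ hρ,
      ← zpow_natCast (s ^ 2), ← zpow_mul,
      show 1 * ((l : ℤ) + 1) * x l = (l : ℤ) * (1 * x l) + x l by ring,
      zpow_add₀ (pow_ne_zero 2 hs0), zpow_neg]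
    have h1 : (s ^ 2) ^ x l ≠ 0 := zpow_ne_zero _ (pow_ne_zero _ hs0)
    field_simp

theorem fuse_current_psi (hs0 : s ≠ 0) (hs : ∀ m : ℕ, 0 < m → s ^ m ≠ 1)
    {W : VertexFamily n s (-1)} (hτ : W.τ ≠ 0) (l : Fin (n - 1)) (x : Weight n) (p : Osc n K)
    (a b : ℤ) :
    act (delta ((s ^ 2) ^ (l : ℕ))) (nordOp (currentD s (-1) l) (W.data 0 l) (-1) x p) a b
      = ((s ^ 2) ^ (l : ℕ) * W.τ⁻¹ * ((s ^ 2) ^ (l : ℕ)) ^ (-a)) •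
        (W.psiData 0 l ((s ^ 2) ^ (l : ℕ) * s)).op (a + b) (Finsupp.single x p) := by
  have hρ : (s ^ 2) ^ (l : ℕ) ≠ 0 := pow_ne_zero _ (pow_ne_zero _ hs0)
  refine act_delta_nordOp _ _ _ hρ (fun k hk b => ?_) (fun k hk b => ?_) ?_ ?_ ?_ p a b
  · show bosonF s (-1) ((l : ℕ) + 1) 0 k b = _ * currentF s (-1) l k b + bosonF s (-1) l 0 k b
    rw [bosonF_succ hs0 hs (-1) 0 l b hk, currentF, add_comm]
    congr 1
    split_ifs
    · rw [sq_pow, zpow_pow', show (2 * (l : ℤ) + 1 + 0) * k = 2 * (l : ℤ) * k + -(-1) * k by ring,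
        zpow_add₀ hs0]
      ring
    · rw [mul_zero]
  · show ((s ^ 2) ^ (l : ℕ) * s)⁻¹ ^ k * psiH s l k b + bosonH s (-1) ((l : ℕ) + 1) 0 k b
      = _ * currentH s (-1) l k b + bosonH s (-1) l 0 k b
    rw [bosonH_succ hs0 hs (-1) 0 l b hk, currentH, psiH]
    have hqk := qInt_ne_zero hs0 hs (show (k : ℤ) ≠ 0 by omega)
    have h := q_sub_inv_mul_qInt hs0 hs (k : ℤ)
    rw [sq_zpow, sq_zpow] at h
    have e1 : ((s ^ 2) ^ (l : ℕ) * s)⁻¹ ^ k * s ^ (2 * -(k : ℤ))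
        = s ^ ((0 - 3 - 2 * (l : ℤ)) * k) := by
      rw [sq_pow, ← zpow_add_one₀ hs0, ← zpow_neg, zpow_pow', ← zpow_add₀ hs0]; congr 1; ring
    have e2 : ((s ^ 2) ^ (l : ℕ) * s)⁻¹ ^ k * s ^ (2 * (k : ℤ))
        = ((s ^ 2) ^ (l : ℕ))⁻¹ ^ k * s ^ (-(-1) * (k : ℤ)) := by
      rw [sq_pow, ← zpow_add_one₀ hs0, ← zpow_neg, ← zpow_neg, zpow_pow', zpow_pow',
        ← zpow_add₀ hs0, ← zpow_add₀ hs0]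
      congr 1; ring
    rw [← e1]
    have e3 : ((s ^ 2) ^ (l : ℕ))⁻¹ ^ k * (-((-1 : ℤ) : K) * s ^ (-(-1) * (k : ℤ)) / qInt s k * heisH s l k b)
        = ((s ^ 2) ^ (l : ℕ) * s)⁻¹ ^ k * s ^ (2 * (k : ℤ)) / qInt s k * heisH s l k b := by
      rw [e2]; push_cast; ring
    rw [e3]
    have e4 : s ^ 2 - (s ^ 2)⁻¹ = (s ^ (2 * (k : ℤ)) - s ^ (2 * -(k : ℤ))) / qInt s k := by
      rw [← h]; field_simp
    rw [e4]
    push_cast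
    ring
  · show (-1 : ℤ) • simpleRoot l + (-1 : ℤ) • compWt l = (-1 : ℤ) • compWt ((l : ℕ) + 1)
    rw [← smul_add, simpleRoot_eq_compWt, sub_add_cancel]
  · show -1 * x l + 1 + W.e l x + -1 = W.e ((l : ℕ) + 1) x
    rw [W.e_succ]; ring
  · show 1 * W.κ l x * sgn K ((-1 : ℤ) • simpleRoot l) ((-1 : ℤ) • compWt l) * _ ^ (-1 * x l + 1)
      = _ * ((s ^ 2) ^ (x l) * W.κ ((l : ℕ) + 1) x)
    rw [sgn_zsmul (Or.inr rfl) (Or.inr rfl), sgn_simpleRoot_compWt, W.κ_succ, zpow_add_one₀ hρ,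
      ← zpow_natCast (s ^ 2), ← zpow_mul,
      show -1 * ((l : ℤ) + 1) * x l = (l : ℤ) * (-1 * x l) + -x l by ring,
      zpow_add₀ (pow_ne_zero 2 hs0), zpow_neg]
    have h1 : (s ^ 2) ^ x l ≠ 0 := zpow_ne_zero _ (pow_ne_zero _ hs0)
    field_simp

end Fusion


/-! ### The intertwining relations on the total Fock space -/

section Relations

theorem sq_eq_zpow {K : Type*} [Field K] (s : K) : s ^ 2 = s ^ (2 : ℤ) := by norm_cast

variable {n : ℕ} {K : Type*} [Field K] {s : K}

/-- `φ` and `ψ` enter with argument `w q^{1/2}`, that is, with weights `s^a`. Rescaling moves the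
point of the delta function from `ρ` to `ρ s`. -/
theorem isSeriesMul_delta_scale {V : Type*} [AddCommGroup V] [Module K V] {N : ℤ → ℤ → V}
    (hN : IsBddBelow₂ N) (hs0 : s ≠ 0) (ρ r : K) :
    IsSeriesMul (delta ρ) (fun a b => (s ^ a * r) • N a b)
      (fun a b => (s ^ a * r) • act (delta (ρ * s)) N a b) := by
  have hN' : IsBddBelow₂ fun a b => (s ^ a * r) • N a b := by
    obtain ⟨B, hB⟩ := hN
    exact ⟨B, fun a b h => by simp only [hB a b h, smul_zero]⟩
  have e : (fun a b => (s ^ a * r) • act (delta (ρ * s)) N a b)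
      = act (delta ρ) (fun a b => (s ^ a * r) • N a b) := by
    funext a b
    rw [← act_smul hN]
    refine finsum_congr fun k => ?_
    show ((s ^ a * r) * (ρ * s) ^ (-k)) • N (a - k) (b + k)
      = ρ ^ (-k) • ((s ^ (a - k) * r) • N (a - k) (b + k))
    rw [smul_smul, mul_zpow, zpow_sub₀ hs0, zpow_neg s]
    congr 1
    ring
  rw [e]
  exact isSeriesMul_act hN' _

variable [CharZero K]

section Generic

variable {σ : ℤ} (W : VertexFamily n s σ) (hs0 : s ≠ 0) (hs : ∀ m : ℕ, 0 < m → s ^ m ≠ 1)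
  (hσ : σ = 1 ∨ σ = -1)

include hs0 hs hσ

theorem current_comm_hi {c : ℤ} (hc : c = σ + 1) (l : Fin (n - 1)) (a b : ℤ) :
    (currentD s σ l).op a * (W.data c ((l : ℕ) + 1)).op b
      = (W.data c ((l : ℕ) + 1)).op b * (currentD s σ l).op a := by
  refine Finsupp.lhom_ext fun x p => ?_
  have H := isOPE_current_hi W hs0 hs hσ hσ c l x p
  rw [show σ * σ = 1 by rcases hσ with rfl | rfl <;> rfl] at H
  refine congrFun (congrFun (H.comm ?_ ?_) a) b
  · congr 1; rw [hc]; ring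
  · rw [hc, show 1 * (σ + 1 - 1 - σ) = 0 by ring, zpow_zero]

theorem current_comm_lo {c : ℤ} (hc : c = -σ + 1) (l : Fin (n - 1)) (a b : ℤ) :
    (currentD s (-σ) l).op a * (W.data c l).op b
      = (W.data c l).op b * (currentD s (-σ) l).op a := by
  refine Finsupp.lhom_ext fun x p => ?_
  have H := isOPE_current_lo W hs0 hs (show -σ = 1 ∨ -σ = -1 by omega) hσ c l x p
  rw [show -(-σ * σ) = 1 by rcases hσ with rfl | rfl <;> rfl] at H
  refine congrFun (congrFun (H.comm ?_ ?_) a) b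
  · congr 1; rw [hc]; ring
  · rw [hc, show 1 * (-σ + 1 - 1 - -σ) = 0 by ring, zpow_zero]

theorem current_local_hi {c : ℤ} (hc : c = -σ + 1) (l : Fin (n - 1)) (v : TotalFock n K)
    (a b : ℤ) :
    (currentD s (-σ) l).op a ((W.data c ((l : ℕ) + 1)).op b v)
      - (W.data c ((l : ℕ) + 1)).op b ((currentD s (-σ) l).op a v)
      - (s ^ 2) ^ (-((l : ℤ) + 2)) •
        ((currentD s (-σ) l).op (a - 1) ((W.data c ((l : ℕ) + 1)).op (b + 1) v)
          - (W.data c ((l : ℕ) + 1)).op (b + 1) ((currentD s (-σ) l).op (a - 1) v)) = 0 := by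
  induction v using Finsupp.induction_linear with
  | zero => simp
  | add v w hv hw =>
    have := congrArg₂ (· + ·) hv hw
    simp only [add_zero] at this
    rw [← this]
    simp only [map_add, smul_sub, smul_add]
    abel
  | single x p =>
    have H := isOPE_current_hi W hs0 hs (show -σ = 1 ∨ -σ = -1 by omega) hσ c l x p
    rw [show -σ * σ = -1 by rcases hσ with rfl | rfl <;> rfl] at H
    have e : (s ^ 2) ^ (-((l : ℤ) + 2)) = (s ^ (2 * (l : ℤ) + 3 + c - -σ))⁻¹ := by
      rw [sq_zpow, ← zpow_neg]; congr 1; rw [hc]; ring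
    rw [e]
    refine H.local (zpow_ne_zero _ hs0) ?_ ?_ a b
    · congr 1; rw [hc]; ring
    · rw [hc, show -1 * (-σ + 1 - 1 - -σ) = 0 by ring, zpow_zero]

end Generic

variable (hs0 : s ≠ 0) (hs : ∀ m : ℕ, 0 < m → s ^ m ≠ 1)

include hs0 hs

/-- The residue of `x^+ Φ_l` at `w = q^l z` and the product `φ(w q^{1/2}) Φ_{l+1}` on that line both
fuse to the operator of `phiData`. The scalars agree because `τ = -q` while the zero mode of `φ`
contributes `q^{-1}`. -/
theorem xPlus_delta_phi (W : VertexFamily n s 1) (hτ : W.τ = -s ^ 2) (l : Fin (n - 1))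
    (v : TotalFock n K) :
    IsSeriesMul (delta ((s ^ 2) ^ (l : ℕ)))
      (fun a b => s ^ a • (phiD s l).op a ((W.data 2 ((l : ℕ) + 1)).op b v))
      (fun a b => (W.data 2 l).op b ((currentD s 1 l).op a v)
        - (currentD s 1 l).op a ((W.data 2 l).op b v)) := by
  refine isSeriesMul_of_single
    (P := fun a b => s ^ a • ((phiD s l).op a * (W.data 2 ((l : ℕ) + 1)).op b))
    (R := fun a b => (W.data 2 l).op b * (currentD s 1 l).op a
      - (currentD s 1 l).op a * (W.data 2 l).op b) (fun x p => ?_) v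
  have hs2 : s ^ 2 ≠ 0 := pow_ne_zero 2 hs0
  have hρ : (s ^ 2) ^ (l : ℕ) ≠ 0 := pow_ne_zero _ hs2
  have hN := isBddBelow₂_nordOp (phiD s l) (W.data 2 ((l : ℕ) + 1)) 0 x p
  convert isSeriesMul_delta_scale hN hs0 ((s ^ 2) ^ (l : ℕ)) (s ^ 2)⁻¹ using 1
  · funext a b
    -- Moving `φ` to the left past a weight with pairing `1` costs `q^{-1}`, the constant chosen for
    -- `isSeriesMul_delta_scale`.
    have hγ : (W.data 2 ((l : ℕ) + 1)).γ l = 1 := by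
      show ((1 : ℤ) • (compWt ((l : ℕ) + 1) : Weight n)) l = 1
      rw [one_smul, compWt_apply]; simp
    rw [LinearMap.smul_apply, Module.End.mul_apply, phi_op_op l _ x p hs0, act_smul hN, act_single,
      smul_smul, hγ, zpow_neg_one]
  · funext a b
    have H := isOPE_current_lo W hs0 hs (Or.inl rfl) (Or.inl rfl) 2 l x p
    have eA : s ^ (2 * (l : ℤ) - 1 + 2 - 1) = (s ^ 2) ^ (l : ℕ) := by
      rw [sq_pow]; congr 1; ring
    rw [eA, show -((1 : ℤ) * 1) = -1 by rfl] at H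
    have h1 := H.delta hρ (by rw [sq_pow]; congr 1; ring) (by norm_num) a b
    rw [fuse_current_phi hs0 hs (by rw [hτ]; exact neg_ne_zero.mpr hs2)] at h1
    rw [fuse_phi W 2 l (mul_ne_zero hρ hs0), LinearMap.sub_apply, ← neg_sub]
    simp only [Module.End.mul_apply]
    rw [h1, smul_smul, smul_smul, ← neg_smul, hτ]
    congr 1
    rw [mul_zpow, zpow_neg s]
    have := zpow_ne_zero a hs0
    field_simp

theorem xMinus_delta_psi (W : VertexFamily n s (-1)) (hτ : W.τ = 1) (l : Fin (n - 1))
    (v : TotalFock n K) :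
    IsSeriesMul (delta ((s ^ 2) ^ (l : ℕ)))
      (fun a b => s ^ a • (W.data 0 ((l : ℕ) + 1)).op b ((psiD s l).op a v))
      (fun a b => (currentD s (-1) l).op a ((W.data 0 l).op b v)
        - (W.data 0 l).op b ((currentD s (-1) l).op a v)) := by
  refine isSeriesMul_of_single
    (P := fun a b => s ^ a • ((W.data 0 ((l : ℕ) + 1)).op b * (psiD s l).op a))
    (R := fun a b => (currentD s (-1) l).op a * (W.data 0 l).op b
      - (W.data 0 l).op b * (currentD s (-1) l).op a) (fun x p => ?_) v
  have hs2 : s ^ 2 ≠ 0 := pow_ne_zero 2 hs0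
  have hρ : (s ^ 2) ^ (l : ℕ) ≠ 0 := pow_ne_zero _ hs2
  have hN := isBddBelow₂_nordOp (psiD s l) (W.data 0 ((l : ℕ) + 1)) 0 x p
  convert isSeriesMul_delta_scale hN hs0 ((s ^ 2) ^ (l : ℕ)) 1 using 1
  · funext a b
    rw [LinearMap.smul_apply, Module.End.mul_apply, op_psi_op l _ x p, act_single, mul_one]
  · funext a b
    have H := isOPE_current_lo W hs0 hs (Or.inr rfl) (Or.inr rfl) 0 l x p
    have eA : s ^ (2 * (l : ℤ) - 1 + 0 - -1) = (s ^ 2) ^ (l : ℕ) := by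
      rw [sq_pow]; congr 1; ring
    rw [eA, show -((-1 : ℤ) * -1) = -1 by rfl] at H
    have h1 := H.delta hρ (by rw [sq_pow]; congr 1; ring) (by norm_num) a b
    rw [fuse_current_psi hs0 hs (by rw [hτ]; exact one_ne_zero)] at h1
    rw [fuse_psi W 0 l (mul_ne_zero hρ hs0), LinearMap.sub_apply]
    simp only [Module.End.mul_apply]
    rw [h1, smul_smul, smul_smul, hτ]
    congr 1
    rw [mul_zpow, zpow_neg s]
    have := zpow_ne_zero a hs0
    field_simp

theorem typeI_xMinus_lo (W : VertexFamily n s 1) (l : Fin (n - 1)) (v : TotalFock n K) :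
    IsSeriesMul (fracZ (s ^ 2) ((s ^ 2) ^ (l : ℕ)) ((s ^ 2) ^ ((l : ℕ) + 1)))
      (fun a b => (currentD s (-1) l).op a ((W.data 2 l).op b v))
      (fun a b => (W.data 2 l).op b ((currentD s (-1) l).op a v)) := by
  refine isSeriesMul_of_single (P := fun a b => (currentD s (-1) l).op a * (W.data 2 l).op b)
    (R := fun a b => (W.data 2 l).op b * (currentD s (-1) l).op a) (fun x p => ?_) v
  refine (isOPE_current_lo W hs0 hs (Or.inr rfl) (Or.inl rfl) 2 l x p).fracZ ?_ ?_ ?_ <;>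
  · simp only [sq_eq_zpow s, zpow_pow', ← zpow_add₀ hs0]
    congr 1 <;> (push_cast; ring)

/-- The delta term comes from the pole at `A' = q^{l+1}` by `fuse_down`. Its coefficient is `r τ`
with `r = q^{-1}`, so `τ = -q` is forced; hence the factor `(-q)^{j-i}` in the formula. -/
theorem typeI_xMinus_hi (W : VertexFamily n s 1) (hτ : W.τ = -s ^ 2) (l : Fin (n - 1))
    (v : TotalFock n K) :
    IsSeriesMul (fracZ (s ^ 2)⁻¹ ((s ^ 2) ^ ((l : ℕ) + 2)) ((s ^ 2) ^ ((l : ℕ) + 1)))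
      (fun a b => (currentD s (-1) l).op a ((W.data 2 ((l : ℕ) + 1)).op b v))
      (fun a b => (W.data 2 ((l : ℕ) + 1)).op b ((currentD s (-1) l).op a v)
        - delta ((s ^ 2) ^ ((l : ℕ) + 1)) a • (W.data 2 l).op (a + b) v) := by
  refine isSeriesMul_of_single
    (P := fun a b => (currentD s (-1) l).op a * (W.data 2 ((l : ℕ) + 1)).op b)
    (R := fun a b => (W.data 2 ((l : ℕ) + 1)).op b * (currentD s (-1) l).op a
      - delta ((s ^ 2) ^ ((l : ℕ) + 1)) a • (W.data 2 l).op (a + b)) (fun x p => ?_) v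
  have hs2 : s ^ 2 ≠ 0 := pow_ne_zero 2 hs0
  have eA : s ^ (2 * (l : ℤ) + 5 - 2 + -1) = (s ^ 2) ^ ((l : ℕ) + 1) := by
    rw [sq_pow]; congr 1; push_cast; ring
  refine (isOPE_current_hi W hs0 hs (Or.inr rfl) (Or.inl rfl) 2 l x p).fracZ_delta
    (zpow_ne_zero _ hs0) (zpow_ne_zero _ hs0) eA.symm ?_ ?_ fun a b => ?_
  · simp only [sq_eq_zpow s, ← zpow_neg]
    congr 1
  · simp only [sq_eq_zpow s, zpow_pow', ← zpow_add₀ hs0]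
    congr 1; push_cast; ring
  · rw [eA, show (-1 : ℤ) * 1 = -1 by rfl, fuse_down (c := 2) W hs0 hs (Or.inl rfl) rfl, smul_smul,
      LinearMap.smul_apply, ← neg_smul, hτ, delta]
    congr 1
    rw [show (-1 : ℤ) * (2 - 1 - -1) = -2 by rfl, ← sq_inv]
    have := pow_ne_zero ((l : ℕ) + 1) hs2
    field_simp

theorem typeII_xPlus_hi (W : VertexFamily n s 1) (l : Fin (n - 1)) (v : TotalFock n K) :
    IsSeriesMul (fracW' (s ^ 2) ((s ^ 2) ^ (-((l : ℤ) + 2))) ((s ^ 2) ^ (-((l : ℤ) + 1))))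
      (fun a b => (currentD s 1 l).op a ((W.data 0 ((l : ℕ) + 1)).op b v))
      (fun a b => (W.data 0 ((l : ℕ) + 1)).op b ((currentD s 1 l).op a v)) := by
  refine isSeriesMul_of_single
    (P := fun a b => (currentD s 1 l).op a * (W.data 0 ((l : ℕ) + 1)).op b)
    (R := fun a b => (W.data 0 ((l : ℕ) + 1)).op b * (currentD s 1 l).op a) (fun x p => ?_) v
  refine (isOPE_current_hi W hs0 hs (Or.inl rfl) (Or.inl rfl) 0 l x p).fracZ ?_ ?_ ?_ <;>
  · simp only [sq_eq_zpow s, ← zpow_mul, ← zpow_neg, ← zpow_add₀ hs0, ← zpow_sub₀ hs0]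
    congr 1; ring

/-- Here the delta term comes from `fuse_up`; its coefficient is `r τ⁻¹` with `r = q`, which leads
to the same `τ = -q` as in type I. -/
theorem typeII_xPlus_lo (W : VertexFamily n s 1) (hτ : W.τ = -s ^ 2) (l : Fin (n - 1))
    (v : TotalFock n K) :
    IsSeriesMul (fracW' (s ^ 2)⁻¹ ((s ^ 2) ^ (-(l : ℤ))) ((s ^ 2) ^ (-((l : ℤ) + 1))))
      (fun a b => (currentD s 1 l).op a ((W.data 0 l).op b v))
      (fun a b => (W.data 0 l).op b ((currentD s 1 l).op a v)
        - delta ((s ^ 2) ^ ((l : ℕ) + 1)) a • (W.data 0 ((l : ℕ) + 1)).op (a + b) v) := by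
  refine isSeriesMul_of_single (P := fun a b => (currentD s 1 l).op a * (W.data 0 l).op b)
    (R := fun a b => (W.data 0 l).op b * (currentD s 1 l).op a
      - delta ((s ^ 2) ^ ((l : ℕ) + 1)) a • (W.data 0 ((l : ℕ) + 1)).op (a + b))
    (fun x p => ?_) v
  have hs2 : s ^ 2 ≠ 0 := pow_ne_zero 2 hs0
  have eA : s ^ (2 * (l : ℤ) + 1 - 0 + 1) = (s ^ 2) ^ ((l : ℕ) + 1) := by
    rw [sq_pow]; congr 1
  refine (isOPE_current_lo W hs0 hs (Or.inl rfl) (Or.inl rfl) 0 l x p).fracZ_delta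
    (zpow_ne_zero _ hs0) (zpow_ne_zero _ hs0) ?_ ?_ ?_ fun a b => ?_
  · simp only [sq_eq_zpow s, ← zpow_mul, ← zpow_neg]
    congr 1
  · simp only [sq_eq_zpow s, ← zpow_mul, ← zpow_sub₀ hs0]
    congr 1; ring
  · simp only [sq_eq_zpow s, ← zpow_mul, ← zpow_neg, ← zpow_add₀ hs0, ← zpow_sub₀ hs0]
    congr 1; ring
  · rw [eA, show -((1 : ℤ) * 1) = -1 by rfl, fuse_up (c := 0) W hs0 hs (Or.inl rfl)
      (by rw [hτ]; exact neg_ne_zero.mpr hs2) rfl, smul_smul,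
      LinearMap.smul_apply, ← neg_smul, hτ, delta]
    congr 1
    rw [show (-1 : ℤ) * (0 - 1 - 1) = 2 by rfl, ← sq_eq_zpow]
    have := pow_ne_zero ((l : ℕ) + 1) hs2
    field_simp

theorem dualTypeI_xMinus_hi (W : VertexFamily n s (-1)) (l : Fin (n - 1)) (v : TotalFock n K) :
    IsSeriesMul (fracZ' (s ^ 2)⁻¹ ((s ^ 2) ^ ((l : ℕ) + 2)) ((s ^ 2) ^ ((l : ℕ) + 1)))
      (fun a b => (W.data 2 ((l : ℕ) + 1)).op b ((currentD s (-1) l).op a v))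
      (fun a b => (currentD s (-1) l).op a ((W.data 2 ((l : ℕ) + 1)).op b v)) := by
  refine isSeriesMul_of_single
    (P := fun a b => (W.data 2 ((l : ℕ) + 1)).op b * (currentD s (-1) l).op a)
    (R := fun a b => (currentD s (-1) l).op a * (W.data 2 ((l : ℕ) + 1)).op b) (fun x p => ?_) v
  refine (isOPE_current_hi W hs0 hs (Or.inr rfl) (Or.inr rfl) 2 l x p).fracW ?_ ?_ ?_
  · rw [sq_pow, ← zpow_neg, ← zpow_add₀ hs0, ← zpow_zero s]
    congr 1; push_cast; ring
  all_goals
    simp only [sq_eq_zpow s, zpow_pow', ← zpow_neg, ← zpow_add₀ hs0, ← zpow_sub₀ hs0]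
    congr 1; push_cast; ring

/-- For the duals the pole sits in the other order and is not multiplied by `r`, so the coefficient
of the delta term is `τ⁻¹` and the normalization is `τ = 1`. -/
theorem dualTypeI_xMinus_lo (W : VertexFamily n s (-1)) (hτ : W.τ = 1) (l : Fin (n - 1))
    (v : TotalFock n K) :
    IsSeriesMul (fracZ' (s ^ 2) ((s ^ 2) ^ (l : ℕ)) ((s ^ 2) ^ ((l : ℕ) + 1)))
      (fun a b => (W.data 2 l).op b ((currentD s (-1) l).op a v))
      (fun a b => (currentD s (-1) l).op a ((W.data 2 l).op b v)
        - delta ((s ^ 2) ^ ((l : ℕ) + 1)) a • (W.data 2 ((l : ℕ) + 1)).op (a + b) v) := by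
  refine isSeriesMul_of_single (P := fun a b => (W.data 2 l).op b * (currentD s (-1) l).op a)
    (R := fun a b => (currentD s (-1) l).op a * (W.data 2 l).op b
      - delta ((s ^ 2) ^ ((l : ℕ) + 1)) a • (W.data 2 ((l : ℕ) + 1)).op (a + b))
    (fun x p => ?_) v
  have hs2 : s ^ 2 ≠ 0 := pow_ne_zero 2 hs0
  have eA : s ^ (2 * (l : ℤ) - 1 + 2 - -1) = (s ^ 2) ^ ((l : ℕ) + 1) := by
    rw [sq_pow]; congr 1; push_cast; ring
  refine (isOPE_current_lo W hs0 hs (Or.inr rfl) (Or.inr rfl) 2 l x p).fracW_delta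
    (zpow_ne_zero _ hs0) (zpow_ne_zero _ hs0) ?_ ?_ ?_ fun a b => ?_
  · rw [sq_pow, ← zpow_neg, ← zpow_add₀ hs0, ← zpow_zero s]
    congr 1; push_cast; ring
  · simp only [sq_eq_zpow s, zpow_pow', ← zpow_neg, ← zpow_add₀ hs0, ← zpow_sub₀ hs0]
    congr 1; push_cast; ring
  · simp only [sq_eq_zpow s, zpow_pow', ← zpow_add₀ hs0, ← zpow_sub₀ hs0]
    congr 1; push_cast; ring
  · rw [eA, show -((-1 : ℤ) * -1) = -1 by rfl, fuse_up (c := 2) W hs0 hs (Or.inr rfl)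
      (by rw [hτ]; exact one_ne_zero) rfl, smul_smul, LinearMap.smul_apply, hτ, delta]
    congr 1
    have := pow_ne_zero ((l : ℕ) + 1) hs2
    field_simp

theorem dualTypeII_xPlus_lo (W : VertexFamily n s (-1)) (l : Fin (n - 1)) (v : TotalFock n K) :
    IsSeriesMul (fracW (s ^ 2)⁻¹ ((s ^ 2) ^ (-(l : ℤ))) ((s ^ 2) ^ (-((l : ℤ) + 1))))
      (fun a b => (W.data 0 l).op b ((currentD s 1 l).op a v))
      (fun a b => (currentD s 1 l).op a ((W.data 0 l).op b v)) := by
  refine isSeriesMul_of_single (P := fun a b => (W.data 0 l).op b * (currentD s 1 l).op a)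
    (R := fun a b => (currentD s 1 l).op a * (W.data 0 l).op b) (fun x p => ?_) v
  refine (isOPE_current_lo W hs0 hs (Or.inl rfl) (Or.inr rfl) 0 l x p).fracW ?_ ?_ ?_
  · rw [sq_zpow, ← zpow_add₀ hs0, ← zpow_zero s]
    congr 1; ring
  all_goals
    simp only [sq_eq_zpow s, ← zpow_mul, ← zpow_neg, ← zpow_add₀ hs0]
    congr 1; ring

theorem dualTypeII_xPlus_hi (W : VertexFamily n s (-1)) (hτ : W.τ = 1) (l : Fin (n - 1))
    (v : TotalFock n K) :
    IsSeriesMul (fracW (s ^ 2) ((s ^ 2) ^ (-((l : ℤ) + 2))) ((s ^ 2) ^ (-((l : ℤ) + 1))))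
      (fun a b => (W.data 0 ((l : ℕ) + 1)).op b ((currentD s 1 l).op a v))
      (fun a b => (currentD s 1 l).op a ((W.data 0 ((l : ℕ) + 1)).op b v)
        - delta ((s ^ 2) ^ ((l : ℕ) + 1)) a • (W.data 0 l).op (a + b) v) := by
  refine isSeriesMul_of_single
    (P := fun a b => (W.data 0 ((l : ℕ) + 1)).op b * (currentD s 1 l).op a)
    (R := fun a b => (currentD s 1 l).op a * (W.data 0 ((l : ℕ) + 1)).op b
      - delta ((s ^ 2) ^ ((l : ℕ) + 1)) a • (W.data 0 l).op (a + b)) (fun x p => ?_) v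
  have hs2 : s ^ 2 ≠ 0 := pow_ne_zero 2 hs0
  have eA : s ^ (2 * (l : ℤ) + 3 + 0 - 1) = (s ^ 2) ^ ((l : ℕ) + 1) := by
    rw [sq_pow]; congr 1; push_cast; ring
  refine (isOPE_current_hi W hs0 hs (Or.inl rfl) (Or.inr rfl) 0 l x p).fracW_delta
    (zpow_ne_zero _ hs0) (zpow_ne_zero _ hs0) ?_ ?_ ?_ fun a b => ?_
  · rw [sq_zpow, ← zpow_add₀ hs0, ← zpow_zero s]
    congr 1; ring
  · simp only [sq_eq_zpow s, ← zpow_mul, ← zpow_add₀ hs0]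
    congr 1
  · simp only [sq_eq_zpow s, ← zpow_mul, ← zpow_add₀ hs0]
    congr 1; ring
  · rw [eA, show (1 : ℤ) * -1 = -1 by rfl]
    have h := fuse_down W hs0 hs (Or.inr rfl) (show (0 : ℤ) = 1 + -1 by rfl) l x p a b
    rw [neg_neg] at h
    rw [h, smul_smul, LinearMap.smul_apply, hτ, delta]
    congr 1
    have := pow_ne_zero ((l : ℕ) + 1) hs2
    field_simp

end Relations


/-! ### The zero modes of the bosonic formulas -/

section ZeroModes

variable {n : ℕ} {K : Type*} [Field K] {s : K}

theorem pairing_fundWt_current (l : Fin (n - 1)) (j : ℕ) (ε : ℤ) (x : Weight n) :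
    pairing (fundWt j) (ε • simpleRoot l + x)
      = pairing (fundWt j) x + ε * if (l : ℕ) + 1 = j then 1 else 0 := by
  rw [pairing_add_right, pairing_zsmul_right, pairing_fundWt_simpleRoot, add_comm]

/-- The relations only compare exponents that differ by an explicit integer, and such a shift passes
through the floor. Integrality of the exponents on a coset is therefore not needed for the
relations. -/
theorem floor_eq_add_int {a b : ℚ} {z : ℤ} (h : a = b + z) : ⌊a⌋ = ⌊b⌋ + z := by
  rw [h, Int.floor_add_intCast]

variable (n) in
/-- The zero modes of the vertex operators `F_{i+1} → F_i`. -/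
def vertexFamily (hs0 : s ≠ 0) (i : ℕ) : VertexFamily n s 1 where
  κ j := vertexScalar s i j
  e j := vertexZExp i j
  τ := -s ^ 2
  e_current l j _ ε x := by
    apply floor_eq_add_int
    rw [pairing_fundWt_current, pairing_fundWt_current, compWt_apply]
    push_cast
    ring
  κ_current l j _ ε x := by
    have h1 : ⌊((j : ℚ) + 1) * pairing (fundWt j) (ε • simpleRoot l + x)
        - (j : ℚ) * pairing (fundWt (j + 1)) (ε • simpleRoot l + x)⌋
        = ⌊((j : ℚ) + 1) * pairing (fundWt j) x - (j : ℚ) * pairing (fundWt (j + 1)) x⌋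
        + ε * 1 * (((j : ℤ) + 1) * (if (l : ℕ) + 1 = j then 1 else 0)
          - (j : ℤ) * if (l : ℕ) = j then 1 else 0) := by
      apply floor_eq_add_int
      rw [pairing_fundWt_current, pairing_fundWt_current]
      push_cast
      ring
    have h2 : ⌊((n : ℚ) - 1) * (pairing (fundWt 1) (ε • simpleRoot l + x)
          - ((n : ℚ) - i - 1) / n)⌋
        = ⌊((n : ℚ) - 1) * (pairing (fundWt 1) x - ((n : ℚ) - i - 1) / n)⌋
        + ε * (((n : ℤ) - 1) * if (l : ℕ) = 0 then 1 else 0) := by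
      apply floor_eq_add_int
      rw [pairing_fundWt_current]
      push_cast
      ring
    rw [vertexScalar, vertexScalar, h1, h2, zpow_add₀ (pow_ne_zero 2 hs0),
      zpow_add₀ (neg_ne_zero.mpr one_ne_zero)]
    ring
  e_succ l x := by
    apply floor_eq_add_int
    have h := pairing_second_difference l x
    push_cast
    linear_combination h
  κ_succ l x := by
    have h := pairing_second_difference l x
    have h1 : ⌊((((l : ℕ) + 1 : ℕ) : ℚ) + 1) * pairing (fundWt ((l : ℕ) + 1)) x
        - (((l : ℕ) + 1 : ℕ) : ℚ) * pairing (fundWt ((l : ℕ) + 1 + 1)) x⌋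
        = ⌊((l : ℚ) + 1) * pairing (fundWt (l : ℕ)) x
          - (l : ℚ) * pairing (fundWt ((l : ℕ) + 1)) x⌋ + 1 * ((l : ℤ) + 1) * x l := by
      apply floor_eq_add_int
      push_cast
      linear_combination ((l : ℚ) + 1) * h
    have hc : (((compSign n ((l : ℕ) + 1) : ℤˣ) : ℤ) : K) = 1 := by simp [compSign]
    rw [vertexScalar, vertexScalar, h1, hc, zpow_add₀ (pow_ne_zero 2 hs0), mul_one,
      show ((((l : ℕ) + 1 : ℕ) : ℤ) - i) = ((l : ℤ) - i) + 1 by push_cast; ring,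
      zpow_add_one₀ (neg_ne_zero.mpr (pow_ne_zero 2 hs0))]
    linear_combination (-((s ^ 2) ^ ⌊((l : ℚ) + 1) * pairing (fundWt (l : ℕ)) x
          - (l : ℚ) * pairing (fundWt ((l : ℕ) + 1)) x⌋ * (s ^ 2) ^ (1 * ((l : ℤ) + 1) * x l) *
      (-1) ^ ⌊((n : ℚ) - 1) * (pairing (fundWt 1) x - ((n : ℚ) - i - 1) / n)⌋ *
      (-1) ^ (n - i - 1).choose 2 * (-(s ^ 2)) ^ ((l : ℤ) - i) * (-s ^ 2))) *
      compSign_sq (K := K) n l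

variable (n) in
/-- The zero modes of the dual vertex operators `F_i → F_{i+1}`. -/
def dualFamily (hs0 : s ≠ 0) (i : ℕ) : VertexFamily n s (-1) where
  κ j := dualScalar s i j
  e j := dualZExp i j
  τ := 1
  e_current l j _ ε x := by
    apply floor_eq_add_int
    rw [pairing_fundWt_current, pairing_fundWt_current, compWt_apply]
    push_cast
    ring
  κ_current l j _ ε x := by
    have h1 : ⌊-((j : ℚ) + 1) * pairing (fundWt j) (ε • simpleRoot l + x)
        + (j : ℚ) * pairing (fundWt (j + 1)) (ε • simpleRoot l + x) + i⌋
        = ⌊-((j : ℚ) + 1) * pairing (fundWt j) x + (j : ℚ) * pairing (fundWt (j + 1)) x + i⌋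
        + ε * -1 * (((j : ℤ) + 1) * (if (l : ℕ) + 1 = j then 1 else 0)
          - (j : ℤ) * if (l : ℕ) = j then 1 else 0) := by
      apply floor_eq_add_int
      rw [pairing_fundWt_current, pairing_fundWt_current]
      push_cast
      ring
    have h2 : ⌊((n : ℚ) - 1) * (-pairing (fundWt 1) (ε • simpleRoot l + x)
          + ((n : ℚ) - i) / n)⌋
        = ⌊((n : ℚ) - 1) * (-pairing (fundWt 1) x + ((n : ℚ) - i) / n)⌋
        + -(ε * (((n : ℤ) - 1) * if (l : ℕ) = 0 then 1 else 0)) := by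
      apply floor_eq_add_int
      rw [pairing_fundWt_current]
      push_cast
      ring
    rw [dualScalar, dualScalar, h1, h2, zpow_add₀ (pow_ne_zero 2 hs0),
      zpow_add₀ (neg_ne_zero.mpr one_ne_zero), neg_one_zpow_neg]
    ring
  e_succ l x := by
    apply floor_eq_add_int
    have h := pairing_second_difference l x
    push_cast
    linear_combination -h
  κ_succ l x := by
    have h := pairing_second_difference l x
    have h1 : ⌊-((((l : ℕ) + 1 : ℕ) : ℚ) + 1) * pairing (fundWt ((l : ℕ) + 1)) x
        + (((l : ℕ) + 1 : ℕ) : ℚ) * pairing (fundWt ((l : ℕ) + 1 + 1)) x + i⌋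
        = ⌊-((l : ℚ) + 1) * pairing (fundWt (l : ℕ)) x
          + (l : ℚ) * pairing (fundWt ((l : ℕ) + 1)) x + i⌋ + -1 * ((l : ℤ) + 1) * x l := by
      apply floor_eq_add_int
      push_cast
      linear_combination (-((l : ℚ) + 1)) * h
    have hc : (((compSign n ((l : ℕ) + 1) : ℤˣ) : ℤ) : K) = 1 := by simp [compSign]
    rw [dualScalar, dualScalar, h1, hc, zpow_add₀ (pow_ne_zero 2 hs0), mul_one]
    linear_combination (-((s ^ 2) ^ ⌊-((l : ℚ) + 1) * pairing (fundWt (l : ℕ)) x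
          + (l : ℚ) * pairing (fundWt ((l : ℕ) + 1)) x + i⌋ * (s ^ 2) ^ (-1 * ((l : ℤ) + 1) * x l) *
      (-1) ^ ⌊((n : ℚ) - 1) * (-pairing (fundWt 1) x + ((n : ℚ) - i) / n)⌋ *
      (-1) ^ (n - i).choose 2)) * compSign_sq (K := K) n l

theorem pairing_fundWt_fundWt {j k : ℕ} (hj : j ≤ n) (hk : k ≤ n) :
    pairing (fundWt j : Weight n) (fundWt k)
      = ((min j k : ℕ) : ℚ) * ((n : ℚ) - ((max j k : ℕ) : ℚ)) / n := by
  rw [pairing_fundWt hj]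
  by_cases h : 1 ≤ k ∧ k < n
  · rw [Finset.sum_eq_single ⟨k - 1, by omega⟩]
    · have hk1 : k - 1 + 1 = k := by omega
      simp only [fundWt, hk1, if_true]
      push_cast
      ring
    · intro b _ hb
      rw [fundWt, if_neg fun h' => hb (Fin.ext (by simp; omega))]
      simp
    · intro h'; exact absurd (Finset.mem_univ _) h'
  · have e : ∀ b : Fin (n - 1), (fundWt k : Weight n) b = 0 := by
      intro b
      have := b.2
      rw [fundWt, if_neg (by omega)]
    rw [Finset.sum_eq_zero fun b _ => by rw [e]; simp]
    rcases Nat.eq_zero_or_pos k with rfl | hk0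
    · simp
    · rw [show k = n by omega, max_eq_right hj]; simp

theorem vertexZExp_fundWt {i : ℕ} (hi : i < n) :
    vertexZExp i i (fundWt (i + 1) : Weight n) = 0 := by
  have hn : (n : ℚ) ≠ 0 := by exact_mod_cast (show n ≠ 0 by omega)
  rw [vertexZExp, pairing_fundWt_fundWt hi.le hi, pairing_fundWt_fundWt hi hi, min_self, max_self,
    min_eq_left (Nat.le_succ i), max_eq_right (Nat.le_succ i)]
  rw [Int.floor_eq_zero_iff]
  convert Set.left_mem_Ico.mpr (zero_lt_one (α := ℚ)) using 1
  field_simp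
  push_cast
  ring

theorem dualZExp_fundWt {i : ℕ} (hi : i < n) :
    dualZExp i i (fundWt i : Weight n) = 0 := by
  have hn : (n : ℚ) ≠ 0 := by exact_mod_cast (show n ≠ 0 by omega)
  rw [dualZExp, pairing_fundWt_fundWt hi.le hi.le, pairing_fundWt_fundWt hi hi.le, min_self,
    max_self, min_eq_right (Nat.le_succ i), max_eq_left (Nat.le_succ i)]
  rw [Int.floor_eq_zero_iff]
  convert Set.left_mem_Ico.mpr (zero_lt_one (α := ℚ)) using 1
  field_simp
  push_cast
  ring

theorem neg_one_pow_sq (m : ℕ) : ((-1 : K) ^ m) * (-1) ^ m = 1 := by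
  rw [← mul_pow]; simp

/-- On the highest weight vector both floor exponents vanish, and the binomial sign cancels the
cocycle sign for `i ≥ 1`. -/
theorem vertexScalar_fundWt (hn2 : 2 ≤ n) {i : ℕ} (hi : i < n) :
    vertexScalar s i i (fundWt (i + 1) : Weight n) * sgn K (compWt i : Weight n) (fundWt (i + 1))
      = 1 := by
  have hn : (n : ℚ) ≠ 0 := by exact_mod_cast (show n ≠ 0 by omega)
  have h1 : ⌊((i : ℚ) + 1) * pairing (fundWt i) (fundWt (i + 1) : Weight n)
      - (i : ℚ) * pairing (fundWt (i + 1)) (fundWt (i + 1) : Weight n)⌋ = 0 := by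
    rw [pairing_fundWt_fundWt hi.le hi, pairing_fundWt_fundWt hi hi, min_self, max_self,
      min_eq_left (Nat.le_succ i), max_eq_right (Nat.le_succ i), Int.floor_eq_zero_iff]
    convert Set.left_mem_Ico.mpr (zero_lt_one (α := ℚ)) using 1
    field_simp
    push_cast
    ring
  have h2 : ⌊((n : ℚ) - 1) * (pairing (fundWt 1) (fundWt (i + 1) : Weight n)
      - ((n : ℚ) - i - 1) / n)⌋ = 0 := by
    rw [pairing_fundWt_fundWt (by omega) hi, min_eq_left (by omega), max_eq_right (by omega),
      Int.floor_eq_zero_iff]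
    convert Set.left_mem_Ico.mpr (zero_lt_one (α := ℚ)) using 1
    field_simp
    push_cast
    ring
  rw [vertexScalar, h1, h2, sub_self, zpow_zero, zpow_zero, zpow_zero, one_mul, one_mul, mul_one,
    compSign, sgn]
  rcases Nat.eq_zero_or_pos i with rfl | hi0
  -- For `i = 0` the cocycle sign is trivial; the binomial sign cancels `κ_0` instead.
  · rw [latticeSign_compWt_zero (by omega), if_pos rfl]
    push_cast
    rw [Nat.sub_zero, mul_one, neg_one_pow_sq]
  · rw [latticeSign_compWt_fundWt hi0 hi (Nat.le_succ i) hi, if_neg hi0.ne']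
    push_cast
    rw [mul_one, Nat.sub_sub, neg_one_pow_sq]

theorem dualScalar_fundWt (hn2 : 2 ≤ n) {i : ℕ} (hi : i < n) :
    dualScalar s i i (fundWt i : Weight n) * sgn K (-compWt i : Weight n) (fundWt i) = 1 := by
  have hn : (n : ℚ) ≠ 0 := by exact_mod_cast (show n ≠ 0 by omega)
  have h1 : ⌊-((i : ℚ) + 1) * pairing (fundWt i) (fundWt i : Weight n)
      + (i : ℚ) * pairing (fundWt (i + 1)) (fundWt i : Weight n) + i⌋ = 0 := by
    rw [pairing_fundWt_fundWt hi.le hi.le, pairing_fundWt_fundWt hi hi.le, min_self,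
      max_self, min_eq_right (Nat.le_succ i), max_eq_left (Nat.le_succ i), Int.floor_eq_zero_iff]
    convert Set.left_mem_Ico.mpr (zero_lt_one (α := ℚ)) using 1
    field_simp
    push_cast
    ring
  rw [dualScalar, h1, zpow_zero, one_mul, compSign, sgn, latticeSign_neg_left]
  rcases Nat.eq_zero_or_pos i with rfl | hi0
  -- For `i = 0` the power of `-1` has exponent `n - 1`; with `C(n,2) = (n-1) + C(n-1,2)` it
  -- combines with `κ_0` to the trivial sign.
  · have h2 : ⌊((n : ℚ) - 1) * (-pairing (fundWt 1) (fundWt 0 : Weight n)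
        + ((n : ℚ) - (0 : ℕ)) / n)⌋ = (n - 1 : ℕ) := by
      rw [pairing_fundWt_fundWt (by omega) (by omega)]
      simp only [Nat.min_zero, Nat.cast_zero, zero_mul, zero_div, neg_zero, zero_add, sub_zero]
      rw [div_self hn, mul_one, Int.floor_eq_iff]
      push_cast [show 1 ≤ n by omega]
      constructor <;> linarith
    rw [h2, show (fundWt 0 : Weight n) = 0 by funext b; simp [fundWt]]
    have h3 := sgn_zero_right (K := K) (compWt 0 : Weight n)
    rw [sgn] at h3
    rw [h3, if_pos rfl, zpow_natCast, Nat.sub_zero]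
    obtain ⟨m, rfl⟩ : ∃ m, n = m + 1 := ⟨n - 1, by omega⟩
    rw [Nat.choose_succ_succ' m 1, Nat.add_sub_cancel, Nat.choose_one_right, pow_add]
    push_cast
    linear_combination (((-1 : K) ^ m.choose (1 + 1)) * (-1) ^ m.choose (1 + 1)) *
      neg_one_pow_sq (K := K) m + neg_one_pow_sq (K := K) (m.choose (1 + 1))
  · have h2 : ⌊((n : ℚ) - 1) * (-pairing (fundWt 1) (fundWt i : Weight n)
        + ((n : ℚ) - i) / n)⌋ = 0 := by
      rw [pairing_fundWt_fundWt (by omega) hi.le, min_eq_left (by omega), max_eq_right (by omega),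
        Int.floor_eq_zero_iff]
      convert Set.left_mem_Ico.mpr (zero_lt_one (α := ℚ)) using 1
      field_simp
      push_cast
      ring
    rw [h2, zpow_zero, one_mul, latticeSign_compWt_fundWt hi0 hi le_rfl hi.le, if_neg hi0.ne']
    push_cast
    rw [mul_one, neg_one_pow_sq]

end ZeroModes


/-! ### Existence of the vertex operators -/

section Existence

variable {n : ℕ} {K : Type*} [Field K] {s : K}

theorem pairL_eq_zero {S : Type*} [CommRing S] {A : ℤ → S} (hA : ∀ m < 0, A m = 0)
    (Q : Polynomial S) : ∃ N : ℤ, ∀ m < N, pairL A m Q = 0 := by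
  induction Q using Polynomial.induction_on' with
  | add p q hp hq =>
    obtain ⟨M, hM⟩ := hp
    obtain ⟨N, hN⟩ := hq
    refine ⟨min M N, fun m hm => ?_⟩
    rw [map_add, hM m (lt_of_lt_of_le hm (min_le_left _ _)),
      hN m (lt_of_lt_of_le hm (min_le_right _ _)), add_zero]
  | monomial t r =>
    refine ⟨-(t : ℤ), fun m hm => ?_⟩
    rw [pairL_monomial, hA _ (by omega), zero_mul]

theorem VOData.exists_op_eq_zero (D : VOData n K) (v : TotalFock n K) :
    ∃ N : ℤ, ∀ m < N, D.op m v = 0 := by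
  induction v using Finsupp.induction_linear with
  | zero => exact ⟨0, fun m _ => map_zero _⟩
  | add v w hv hw =>
    obtain ⟨M, hM⟩ := hv
    obtain ⟨N, hN⟩ := hw
    refine ⟨min M N, fun m hm => ?_⟩
    rw [map_add, hM m (lt_of_lt_of_le hm (min_le_left _ _)),
      hN m (lt_of_lt_of_le hm (min_le_right _ _)), add_zero]
  | single x p =>
    obtain ⟨N, hN⟩ := pairL_eq_zero (fun m hm => creCoeff_of_neg D.F hm) (transl D.H p)
    refine ⟨N + D.e x, fun m hm => ?_⟩
    rw [VOData.op_single, mode_apply, hN _ (by omega), smul_zero, Finsupp.single_zero]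

theorem mode_one (F H : ℕ → Fin (n - 1) → K) (m : ℤ) : mode F H m 1 = creCoeff F m := by
  rw [mode_apply, map_one, ← Polynomial.monomial_zero_one, pairL_monomial]
  simp

theorem creForm_zero (k : ℕ) : creForm (fun _ _ => 0 : ℕ → Fin (n - 1) → K) k = 0 := by
  simp [creForm]

theorem annDer_zero (k : ℕ) : annDer (fun _ _ => 0 : ℕ → Fin (n - 1) → K) k = 0 := by
  apply MvPolynomial.derivation_ext
  intro p
  rw [annDer_X]
  simp

theorem isLaurent_of_coe {a b : ℕ} {Φ : Components n K a b} {D : Fin n → VOData n K}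
    (h : ∀ j m v, ((Φ j m v : Fock n K b) : TotalFock n K) = (D j).op m v) : IsLaurent Φ := by
  intro j v
  obtain ⟨N, hN⟩ := (D j).exists_op_eq_zero v
  exact ⟨N, fun m hm => Subtype.ext (by rw [h, hN m hm]; rfl)⟩

section

variable {σ : ℤ} (W : VertexFamily n s σ)

theorem data_γ (c : ℤ) (l : Fin (n - 1)) (j : ℕ) : (W.data c j).γ l
    = σ * ((if (l : ℕ) + 1 = j then 1 else 0) - if (l : ℕ) = j then 1 else 0) := by
  rw [← compWt_apply]
  rfl

theorem data_γ_hi (c : ℤ) (l : Fin (n - 1)) : (W.data c ((l : ℕ) + 1)).γ l = σ := by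
  rw [data_γ, if_pos rfl, if_neg (by omega)]; ring

theorem data_γ_lo (c : ℤ) (l : Fin (n - 1)) : (W.data c l).γ l = -σ := by
  rw [data_γ, if_neg (by omega), if_pos rfl]; ring

end

variable [CharZero K]

theorem constantCoeff_creCoeff (F : ℕ → Fin (n - 1) → K) (m : ℤ) :
    MvPolynomial.constantCoeff (creCoeff F m) = if m = 0 then 1 else 0 := by
  rw [creCoeff]
  split_ifs with h1 h2 h2
  · subst h2; simp [expCoeff_zero]
  · have h := expCoeff_map (K := K) (MvPolynomial.aeval (fun _ => (0 : K)) : Osc n K →ₐ[K] K)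
      (creForm F) m.toNat
    rw [expCoeff_of_eq_zero (f := fun k => MvPolynomial.aeval (fun _ => (0 : K)) (creForm F k))
      (fun k _ => by simp [creForm, map_sum]), if_neg (by omega)] at h
    have e : ∀ p : Osc n K, MvPolynomial.aeval (fun _ => (0 : K)) p
        = MvPolynomial.constantCoeff p := fun p => by
      rw [MvPolynomial.aeval_eq_constantCoeff_of_vars (fun _ _ => rfl)]; rfl
    rw [← e]
    exact h
  · omega
  · simp

/-- Transfers the operators to the total Fock space, where all relations were established
irrespective of the coset. -/
theorem coe_fockMode (D : VOData n K) {f g : ℕ → Module.End K (Osc n K)} {γ : Weight n}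
    {κ : Weight n → K} {e : Weight n → ℤ} (hγ : D.γ = γ) (hκ : D.κ = κ) (he : D.e = e)
    (hf : ∀ k, 0 < k → f k = LinearMap.mulLeft K (creForm D.F k))
    (hg : ∀ k, 0 < k → g k = (annDer D.H k).toLinearMap) (m : ℤ) (i i' : ℕ)
    (h : ∀ x ∈ wtCoset n i, γ + x ∈ wtCoset n i') (v : Fock n K i) :
    ((fockMode f g γ κ e m i i' h v : Fock n K i') : TotalFock n K) = D.op m v := by
  subst hγ hκ he
  rw [← D.totalMode_eq_op hf hg]
  rfl

theorem coe_current (ε : ℤ) (l : Fin (n - 1)) (i : ℕ) (a : ℤ) (v : Fock n K i) :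
    ((current s ε l i a v : Fock n K i) : TotalFock n K) = (currentD s ε l).op a v :=
  coe_fockMode (currentD s ε l) rfl rfl rfl
    (fun _ hk => smul_heis_neg s l (fun k => (ε : K) * s ^ (-ε * k) / qInt s k) hk)
    (fun _ hk => smul_heis_pos s l (fun k => -(ε : K) * s ^ (-ε * k) / qInt s k) hk) a i i _ v

theorem coe_phiCur (l : Fin (n - 1)) (i : ℕ) (a : ℤ) (v : Fock n K i) :
    ((phiCur s l i a v : Fock n K i) : TotalFock n K) = (phiD s l).op a v :=
  coe_fockMode (phiD s l) rfl rfl rfl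
    (fun _ hk => smul_heis_neg s l (fun _ => -(s ^ 2 - (s ^ 2)⁻¹)) hk)
    (fun k _ => by
      show 0 = (annDer (fun _ _ => (0 : K)) k).toLinearMap
      rw [annDer_zero]; rfl) a i i _ v

theorem coe_psiCur (l : Fin (n - 1)) (i : ℕ) (a : ℤ) (v : Fock n K i) :
    ((psiCur s l i a v : Fock n K i) : TotalFock n K) = (psiD s l).op a v :=
  coe_fockMode (psiD s l) rfl rfl rfl
    (fun k _ => by
      show 0 = LinearMap.mulLeft K (creForm (fun _ _ => (0 : K)) k)
      rw [creForm_zero, LinearMap.mulLeft_zero_eq_zero])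
    (fun _ hk => smul_heis_pos s l (fun _ => s ^ 2 - (s ^ 2)⁻¹) hk) a i i _ v

section Vertex

variable (hs0 : s ≠ 0) (hs : ∀ m : ℕ, 0 < m → s ^ m ≠ 1) {i : ℕ} (hi' : i < n)
include hs

theorem coe_typeI (j : Fin n) (m : ℤ) (v : Fock n K (i + 1)) :
    ((typeI s i hi' j m v : Fock n K i) : TotalFock n K)
      = ((vertexFamily n hs0 i).data 2 j).op m v :=
  coe_fockMode ((vertexFamily n hs0 i).data 2 j) (one_smul _ _) rfl rfl
    (fun k hk => by
      show creExp s j 3 1 k = LinearMap.mulLeft K (creForm (bosonF s 1 j 2) k)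
      rw [← creExp_eq s 1 (j : ℕ) 2 hk]; simp)
    (fun k hk => by
      show annExp s j (-1) 1 k = (annDer (bosonH s 1 j 2) k).toLinearMap
      rw [← annExp_eq hs0 hs 1 j.2 2 hk]; simp) m (i + 1) i _ v

theorem coe_typeII (j : Fin n) (m : ℤ) (v : Fock n K (i + 1)) :
    ((typeII s i hi' j m v : Fock n K i) : TotalFock n K)
      = ((vertexFamily n hs0 i).data 0 j).op m v :=
  coe_fockMode ((vertexFamily n hs0 i).data 0 j) (one_smul _ _) rfl rfl
    (fun k hk => by
      show creExp s j 1 (-1) k = LinearMap.mulLeft K (creForm (bosonF s 1 j 0) k)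
      rw [← creExp_eq s 1 (j : ℕ) 0 hk]; simp)
    (fun k hk => by
      show annExp s j (-3) (-1) k = (annDer (bosonH s 1 j 0) k).toLinearMap
      rw [← annExp_eq hs0 hs 1 j.2 0 hk]; simp) m (i + 1) i _ v

theorem coe_dualTypeI (j : Fin n) (m : ℤ) (v : Fock n K i) :
    ((dualTypeI s i hi' j m v : Fock n K (i + 1)) : TotalFock n K)
      = ((dualFamily n hs0 i).data 2 j).op m v :=
  coe_fockMode ((dualFamily n hs0 i).data 2 j)
    (show (-1 : ℤ) • compWt (j : ℕ) = _ by rw [neg_one_zsmul, neg_sub, sub_eq_neg_add]) rfl rfl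
    (fun k hk => by
      show -creExp s j 3 1 k = LinearMap.mulLeft K (creForm (bosonF s (-1) j 2) k)
      rw [← creExp_eq s (-1) (j : ℕ) 2 hk, Int.cast_neg, Int.cast_one]; exact (neg_one_smul K _).symm)
    (fun k hk => by
      show -annExp s j (-1) 1 k = (annDer (bosonH s (-1) j 2) k).toLinearMap
      rw [← annExp_eq hs0 hs (-1) j.2 2 hk, Int.cast_neg, Int.cast_one]; exact (neg_one_smul K _).symm) m i (i + 1) _ v

theorem coe_dualTypeII (j : Fin n) (m : ℤ) (v : Fock n K i) :
    ((dualTypeII s i hi' j m v : Fock n K (i + 1)) : TotalFock n K)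
      = ((dualFamily n hs0 i).data 0 j).op m v :=
  coe_fockMode ((dualFamily n hs0 i).data 0 j)
    (show (-1 : ℤ) • compWt (j : ℕ) = _ by rw [neg_one_zsmul, neg_sub, sub_eq_neg_add]) rfl rfl
    (fun k hk => by
      show -creExp s j 1 (-1) k = LinearMap.mulLeft K (creForm (bosonF s (-1) j 0) k)
      rw [← creExp_eq s (-1) (j : ℕ) 0 hk, Int.cast_neg, Int.cast_one]; exact (neg_one_smul K _).symm)
    (fun k hk => by
      show -annExp s j (-3) (-1) k = (annDer (bosonH s (-1) j 0) k).toLinearMap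
      rw [← annExp_eq hs0 hs (-1) j.2 0 hk, Int.cast_neg, Int.cast_one]; exact (neg_one_smul K _).symm) m i (i + 1) _ v

end Vertex

/-- On the vacuum only the creation exponential survives, and its constant coefficient is
concentrated in degree `0`. -/
theorem vacCoeff_of_coe {a b : ℕ} {Φ : Fock n K a →ₗ[K] Fock n K b} {D : VOData n K} {m : ℤ}
    (h : ∀ v, ((Φ v : Fock n K b) : TotalFock n K) = D.op m v)
    (hγ : D.γ + fundWt a = fundWt b) (he : D.e (fundWt a) = 0)
    (hκ : D.κ (fundWt a) * sgn K D.γ (fundWt a) = 1) :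
    vacCoeff b (Φ (vac n K a)) = if m = 0 then 1 else 0 := by
  rw [vacCoeff, h, vac, VOData.op_single, hγ, Finsupp.single_eq_same, he, hκ, one_smul, sub_zero,
    mode_one, constantCoeff_creCoeff]

section Components

variable {σ : ℤ} (W : VertexFamily n s σ)

theorem contr_data_phi_hi (hs0 : s ≠ 0) (hs : ∀ m : ℕ, 0 < m → s ^ m ≠ 1) (c : ℤ)
    (l : Fin (n - 1)) (k : ℕ) :
    contr (W.data c ((l : ℕ) + 1)).H (phiF s l) k = (σ : K) *
      ((s ^ (-2 * ((l : ℤ) + 1) + c - 1)) ^ k / k - (s ^ (-2 * ((l : ℤ) + 1) + c - 5)) ^ k / k) := by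
  refine (contr_bosonH_phiF hs0 hs σ c l _ k).trans ?_
  rw [if_pos rfl, if_neg (by omega)]
  push_cast
  ring

theorem contr_data_phi_lo (hs0 : s ≠ 0) (hs : ∀ m : ℕ, 0 < m → s ^ m ≠ 1) (c : ℤ)
    (l : Fin (n - 1)) (k : ℕ) :
    contr (W.data c l).H (phiF s l) k = -(σ : K) *
      ((s ^ (-2 * (l : ℤ) + c + 1)) ^ k / k - (s ^ (-2 * (l : ℤ) + c - 3)) ^ k / k) := by
  refine (contr_bosonH_phiF hs0 hs σ c l _ k).trans ?_
  rw [if_neg (by omega), if_pos rfl]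
  ring

theorem contr_data_psi_hi (hs0 : s ≠ 0) (hs : ∀ m : ℕ, 0 < m → s ^ m ≠ 1) (c : ℤ)
    (l : Fin (n - 1)) {k : ℕ} (hk : 0 < k) :
    contr (psiH s l) (W.data c ((l : ℕ) + 1)).F k = (σ : K) *
      ((s ^ (2 * ((l : ℤ) + 1) + c + 3)) ^ k / k - (s ^ (2 * ((l : ℤ) + 1) + c - 1)) ^ k / k) := by
  have := l.2
  refine (contr_psiH_bosonF hs0 hs σ c l (by omega) hk).trans ?_
  rw [if_pos rfl, if_neg (by omega)]
  push_cast
  ring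

theorem contr_data_psi_lo (hs0 : s ≠ 0) (hs : ∀ m : ℕ, 0 < m → s ^ m ≠ 1) (c : ℤ)
    (l : Fin (n - 1)) {k : ℕ} (hk : 0 < k) :
    contr (psiH s l) (W.data c l).F k = -(σ : K) *
      ((s ^ (2 * (l : ℤ) + c + 1)) ^ k / k - (s ^ (2 * (l : ℤ) + c - 3)) ^ k / k) := by
  have := l.2
  refine (contr_psiH_bosonF hs0 hs σ c l (by omega) hk).trans ?_
  rw [if_neg (by omega), if_pos rfl]
  ring

theorem phi_comm (hs0 : s ≠ 0) (hs : ∀ m : ℕ, 0 < m → s ^ m ≠ 1) (c : ℤ)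
    (l : Fin (n - 1)) {j : ℕ} (h₁ : (l : ℕ) + 1 ≠ j) (h₂ : (l : ℕ) ≠ j) (a b : ℤ) :
    (phiD s l).op a * (W.data c j).op b = (W.data c j).op b * (phiD s l).op a := by
  refine Finsupp.lhom_ext fun x p => ?_
  rw [Module.End.mul_apply, Module.End.mul_apply, phi_op_op l _ x p hs0, op_phi_op l _ x p]
  congr 1
  funext k
  have hc : ∀ k, 0 < k → contr (W.data c j).H (phiF s l) k = 0 := fun k _ => by
    refine (contr_bosonH_phiF hs0 hs σ c l _ k).trans ?_
    rw [if_neg h₁, if_neg h₂]; ring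
  rw [data_γ, if_neg h₁, if_neg h₂, serW, expCoeff_of_eq_zero hc, sub_self, mul_zero, neg_zero,
    zpow_zero, one_mul]
  split_ifs <;> first | omega | rfl

theorem psi_comm (hs0 : s ≠ 0) (hs : ∀ m : ℕ, 0 < m → s ^ m ≠ 1) (c : ℤ)
    (l : Fin (n - 1)) {j : ℕ} (hj : j < n) (h₁ : (l : ℕ) + 1 ≠ j) (h₂ : (l : ℕ) ≠ j) (a b : ℤ) :
    (psiD s l).op a * (W.data c j).op b = (W.data c j).op b * (psiD s l).op a := by
  refine Finsupp.lhom_ext fun x p => ?_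
  rw [Module.End.mul_apply, Module.End.mul_apply, psi_op_op l _ x p hs0, op_psi_op l _ x p]
  congr 1
  funext k
  have hc : ∀ k, 0 < k → contr (psiH s l) (W.data c j).F k = 0 := fun k hk => by
    refine (contr_psiH_bosonF hs0 hs σ c l hj hk).trans ?_
    rw [if_neg h₁, if_neg h₂]; ring
  rw [data_γ, if_neg h₁, if_neg h₂, serZ, expCoeff_of_eq_zero hc, sub_self, mul_zero,
    zpow_zero, one_mul]
  split_ifs <;> first | omega | rfl

end Components

theorem ne_of_ne_lo {l : Fin (n - 1)} {j : Fin n} (h : j ≠ lo l) : (l : ℕ) ≠ j :=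
  fun h' => h (Fin.ext h'.symm)

theorem ne_of_ne_hi {l : Fin (n - 1)} {j : Fin n} (h : j ≠ hi l) : (l : ℕ) + 1 ≠ j :=
  fun h' => h (Fin.ext h'.symm)

end Existence


/-! ### The bosonic formulas satisfy the defining relations. -/

section ExistenceTheorems

theorem apply_apply_comm {R V : Type*} [CommRing R] [AddCommGroup V] [Module R V]
    {A B : Module.End R V} (h : A * B = B * A) (v : V) : A (B v) = B (A v) :=
  LinearMap.congr_fun h v

variable {n : ℕ} {K : Type*} [Field K] [CharZero K] {s : K}
variable (hs0 : s ≠ 0) (hs : ∀ m : ℕ, 0 < m → s ^ m ≠ 1)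
include hs0 hs

theorem vertex_phi_lo (W : VertexFamily n s 1) (c : ℤ) (l : Fin (n - 1)) {e f : ℤ}
    (he : e = -2 * ((l : ℤ) + 1) + c + 1) (hf : f = -2 * ((l : ℤ) + 1) + c - 1) (v : TotalFock n K) :
    IsSeriesMul (fracW (s ^ 2)⁻¹ (s ^ e) (s ^ f))
      (fun a b => (phiD s l).op a ((W.data c l).op b v))
      (fun a b => (W.data c l).op b ((phiD s l).op a v)) := by
  subst he hf
  refine isSeriesMul_phi hs0 l _ (X := s ^ (-2 * ((l : ℤ) + 1) + c + 3)) (fun k hk => ?_) ?_ ?_ v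
  · rw [contr_data_phi_lo W hs0 hs c l _,
      show -2 * (l : ℤ) + c + 1 = -2 * ((l : ℤ) + 1) + c + 3 by ring,
      show -2 * (l : ℤ) + c - 3 = -2 * ((l : ℤ) + 1) + c - 1 by ring]
    push_cast
    ring
  · rw [data_γ_lo]; norm_num
  · simp only [sq_eq_zpow s, ← zpow_neg, ← zpow_add₀ hs0]
    congr 1; ring

theorem vertex_phi_hi (W : VertexFamily n s 1) (c : ℤ) (l : Fin (n - 1)) {e f : ℤ}
    (he : e = -2 * ((l : ℤ) + 1) + c - 3) (hf : f = -2 * ((l : ℤ) + 1) + c - 1) (v : TotalFock n K) :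
    IsSeriesMul (fracW (s ^ 2) (s ^ e) (s ^ f))
      (fun a b => (phiD s l).op a ((W.data c ((l : ℕ) + 1)).op b v))
      (fun a b => (W.data c ((l : ℕ) + 1)).op b ((phiD s l).op a v)) := by
  subst he hf
  refine isSeriesMul_phi hs0 l _ (X := s ^ (-2 * ((l : ℤ) + 1) + c - 5)) (fun k hk => ?_) ?_ ?_ v
  · rw [contr_data_phi_hi W hs0 hs c l _]
    push_cast
    ring
  · rw [data_γ_hi]; norm_num
  · simp only [sq_eq_zpow s, ← zpow_add₀ hs0]
    congr 1; ring

theorem vertex_psi_lo (W : VertexFamily n s 1) (c : ℤ) (l : Fin (n - 1)) {e f : ℤ}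
    (he : e = 2 * ((l : ℤ) + 1) + c - 3) (hf : f = 2 * ((l : ℤ) + 1) + c - 1) (v : TotalFock n K) :
    IsSeriesMul (fracZ (s ^ 2) (s ^ e) (s ^ f))
      (fun a b => (psiD s l).op a ((W.data c l).op b v))
      (fun a b => (W.data c l).op b ((psiD s l).op a v)) := by
  subst he hf
  refine isSeriesMul_psi hs0 l _ (Y := s ^ (2 * ((l : ℤ) + 1) + c - 5)) (fun k hk => ?_) ?_ ?_ v
  · rw [contr_data_psi_lo W hs0 hs c l hk,
      show 2 * (l : ℤ) + c + 1 = 2 * ((l : ℤ) + 1) + c - 1 by ring,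
      show 2 * (l : ℤ) + c - 3 = 2 * ((l : ℤ) + 1) + c - 5 by ring]
    push_cast
    ring
  · rw [data_γ_lo]; norm_num
  · simp only [sq_eq_zpow s, ← zpow_add₀ hs0]
    congr 1; ring

theorem vertex_psi_hi (W : VertexFamily n s 1) (c : ℤ) (l : Fin (n - 1)) {e f : ℤ}
    (he : e = 2 * ((l : ℤ) + 1) + c + 1) (hf : f = 2 * ((l : ℤ) + 1) + c - 1) (v : TotalFock n K) :
    IsSeriesMul (fracZ (s ^ 2)⁻¹ (s ^ e) (s ^ f))
      (fun a b => (psiD s l).op a ((W.data c ((l : ℕ) + 1)).op b v))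
      (fun a b => (W.data c ((l : ℕ) + 1)).op b ((psiD s l).op a v)) := by
  subst he hf
  refine isSeriesMul_psi hs0 l _ (Y := s ^ (2 * ((l : ℤ) + 1) + c + 3)) (fun k hk => ?_) ?_ ?_ v
  · rw [contr_data_psi_hi W hs0 hs c l hk]
    push_cast
    ring
  · rw [data_γ_hi]; norm_num
  · simp only [sq_eq_zpow s, ← zpow_neg, ← zpow_add₀ hs0]
    congr 1; ring

theorem dual_phi_lo (W : VertexFamily n s (-1)) (c : ℤ) (l : Fin (n - 1)) {e f : ℤ}
    (he : e = -2 * ((l : ℤ) + 1) + c + 1) (hf : f = -2 * ((l : ℤ) + 1) + c - 1) (v : TotalFock n K) :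
    IsSeriesMul (fracW (s ^ 2)⁻¹ (s ^ e) (s ^ f))
      (fun a b => (W.data c l).op b ((phiD s l).op a v))
      (fun a b => (phiD s l).op a ((W.data c l).op b v)) := by
  subst he hf
  refine isSeriesMul_phi_dual hs0 l _ (Y := s ^ (-2 * ((l : ℤ) + 1) + c + 3)) (fun k hk => ?_) ?_ ?_ v
  · rw [contr_data_phi_lo W hs0 hs c l _,
      show -2 * (l : ℤ) + c + 1 = -2 * ((l : ℤ) + 1) + c + 3 by ring,
      show -2 * (l : ℤ) + c - 3 = -2 * ((l : ℤ) + 1) + c - 1 by ring]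
    push_cast
    ring
  · rw [data_γ_lo]; norm_num
  · simp only [sq_eq_zpow s, ← zpow_neg, ← zpow_add₀ hs0]
    congr 1; ring

theorem dual_phi_hi (W : VertexFamily n s (-1)) (c : ℤ) (l : Fin (n - 1)) {e f : ℤ}
    (he : e = -2 * ((l : ℤ) + 1) + c - 3) (hf : f = -2 * ((l : ℤ) + 1) + c - 1) (v : TotalFock n K) :
    IsSeriesMul (fracW (s ^ 2) (s ^ e) (s ^ f))
      (fun a b => (W.data c ((l : ℕ) + 1)).op b ((phiD s l).op a v))
      (fun a b => (phiD s l).op a ((W.data c ((l : ℕ) + 1)).op b v)) := by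
  subst he hf
  refine isSeriesMul_phi_dual hs0 l _ (Y := s ^ (-2 * ((l : ℤ) + 1) + c - 5)) (fun k hk => ?_) ?_ ?_ v
  · rw [contr_data_phi_hi W hs0 hs c l _]
    push_cast
    ring
  · rw [data_γ_hi]; norm_num
  · simp only [sq_eq_zpow s, ← zpow_add₀ hs0]
    congr 1; ring

theorem dual_psi_lo (W : VertexFamily n s (-1)) (c : ℤ) (l : Fin (n - 1)) {e f : ℤ}
    (he : e = 2 * ((l : ℤ) + 1) + c - 3) (hf : f = 2 * ((l : ℤ) + 1) + c - 1) (v : TotalFock n K) :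
    IsSeriesMul (fracZ (s ^ 2) (s ^ e) (s ^ f))
      (fun a b => (W.data c l).op b ((psiD s l).op a v))
      (fun a b => (psiD s l).op a ((W.data c l).op b v)) := by
  subst he hf
  refine isSeriesMul_psi_dual hs0 l _ (X := s ^ (2 * ((l : ℤ) + 1) + c - 5)) (fun k hk => ?_) ?_ ?_ v
  · rw [contr_data_psi_lo W hs0 hs c l hk,
      show 2 * (l : ℤ) + c + 1 = 2 * ((l : ℤ) + 1) + c - 1 by ring,
      show 2 * (l : ℤ) + c - 3 = 2 * ((l : ℤ) + 1) + c - 5 by ring]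
    push_cast
    ring
  · rw [data_γ_lo]; norm_num
  · simp only [sq_eq_zpow s, ← zpow_add₀ hs0]
    congr 1; ring

theorem dual_psi_hi (W : VertexFamily n s (-1)) (c : ℤ) (l : Fin (n - 1)) {e f : ℤ}
    (he : e = 2 * ((l : ℤ) + 1) + c + 1) (hf : f = 2 * ((l : ℤ) + 1) + c - 1) (v : TotalFock n K) :
    IsSeriesMul (fracZ (s ^ 2)⁻¹ (s ^ e) (s ^ f))
      (fun a b => (W.data c ((l : ℕ) + 1)).op b ((psiD s l).op a v))
      (fun a b => (psiD s l).op a ((W.data c ((l : ℕ) + 1)).op b v)) := by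
  subst he hf
  refine isSeriesMul_psi_dual hs0 l _ (X := s ^ (2 * ((l : ℤ) + 1) + c + 3)) (fun k hk => ?_) ?_ ?_ v
  · rw [contr_data_psi_hi W hs0 hs c l hk]
    push_cast
    ring
  · rw [data_γ_hi]; norm_num
  · simp only [sq_eq_zpow s, ← zpow_neg, ← zpow_add₀ hs0]
    congr 1; ring

variable {i : ℕ} (hi' : i < n)

theorem isTypeI_typeI (hn2 : 2 ≤ n) : IsTypeI s i hi' (typeI (n := n) s i hi') where
  laurent := isLaurent_of_coe (coe_typeI hs0 hs hi')
  normalized _ := vacCoeff_of_coe (coe_typeI hs0 hs hi' ⟨i, hi'⟩ _)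
    (show (1 : ℤ) • (compWt i : Weight n) + fundWt (i + 1) = _ by rw [one_zsmul, sub_add_cancel])
    (vertexZExp_fundWt hi')
    (show vertexScalar s i i (fundWt (i + 1)) * sgn K ((1 : ℤ) • compWt i) (fundWt (i + 1)) = 1 by
      rw [one_zsmul, vertexScalar_fundWt hn2 hi'])
  xPlus_lo l v := isSeriesMul_of_coe (by
    simp only [coe_typeI hs0 hs hi', coe_current, coe_phiCur, AddSubgroupClass.coe_sub,
      Submodule.coe_smul]
    exact xPlus_delta_phi hs0 hs (vertexFamily n hs0 i) rfl l v)
  xPlus_ne l j h₁ v a b := by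
    by_cases h₂ : j = hi l
    · subst h₂
      exact Subtype.ext (by
        simp only [coe_typeI hs0 hs hi', coe_current, hi]
        exact Eq.symm <| apply_apply_comm (current_comm_hi (vertexFamily n hs0 i) hs0 hs (Or.inl rfl) (c := 2) rfl l a b) _)
    · exact Subtype.ext (by
        simp only [coe_typeI hs0 hs hi', coe_current]
        exact Eq.symm <| apply_apply_comm (current_comm (vertexFamily n hs0 i) hs0 hs (ε := 1) (by decide) (Or.inl rfl) 2 l j.2
          (ne_of_ne_hi h₂) (ne_of_ne_lo h₁) a b) _)
  xMinus_lo l v := isSeriesMul_of_coe (by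
    simp only [coe_typeI hs0 hs hi', coe_current]
    exact typeI_xMinus_lo hs0 hs (vertexFamily n hs0 i) l v)
  xMinus_hi l v := isSeriesMul_of_coe (by
    simp only [coe_typeI hs0 hs hi', coe_current, AddSubgroupClass.coe_sub,
      Submodule.coe_smul]
    exact typeI_xMinus_hi hs0 hs (vertexFamily n hs0 i) rfl l v)
  xMinus_ne l j h₁ h₂ v a b := Subtype.ext (by
    simp only [coe_typeI hs0 hs hi', coe_current]
    exact Eq.symm <| apply_apply_comm (current_comm (vertexFamily n hs0 i) hs0 hs (ε := -1) (by decide) (Or.inl rfl) 2 l j.2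
      (ne_of_ne_hi h₂) (ne_of_ne_lo h₁) a b) _)
  phi_lo l v := isSeriesMul_of_coe (by
    simp only [coe_typeI hs0 hs hi', coe_phiCur]
    exact vertex_phi_lo hs0 hs (vertexFamily n hs0 i) 2 l (by ring) (by ring) v)
  phi_hi l v := isSeriesMul_of_coe (by
    simp only [coe_typeI hs0 hs hi', coe_phiCur]
    exact vertex_phi_hi hs0 hs (vertexFamily n hs0 i) 2 l (by ring) (by ring) v)
  phi_ne l j h₁ h₂ v a b := Subtype.ext (by
    simp only [coe_typeI hs0 hs hi', coe_phiCur]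
    exact Eq.symm <| apply_apply_comm (phi_comm (vertexFamily n hs0 i) hs0 hs 2 l (ne_of_ne_hi h₂) (ne_of_ne_lo h₁) a b) _)
  psi_lo l v := isSeriesMul_of_coe (by
    simp only [coe_typeI hs0 hs hi', coe_psiCur]
    exact vertex_psi_lo hs0 hs (vertexFamily n hs0 i) 2 l (by ring) (by ring) v)
  psi_hi l v := isSeriesMul_of_coe (by
    simp only [coe_typeI hs0 hs hi', coe_psiCur]
    exact vertex_psi_hi hs0 hs (vertexFamily n hs0 i) 2 l (by ring) (by ring) v)
  psi_ne l j h₁ h₂ v a b := Subtype.ext (by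
    simp only [coe_typeI hs0 hs hi', coe_psiCur]
    exact Eq.symm <| apply_apply_comm (psi_comm (vertexFamily n hs0 i) hs0 hs 2 l j.2 (ne_of_ne_hi h₂) (ne_of_ne_lo h₁) a b) _)

theorem isTypeII_typeII (hn2 : 2 ≤ n) : IsTypeII s i hi' (typeII (n := n) s i hi') where
  laurent := isLaurent_of_coe (coe_typeII hs0 hs hi')
  normalized _ := vacCoeff_of_coe (coe_typeII hs0 hs hi' ⟨i, hi'⟩ _)
    (show (1 : ℤ) • (compWt i : Weight n) + fundWt (i + 1) = _ by rw [one_zsmul, sub_add_cancel])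
    (vertexZExp_fundWt hi')
    (show vertexScalar s i i (fundWt (i + 1)) * sgn K ((1 : ℤ) • compWt i) (fundWt (i + 1)) = 1 by
      rw [one_zsmul, vertexScalar_fundWt hn2 hi'])
  xPlus_lo l v := isSeriesMul_of_coe (by
    simp only [coe_typeII hs0 hs hi', coe_current, AddSubgroupClass.coe_sub,
      Submodule.coe_smul]
    exact typeII_xPlus_lo hs0 hs (vertexFamily n hs0 i) rfl l v)
  xPlus_hi l v := isSeriesMul_of_coe (by
    simp only [coe_typeII hs0 hs hi', coe_current]
    exact typeII_xPlus_hi hs0 hs (vertexFamily n hs0 i) l v)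
  xPlus_ne l j h₁ h₂ v a b := Subtype.ext (by
    simp only [coe_typeII hs0 hs hi', coe_current]
    exact Eq.symm <| apply_apply_comm (current_comm (vertexFamily n hs0 i) hs0 hs (ε := 1) (by decide) (Or.inl rfl) 0 l j.2
      (ne_of_ne_hi h₂) (ne_of_ne_lo h₁) a b) _)
  xMinus_hi l v a b := Subtype.ext (by
    simp only [coe_typeII hs0 hs hi', coe_current, AddSubgroupClass.coe_sub,
      Submodule.coe_smul]
    -- The relation of type II has the commutator in the opposite order, hence the change of sign.
    have h := current_local_hi (vertexFamily n hs0 i) hs0 hs (Or.inl rfl) (c := 0) rfl l v a b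
    refine Eq.trans ?_ (neg_eq_zero.mpr h)
    simp only [hi]
    module)
  xMinus_ne l j h₂ v a b := by
    by_cases h₁ : j = lo l
    · subst h₁
      exact Subtype.ext (by
        simp only [coe_typeII hs0 hs hi', coe_current, lo]
        exact Eq.symm <| apply_apply_comm (current_comm_lo (vertexFamily n hs0 i) hs0 hs (Or.inl rfl) (c := 0) rfl l a b) _)
    · exact Subtype.ext (by
        simp only [coe_typeII hs0 hs hi', coe_current]
        exact Eq.symm <| apply_apply_comm (current_comm (vertexFamily n hs0 i) hs0 hs (ε := -1) (by decide) (Or.inl rfl) 0 l j.2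
          (ne_of_ne_hi h₂) (ne_of_ne_lo h₁) a b) _)
  phi_lo l v := isSeriesMul_of_coe (by
    simp only [coe_typeII hs0 hs hi', coe_phiCur]
    exact vertex_phi_lo hs0 hs (vertexFamily n hs0 i) 0 l (by ring) (by ring) v)
  phi_hi l v := isSeriesMul_of_coe (by
    simp only [coe_typeII hs0 hs hi', coe_phiCur]
    exact vertex_phi_hi hs0 hs (vertexFamily n hs0 i) 0 l (by ring) (by ring) v)
  phi_ne l j h₁ h₂ v a b := Subtype.ext (by
    simp only [coe_typeII hs0 hs hi', coe_phiCur]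
    exact Eq.symm <| apply_apply_comm (phi_comm (vertexFamily n hs0 i) hs0 hs 0 l (ne_of_ne_hi h₂) (ne_of_ne_lo h₁) a b) _)
  psi_lo l v := isSeriesMul_of_coe (by
    simp only [coe_typeII hs0 hs hi', coe_psiCur]
    exact vertex_psi_lo hs0 hs (vertexFamily n hs0 i) 0 l (by ring) (by ring) v)
  psi_hi l v := isSeriesMul_of_coe (by
    simp only [coe_typeII hs0 hs hi', coe_psiCur]
    exact vertex_psi_hi hs0 hs (vertexFamily n hs0 i) 0 l (by ring) (by ring) v)
  psi_ne l j h₁ h₂ v a b := Subtype.ext (by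
    simp only [coe_typeII hs0 hs hi', coe_psiCur]
    exact Eq.symm <| apply_apply_comm (psi_comm (vertexFamily n hs0 i) hs0 hs 0 l j.2 (ne_of_ne_hi h₂) (ne_of_ne_lo h₁) a b) _)

theorem isDualTypeI_dualTypeI (hn2 : 2 ≤ n) : IsDualTypeI s i hi' (dualTypeI (n := n) s i hi') where
  laurent := isLaurent_of_coe (coe_dualTypeI hs0 hs hi')
  normalized _ := vacCoeff_of_coe (coe_dualTypeI hs0 hs hi' ⟨i, hi'⟩ _)
    (show (-1 : ℤ) • (compWt i : Weight n) + fundWt i = _ by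
      rw [neg_one_zsmul, neg_sub, sub_add_cancel])
    (dualZExp_fundWt hi')
    (show dualScalar s i i (fundWt (i)) * sgn K ((-1 : ℤ) • compWt i) (fundWt (i)) = 1 by
      rw [neg_one_zsmul, dualScalar_fundWt hn2 hi'])
  xPlus_hi l v a b := Subtype.ext (by
    simp only [coe_dualTypeI hs0 hs hi', coe_current, AddSubgroupClass.coe_sub,
      Submodule.coe_smul]
    exact current_local_hi (dualFamily n hs0 i) hs0 hs (Or.inr rfl) (c := 2) rfl l v a b)
  xPlus_ne l j h₂ v a b := by
    by_cases h₁ : j = lo l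
    · subst h₁
      exact Subtype.ext (by
        simp only [coe_dualTypeI hs0 hs hi', coe_current, lo]
        exact apply_apply_comm (current_comm_lo (dualFamily n hs0 i) hs0 hs (Or.inr rfl) (c := 2) rfl l a b) _)
    · exact Subtype.ext (by
        simp only [coe_dualTypeI hs0 hs hi', coe_current]
        exact apply_apply_comm (current_comm (dualFamily n hs0 i) hs0 hs (ε := 1) (by decide) (Or.inr rfl) 2 l j.2
          (ne_of_ne_hi h₂) (ne_of_ne_lo h₁) a b) _)
  xMinus_lo l v := isSeriesMul_of_coe (by
    simp only [coe_dualTypeI hs0 hs hi', coe_current, AddSubgroupClass.coe_sub,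
      Submodule.coe_smul]
    exact dualTypeI_xMinus_lo hs0 hs (dualFamily n hs0 i) rfl l v)
  xMinus_hi l v := isSeriesMul_of_coe (by
    simp only [coe_dualTypeI hs0 hs hi', coe_current]
    exact dualTypeI_xMinus_hi hs0 hs (dualFamily n hs0 i) l v)
  xMinus_ne l j h₁ h₂ v a b := Subtype.ext (by
    simp only [coe_dualTypeI hs0 hs hi', coe_current]
    exact apply_apply_comm (current_comm (dualFamily n hs0 i) hs0 hs (ε := -1) (by decide) (Or.inr rfl) 2 l j.2
      (ne_of_ne_hi h₂) (ne_of_ne_lo h₁) a b) _)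
  phi_lo l v := isSeriesMul_of_coe (by
    simp only [coe_dualTypeI hs0 hs hi', coe_phiCur]
    exact dual_phi_lo hs0 hs (dualFamily n hs0 i) 2 l (by ring) (by ring) v)
  phi_hi l v := isSeriesMul_of_coe (by
    simp only [coe_dualTypeI hs0 hs hi', coe_phiCur]
    exact dual_phi_hi hs0 hs (dualFamily n hs0 i) 2 l (by ring) (by ring) v)
  phi_ne l j h₁ h₂ v a b := Subtype.ext (by
    simp only [coe_dualTypeI hs0 hs hi', coe_phiCur]
    exact apply_apply_comm (phi_comm (dualFamily n hs0 i) hs0 hs 2 l (ne_of_ne_hi h₂) (ne_of_ne_lo h₁) a b) _)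
  psi_lo l v := isSeriesMul_of_coe (by
    simp only [coe_dualTypeI hs0 hs hi', coe_psiCur]
    exact dual_psi_lo hs0 hs (dualFamily n hs0 i) 2 l (by ring) (by ring) v)
  psi_hi l v := isSeriesMul_of_coe (by
    simp only [coe_dualTypeI hs0 hs hi', coe_psiCur]
    exact dual_psi_hi hs0 hs (dualFamily n hs0 i) 2 l (by ring) (by ring) v)
  psi_ne l j h₁ h₂ v a b := Subtype.ext (by
    simp only [coe_dualTypeI hs0 hs hi', coe_psiCur]
    exact apply_apply_comm (psi_comm (dualFamily n hs0 i) hs0 hs 2 l j.2 (ne_of_ne_hi h₂) (ne_of_ne_lo h₁) a b) _)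

theorem isDualTypeII_dualTypeII (hn2 : 2 ≤ n) : IsDualTypeII s i hi' (dualTypeII (n := n) s i hi') where
  laurent := isLaurent_of_coe (coe_dualTypeII hs0 hs hi')
  normalized _ := vacCoeff_of_coe (coe_dualTypeII hs0 hs hi' ⟨i, hi'⟩ _)
    (show (-1 : ℤ) • (compWt i : Weight n) + fundWt i = _ by
      rw [neg_one_zsmul, neg_sub, sub_add_cancel])
    (dualZExp_fundWt hi')
    (show dualScalar s i i (fundWt (i)) * sgn K ((-1 : ℤ) • compWt i) (fundWt (i)) = 1 by
      rw [neg_one_zsmul, dualScalar_fundWt hn2 hi'])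
  xPlus_lo l v := isSeriesMul_of_coe (by
    simp only [coe_dualTypeII hs0 hs hi', coe_current]
    exact dualTypeII_xPlus_lo hs0 hs (dualFamily n hs0 i) l v)
  xPlus_hi l v := isSeriesMul_of_coe (by
    simp only [coe_dualTypeII hs0 hs hi', coe_current, AddSubgroupClass.coe_sub,
      Submodule.coe_smul]
    exact dualTypeII_xPlus_hi hs0 hs (dualFamily n hs0 i) rfl l v)
  xPlus_ne l j h₁ h₂ v a b := Subtype.ext (by
    simp only [coe_dualTypeII hs0 hs hi', coe_current]
    exact apply_apply_comm (current_comm (dualFamily n hs0 i) hs0 hs (ε := 1) (by decide) (Or.inr rfl) 0 l j.2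
      (ne_of_ne_hi h₂) (ne_of_ne_lo h₁) a b) _)
  xMinus_lo l v := isSeriesMul_of_coe (by
    simp only [coe_dualTypeII hs0 hs hi', coe_current, coe_psiCur, AddSubgroupClass.coe_sub,
      Submodule.coe_smul]
    exact xMinus_delta_psi hs0 hs (dualFamily n hs0 i) rfl l v)
  xMinus_ne l j h₁ v a b := by
    by_cases h₂ : j = hi l
    · subst h₂
      exact Subtype.ext (by
        simp only [coe_dualTypeII hs0 hs hi', coe_current, hi]
        exact apply_apply_comm (current_comm_hi (dualFamily n hs0 i) hs0 hs (Or.inr rfl) (c := 0) rfl l a b) _)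
    · exact Subtype.ext (by
        simp only [coe_dualTypeII hs0 hs hi', coe_current]
        exact apply_apply_comm (current_comm (dualFamily n hs0 i) hs0 hs (ε := -1) (by decide) (Or.inr rfl) 0 l j.2
          (ne_of_ne_hi h₂) (ne_of_ne_lo h₁) a b) _)
  phi_lo l v := isSeriesMul_of_coe (by
    simp only [coe_dualTypeII hs0 hs hi', coe_phiCur]
    exact dual_phi_lo hs0 hs (dualFamily n hs0 i) 0 l (by ring) (by ring) v)
  phi_hi l v := isSeriesMul_of_coe (by
    simp only [coe_dualTypeII hs0 hs hi', coe_phiCur]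
    exact dual_phi_hi hs0 hs (dualFamily n hs0 i) 0 l (by ring) (by ring) v)
  phi_ne l j h₁ h₂ v a b := Subtype.ext (by
    simp only [coe_dualTypeII hs0 hs hi', coe_phiCur]
    exact apply_apply_comm (phi_comm (dualFamily n hs0 i) hs0 hs 0 l (ne_of_ne_hi h₂) (ne_of_ne_lo h₁) a b) _)
  psi_lo l v := isSeriesMul_of_coe (by
    simp only [coe_dualTypeII hs0 hs hi', coe_psiCur]
    exact dual_psi_lo hs0 hs (dualFamily n hs0 i) 0 l (by ring) (by ring) v)
  psi_hi l v := isSeriesMul_of_coe (by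
    simp only [coe_dualTypeII hs0 hs hi', coe_psiCur]
    exact dual_psi_hi hs0 hs (dualFamily n hs0 i) 0 l (by ring) (by ring) v)
  psi_ne l j h₁ h₂ v a b := Subtype.ext (by
    simp only [coe_dualTypeII hs0 hs hi', coe_psiCur]
    exact apply_apply_comm (psi_comm (dualFamily n hs0 i) hs0 hs 0 l j.2 (ne_of_ne_hi h₂) (ne_of_ne_lo h₁) a b) _)

end ExistenceTheorems


/-! ### The oscillator space as a module over the current modes -/

section Oscillator

variable {n : ℕ} {K : Type*} [Field K] {s : K}

theorem mode_C (F H : ℕ → Fin (n - 1) → K) (m : ℤ) (c : K) :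
    mode F H m (MvPolynomial.C c) = creCoeff F m * MvPolynomial.C c := by
  rw [mode_apply, transl_C, ← Polynomial.monomial_zero_left, pairL_monomial]
  simp

theorem creCoeff_zero (F : ℕ → Fin (n - 1) → K) : creCoeff F 0 = 1 := by
  rw [creCoeff, if_pos le_rfl, Int.toNat_zero, expCoeff_zero]

/-- Among the powers of the translation variable the highest one is isolated by the mode `-N`, where
the creation series contributes only its constant term `1`. Thus the translated vector, and with it
`p`, vanishes. -/
theorem eq_zero_of_mode_eq_zero {F H : ℕ → Fin (n - 1) → K} {p : Osc n K}
    (h : ∀ m, mode F H m p = 0) : p = 0 := by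
  have e : transl H p = 0 := by
    rw [← Polynomial.leadingCoeff_eq_zero, Polynomial.leadingCoeff]
    obtain ⟨N, hN⟩ : ∃ N, N = (transl H p).natDegree := ⟨_, rfl⟩
    have h0 := h (-(N : ℤ))
    rw [← hN]
    rw [mode_apply, (transl H p).as_sum_range, ← hN, map_sum, Finset.sum_range_succ,
      Finset.sum_eq_zero, zero_add, pairL_monomial, neg_add_cancel, creCoeff_zero, one_mul] at h0
    · exact h0
    · intro t ht
      rw [pairL_monomial, creCoeff_of_neg _ (by have := Finset.mem_range.mp ht; omega), zero_mul]
  rw [← coeff_zero_transl H p, e, Polynomial.coeff_zero]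

theorem creForm_phiF (l : Fin (n - 1)) (k : ℕ) : creForm (phiF s l) k
    = MvPolynomial.C (-(s ^ 2 - (s ^ 2)⁻¹)) * MvPolynomial.X (l, k - 1) := by
  rw [creForm, Finset.sum_eq_single l]
  · rw [phiF, if_pos rfl]
  · intro b _ hb
    rw [phiF, if_neg hb, map_zero, zero_mul]
  · intro h
    exact absurd (Finset.mem_univ l) h

variable [CharZero K]

/-- The coefficients of the exponentials of the creation parts of the `φ_l` generate the
oscillator space. -/
theorem mem_of_creCoeff_mul_mem (hs0 : s ≠ 0) (hs : ∀ m : ℕ, 0 < m → s ^ m ≠ 1)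
    {S : Submodule K (Osc n K)} (h1 : 1 ∈ S)
    (h : ∀ (l : Fin (n - 1)) (m : ℤ), ∀ p ∈ S, creCoeff (phiF s l) m * p ∈ S) (p : Osc n K) :
    p ∈ S := by
  have key : ∀ (l : Fin (n - 1)) (k : ℕ), ∀ p ∈ S, creForm (phiF s l) (k + 1) * p ∈ S := by
    intro l k
    induction k using Nat.strong_induction_on with
    | _ k ih =>
      intro p hp
      have e := expCoeff_succ (K := K) (f := creForm (phiF s l)) (fun _ _ => mul_comm _ _) k
      rw [Finset.Nat.sum_antidiagonal_eq_sum_range_succ_mk, Finset.sum_range_succ',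
        expCoeff_zero, one_mul, Nat.sub_zero] at e
      -- Newton's recursion between an exponential and its exponent, solved for the exponent: the
      -- linear form number `k + 1` is expressed by exponential coefficients and earlier linear
      -- forms.
      have e2 : ((k : K) + 1) • (creForm (phiF s l) (k + 1) * p)
          = ((k : K) + 1) • (expCoeff (K := K) (creForm (phiF s l)) (k + 1) * p)
            - ∑ j ∈ Finset.range k, ((k - (j + 1) : ℕ) + 1 : K) •
              (expCoeff (K := K) (creForm (phiF s l)) (j + 1) *
                (creForm (phiF s l) (k - (j + 1) + 1) * p)) := by
        have e' := congrArg (· * p) e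
        simp only [add_mul, Finset.sum_mul] at e'
        rw [eq_sub_iff_add_eq', ← smul_mul_assoc ((k : K) + 1) (expCoeff _ _)]
        have c : ∀ (m : ℕ) (q : Osc n K), ((m : K) + 1) • q = (m + 1) • q := fun m q => by
          rw [← Nat.cast_smul_eq_nsmul K]; push_cast; rfl
        simp only [c]
        rw [e', smul_mul_assoc]
        congr 1
        refine Finset.sum_congr rfl fun j _ => ?_
        simp only [nsmul_eq_mul]
        ring
      have hk : ((k : K) + 1) ≠ 0 := by exact_mod_cast Nat.succ_ne_zero k
      rw [← S.smul_mem_iff hk, e2]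
      have hE : ∀ m : ℕ, ∀ p ∈ S, expCoeff (K := K) (creForm (phiF s l)) m * p ∈ S := fun m p hp => by
        rw [← creCoeff_natCast]; exact h l m p hp
      refine S.sub_mem (S.smul_mem _ (hE _ _ hp)) (S.sum_mem fun j hj => S.smul_mem _ (hE _ _ ?_))
      have := Finset.mem_range.mp hj
      exact ih _ (by omega) _ hp
  have hX : ∀ (v : Fin (n - 1) × ℕ), ∀ p ∈ S, MvPolynomial.X v * p ∈ S := by
    rintro ⟨l, k⟩ p hp
    have := key l k p hp
    rw [creForm_phiF, mul_assoc, MvPolynomial.C_mul', S.smul_mem_iff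
      (neg_ne_zero.mpr (q_sub_inv_ne_zero hs0 hs))] at this
    exact this
  induction p using MvPolynomial.induction_on with
  | C a =>
    rw [← mul_one (MvPolynomial.C a), MvPolynomial.C_mul']
    exact S.smul_mem _ h1
  | add p q hp hq => exact S.add_mem hp hq
  | mul_X p v hp =>
    rw [mul_comm]
    exact hX v p hp

theorem eq_C_of_pderiv_eq_zero {σ : Type*} {r : MvPolynomial σ K}
    (h : ∀ v, MvPolynomial.pderiv v r = 0) : r = MvPolynomial.C (MvPolynomial.constantCoeff r) := by
  classical
  ext m
  rw [MvPolynomial.coeff_C]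
  split_ifs with hm
  · rw [← hm]; rfl
  · obtain ⟨v, hv⟩ : ∃ v, m v ≠ 0 := by
      by_contra! hcon
      exact hm (Finsupp.ext fun v => (hcon v).symm)
    have e : m = (m - Finsupp.single v 1) + Finsupp.single v 1 :=
      (tsub_add_cancel_of_le (Finsupp.single_le_iff.mpr (Nat.one_le_iff_ne_zero.mpr hv))).symm
    have h1 := MvPolynomial.coeff_pderiv (i := v) r (m - Finsupp.single v 1)
    rw [h v, MvPolynomial.coeff_zero, ← e] at h1
    refine (mul_eq_zero.mp h1.symm).resolve_right (Nat.cast_add_one_ne_zero _)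

/-- The inverse `q`-Cartan matrix recovers single partial derivatives from the annihilation parts of
the `ψ_l`. -/
theorem sum_dualCoeff_smul_annDer_psiH (hs0 : s ≠ 0) (hs : ∀ m : ℕ, 0 < m → s ^ m ≠ 1)
    (j : Fin (n - 1)) {t : ℕ} (ht : 0 < t) :
    ∑ l : Fin (n - 1), dualCoeff s ((j : ℕ) + 1) t l • annDer (psiH s l) t
      = ((s ^ 2 - (s ^ 2)⁻¹) * (qInt s t / t)) • MvPolynomial.pderiv (j, t - 1) := by
  have hj := j.2
  apply MvPolynomial.derivation_ext
  rintro ⟨b, k⟩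
  rw [derivation_sum_apply, Derivation.smul_apply, MvPolynomial.pderiv_X]
  simp only [Derivation.smul_apply, annDer_X]
  by_cases hk : k + 1 = t
  · have e := sum_dualCoeff_mul_qInt_cartan hs0 hs b (j := (j : ℕ) + 1) (by omega) (k := t)
      (by omega)
    simp only [if_pos hk, MvPolynomial.smul_eq_C_mul, ← map_mul, ← map_sum]
    have e2 : ∑ l, dualCoeff s ((j : ℕ) + 1) t l * psiH s l t b
        = ((s ^ 2 - (s ^ 2)⁻¹) * (qInt s t / t)) *
          if (b : ℕ) + 1 = (j : ℕ) + 1 then 1 else 0 := by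
      rw [← e, Finset.mul_sum]
      refine Finset.sum_congr rfl fun l _ => ?_
      rw [psiH, heisH]
      ring
    rw [e2, map_mul]
    congr 1
    subst hk
    simp only [Pi.single_apply, Nat.add_sub_cancel, Prod.mk.injEq, and_true, Fin.ext_iff,
      Nat.add_right_cancel_iff]
    split_ifs <;> simp
  · simp only [if_neg hk, smul_zero, Finset.sum_const_zero]
    rw [Pi.single_eq_of_ne, smul_zero]
    intro h
    have := congrArg Prod.snd h
    simp only at this
    omega

/-- The same inversion of exponentials for annihilation parts: if all positive modes of the `ψ_l`
kill `r`, so do all partial derivatives, and `r` is constant in characteristic zero. -/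
theorem eq_C_of_coeff_transl_psiH (hs0 : s ≠ 0) (hs : ∀ m : ℕ, 0 < m → s ^ m ≠ 1) {r : Osc n K}
    (h : ∀ (l : Fin (n - 1)) (t : ℕ), 0 < t → (transl (psiH s l) r).coeff t = 0) :
    r = MvPolynomial.C (MvPolynomial.constantCoeff r) := by
  have key : ∀ (l : Fin (n - 1)) (k : ℕ), annDer (psiH s l) (k + 1) r = 0 := by
    intro l k
    induction k using Nat.strong_induction_on with
    | _ k ih =>
      have e := coeff_transl_succ (psiH s l) r k
      rw [h l _ (Nat.succ_pos k), smul_zero, Finset.Nat.sum_antidiagonal_eq_sum_range_succ_mk,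
        Finset.sum_range_succ', Nat.sub_zero, coeff_zero_transl, Finset.sum_eq_zero, zero_add] at e
      · rw [← Nat.cast_smul_eq_nsmul K] at e
        exact (smul_eq_zero.mp e.symm).resolve_left (by exact_mod_cast Nat.succ_ne_zero k)
      · intro j hj
        have := Finset.mem_range.mp hj
        rw [ih _ (by omega), smul_zero, map_zero, Polynomial.coeff_zero]
  refine eq_C_of_pderiv_eq_zero fun v => ?_
  obtain ⟨j, k⟩ := v
  have e := congrArg (fun D : Derivation K (Osc n K) (Osc n K) => D r)
    (sum_dualCoeff_smul_annDer_psiH hs0 hs j (Nat.succ_pos k))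
  simp only [derivation_sum_apply, Derivation.smul_apply, Nat.succ_eq_add_one, key, smul_zero,
    Finset.sum_const_zero, Nat.add_sub_cancel] at e
  refine (smul_eq_zero.mp e.symm).resolve_left (mul_ne_zero (q_sub_inv_ne_zero hs0 hs)
    (div_ne_zero (qInt_ne_zero hs0 hs (by omega)) (by exact_mod_cast Nat.succ_ne_zero k)))

end Oscillator


/-! ### Operators that intertwine the Cartan currents -/

section Sectors

variable {n : ℕ} {K : Type*} [Field K] {s : K}

theorem VOData.op_apply_add (D : VOData n K) (m : ℤ) (v : TotalFock n K) (y : Weight n) :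
    D.op m v (D.γ + y) = (D.κ y * sgn K D.γ y) • mode D.F D.H (m - D.e y) (v y) := by
  induction v using Finsupp.induction_linear with
  | zero => simp
  | add v w hv hw =>
    rw [LinearMap.map_add, Finsupp.add_apply, hv, hw, Finsupp.add_apply, LinearMap.map_add, smul_add]
  | single x p =>
    rw [VOData.op_single]
    by_cases h : x = y
    · subst h
      rw [Finsupp.single_eq_same, Finsupp.single_eq_same]
    · rw [Finsupp.single_eq_of_ne (fun h' => h (add_left_cancel h').symm),
        Finsupp.single_eq_of_ne (Ne.symm h), map_zero, smul_zero]

theorem transl_zero (p : Osc n K) :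
    transl (fun _ _ => (0 : K)) p = Polynomial.C p := by
  have : transl (fun _ _ => (0 : K)) = Polynomial.CAlgHom (R := K) (A := Osc n K) := by
    apply MvPolynomial.algHom_ext
    intro v
    rw [transl_X]
    simp
  rw [this]
  rfl

theorem mode_zero_right (F : ℕ → Fin (n - 1) → K) (m : ℤ) (p : Osc n K) :
    mode F (fun _ _ => 0) m p = creCoeff F m * p := by
  rw [mode_apply, transl_zero, ← Polynomial.monomial_zero_left, pairL_monomial]
  simp

/-- The vector `p ⊗ e^x` of `F_a`. -/
def sec {a : ℕ} {x : Weight n} (hx : x ∈ wtCoset n a) (p : Osc n K) : Fock n K a :=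
  ⟨Finsupp.single x p, Finsupp.single_mem_supported K _ hx⟩

theorem sec_add {a : ℕ} {x : Weight n} (hx : x ∈ wtCoset n a) (p q : Osc n K) :
    sec hx (p + q) = sec hx p + sec hx q :=
  Subtype.ext (Finsupp.single_add x p q)

theorem sec_smul {a : ℕ} {x : Weight n} (hx : x ∈ wtCoset n a) (c : K) (p : Osc n K) :
    sec hx (c • p) = c • sec hx p :=
  Subtype.ext (Finsupp.smul_single c x p).symm

theorem sec_zero {a : ℕ} {x : Weight n} (hx : x ∈ wtCoset n a) :
    sec hx (0 : Osc n K) = 0 :=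
  Subtype.ext (Finsupp.single_zero x)

theorem linearMap_eq_zero_of_sec {a b : ℕ} {D : Fock n K a →ₗ[K] Fock n K b}
    (h : ∀ (x : Weight n) (hx : x ∈ wtCoset n a) (p : Osc n K), D (sec hx p) = 0) : D = 0 := by
  have e : D.comp (Finsupp.supportedEquivFinsupp (M := Osc n K) (R := K)
      (wtCoset n a)).symm.toLinearMap = 0 := by
    refine Finsupp.lhom_ext fun x p => ?_
    rw [LinearMap.comp_apply, LinearMap.zero_apply]
    refine Eq.trans (congrArg D (Subtype.ext ?_)) (h x x.2 p)
    exact Finsupp.supportedEquivFinsupp_symm_single _ _ _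
  refine LinearMap.ext fun v => ?_
  have := LinearMap.congr_fun e (Finsupp.supportedEquivFinsupp (wtCoset n a) v)
  rw [LinearMap.comp_apply, LinearEquiv.coe_coe, LinearEquiv.symm_apply_apply] at this
  exact this

theorem zsmul_simpleRoot_add_mem {a : ℕ} {x : Weight n} (hx : x ∈ wtCoset n a) (ε : ℤ)
    (l : Fin (n - 1)) : ε • simpleRoot l + x ∈ wtCoset n a :=
  add_mem_wtCoset (by
    rw [add_sub_cancel_right]; exact AddSubgroup.zsmul_mem _ (simpleRoot_mem l) ε) x hx

theorem simpleRoot_self (l : Fin (n - 1)) : (simpleRoot l : Weight n) l = 2 := by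
  simp [simpleRoot, cartan, CartanMatrix.A]

variable [CharZero K]

theorem creCoeff_of_zero {m : ℤ} (hm : m ≠ 0) :
    creCoeff (fun _ _ => 0 : ℕ → Fin (n - 1) → K) m = 0 := by
  rw [creCoeff, expCoeff_of_eq_zero (fun k _ => creForm_zero k)]
  split_ifs <;> first | rfl | omega

theorem mode_zero_left (H : ℕ → Fin (n - 1) → K) (t : ℕ) (p : Osc n K) :
    mode (fun _ _ => 0) H (-(t : ℤ)) p = (transl H p).coeff t := by
  rw [mode_apply]
  induction transl H p using Polynomial.induction_on' with
  | add P Q hP hQ => rw [map_add, hP, hQ, Polynomial.coeff_add]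
  | monomial k r =>
    rw [pairL_monomial, Polynomial.coeff_monomial]
    split_ifs with h
    · rw [h, neg_add_cancel, creCoeff_zero, one_mul]
    · rw [creCoeff_of_zero (by omega), zero_mul]

theorem current_sec (ε : ℤ) (l : Fin (n - 1)) {a : ℕ} (m : ℤ) {x : Weight n}
    (hx : x ∈ wtCoset n a) (p : Osc n K) : current s ε l a m (sec hx p)
      = sgn K (ε • simpleRoot l) x • sec (zsmul_simpleRoot_add_mem hx ε l)
        (mode (currentF s ε l) (currentH s ε l) (m - (ε * x l + 1)) p) := by
  refine Subtype.ext ?_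
  rw [coe_current, ← sec_smul]
  refine (VOData.op_single _ _ _ _).trans ?_
  show Finsupp.single _ ((1 * sgn K (ε • simpleRoot l) x) • _) = _
  rw [one_mul]
  rfl

/-- Annihilation parts act trivially on constants, so `x^ε` on `1 ⊗ e^x` starts at the exponent `ε
x_l + 1` with an invertible coefficient. Uniqueness is decided by comparing such leading exponents.
-/
theorem current_sec_C (ε : ℤ) (l : Fin (n - 1)) {a : ℕ} (m : ℤ) {x : Weight n}
    (hx : x ∈ wtCoset n a) (c : K) (hm : m ≤ ε * x l + 1) :
    current s ε l a m (sec hx (MvPolynomial.C c))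
      = if m = ε * x l + 1 then sgn K (ε • simpleRoot l) x •
        sec (zsmul_simpleRoot_add_mem hx ε l) (MvPolynomial.C c) else 0 := by
  rw [current_sec, mode_C]
  split_ifs with h
  · rw [h, sub_self, creCoeff_zero, one_mul]
  · rw [creCoeff_of_neg _ (by omega), zero_mul, sec_zero, smul_zero]

/-- A current maps different sectors to different sectors and is injective on each of them by
`eq_zero_of_mode_eq_zero`. -/
theorem eq_zero_of_current_eq_zero (ε : ℤ) (l : Fin (n - 1)) {a : ℕ} {w : Fock n K a}
    (h : ∀ m, current s ε l a m w = 0) : w = 0 := by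
  refine Subtype.ext (Finsupp.ext fun y => ?_)
  refine eq_zero_of_mode_eq_zero (F := currentF s ε l) (H := currentH s ε l) fun m => ?_
  have e := (currentD s ε l).op_apply_add (m + (ε * y l + 1)) w y
  rw [← coe_current, h] at e
  change (0 : Osc n K) = (1 * sgn K (ε • simpleRoot l) y) •
    mode (currentF s ε l) (currentH s ε l) (m + (ε * y l + 1) - (ε * y l + 1)) _ at e
  rw [add_sub_cancel_right, one_mul] at e
  exact (smul_eq_zero.mp e.symm).resolve_left (sgn_ne_zero _ _)

theorem phiCur_apply (l : Fin (n - 1)) {a : ℕ} (m : ℤ) (w : Fock n K a) (y : Weight n) :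
    (phiCur s l a m w : TotalFock n K) y
      = (s ^ 2) ^ (-y l) • (creCoeff (phiF s l) m * (w : TotalFock n K) y) := by
  have e := (phiD s l).op_apply_add m w y
  rw [← coe_phiCur] at e
  change (phiCur s l a m w : TotalFock n K) (0 + y) = ((s ^ 2) ^ (-y l) * sgn K 0 y) •
    mode (phiF s l) (fun _ _ => 0) (m - 0) _ at e
  rw [zero_add, sgn_zero_left, mul_one, mode_zero_right, sub_zero] at e
  exact e

theorem psiCur_apply (l : Fin (n - 1)) {a : ℕ} (t : ℕ) (w : Fock n K a) (y : Weight n) :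
    (psiCur s l a (-t) w : TotalFock n K) y
      = (s ^ 2) ^ (y l) • (transl (psiH s l) ((w : TotalFock n K) y)).coeff t := by
  have e := (psiD s l).op_apply_add (-t) w y
  rw [← coe_psiCur] at e
  change (psiCur s l a (-t) w : TotalFock n K) (0 + y) = ((s ^ 2) ^ (y l) * sgn K 0 y) •
    mode (fun _ _ => 0) (psiH s l) (-t - 0) _ at e
  rw [zero_add, sgn_zero_left, mul_one, sub_zero, mode_zero_left] at e
  exact e

theorem phiCur_sec (l : Fin (n - 1)) {a : ℕ} (m : ℤ) {x : Weight n}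
    (hx : x ∈ wtCoset n a) (p : Osc n K) : phiCur s l a m (sec hx p)
      = (s ^ 2) ^ (-x l) • sec hx (creCoeff (phiF s l) m * p) := by
  refine Subtype.ext (Finsupp.ext fun y => ?_)
  rw [phiCur_apply]
  show _ • (_ * Finsupp.single x p y) = (s ^ 2) ^ (-x l) • Finsupp.single x _ y
  by_cases h : x = y
  · subst h
    rw [Finsupp.single_eq_same, Finsupp.single_eq_same]
  · rw [Finsupp.single_eq_of_ne (Ne.symm h), Finsupp.single_eq_of_ne (Ne.symm h), mul_zero,
      smul_zero, smul_zero]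

theorem psiCur_sec_one (l : Fin (n - 1)) {a : ℕ} (t : ℕ) {x : Weight n}
    (hx : x ∈ wtCoset n a) : psiCur s l a (-t) (sec hx (1 : Osc n K))
      = (if t = 0 then (s ^ 2) ^ (x l) else 0) • sec hx (1 : Osc n K) := by
  refine Subtype.ext (Finsupp.ext fun y => ?_)
  rw [psiCur_apply]
  show _ • (transl _ (Finsupp.single x (1 : Osc n K) y)).coeff t
    = (if t = 0 then (s ^ 2) ^ (x l) else 0) • Finsupp.single x (1 : Osc n K) y
  by_cases h : x = y
  · subst h
    rw [Finsupp.single_eq_same, map_one, Polynomial.coeff_one]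
    split_ifs <;> simp
  · rw [Finsupp.single_eq_of_ne (Ne.symm h), map_zero, Polynomial.coeff_zero, smul_zero, smul_zero]

theorem smul_eq_smul_of_sub {V : Type*} [AddCommGroup V] [Module K V] {C A C' A' : K}
    {x y x' y' : V} (h : C • x - C' • x' = A • y - A' • y') (hx : x' = 0) (hy : y' = 0) :
    C • x = A • y := by
  simpa [hx, hy] using h

/-- The relations with the currents `φ` and `ψ` that are shared by the components of the vertex
operators, where `γ` is the weight of the operator. -/
structure IsIntertwiner (s : K) {a b : ℕ} (γ : Weight n) (D : ℤ → Fock n K a →ₗ[K] Fock n K b) :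
    Prop where
  laurent : ∀ v, ∃ N : ℤ, ∀ m < N, D m v = 0
  phi : ∀ l : Fin (n - 1), ∃ C A C' A' : K, C ≠ 0 ∧ A = C * (s ^ 2) ^ (γ l) ∧ ∀ v c d,
    C • D d (phiCur s l a c v) - C' • D (d + 1) (phiCur s l a (c - 1) v)
      = A • phiCur s l b c (D d v) - A' • phiCur s l b (c - 1) (D (d + 1) v)
  psi : ∀ l : Fin (n - 1), ∃ C A C' A' : K, A ≠ 0 ∧ ∀ v c d,
    C • D d (psiCur s l a c v) - C' • D (d - 1) (psiCur s l a (c + 1) v)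
      = A • psiCur s l b c (D d v) - A' • psiCur s l b (c + 1) (D (d - 1) v)

/-- `D` vanishes on the vectors `p ⊗ e^x`. -/
def VanishesAt {a b : ℕ} (D : ℤ → Fock n K a →ₗ[K] Fock n K b) (x : Weight n) : Prop :=
  ∀ (hx : x ∈ wtCoset n a) (p : Osc n K) (d : ℤ), D d (sec hx p) = 0

variable (hs0 : s ≠ 0) (hs : ∀ m : ℕ, 0 < m → s ^ m ≠ 1)
variable {a b : ℕ} {γ : Weight n} {D : ℤ → Fock n K a →ₗ[K] Fock n K b}

theorem phiCur_of_neg (l : Fin (n - 1)) {c : ℤ} (hc : c < 0) (w : Fock n K a) :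
    phiCur s l a c w = 0 := by
  refine Subtype.ext (Finsupp.ext fun y => ?_)
  rw [phiCur_apply, creCoeff_of_neg _ hc, zero_mul, smul_zero]
  rfl

include hs0 hs

/-- The vectors of the sector killed by all modes of `D` form a subspace stable under the modes of
`φ`; as these generate the sector from `1 ⊗ e^x`, it is enough to test that vector. -/
theorem IsIntertwiner.vanishesAt (h : IsIntertwiner s γ D) {x : Weight n}
    (h1 : ∀ (hx : x ∈ wtCoset n a) (d : ℤ), D d (sec hx 1) = 0) : VanishesAt D x := by
  intro hx p
  have key : p ∈ (⨅ d, LinearMap.ker ((D d).comp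
      ({ toFun := sec hx, map_add' := sec_add hx, map_smul' := sec_smul hx } :
        Osc n K →ₗ[K] Fock n K a))) := by
    refine mem_of_creCoeff_mul_mem hs0 hs ?_ (fun l m => ?_) p
    · rw [Submodule.mem_iInf]
      exact fun d => h1 hx d
    · intro p hp
      rw [Submodule.mem_iInf] at hp ⊢
      replace hp : ∀ d, D d (sec hx p) = 0 := hp
      obtain ⟨C, A, C', A', hC, -, hrel⟩ := h.phi l
      have hs2 : (s ^ 2) ^ (-x l) ≠ 0 := zpow_ne_zero _ (pow_ne_zero 2 hs0)
      -- Induction on the mode number of `φ`: the cleared relation expresses `D φ_c` by `D φ_{c-1}`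
      -- and by terms in which `D` acts first. Negative modes of `φ` vanish.
      suffices H : ∀ (k : ℕ) (c : ℤ), c < k → ∀ d, D d (phiCur s l a c (sec hx p)) = 0 by
        intro d
        have e := H (m.toNat + 1) m (by omega) d
        rw [phiCur_sec, map_smul] at e
        exact (smul_eq_zero.mp e).resolve_left hs2
      intro k
      induction k with
      | zero =>
        intro c hc d
        rw [phiCur_of_neg l (by simpa using hc), map_zero]
      | succ k ih =>
        intro c hc d
        have e := smul_eq_smul_of_sub (V := Fock n K b) (hrel (sec hx p) c d)
          (by rw [ih (c - 1) (by push_cast at hc; omega)]) (by rw [hp, map_zero])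
        rw [hp, map_zero, smul_zero] at e
        exact (smul_eq_zero.mp e).resolve_left hC
  rw [Submodule.mem_iInf] at key
  exact key

/-- The zero mode of `φ_{l+1}` is `q^{-∂}`, and the relation tells its eigenvalue on `D(1 ⊗ e^x)`.
Since `q` is not a root of unity, the eigenvalues for all nodes determine the weight. -/
theorem IsIntertwiner.apply_of_ne (h : IsIntertwiner s γ D) {x : Weight n}
    (hx : x ∈ wtCoset n a) (d : ℤ) {y : Weight n} (hy : y ≠ γ + x) :
    (D d (sec hx 1) : TotalFock n K) y = 0 := by
  by_contra hne
  refine hy (funext fun l => ?_)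
  obtain ⟨C, A, C', A', hC, hA, hrel⟩ := h.phi l
  have e := smul_eq_smul_of_sub (V := Fock n K b) (hrel (sec hx 1) 0 d)
    (by rw [phiCur_of_neg l (by norm_num), map_zero]) (by rw [phiCur_of_neg l (by norm_num)])
  rw [phiCur_sec, creCoeff_zero, one_mul, map_smul] at e
  have e' := congrArg (fun w : Fock n K b => (w : TotalFock n K) y) e
  change C • (s ^ 2) ^ (-x l) • (D d (sec hx 1) : TotalFock n K) y
    = A • (phiCur s l b 0 (D d (sec hx 1)) : TotalFock n K) y at e'
  rw [phiCur_apply, creCoeff_zero, one_mul, smul_smul, smul_smul, hA, ← sub_eq_zero, ← sub_smul] at e'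
  have e2 := (smul_eq_zero.mp e').resolve_right hne
  have hs2 : s ^ 2 ≠ 0 := pow_ne_zero 2 hs0
  rw [mul_assoc, ← mul_sub, ← zpow_add₀ hs2] at e2
  have e3 := sub_eq_zero.mp ((mul_eq_zero.mp e2).resolve_left hC)
  by_contra hl
  refine zpow_ne_one_of_ne_zero hs (k := 2 * (γ l + x l - y l)) (fun h0 => hl ?_) ?_
  · show y l = γ l + x l
    omega
  · rw [zpow_mul, show s ^ (2 : ℤ) = s ^ 2 from zpow_natCast s 2,
      show γ l + x l - y l = γ l + -y l - -x l by ring, zpow_sub₀ hs2, ← e3]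
    exact div_self (zpow_ne_zero _ hs2)

/-- In the relation with `ψ` the shifted terms involve the mode `d - 1`, which vanishes on `1 ⊗
e^x`. Hence the positive modes of `ψ` kill `D_d(1 ⊗ e^x)`, leaving only a scalar. -/
theorem IsIntertwiner.lowest (h : IsIntertwiner s γ D) {x : Weight n} (hx : x ∈ wtCoset n a)
    {d : ℤ} (hd : ∀ d' < d, D d' (sec hx 1) = 0) : (D d (sec hx 1) : TotalFock n K)
      = Finsupp.single (γ + x) (MvPolynomial.C
        (MvPolynomial.constantCoeff ((D d (sec hx 1) : TotalFock n K) (γ + x)))) := by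
  refine Finsupp.ext fun y => ?_
  by_cases hy : y = γ + x
  · subst hy
    rw [Finsupp.single_eq_same]
    refine eq_C_of_coeff_transl_psiH hs0 hs fun l t ht => ?_
    obtain ⟨C, A, C', A', hA, hrel⟩ := h.psi l
    obtain ⟨r, rfl⟩ : ∃ r, t = r + 1 := ⟨t - 1, by omega⟩
    have e := smul_eq_smul_of_sub (V := Fock n K b) (hrel (sec hx 1) (-(r + 1 : ℕ)) d)
      (by rw [show (-((r + 1 : ℕ) : ℤ) + 1) = -(r : ℤ) by push_cast; ring, psiCur_sec_one,
        map_smul, hd _ (sub_one_lt d), smul_zero]) (by rw [hd _ (sub_one_lt d), map_zero])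
    rw [psiCur_sec_one, if_neg (Nat.succ_ne_zero r), zero_smul, map_zero, smul_zero] at e
    have e1 := (smul_eq_zero.mp e.symm).resolve_left hA
    have e2 := congrArg (fun w : Fock n K b => (w : TotalFock n K) (γ + x)) e1
    change (psiCur s l b _ _ : TotalFock n K) (γ + x) = 0 at e2
    rw [psiCur_apply] at e2
    exact (smul_eq_zero.mp e2).resolve_left (zpow_ne_zero _ (pow_ne_zero 2 hs0))
  · rw [h.apply_of_ne hs0 hs hx d hy, Finsupp.single_eq_of_ne hy]

/-- Induction from the Laurent bound upwards: a single scalar has to be checked in each degree,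
under the assumption that all lower modes vanish. -/
theorem IsIntertwiner.vanishesAt_of_lowest (h : IsIntertwiner s γ D) {x : Weight n}
    (h1 : ∀ (hx : x ∈ wtCoset n a) (d : ℤ), (∀ d' < d, D d' (sec hx 1) = 0) →
      MvPolynomial.constantCoeff ((D d (sec hx 1) : TotalFock n K) (γ + x)) = 0) :
    VanishesAt D x := by
  refine h.vanishesAt hs0 hs fun hx => ?_
  obtain ⟨N, hN⟩ := h.laurent (sec hx 1)
  suffices H : ∀ (k : ℕ), ∀ d < N + k, D d (sec hx 1) = 0 from fun d =>
    H (d - N + 1).toNat d (by omega)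
  intro k
  induction k with
  | zero => simpa using hN
  | succ k ih =>
    intro d hd
    have hd' : ∀ d' < d, D d' (sec hx 1) = 0 := fun d' hd' => ih d' (by push_cast at hd; omega)
    refine Subtype.ext ?_
    rw [h.lowest hs0 hs hx hd', h1 hx d hd', map_zero, Finsupp.single_zero]
    rfl

end Sectors


/-! ### Operators that intertwine the currents `x^±` -/

section Propagation

section Series

variable {K : Type*} [Field K] {V : Type*} [AddCommGroup V] [Module K V]

theorem IsSeriesMul.congr {c : ℤ → K} {P P' R R' : ℤ → ℤ → V} (h : IsSeriesMul c P R)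
    (hP : ∀ a b, P a b = P' a b) (hR : ∀ a b, R a b = R' a b) : IsSeriesMul c P' R' := by
  rwa [← funext fun a => funext (hP a), ← funext fun a => funext (hR a)]

theorem IsSeriesMul.sub {c : ℤ → K} {P P' R R' : ℤ → ℤ → V} (h : IsSeriesMul c P R)
    (h' : IsSeriesMul c P' R') :
    IsSeriesMul c (fun a b => P a b - P' a b) (fun a b => R a b - R' a b) := by
  intro a b
  obtain ⟨h1, h2⟩ := h a b
  obtain ⟨h3, h4⟩ := h' a b
  simp only [smul_sub]
  refine ⟨(h1.union h3).subset (Function.support_sub _ _), ?_⟩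
  rw [finsum_sub_distrib h1 h3, h2, h4]

theorem IsSeriesMul.eq_zero {c : ℤ → K} {P R : ℤ → ℤ → V} (h : IsSeriesMul c P R) {a b : ℤ}
    (h0 : ∀ k, c k ≠ 0 → P (a - k) (b + k) = 0) : R a b = 0 := by
  rw [← (h a b).2, finsum_eq_zero_of_forall_eq_zero]
  intro k
  by_cases hk : c k = 0
  · rw [hk, zero_smul]
  · rw [h0 k hk, smul_zero]

/-- Multiplication by a series in `z / w` with nonzero constant term is injective on series that
are bounded below in `z`. -/
theorem IsSeriesMul.eq_zero_iff_fracZ {A B D : K} (hA : A ≠ 0) {P R : ℤ → ℤ → V}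
    (h : IsSeriesMul (fracZ A B D) P R) {N : ℤ} (hN : ∀ a, ∀ b < N, P a b = 0) :
    (∀ a b, R a b = 0) ↔ ∀ a b, P a b = 0 := by
  have hc : ∀ k, 0 < k → fracZ A B D k = 0 := fun k hk => by
    rw [fracZ, expand, if_pos (by omega)]
  refine ⟨fun hR => ?_, fun hP a b => h.eq_zero fun k _ => hP _ _⟩
  suffices H : ∀ (k : ℕ) (a : ℤ), ∀ b < N + k, P a b = 0 from fun a b =>
    H (b - N + 1).toNat a b (by omega)
  intro k
  induction k with
  | zero => simpa using hN
  | succ k ih =>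
    intro a b hb
    have e := (h a b).2
    -- Terms with negative index vanish by induction and those with positive index by the expansion,
    -- which leaves the constant term `A`.
    rw [hR, finsum_eq_single _ 0] at e
    · rw [sub_zero, add_zero] at e
      exact (smul_eq_zero.mp e).resolve_left (by
        rw [fracZ, expand, if_neg (by norm_num), if_pos (by norm_num)]; exact hA)
    · intro j hj
      rcases lt_or_gt_of_ne hj with h1 | h1
      · rw [ih _ _ (by push_cast at hb; omega), smul_zero]
      · rw [hc j h1, zero_smul]

theorem IsSeriesMul.eq_zero_iff_fracW {A B D : K} (hA : A ≠ 0) {P R : ℤ → ℤ → V}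
    (h : IsSeriesMul (fracW A B D) P R) {N : ℤ} (hN : ∀ a < N, ∀ b, P a b = 0) :
    (∀ a b, R a b = 0) ↔ ∀ a b, P a b = 0 := by
  have h' : IsSeriesMul (fracZ A B D) (fun a b => P b a) (fun a b => R b a) := by
    rw [← isSeriesMul_swap]
    simp only [fracZ, neg_neg]
    exact h
  have := h'.eq_zero_iff_fracZ hA (N := N) (fun a b hb => hN b hb a)
  exact ⟨fun hR a b => this.mp (fun a b => hR b a) b a,
    fun hP a b => this.mpr (fun a b => hP b a) b a⟩

end Series

variable {n : ℕ} {K : Type*} [Field K] {s : K}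
variable {a b : ℕ} {γ : Weight n} {D : ℤ → Fock n K a →ₗ[K] Fock n K b}

/-- The two products of `D` with a current vanish simultaneously. -/
def IsLinked (s : K) (D : ℤ → Fock n K a →ₗ[K] Fock n K b) (ε : ℤ) (l : Fin (n - 1)) : Prop :=
  ∀ v, (∀ c d, D d (current s ε l a c v) = 0) ↔ ∀ c d, current s ε l b c (D d v) = 0

theorem isLinked_of_comm {ε : ℤ} {l : Fin (n - 1)}
    (h : ∀ v c d, D d (current s ε l a c v) = current s ε l b c (D d v)) : IsLinked s D ε l :=
  fun v => by simp only [h]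

theorem isLinked_of_fracZ {ε : ℤ} {l : Fin (n - 1)} {A B C : K} (hA : A ≠ 0)
    (hD : ∀ v, ∃ N : ℤ, ∀ m < N, D m v = 0)
    (h : ∀ v, IsSeriesMul (fracZ A B C) (fun c d => current s ε l b c (D d v))
      (fun c d => D d (current s ε l a c v))) : IsLinked s D ε l := fun v => by
  obtain ⟨N, hN⟩ := hD v
  exact (h v).eq_zero_iff_fracZ hA (N := N) fun c d hd => by rw [hN d hd, map_zero]

theorem sec_congr {x y : Weight n} (h : x = y) (hx : x ∈ wtCoset n a) (p : Osc n K) :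
    sec hx p = sec (h ▸ hx) p := by
  subst h; rfl

variable [CharZero K]

theorem exists_current_eq_zero (ε : ℤ) (l : Fin (n - 1)) (v : Fock n K a) :
    ∃ N : ℤ, ∀ m < N, current s ε l a m v = 0 := by
  obtain ⟨N, hN⟩ := (currentD s ε l).exists_op_eq_zero (v : TotalFock n K)
  exact ⟨N, fun m hm => Subtype.ext (by rw [coe_current, hN m hm]; rfl)⟩

theorem isLinked_of_fracW {ε : ℤ} {l : Fin (n - 1)} {A B C : K} (hA : A ≠ 0)
    (h : ∀ v, IsSeriesMul (fracW A B C) (fun c d => D d (current s ε l a c v))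
      (fun c d => current s ε l b c (D d v))) : IsLinked s D ε l := fun v => by
  obtain ⟨N, hN⟩ := exists_current_eq_zero (s := s) ε l v
  exact ((h v).eq_zero_iff_fracW hA (N := N) fun c hc d => by rw [hN c hc, map_zero]).symm

/-- If `D` vanishes on the sector reached by the current, then the current annihilates the values of
`D` on the original sector, and it is injective. -/
theorem vanishesAt_of_linked_up {ε : ℤ} {l : Fin (n - 1)} (hL : IsLinked s D ε l) {x : Weight n}
    (h : VanishesAt D (ε • simpleRoot l + x)) : VanishesAt D x := by
  intro hx p d
  refine eq_zero_of_current_eq_zero (s := s) ε l fun c => ?_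
  refine (hL (sec hx p)).mp (fun c d => ?_) c d
  rw [current_sec, map_smul, h, smul_zero]

theorem apply_sec_one_eq_zero (x : Weight n) (hx : x ∈ wtCoset n a) (ε : ℤ) (l : Fin (n - 1))
    {d : ℤ} (h : D d (current s ε l a (ε * x l + 1) (sec hx 1)) = 0) :
    D d (sec (zsmul_simpleRoot_add_mem hx ε l) 1) = 0 := by
  rw [← map_one MvPolynomial.C, current_sec_C _ _ _ hx _ le_rfl, if_pos rfl, map_smul] at h
  rw [← map_one MvPolynomial.C]
  exact (smul_eq_zero.mp h).resolve_left (sgn_ne_zero _ _)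

variable (hs0 : s ≠ 0) (hs : ∀ m : ℕ, 0 < m → s ^ m ≠ 1)
include hs0 hs

/-- The leading coefficient of the current on `1 ⊗ e^x` is `1 ⊗ e^{x+εα}` up to sign, and this
vector suffices by `vanishesAt`. -/
theorem IsIntertwiner.vanishesAt_of_linked_down (hD : IsIntertwiner s γ D) {ε : ℤ}
    {l : Fin (n - 1)} (hL : IsLinked s D ε l) {x : Weight n} (hx : x ∈ wtCoset n a)
    (h : VanishesAt D x) : VanishesAt D (ε • simpleRoot l + x) := by
  refine hD.vanishesAt hs0 hs fun _ d => ?_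
  refine apply_sec_one_eq_zero (s := s) x hx ε l ?_
  exact (hL (sec hx 1)).mpr (fun c d => by rw [h, map_zero]) _ d

/-- One linked current per node joins the sectors `x` and `x + α` in both directions, whatever the
sign of the current. The simple roots generate the root lattice, so every sector of the coset is
reached. -/
theorem IsIntertwiner.eq_zero_of_linked (hD : IsIntertwiner s γ D)
    (hL : ∀ l : Fin (n - 1), IsLinked s D 1 l ∨ IsLinked s D (-1) l) {x₀ : Weight n}
    (hx₀ : x₀ ∈ wtCoset n a) (h : VanishesAt D x₀) (d : ℤ) : D d = 0 := by
  have step : ∀ (l : Fin (n - 1)), ∀ x ∈ wtCoset n a,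
      (VanishesAt D x ↔ VanishesAt D (simpleRoot l + x)) := by
    intro l x hx
    rcases hL l with h1 | h1
    · have e : (1 : ℤ) • simpleRoot l + x = simpleRoot l + x := by rw [one_zsmul]
      rw [← e]
      exact ⟨hD.vanishesAt_of_linked_down hs0 hs h1 hx, vanishesAt_of_linked_up h1⟩
    · have hx' : simpleRoot l + x ∈ wtCoset n a := by
        simpa using zsmul_simpleRoot_add_mem hx 1 l
      have e : (-1 : ℤ) • simpleRoot l + (simpleRoot l + x) = x := by
        rw [neg_one_zsmul, neg_add_cancel_left]
      constructor
      · intro h2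
        rw [← e] at h2
        exact vanishesAt_of_linked_up h1 h2
      · intro h2
        have h3 := hD.vanishesAt_of_linked_down hs0 hs h1 hx' h2
        rwa [e] at h3
  have mem : ∀ g ∈ rootLattice n, ∀ x ∈ wtCoset n a, g + x ∈ wtCoset n a := fun g hg x hx =>
    add_mem_wtCoset (by rwa [add_sub_cancel_right]) x hx
  have all : ∀ g ∈ rootLattice n, ∀ x ∈ wtCoset n a, (VanishesAt D x ↔ VanishesAt D (g + x)) := by
    intro g hg
    induction hg using AddSubgroup.closure_induction with
    | mem g hg =>
      obtain ⟨l, rfl⟩ := hg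
      exact step l
    | zero => intro x _; rw [zero_add]
    | add g g' hg hg' h1 h2 =>
      intro x hx
      rw [h2 x hx, h1 _ (mem g' hg' x hx), add_assoc]
    | neg g hg h1 =>
      intro x hx
      rw [h1 _ (mem (-g) (neg_mem hg) x hx), add_neg_cancel_left]
  refine linearMap_eq_zero_of_sec fun x hx p => ?_
  have hg : x - x₀ ∈ rootLattice n := by
    rw [← sub_sub_sub_cancel_right x x₀ (fundWt a)]
    exact sub_mem (show x - fundWt a ∈ rootLattice n from hx) hx₀
  have h2 := (all _ hg x₀ hx₀).mp h
  rw [sub_add_cancel] at h2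
  exact h2 hx p d

/-- An operator of weight `γ` with `ε γ_l = -1` that satisfies the relation of a component of a
vertex operator with `x^ε_l`, but without the inhomogeneous term, is zero. -/
theorem IsIntertwiner.eq_zero_of_fracZ (hD : IsIntertwiner s γ D) {ε : ℤ} (hε : ε = 1 ∨ ε = -1)
    {l : Fin (n - 1)} (hγ : ε * γ l = -1) {A B C : K}
    (h : ∀ v, IsSeriesMul (fracZ A B C) (fun c d => current s ε l b c (D d v))
      (fun c d => D d (current s ε l a c v)))
    (hcomm : ∀ v c d, D d (current s (-ε) l a c v) = current s (-ε) l b c (D d v)) (d : ℤ) :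
    D d = 0 := by
  refine linearMap_eq_zero_of_sec fun x hx p => ?_
  refine hD.vanishesAt_of_lowest hs0 hs (fun _ d hd => ?_) hx p d
  have hy := zsmul_simpleRoot_add_mem hx ε l
  -- The series contains only nonpositive powers of `u`, so the mode `d'` of `D` on the current is
  -- expressed by modes of `D` not above `d'`, all zero on `1 ⊗ e^x`.
  have h1 : ∀ d' < d, D d' (sec hy 1) = 0 := fun d' hd' => by
    refine apply_sec_one_eq_zero (s := s) x hx ε l ?_
    refine (h (sec hx 1)).eq_zero fun k hk => ?_
    have hk' : k ≤ 0 := by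
      by_contra hk'
      exact hk (by rw [fracZ, expand, if_pos (by omega)])
    rw [hd _ (by omega), map_zero]
  have h2 := hD.lowest hs0 hs hy h1
  have e : -ε • simpleRoot l + (ε • simpleRoot l + x) = x := by
    rw [neg_zsmul, neg_add_cancel_left]
  have hyl : (ε • simpleRoot l + x : Weight n) l = 2 * ε + x l := by
    rw [Pi.add_apply, Pi.smul_apply, simpleRoot_self, smul_eq_mul, mul_comm]
  have hεε : ε * ε = 1 := by rcases hε with rfl | rfl <;> norm_num
  -- Returning with the opposite current: its leading exponent on `e^{γ+y}` exceeds the one on `e^y`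
  -- by `1`, as `-ε γ_l = 1`. At the leading exponent of `e^y` the right-hand side of the
  -- commutation relation is therefore zero.
  have h3 : D d (current s (-ε) l a (-ε * (ε • simpleRoot l + x : Weight n) l + 1) (sec hy 1))
      = 0 := by
    rw [hcomm]
    -- No assumption places `γ` in the right coset; a nonzero value of `D` has to lie in `F_b`,
    -- which supplies the membership.
    have hw : γ + (ε • simpleRoot l + x) ∈ wtCoset n b ∨ D d (sec hy 1) = 0 := by
      by_cases h0 : D d (sec hy 1) = 0
      · exact Or.inr h0
      · left
        have hm := (D d (sec hy 1)).2
        rw [h2] at hm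
        refine hm ?_
        rw [Finset.mem_coe, Finsupp.mem_support_iff, Finsupp.single_eq_same]
        intro h5
        exact h0 (Subtype.ext (by rw [h2, h5, Finsupp.single_zero]; rfl))
    rcases hw with hw | hw
    · have h4 : D d (sec hy 1) = sec hw (MvPolynomial.C _) := Subtype.ext h2
      have e1 : -ε * (γ + (ε • simpleRoot l + x) : Weight n) l + 1
          = -ε * (ε • simpleRoot l + x : Weight n) l + 1 + 1 := by
        rw [Pi.add_apply]
        linear_combination -hγ
      rw [h4, current_sec_C _ _ _ hw _ (by omega), if_neg (by omega)]
    · rw [hw, map_zero]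
  have h4 := apply_sec_one_eq_zero _ hy (-ε) l h3
  rw [sec_congr e] at h4
  rw [h4]
  simp

/-- The analogue of `IsIntertwiner.eq_zero_of_fracZ` for the dual vertex operators. -/
theorem IsIntertwiner.eq_zero_of_fracW (hD : IsIntertwiner s γ D) {ε : ℤ}
    {l : Fin (n - 1)} (hγ : ε * γ l = -1) {A B C : K}
    (h : ∀ v, IsSeriesMul (fracW A B C) (fun c d => D d (current s ε l a c v))
      (fun c d => current s ε l b c (D d v))) (d : ℤ) : D d = 0 := by
  refine linearMap_eq_zero_of_sec fun x hx p => ?_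
  refine hD.vanishesAt_of_lowest hs0 hs (fun _ d hd => ?_) hx p d
  have h2 := hD.lowest hs0 hs hx hd
  -- In the expansion in `u` only modes of the current up to `ε x_l` occur, and these lie below its
  -- leading exponent on `e^x`.
  have h1 : current s ε l b (ε * x l) (D d (sec hx 1)) = 0 := by
    refine (h (sec hx 1)).eq_zero (a := ε * x l) fun k hk => ?_
    have hk' : 0 ≤ k := by
      by_contra hk'
      exact hk (by rw [fracW, expand, if_pos (by omega)])
    rw [← map_one MvPolynomial.C, current_sec_C _ _ _ hx _ (by omega), if_neg (by omega), map_zero]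
  by_contra hne
  have hw : γ + x ∈ wtCoset n b := by
    have hm := (D d (sec hx 1)).2
    refine hm ?_
    rw [Finset.mem_coe, Finsupp.mem_support_iff]
    intro h5
    exact hne (by rw [h5, map_zero])
  have h4 : D d (sec hx 1) = sec hw (MvPolynomial.C _) := Subtype.ext h2
  -- Since `ε γ_l = -1`, the vanishing mode is precisely the leading one on `e^{γ+x}`; its
  -- coefficient is invertible, so the scalar is zero.
  have e1 : ε * (γ + x : Weight n) l + 1 = ε * x l := by
    rw [Pi.add_apply]
    linear_combination hγ
  rw [h4, ← e1, current_sec_C _ _ _ hw _ le_rfl, if_pos rfl] at h1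
  have h5 := (smul_eq_zero.mp h1).resolve_left (sgn_ne_zero _ _)
  have h6 : Finsupp.single (ε • simpleRoot l + (γ + x)) (MvPolynomial.C (σ := Fin (n - 1) × ℕ)
      (MvPolynomial.constantCoeff ((D d (sec hx 1) : TotalFock n K) (γ + x)))) = 0 :=
    congrArg Subtype.val h5
  rw [Finsupp.single_eq_zero, MvPolynomial.C_eq_zero] at h6
  exact hne h6

theorem IsIntertwiner.vanishesAt_fundWt (hD : IsIntertwiner s γ D) (hγ : γ + fundWt a = fundWt b)
    (h : ∀ d, vacCoeff b (D d (vac n K a)) = 0) : VanishesAt D (fundWt a) := by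
  refine hD.vanishesAt_of_lowest hs0 hs fun hx d _ => ?_
  rw [hγ]
  exact h d

end Propagation


/-! ### Uniqueness of the vertex operators -/

section Uniqueness

variable {n : ℕ} {K : Type*} [Field K] {s : K} {a b : ℕ}

/-- The difference of linear maps of Fock spaces. -/
instance instSubFockHom : Sub (Fock n K a →ₗ[K] Fock n K b) :=
  @LinearMap.instSub K K (Fock n K a) (Fock n K b) _ _ _ (Submodule.addCommGroup _) _ _ _

theorem fockHom_sub_apply (E E' : Fock n K a →ₗ[K] Fock n K b) (v : Fock n K a) :
    (E - E') v = E v - E' v := rfl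

theorem fockHom_map_sub (Y : Fock n K a →ₗ[K] Fock n K b) (v w : Fock n K a) :
    Y (v - w) = Y v - Y w :=
  @LinearMap.map_sub K K (Fock n K a) (Fock n K b) _ _ (Submodule.addCommGroup _)
    (Submodule.addCommGroup _) _ _ _ Y v w

theorem sub_smul_sub_comm {V : Type*} [AddCommGroup V] [Module K V] (r : K) (x y x' y' : V) :
    x - r • y - (x' - r • y') = x - x' - r • (y - y') := by
  rw [smul_sub]; abel

section Differences

variable {c : ℤ → K} {v : Fock n K a} {E E' G G' : ℤ → Fock n K a →ₗ[K] Fock n K b}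
variable {X : ℤ → Fock n K a →ₗ[K] Fock n K a} {Y : ℤ → Fock n K b →ₗ[K] Fock n K b}

theorem IsSeriesMul.left_sub
    (h : IsSeriesMul c (fun k d => Y k (E d v)) (fun k d => E d (X k v)))
    (h' : IsSeriesMul c (fun k d => Y k (E' d v)) (fun k d => E' d (X k v))) :
    IsSeriesMul c (fun k d => Y k ((E d - E' d) v)) (fun k d => (E d - E' d) (X k v)) :=
  (h.sub h').congr (fun _ _ => (fockHom_map_sub _ _ _).symm) fun _ _ => rfl

theorem IsSeriesMul.right_sub
    (h : IsSeriesMul c (fun k d => E d (X k v)) (fun k d => Y k (E d v)))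
    (h' : IsSeriesMul c (fun k d => E' d (X k v)) (fun k d => Y k (E' d v))) :
    IsSeriesMul c (fun k d => (E d - E' d) (X k v)) (fun k d => Y k ((E d - E' d) v)) :=
  (h.sub h').congr (fun _ _ => rfl) fun _ _ => (fockHom_map_sub _ _ _).symm

theorem IsSeriesMul.left_sub_delta {p : K}
    (h : ∀ v, IsSeriesMul c (fun k d => Y k (E d v))
      (fun k d => E d (X k v) - delta p k • G (k + d) v))
    (h' : ∀ v, IsSeriesMul c (fun k d => Y k (E' d v))
      (fun k d => E' d (X k v) - delta p k • G' (k + d) v)) (v : Fock n K a) :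
    IsSeriesMul c (fun k d => Y k ((E d - E' d) v))
      (fun k d => (E d - E' d) (X k v) - delta p k • (G (k + d) - G' (k + d)) v) :=
  ((h v).sub (h' v)).congr (fun _ _ => (fockHom_map_sub _ _ _).symm) fun _ _ =>
    sub_smul_sub_comm (V := Fock n K b) _ _ _ _ _

theorem IsSeriesMul.right_sub_delta {p : K}
    (h : ∀ v, IsSeriesMul c (fun k d => E d (X k v))
      (fun k d => Y k (E d v) - delta p k • G (k + d) v))
    (h' : ∀ v, IsSeriesMul c (fun k d => E' d (X k v))
      (fun k d => Y k (E' d v) - delta p k • G' (k + d) v)) (v : Fock n K a) :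
    IsSeriesMul c (fun k d => (E d - E' d) (X k v))
      (fun k d => Y k ((E d - E' d) v) - delta p k • (G (k + d) - G' (k + d)) v) :=
  ((h v).sub (h' v)).congr (fun _ _ => rfl) fun _ _ =>
    (sub_smul_sub_comm (V := Fock n K b) _ _ _ _ _).trans
      (congrArg (· - _) (fockHom_map_sub _ _ _).symm)

/-- The inhomogeneous term of a relation is determined by the other terms. -/
theorem IsSeriesMul.delta_eq_zero {V : Type*} [AddCommGroup V] [Module K V] {c : ℤ → K} {p : K}
    {P R : ℤ → ℤ → V} {g : ℤ → V}
    (h : IsSeriesMul c P (fun k d => R k d - delta p k • g (k + d))) (hP : ∀ k d, P k d = 0)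
    (hR : ∀ k d, R k d = 0) (d : ℤ) : g d = 0 := by
  have e := h.eq_zero (a := 0) (b := d) fun k _ => hP _ _
  simpa [hR, delta] using e

/-- If the differences `E - E'` vanish, all homogeneous terms of the subtracted relation disappear
and only the delta term remains; its coefficients `p^{-k}` at `k = 0` read off the difference `G -
G'`. -/
theorem sub_eq_zero_of_left {p : K}
    (h : ∀ v, IsSeriesMul c (fun k d => Y k (E d v))
      (fun k d => E d (X k v) - delta p k • G (k + d) v))
    (h' : ∀ v, IsSeriesMul c (fun k d => Y k (E' d v))
      (fun k d => E' d (X k v) - delta p k • G' (k + d) v))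
    (h0 : ∀ d, E d - E' d = 0) (d : ℤ) : G d - G' d = 0 := by
  refine LinearMap.ext fun v => (IsSeriesMul.left_sub_delta h h' v).delta_eq_zero
    (V := Fock n K b) (g := fun d => (G d - G' d) v) (fun k d => ?_) (fun k d => ?_) d
  · rw [h0]; exact (Y k).map_zero
  · rw [h0]; rfl

theorem sub_eq_zero_of_right {p : K}
    (h : ∀ v, IsSeriesMul c (fun k d => E d (X k v))
      (fun k d => Y k (E d v) - delta p k • G (k + d) v))
    (h' : ∀ v, IsSeriesMul c (fun k d => E' d (X k v))
      (fun k d => Y k (E' d v) - delta p k • G' (k + d) v))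
    (h0 : ∀ d, E d - E' d = 0) (d : ℤ) : G d - G' d = 0 := by
  refine LinearMap.ext fun v => (IsSeriesMul.right_sub_delta h h' v).delta_eq_zero
    (V := Fock n K b) (g := fun d => (G d - G' d) v) (fun k d => ?_) (fun k d => ?_) d
  · rw [h0]; rfl
  · rw [h0]; exact (Y k).map_zero

theorem sub_smul_zero_apply (r : K) (x : Fock n K b) :
    x - r • (0 : Fock n K a →ₗ[K] Fock n K b) v = x :=
  (congrArg (x - ·) (smul_zero r)).trans (sub_zero (G := Fock n K b) x)

/-- Conversely, once the components in the delta term agree, the difference satisfies the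
homogeneous relation to which `eq_zero_of_fracZ` applies. -/
theorem left_sub_of_sub_eq_zero {p : K}
    (h : ∀ v, IsSeriesMul c (fun k d => Y k (E d v))
      (fun k d => E d (X k v) - delta p k • G (k + d) v))
    (h' : ∀ v, IsSeriesMul c (fun k d => Y k (E' d v))
      (fun k d => E' d (X k v) - delta p k • G' (k + d) v))
    (h0 : ∀ d, G d - G' d = 0) (v : Fock n K a) :
    IsSeriesMul c (fun k d => Y k ((E d - E' d) v)) (fun k d => (E d - E' d) (X k v)) :=
  (IsSeriesMul.left_sub_delta h h' v).congr (fun _ _ => rfl) fun k d => by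
    rw [h0]; exact sub_smul_zero_apply _ _

theorem right_sub_of_sub_eq_zero {p : K}
    (h : ∀ v, IsSeriesMul c (fun k d => E d (X k v))
      (fun k d => Y k (E d v) - delta p k • G (k + d) v))
    (h' : ∀ v, IsSeriesMul c (fun k d => E' d (X k v))
      (fun k d => Y k (E' d v) - delta p k • G' (k + d) v))
    (h0 : ∀ d, G d - G' d = 0) (v : Fock n K a) :
    IsSeriesMul c (fun k d => (E d - E' d) (X k v)) (fun k d => Y k ((E d - E' d) v)) :=
  (IsSeriesMul.right_sub_delta h h' v).congr (fun _ _ => rfl) fun k d => by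
    rw [h0]; exact sub_smul_zero_apply _ _

theorem comm_sub (h : ∀ v k d, E d (X k v) = Y k (E d v))
    (h' : ∀ v k d, E' d (X k v) = Y k (E' d v)) (v : Fock n K a) (k d : ℤ) :
    (E d - E' d) (X k v) = Y k ((E d - E' d) v) := by
  rw [fockHom_sub_apply, fockHom_sub_apply, h, h', fockHom_map_sub]

end Differences

theorem IsLaurent.sub {Φ Φ' : Components n K a b} (h : IsLaurent Φ) (h' : IsLaurent Φ')
    (j : Fin n) (v : Fock n K a) : ∃ N : ℤ, ∀ m < N, (Φ j m - Φ' j m) v = 0 := by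
  obtain ⟨M, hM⟩ := h j v
  obtain ⟨N, hN⟩ := h' j v
  refine ⟨min M N, fun m hm => ?_⟩
  rw [fockHom_sub_apply, hM m (lt_of_lt_of_le hm (min_le_left _ _)),
    hN m (lt_of_lt_of_le hm (min_le_right _ _))]
  exact sub_self (G := Fock n K b) 0

theorem vacCoeff_sub (v w : Fock n K b) : vacCoeff b (v - w) = vacCoeff b v - vacCoeff b w :=
  map_sub (MvPolynomial.constantCoeff (R := K)) ((v : TotalFock n K) (fundWt b))
    ((w : TotalFock n K) (fundWt b))

theorem compWt_lo (l : Fin (n - 1)) : (compWt (lo l : ℕ) : Weight n) l = -1 := by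
  rw [compWt_apply, lo, if_neg (by simp), if_pos rfl]; rfl

theorem compWt_hi (l : Fin (n - 1)) : (compWt (hi l : ℕ) : Weight n) l = 1 := by
  rw [compWt_apply, hi, if_pos rfl, if_neg (by simp)]; rfl

theorem compWt_of_ne {l : Fin (n - 1)} {j : Fin n} (h₁ : j ≠ lo l) (h₂ : j ≠ hi l) :
    (compWt (j : ℕ) : Weight n) l = 0 := by
  rw [compWt_apply, if_neg (ne_of_ne_hi h₂), if_neg (ne_of_ne_lo h₁)]; rfl

theorem lo_ne_hi (l : Fin (n - 1)) : lo l ≠ hi l := fun h => by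
  have := congrArg Fin.val h
  simp [lo, hi] at this

theorem forall_component {P : Fin n → Prop} {i : Fin n} (hi' : P i)
    (up : ∀ l : Fin (n - 1), P (lo l) → P (hi l)) (down : ∀ l : Fin (n - 1), P (hi l) → P (lo l))
    (j : Fin n) : P j := by
  have step : ∀ (m : ℕ) (h : m + 1 < n), P ⟨m, by omega⟩ ↔ P ⟨m + 1, h⟩ := fun m h =>
    ⟨up ⟨m, by omega⟩, down ⟨m, by omega⟩⟩
  have zero : ∀ (m : ℕ) (h : m < n), P ⟨0, by omega⟩ ↔ P ⟨m, h⟩ := by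
    intro m
    induction m with
    | zero => intro h; rfl
    | succ m ih => intro h; rw [ih (by omega), step m h]
  exact (zero j j.2).mp ((zero i i.2).mpr hi')

/-- Only the local forms of the relations are kept, so that vertex operators and their duals can be
treated together; the leading constants `q^{±1}` encode the weight. -/
theorem isIntertwiner_of_left (hs0 : s ≠ 0) {D : ℤ → Fock n K a →ₗ[K] Fock n K b} {j : Fin n}
    (laurent : ∀ v, ∃ N : ℤ, ∀ m < N, D m v = 0)
    (phi_lo : ∀ l : Fin (n - 1), j = lo l → ∃ B C, ∀ v, IsSeriesMul (fracW (s ^ 2)⁻¹ B C)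
      (fun k d => phiCur s l b k (D d v)) (fun k d => D d (phiCur s l a k v)))
    (phi_hi : ∀ l : Fin (n - 1), j = hi l → ∃ B C, ∀ v, IsSeriesMul (fracW (s ^ 2) B C)
      (fun k d => phiCur s l b k (D d v)) (fun k d => D d (phiCur s l a k v)))
    (phi_ne : ∀ l : Fin (n - 1), j ≠ lo l → j ≠ hi l → ∀ v k d,
      D d (phiCur s l a k v) = phiCur s l b k (D d v))
    (psi_lo : ∀ l : Fin (n - 1), j = lo l → ∃ B C, ∀ v, IsSeriesMul (fracZ (s ^ 2) B C)
      (fun k d => psiCur s l b k (D d v)) (fun k d => D d (psiCur s l a k v)))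
    (psi_hi : ∀ l : Fin (n - 1), j = hi l → ∃ B C, ∀ v, IsSeriesMul (fracZ (s ^ 2)⁻¹ B C)
      (fun k d => psiCur s l b k (D d v)) (fun k d => D d (psiCur s l a k v)))
    (psi_ne : ∀ l : Fin (n - 1), j ≠ lo l → j ≠ hi l → ∀ v k d,
      D d (psiCur s l a k v) = psiCur s l b k (D d v)) :
    IsIntertwiner s (compWt j) D := by
  have hs2 : s ^ 2 ≠ 0 := pow_ne_zero 2 hs0
  refine ⟨laurent, fun l => ?_, fun l => ?_⟩
  · by_cases h₁ : j = lo l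
    · obtain ⟨B, C, h⟩ := phi_lo l h₁
      refine ⟨1, (s ^ 2)⁻¹, C, B, one_ne_zero, ?_, fun v k d => ?_⟩
      · rw [h₁, compWt_lo, zpow_neg_one, one_mul]
      · rw [one_smul]; exact (h v).fracW_local k d
    by_cases h₂ : j = hi l
    · obtain ⟨B, C, h⟩ := phi_hi l h₂
      refine ⟨1, s ^ 2, C, B, one_ne_zero, ?_, fun v k d => ?_⟩
      · rw [h₂, compWt_hi, zpow_one, one_mul]
      · rw [one_smul]; exact (h v).fracW_local k d
    · refine ⟨1, 1, 0, 0, one_ne_zero, ?_, fun v k d => ?_⟩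
      · rw [compWt_of_ne h₁ h₂, zpow_zero, one_mul]
      · rw [phi_ne l h₁ h₂, zero_smul, zero_smul]
  · by_cases h₁ : j = lo l
    · obtain ⟨B, C, h⟩ := psi_lo l h₁
      refine ⟨1, s ^ 2, C, B, hs2, fun v k d => ?_⟩
      rw [one_smul]; exact (h v).fracZ_local k d
    by_cases h₂ : j = hi l
    · obtain ⟨B, C, h⟩ := psi_hi l h₂
      refine ⟨1, (s ^ 2)⁻¹, C, B, inv_ne_zero hs2, fun v k d => ?_⟩
      rw [one_smul]; exact (h v).fracZ_local k d
    · refine ⟨1, 1, 0, 0, one_ne_zero, fun v k d => ?_⟩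
      rw [psi_ne l h₁ h₂, zero_smul, zero_smul]

theorem isIntertwiner_of_right (hs0 : s ≠ 0) {D : ℤ → Fock n K a →ₗ[K] Fock n K b} {j : Fin n}
    (laurent : ∀ v, ∃ N : ℤ, ∀ m < N, D m v = 0)
    (phi_lo : ∀ l : Fin (n - 1), j = lo l → ∃ B C, ∀ v, IsSeriesMul (fracW (s ^ 2)⁻¹ B C)
      (fun k d => D d (phiCur s l a k v)) (fun k d => phiCur s l b k (D d v)))
    (phi_hi : ∀ l : Fin (n - 1), j = hi l → ∃ B C, ∀ v, IsSeriesMul (fracW (s ^ 2) B C)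
      (fun k d => D d (phiCur s l a k v)) (fun k d => phiCur s l b k (D d v)))
    (phi_ne : ∀ l : Fin (n - 1), j ≠ lo l → j ≠ hi l → ∀ v k d,
      D d (phiCur s l a k v) = phiCur s l b k (D d v))
    (psi_lo : ∀ l : Fin (n - 1), j = lo l → ∃ B C, ∀ v, IsSeriesMul (fracZ (s ^ 2) B C)
      (fun k d => D d (psiCur s l a k v)) (fun k d => psiCur s l b k (D d v)))
    (psi_hi : ∀ l : Fin (n - 1), j = hi l → ∃ B C, ∀ v, IsSeriesMul (fracZ (s ^ 2)⁻¹ B C)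
      (fun k d => D d (psiCur s l a k v)) (fun k d => psiCur s l b k (D d v)))
    (psi_ne : ∀ l : Fin (n - 1), j ≠ lo l → j ≠ hi l → ∀ v k d,
      D d (psiCur s l a k v) = psiCur s l b k (D d v)) :
    IsIntertwiner s (-compWt j) D := by
  have hs2 : s ^ 2 ≠ 0 := pow_ne_zero 2 hs0
  refine ⟨laurent, fun l => ?_, fun l => ?_⟩
  · by_cases h₁ : j = lo l
    · obtain ⟨B, C, h⟩ := phi_lo l h₁
      refine ⟨(s ^ 2)⁻¹, 1, B, C, inv_ne_zero hs2, ?_, fun v k d => ?_⟩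
      · rw [h₁, Pi.neg_apply, compWt_lo, neg_neg, zpow_one, inv_mul_cancel₀ hs2]
      · rw [one_smul]; exact ((h v).fracW_local k d).symm
    by_cases h₂ : j = hi l
    · obtain ⟨B, C, h⟩ := phi_hi l h₂
      refine ⟨s ^ 2, 1, B, C, hs2, ?_, fun v k d => ?_⟩
      · rw [h₂, Pi.neg_apply, compWt_hi, zpow_neg_one, mul_inv_cancel₀ hs2]
      · rw [one_smul]; exact ((h v).fracW_local k d).symm
    · refine ⟨1, 1, 0, 0, one_ne_zero, ?_, fun v k d => ?_⟩
      · rw [Pi.neg_apply, compWt_of_ne h₁ h₂, neg_zero, zpow_zero, one_mul]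
      · rw [phi_ne l h₁ h₂, zero_smul, zero_smul]
  · by_cases h₁ : j = lo l
    · obtain ⟨B, C, h⟩ := psi_lo l h₁
      refine ⟨s ^ 2, 1, B, C, one_ne_zero, fun v k d => ?_⟩
      rw [one_smul]; exact ((h v).fracZ_local k d).symm
    by_cases h₂ : j = hi l
    · obtain ⟨B, C, h⟩ := psi_hi l h₂
      refine ⟨(s ^ 2)⁻¹, 1, B, C, one_ne_zero, fun v k d => ?_⟩
      rw [one_smul]; exact ((h v).fracZ_local k d).symm
    · refine ⟨1, 1, 0, 0, one_ne_zero, fun v k d => ?_⟩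
      rw [psi_ne l h₁ h₂, zero_smul, zero_smul]

variable [CharZero K] (hs0 : s ≠ 0) (hs : ∀ m : ℕ, 0 < m → s ^ m ≠ 1) {i : ℕ} {hi' : i < n}
include hs0 hs

/-- The normalization starts the argument in the highest weight sector of the component `i`, links
spread it over the coset, and `up` and `down` over the components. -/
theorem eq_of_components {Φ Φ' : Components n K a b} {γ : Fin n → Weight n}
    (hI : ∀ j : Fin n, IsIntertwiner s (γ j) fun m => Φ j m - Φ' j m)
    (hL : ∀ j l, IsLinked s (fun m => Φ j m - Φ' j m) 1 l ∨
      IsLinked s (fun m => Φ j m - Φ' j m) (-1) l)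
    {i : Fin n} (hγ : γ i + fundWt a = fundWt b)
    (hv : ∀ m, vacCoeff b (Φ i m (vac n K a)) = if m = 0 then 1 else 0)
    (hv' : ∀ m, vacCoeff b (Φ' i m (vac n K a)) = if m = 0 then 1 else 0)
    (up : ∀ l : Fin (n - 1), (∀ m, Φ (lo l) m - Φ' (lo l) m = 0) →
      ∀ m, Φ (hi l) m - Φ' (hi l) m = 0)
    (down : ∀ l : Fin (n - 1), (∀ m, Φ (hi l) m - Φ' (hi l) m = 0) →
      ∀ m, Φ (lo l) m - Φ' (lo l) m = 0) : Φ = Φ' := by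
  have h0 := (hI i).vanishesAt_fundWt hs0 hs hγ fun d => by
    rw [fockHom_sub_apply, vacCoeff_sub, hv, hv', sub_self]
  have h1 := (hI i).eq_zero_of_linked hs0 hs (hL i) (by simp [wtCoset]) h0
  funext j m
  refine LinearMap.ext fun v => sub_eq_zero.mp ?_
  exact LinearMap.congr_fun
    (forall_component (P := fun j => ∀ m, Φ j m - Φ' j m = 0) h1 up down j m) v

/-- Each component except `lo l` commutes with `x^+`, and `lo l` has a homogeneous relation with
`x^-`, so all links exist. The relation of `hi l` with `x^-`, whose delta term is `lo l`, connects
neighbours in both directions. -/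
theorem IsTypeI.unique {Φ Φ' : Components n K (i + 1) i} (h : IsTypeI s i hi' Φ)
    (h' : IsTypeI s i hi' Φ') : Φ = Φ' := by
  have hs2 : s ^ 2 ≠ 0 := pow_ne_zero 2 hs0
  have hI : ∀ j : Fin n, IsIntertwiner s (compWt j) fun m => Φ j m - Φ' j m := fun j =>
    isIntertwiner_of_left hs0 (h.laurent.sub h'.laurent j)
      (fun l hl => by subst hl; exact ⟨_, _, fun v => (h.phi_lo l v).left_sub (h'.phi_lo l v)⟩)
      (fun l hl => by subst hl; exact ⟨_, _, fun v => (h.phi_hi l v).left_sub (h'.phi_hi l v)⟩)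
      (fun l h₁ h₂ => comm_sub (h.phi_ne l j h₁ h₂) (h'.phi_ne l j h₁ h₂))
      (fun l hl => by subst hl; exact ⟨_, _, fun v => (h.psi_lo l v).left_sub (h'.psi_lo l v)⟩)
      (fun l hl => by subst hl; exact ⟨_, _, fun v => (h.psi_hi l v).left_sub (h'.psi_hi l v)⟩)
      (fun l h₁ h₂ => comm_sub (h.psi_ne l j h₁ h₂) (h'.psi_ne l j h₁ h₂))
  refine eq_of_components hs0 hs hI (fun j l => ?_) (sub_add_cancel _ _) h.normalized h'.normalized
    (fun l h0 => ?_) fun l h0 => ?_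
  · by_cases hj : j = lo l
    · subst hj
      exact Or.inr (isLinked_of_fracZ hs2 (hI _).laurent
        fun v => (h.xMinus_lo l v).left_sub (h'.xMinus_lo l v))
    · exact Or.inl (isLinked_of_comm (comm_sub (h.xPlus_ne l j hj) (h'.xPlus_ne l j hj)))
  · refine (hI (hi l)).eq_zero_of_fracZ hs0 hs (Or.inr rfl) (by rw [compWt_hi]; rfl)
      (left_sub_of_sub_eq_zero (h.xMinus_hi l) (h'.xMinus_hi l) h0)
      (comm_sub (h.xPlus_ne l _ (lo_ne_hi l).symm) (h'.xPlus_ne l _ (lo_ne_hi l).symm))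
  · exact sub_eq_zero_of_left (h.xMinus_hi l) (h'.xMinus_hi l) h0

theorem IsTypeII.unique {Φ Φ' : Components n K (i + 1) i} (h : IsTypeII s i hi' Φ)
    (h' : IsTypeII s i hi' Φ') : Φ = Φ' := by
  have hs2 : s ^ 2 ≠ 0 := pow_ne_zero 2 hs0
  have hI : ∀ j : Fin n, IsIntertwiner s (compWt j) fun m => Φ j m - Φ' j m := fun j =>
    isIntertwiner_of_left hs0 (h.laurent.sub h'.laurent j)
      (fun l hl => by subst hl; exact ⟨_, _, fun v => (h.phi_lo l v).left_sub (h'.phi_lo l v)⟩)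
      (fun l hl => by subst hl; exact ⟨_, _, fun v => (h.phi_hi l v).left_sub (h'.phi_hi l v)⟩)
      (fun l h₁ h₂ => comm_sub (h.phi_ne l j h₁ h₂) (h'.phi_ne l j h₁ h₂))
      (fun l hl => by subst hl; exact ⟨_, _, fun v => (h.psi_lo l v).left_sub (h'.psi_lo l v)⟩)
      (fun l hl => by subst hl; exact ⟨_, _, fun v => (h.psi_hi l v).left_sub (h'.psi_hi l v)⟩)
      (fun l h₁ h₂ => comm_sub (h.psi_ne l j h₁ h₂) (h'.psi_ne l j h₁ h₂))
  refine eq_of_components hs0 hs hI (fun j l => ?_) (sub_add_cancel _ _) h.normalized h'.normalized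
    (fun l h0 => ?_) fun l h0 => ?_
  · by_cases hj : j = hi l
    · subst hj
      -- The constant term of a function re-expanded in the opposite variable is the quotient of its
      -- leading coefficients, so it is nonzero.
      exact Or.inl (isLinked_of_fracZ (div_ne_zero (zpow_ne_zero _ hs2) (zpow_ne_zero _ hs2))
        (hI _).laurent fun v => (h.xPlus_hi l v).left_sub (h'.xPlus_hi l v))
    · exact Or.inr (isLinked_of_comm (comm_sub (h.xMinus_ne l j hj) (h'.xMinus_ne l j hj)))
  · exact sub_eq_zero_of_left (h.xPlus_lo l) (h'.xPlus_lo l) h0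
  · refine (hI (lo l)).eq_zero_of_fracZ hs0 hs (Or.inl rfl) (by rw [compWt_lo]; rfl)
      (left_sub_of_sub_eq_zero (h.xPlus_lo l) (h'.xPlus_lo l) h0)
      (comm_sub (h.xMinus_ne l _ (lo_ne_hi l)) (h'.xMinus_ne l _ (lo_ne_hi l)))

/-- For the duals the factor multiplies the product in which the current acts first and is expanded
in `u`; the bound needed to cancel it is then the one of the current in `w`. -/
theorem IsDualTypeI.unique {Φ Φ' : Components n K i (i + 1)} (h : IsDualTypeI s i hi' Φ)
    (h' : IsDualTypeI s i hi' Φ') : Φ = Φ' := by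
  have hs2 : s ^ 2 ≠ 0 := pow_ne_zero 2 hs0
  have hI : ∀ j : Fin n, IsIntertwiner s (-compWt j) fun m => Φ j m - Φ' j m := fun j =>
    isIntertwiner_of_right hs0 (h.laurent.sub h'.laurent j)
      (fun l hl => by subst hl; exact ⟨_, _, fun v => (h.phi_lo l v).right_sub (h'.phi_lo l v)⟩)
      (fun l hl => by subst hl; exact ⟨_, _, fun v => (h.phi_hi l v).right_sub (h'.phi_hi l v)⟩)
      (fun l h₁ h₂ => comm_sub (fun v k d => (h.phi_ne l j h₁ h₂ v k d).symm)
        fun v k d => (h'.phi_ne l j h₁ h₂ v k d).symm)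
      (fun l hl => by subst hl; exact ⟨_, _, fun v => (h.psi_lo l v).right_sub (h'.psi_lo l v)⟩)
      (fun l hl => by subst hl; exact ⟨_, _, fun v => (h.psi_hi l v).right_sub (h'.psi_hi l v)⟩)
      (fun l h₁ h₂ => comm_sub (fun v k d => (h.psi_ne l j h₁ h₂ v k d).symm)
        fun v k d => (h'.psi_ne l j h₁ h₂ v k d).symm)
  refine eq_of_components hs0 hs hI (fun j l => ?_)
    (by rw [neg_sub, sub_add_cancel]) h.normalized h'.normalized
    (fun l h0 => ?_) fun l h0 => ?_
  · by_cases hj : j = hi l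
    · subst hj
      exact Or.inr (isLinked_of_fracW (div_ne_zero (pow_ne_zero _ hs2) (pow_ne_zero _ hs2))
        fun v => (h.xMinus_hi l v).right_sub (h'.xMinus_hi l v))
    · exact Or.inl (isLinked_of_comm (comm_sub (fun v k d => (h.xPlus_ne l j hj v k d).symm)
        fun v k d => (h'.xPlus_ne l j hj v k d).symm))
  · exact sub_eq_zero_of_right (h.xMinus_lo l) (h'.xMinus_lo l) h0
  · refine (hI (lo l)).eq_zero_of_fracW hs0 hs (by rw [Pi.neg_apply, compWt_lo]; rfl)
      (right_sub_of_sub_eq_zero (h.xMinus_lo l) (h'.xMinus_lo l) h0)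

theorem IsDualTypeII.unique {Φ Φ' : Components n K i (i + 1)} (h : IsDualTypeII s i hi' Φ)
    (h' : IsDualTypeII s i hi' Φ') : Φ = Φ' := by
  have hs2 : s ^ 2 ≠ 0 := pow_ne_zero 2 hs0
  have hI : ∀ j : Fin n, IsIntertwiner s (-compWt j) fun m => Φ j m - Φ' j m := fun j =>
    isIntertwiner_of_right hs0 (h.laurent.sub h'.laurent j)
      (fun l hl => by subst hl; exact ⟨_, _, fun v => (h.phi_lo l v).right_sub (h'.phi_lo l v)⟩)
      (fun l hl => by subst hl; exact ⟨_, _, fun v => (h.phi_hi l v).right_sub (h'.phi_hi l v)⟩)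
      (fun l h₁ h₂ => comm_sub (fun v k d => (h.phi_ne l j h₁ h₂ v k d).symm)
        fun v k d => (h'.phi_ne l j h₁ h₂ v k d).symm)
      (fun l hl => by subst hl; exact ⟨_, _, fun v => (h.psi_lo l v).right_sub (h'.psi_lo l v)⟩)
      (fun l hl => by subst hl; exact ⟨_, _, fun v => (h.psi_hi l v).right_sub (h'.psi_hi l v)⟩)
      (fun l h₁ h₂ => comm_sub (fun v k d => (h.psi_ne l j h₁ h₂ v k d).symm)
        fun v k d => (h'.psi_ne l j h₁ h₂ v k d).symm)
  refine eq_of_components hs0 hs hI (fun j l => ?_)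
    (by rw [neg_sub, sub_add_cancel]) h.normalized h'.normalized
    (fun l h0 => ?_) fun l h0 => ?_
  · by_cases hj : j = lo l
    · subst hj
      exact Or.inl (isLinked_of_fracW (inv_ne_zero hs2)
        fun v => (h.xPlus_lo l v).right_sub (h'.xPlus_lo l v))
    · exact Or.inr (isLinked_of_comm (comm_sub (fun v k d => (h.xMinus_ne l j hj v k d).symm)
        fun v k d => (h'.xMinus_ne l j hj v k d).symm))
  · refine (hI (hi l)).eq_zero_of_fracW hs0 hs (by rw [Pi.neg_apply, compWt_hi]; rfl)
      (right_sub_of_sub_eq_zero (h.xPlus_hi l) (h'.xPlus_hi l) h0)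
  · exact sub_eq_zero_of_right (h.xPlus_hi l) (h'.xPlus_hi l) h0

end Uniqueness

end
end QAffine

theorem theorem3p4 (n : ℕ) (hn : 2 ≤ n) {K : Type*} [Field K] [CharZero K] (s : K) (hs0 : s ≠ 0)
    (hs : ∀ m : ℕ, 0 < m → s ^ m ≠ 1) (i : ℕ) (hi : i < n) :
    (∀ Φ : QAffine.Components n K (i + 1) i,
      QAffine.IsTypeI s i hi Φ ↔ Φ = QAffine.typeI s i hi) ∧
    (∀ Ψ : QAffine.Components n K (i + 1) i,
      QAffine.IsTypeII s i hi Ψ ↔ Ψ = QAffine.typeII s i hi) ∧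
    (∀ Φ : QAffine.Components n K i (i + 1),
      QAffine.IsDualTypeI s i hi Φ ↔ Φ = QAffine.dualTypeI s i hi) ∧
    (∀ Ψ : QAffine.Components n K i (i + 1),
      QAffine.IsDualTypeII s i hi Ψ ↔ Ψ = QAffine.dualTypeII s i hi) := by
  refine ⟨fun Φ => ⟨fun h => ?_, ?_⟩, fun Ψ => ⟨fun h => ?_, ?_⟩, fun Φ => ⟨fun h => ?_, ?_⟩,
    fun Ψ => ⟨fun h => ?_, ?_⟩⟩
  · exact QAffine.IsTypeI.unique hs0 hs h (QAffine.isTypeI_typeI hs0 hs hi hn)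
  · rintro rfl
    exact QAffine.isTypeI_typeI hs0 hs hi hn
  · exact QAffine.IsTypeII.unique hs0 hs h (QAffine.isTypeII_typeII hs0 hs hi hn)
  · rintro rfl
    exact QAffine.isTypeII_typeII hs0 hs hi hn
  · exact QAffine.IsDualTypeI.unique hs0 hs h (QAffine.isDualTypeI_dualTypeI hs0 hs hi hn)
  · rintro rfl
    exact QAffine.isDualTypeI_dualTypeI hs0 hs hi hn
  · exact QAffine.IsDualTypeII.unique hs0 hs h (QAffine.isDualTypeII_dualTypeII hs0 hs hi hn)
  · rintro rfl
    exact QAffine.isDualTypeII_dualTypeII hs0 hs hi hn
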